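/- \textbf{Setting.} A noisy circuit of depth $d$ on $n$ qubits is \[ \mathcal C\{\rho\}=\mathcal D_0\{U_1\,\mathcal D_1\{U_2\,\mathcal D_2\{\cdots U_d\,\mathcal D_d\{\rho\}\,U_d^\dagger\cdots\}U_2^\dagger\}U_1^\dagger\}, \] where each $U_t$ is a tensor product of two-qubit unitary gates on disjoint pairs of qubits (all other qubits are idle), and each $\mathcal D_t$ is a product of single-qubit depolarizing channels $\mathcal D^{(j)}\{\rho\}=e^{-\gamma}\rho+(1-e^{-\gamma})\,\tfrac{1_j}{2}\otimes\operatorname{tr}_j\rho$. The channel $\mathcal D_0$ acts on all qubits. For $t\ge1$, $\mathcal D_t$ acts on all qubits (\emph{uniform noise}) or on exactly the qubits that take part in a gate of $U_t$ (\emph{gate-based noise}). The Rényi-2 entropy of a state is $S^{(2)}(\rho)=\log_2(1/\|\rho\|_2^2)$ with $\|\rho\|_2^2=\operatorname{tr}(\rho^\dagger\rho)$. An algorithm is a program for a random access machine with unit-cost real arithmetic (addition, subtraction, multiplication, division and comparison of reals; addition, truncated subtraction and comparison of natural numbers; indirect addressing). Its input, stored in memory, is $n$, $d$, $e^{-\gamma}$,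 $\varepsilon$, the positions of the gates and their matrix entries. The Pauli coefficients $\operatorname{tr}(\rho P)/2^n$ of $\rho$ are efficiently computable: the program may query them, a query costing $1$ plus the weight of $P$ (the number of its non-identity factors). It outputs a list of Pauli strings with real coefficients, each at the cost of $1$ plus the weight of the string. It \emph{computes $\mathcal C\{\rho\}$ to trace-norm error $\delta$} if it halts and the sum $\tilde\rho$ of its output terms satisfies $\|\tilde\rho-\mathcal C\{\rho\}\|_1\le\delta$. \textbf{Corollary.} Let $n,d\ge1$, let $\rho$ be an $n$-qubit state with $S^{(2)}(\rho)=n-\log_2 c$, $c>0$, and let $\gamma,\varepsilon>0$. There are programs, each independent of $n,d,\gamma,\varepsilon,c,\rho$ and the circuit, that compute $\mathcal C\{\rho\}$ to trace-norm error $\varepsilon\sqrt c$ within the following times. \begin{enumerate} \item Uniform noise, with $\rho$ given explicitly as a sum of $m$ Pauli strings with real coefficients, $\varepsilon\le1$ and $\gamma\le\gamma_0<1$: \[ \mathrm{poly}(n,m)\cdot(1/\varepsilon)^{O(\log(1/\gamma)/\gamma^2)} ,\] in particular $\mathrm{poly}(n)\cdot(1/\varepsilon)^{O(\log(1/\gamma)/\gamma^2)}$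 for polynomially many Pauli strings. \item Uniform noise, any $\rho$, with $\varepsilon\le1$ and $\gamma\le\gamma_0<1$: \[ O(1)\cdot n^{O(\log(1/\gamma)/\gamma)+O(\log(1/\varepsilon)/(\gamma d))}\cdot(1/\varepsilon)^{O(\log(1/\gamma)/\gamma^2)} .\] \item Gate-based noise, any $\rho$: \[ O\big(d\cdot n^{\ell}\big),\qquad \ell=\max\Big\{0,\Big\lceil\tfrac1\gamma\log\big(\sqrt{d+1}/\varepsilon\big)-1\Big\rceil\Big\} .\] \end{enumerate} In 1 and 2 the implied constants and the polynomial depend only on the fixed $\gamma_0$ (for every $\gamma_0<1$), and the programs do not depend on $\gamma_0$; in 3 the implied constant is absolute. -/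

import Mathlib

namespace NoisyCircuit

open Matrix
open scoped ComplexOrder

/-! ### Operators, Pauli strings, states and norms -/

/-- Operators on `n` qubits, in the computational basis. -/
abbrev Op (n : ℕ) := Matrix (Fin n → Fin 2) (Fin n → Fin 2) ℂ

/-- The single-qubit Pauli matrices; the labels `0, 1, 2, 3` stand for `I, X, Y, Z`. -/
def pauliMatrix : Fin 4 → Matrix (Fin 2) (Fin 2) ℂ :=
  ![1, !![0, 1; 1, 0], !![0, -Complex.I; Complex.I, 0], !![1, 0; 0, -1]]

/-- An `n`-qubit Pauli string: a label for every qubit. -/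
abbrev PauliString (n : ℕ) := Fin n → Fin 4

/-- The operator of a Pauli string: the tensor product of its single-qubit factors. -/
def pauliOp {n : ℕ} (P : PauliString n) : Op n :=
  Matrix.of fun x y => ∏ j, pauliMatrix (P j) (x j) (y j)

/-- The weight of a Pauli string: the number of its non-identity factors. -/
def weight {n : ℕ} (P : PauliString n) : ℕ :=
  (Finset.univ.filter fun j => P j ≠ 0).card

/-- Density matrices. -/
def IsState {n : ℕ} (ρ : Op n) : Prop := ρ.PosSemidef ∧ ρ.trace = 1

/-- The squared Schatten 2-norm `tr (A† A)`. -/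
noncomputable def normTwoSq {n : ℕ} (A : Op n) : ℝ := (Aᴴ * A).trace.re

/-- The Renyi-2 entropy `log₂ (1 / ‖ρ‖₂²)`. -/
noncomputable def renyiTwo {n : ℕ} (ρ : Op n) : ℝ := Real.logb 2 (1 / normTwoSq ρ)

/-- The trace norm: the sum of the singular values. -/
noncomputable def traceNorm {n : ℕ} (A : Op n) : ℝ :=
  ∑ i, Real.sqrt ((isHermitian_conjTranspose_mul_self A).eigenvalues i)

/-- The Pauli coefficient `tr (ρ P) / 2 ^ n`, so that `ρ` is the sum of `pauliCoeff ρ P • P`. -/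
noncomputable def pauliCoeff {n : ℕ} (ρ : Op n) (P : PauliString n) : ℝ :=
  (ρ * pauliOp P).trace.re / 2 ^ n

/-- The operator described by a list of Pauli strings with real coefficients. -/
noncomputable def pauliSum {n : ℕ} (l : List (PauliString n × ℝ)) : Op n :=
  (l.map fun t => (t.2 : ℂ) • pauliOp t.1).sum

/-! ### Noisy circuits -/

/-- A depth-1 layer of two-qubit gates. The qubits `j` and `partner j` form a gate when they
differ; a fixed point of `partner` is an idle qubit. The unitary of the gate on `{j, partner j}`,
`j < partner j`, is `gate j`, with `j` as the first tensor factor; other values of `gate` play no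
role. -/
structure Layer (n : ℕ) where
  partner : Fin n → Fin n
  involutive : ∀ j, partner (partner j) = j
  gate : Fin n → Matrix (Fin 2 × Fin 2) (Fin 2 × Fin 2) ℂ
  unitary : ∀ j, j < partner j → gate j ∈ Matrix.unitaryGroup (Fin 2 × Fin 2) ℂ

/-- The unitary of a layer: the tensor product of its gates and of identities on idle qubits. -/
def Layer.op {n : ℕ} (U : Layer n) : Op n :=
  Matrix.of fun x y => ∏ j,
    if U.partner j = j then (1 : Matrix (Fin 2) (Fin 2) ℂ) (x j) (y j)
    else if j < U.partner j then U.gate j (x j, x (U.partner j)) (y j, y (U.partner j))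
    else 1

/-- Trace out qubit `j` and replace it by the maximally mixed state. -/
noncomputable def mixQubit {n : ℕ} (j : Fin n) (ρ : Op n) : Op n :=
  Matrix.of fun x y =>
    if x j = y j then
      (1 / 2 : ℂ) * ∑ b : Fin 2, ρ (Function.update x j b) (Function.update y j b)
    else 0

/-- The local depolarizing channel of strength `γ` on qubit `j`. -/
noncomputable def depolarize {n : ℕ} (γ : ℝ) (j : Fin n) (ρ : Op n) : Op n :=
  ((Real.exp (-γ) : ℝ) : ℂ) • ρ + ((1 - Real.exp (-γ) : ℝ) : ℂ) • mixQubit j ρ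

/-- Depolarizing noise on every qubit that satisfies `p` (these channels commute). -/
noncomputable def noise {n : ℕ} (γ : ℝ) (p : Fin n → Bool) (ρ : Op n) : Op n :=
  ((List.finRange n).filter p).foldr (depolarize γ) ρ

/-- The two noise models. -/
inductive NoiseModel where
  | uniform
  | gateBased

/-- The qubits that suffer noise in a layer: all of them for uniform noise, and those that take
part in a gate for gate-based noise. -/
def NoiseModel.noisy {n : ℕ} : NoiseModel → Layer n → Fin n → Bool
  | uniform, _ => fun _ => true
  | gateBased, U => fun j => decide (U.partner j ≠ j)

/-- For `L = [U₁, …, U_d]`, the operator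
`U₁ D₁{U₂ D₂{ … U_d D_d{ρ} U_d† … } U₂†} U₁†`. -/
noncomputable def evolve {n : ℕ} (M : NoiseModel) (γ : ℝ) : List (Layer n) → Op n → Op n
  | [], ρ => ρ
  | U :: L, ρ => U.op * noise γ (M.noisy U) (evolve M γ L ρ) * U.opᴴ

/-- The noisy circuit with layers `L = [U₁, …, U_d]` (`U_d` is executed first); read-out noise
acts on all qubits. -/
noncomputable def noisyCircuit {n : ℕ} (M : NoiseModel) (γ : ℝ) (L : List (Layer n)) (ρ : Op n) :
    Op n :=
  noise γ (fun _ => true) (evolve M γ L ρ)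

/-! ### The machine model: programs for a random access machine with real arithmetic -/

/-- Natural-number expressions; `cell a i` is entry `i` of the natural-number array `a`.
There is no multiplication, so numbers cannot be used to pack computations. -/
inductive NExp where
  | const (k : ℕ)
  | cell (a : ℕ) (i : NExp)
  | add (e f : NExp)
  | sub (e f : NExp)

/-- Real expressions; `cell a i` is entry `i` of the real array `a`. -/
inductive RExp where
  | const (k : ℕ)
  | ofNat (e : NExp)
  | cell (a : ℕ) (i : NExp)
  | add (e f : RExp)
  | sub (e f : RExp)
  | mul (e f : RExp)
  | div (e f : RExp)

/-- Tests. -/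
inductive Test where
  | natLe (e f : NExp)
  | realLe (e f : RExp)

/-- Programs. `query p a i` stores in entry `i` of the real array `a` the Pauli coefficient, in
the input state, of the Pauli string that stands in the natural-number array `p`; `emit p e`
appends to the output that Pauli string with the coefficient `e`. -/
inductive Cmd where
  | skip
  | setNat (a : ℕ) (i e : NExp)
  | setReal (a : ℕ) (i : NExp) (e : RExp)
  | query (p a : ℕ) (i : NExp)
  | emit (p : ℕ) (e : RExp)
  | seq (c c' : Cmd)
  | ite (b : Test) (c c' : Cmd)
  | loop (b : Test) (c : Cmd)

/-- The memory (arrays of natural numbers and of reals) and the output list. -/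
structure Store (n : ℕ) where
  nat : ℕ → ℕ → ℕ
  real : ℕ → ℕ → ℝ
  out : List (PauliString n × ℝ)

/-- The array `f` with entry `i` replaced in its `a`-th row. -/
def setCell {α : Type} (f : ℕ → ℕ → α) (a i : ℕ) (v : α) : ℕ → ℕ → α :=
  fun b k => if b = a ∧ k = i then v else f b k

/-- The Pauli string that stands in an array (labels are read modulo 4). -/
def readPauli (n : ℕ) (f : ℕ → ℕ) : PauliString n := fun j => Fin.ofNat 4 (f j)

def NExp.eval {n : ℕ} (s : Store n) : NExp → ℕ
  | const k => k
  | cell a i => s.nat a (i.eval s)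
  | add e f => e.eval s + f.eval s
  | sub e f => e.eval s - f.eval s

noncomputable def RExp.eval {n : ℕ} (s : Store n) : RExp → ℝ
  | const k => k
  | ofNat e => (e.eval s : ℝ)
  | cell a i => s.real a (i.eval s)
  | add e f => e.eval s + f.eval s
  | sub e f => e.eval s - f.eval s
  | mul e f => e.eval s * f.eval s
  | div e f => e.eval s / f.eval s

def Test.holds {n : ℕ} (s : Store n) : Test → Prop
  | natLe e f => e.eval s ≤ f.eval s
  | realLe e f => e.eval s ≤ f.eval s

/-- `Exec orc c s s' T`: the program `c`, started in `s`, halts in `s'` after `T` steps, where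
`orc` gives the Pauli coefficients of the input state. An assignment or a test is one step (the
sizes of its expressions are fixed by the program); a query or an output of a Pauli string `P` is
`weight P + 1` steps. -/
inductive Exec {n : ℕ} (orc : PauliString n → ℝ) : Cmd → Store n → Store n → ℕ → Prop where
  | skip (s : Store n) : Exec orc .skip s s 1
  | setNat (s : Store n) (a : ℕ) (i e : NExp) :
      Exec orc (.setNat a i e) s { s with nat := setCell s.nat a (i.eval s) (e.eval s) } 1
  | setReal (s : Store n) (a : ℕ) (i : NExp) (e : RExp) :
      Exec orc (.setReal a i e) s { s with real := setCell s.real a (i.eval s) (e.eval s) } 1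
  | query (s : Store n) (p a : ℕ) (i : NExp) :
      Exec orc (.query p a i) s
        { s with real := setCell s.real a (i.eval s) (orc (readPauli n (s.nat p))) }
        (weight (readPauli n (s.nat p)) + 1)
  | emit (s : Store n) (p : ℕ) (e : RExp) :
      Exec orc (.emit p e) s
        { s with out := s.out ++ [(readPauli n (s.nat p), e.eval s)] }
        (weight (readPauli n (s.nat p)) + 1)
  | seq {c c' : Cmd} {s₁ s₂ s₃ : Store n} {T T' : ℕ} :
      Exec orc c s₁ s₂ T → Exec orc c' s₂ s₃ T' → Exec orc (.seq c c') s₁ s₃ (T + T')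
  | iteTrue {b : Test} {c c' : Cmd} {s s' : Store n} {T : ℕ} :
      b.holds s → Exec orc c s s' T → Exec orc (.ite b c c') s s' (T + 1)
  | iteFalse {b : Test} {c c' : Cmd} {s s' : Store n} {T : ℕ} :
      ¬ b.holds s → Exec orc c' s s' T → Exec orc (.ite b c c') s s' (T + 1)
  | loopDone {b : Test} {c : Cmd} {s : Store n} :
      ¬ b.holds s → Exec orc (.loop b c) s s 1
  | loopStep {b : Test} {c : Cmd} {s₁ s₂ s₃ : Store n} {T T' : ℕ} :
      b.holds s₁ → Exec orc c s₁ s₂ T → Exec orc (.loop b c) s₂ s₃ T' →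
      Exec orc (.loop b c) s₁ s₃ (T + T' + 1)

/-! ### The input of the algorithms -/

/-- Entry number `e < 16` of a two-qubit gate: its binary digits, from the highest one, are the
two bits of the row and the two bits of the column. -/
def gateEntry (G : Matrix (Fin 2 × Fin 2) (Fin 2 × Fin 2) ℂ) (e : ℕ) : ℂ :=
  G (Fin.ofNat 2 (e / 8), Fin.ofNat 2 (e / 4)) (Fin.ofNat 2 (e / 2), Fin.ofNat 2 e)

/-- Apply `f` to layer `i / n` and qubit `i % n` of a circuit, with default value `0`. -/
def atSite {α : Type} [Zero α] {n : ℕ} (L : List (Layer n)) (i : ℕ) (f : Layer n → Fin n → α) : α :=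
  if h : i / n < L.length ∧ i % n < n then f (L[i / n]'h.1) ⟨i % n, h.2⟩ else 0

/-- The natural-number arrays at the start. Array 0 holds the number `n` of qubits, the depth and
the number of given Pauli terms; array 1 holds the partner of qubit `j` in the layer `U_{t+1}` as
entry `t * n + j`; array 2 holds the label of qubit `j` in the `k`-th given Pauli term as entry
`k * n + j`. -/
def inputNat {n : ℕ} (L : List (Layer n)) (terms : List (PauliString n × ℝ)) : ℕ → ℕ → ℕ
  | 0, 0 => n
  | 0, 1 => L.length
  | 0, 2 => terms.length
  | 1, i => atSite L i fun U j => (U.partner j : ℕ)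
  | 2, i =>
    if h : i / n < terms.length ∧ i % n < n then ((terms[i / n]'h.1).1 ⟨i % n, h.2⟩ : ℕ) else 0
  | _, _ => 0

/-- The real arrays at the start. Array 0 holds the damping factor `e ^ (-γ)` of the noise and
the error tolerance `ε`; array 1 holds the coefficients of the given Pauli terms; for `e < 16`,
the arrays `2 + e` and `18 + e` hold the real and the imaginary part of entry number `e` of the
gate at qubit `j` in the layer `U_{t+1}` as entry `t * n + j`. -/
noncomputable def inputReal {n : ℕ} (L : List (Layer n)) (γ ε : ℝ)
    (terms : List (PauliString n × ℝ)) : ℕ → ℕ → ℝ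
  | 0, 0 => Real.exp (-γ)
  | 0, 1 => ε
  | 0, _ => 0
  | 1, i => if h : i < terms.length then (terms[i]'h).2 else 0
  | a, i =>
    if a < 18 then atSite L i fun U j => (gateEntry (U.gate j) (a - 2)).re
    else if a < 34 then atSite L i fun U j => (gateEntry (U.gate j) (a - 18)).im
    else 0

/-- The store at the start. The list `terms` is empty when the input state is accessible only
through queries. -/
noncomputable def inputStore {n : ℕ} (L : List (Layer n)) (γ ε : ℝ)
    (terms : List (PauliString n × ℝ)) : Store n where
  nat := inputNat L terms
  real := inputReal L γ ε terms
  out := []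

/-- On the circuit `L` with noise model `M` and strength `γ`, the input state `ρ` (with queries to
its Pauli coefficients and the explicitly given Pauli terms `terms`) and the tolerance `ε`, the
program `prog` halts after at most `bound` steps, and the sum of the Pauli terms that it has
output is within trace norm `err` of the output state of the noisy circuit. -/
def Computes (prog : Cmd) {n : ℕ} (M : NoiseModel) (L : List (Layer n)) (γ ε : ℝ) (ρ : Op n)
    (terms : List (PauliString n × ℝ)) (err bound : ℝ) : Prop :=
  ∃ (s : Store n) (T : ℕ),
    Exec (pauliCoeff ρ) prog (inputStore L γ ε terms) s T ∧
    (T : ℝ) ≤ bound ∧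
    traceNorm (pauliSum s.out - noisyCircuit M γ L ρ) ≤ err

end NoisyCircuit

open NoisyCircuit

namespace NoisyCircuit
open Matrix
open scoped ComplexOrder

/-! ### The Pauli basis -/

/-! Everything is carried out on the real vector of Pauli coefficients of the state. By Parseval its
Euclidean norm is the 2-norm up to a factor. The trace norm is at most √(2^n) times the 2-norm, and
the entropy hypothesis says exactly that 2^n tr ρ² = c. Hence an approximation with relative error ε
in Euclidean norm has trace-norm error at most ε√c (`traceNorm_toOp_sub_le`). In this picture a
layer of gates is an isometry whose matrix factorizes over the cells (the gate pairs and the idle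
qubits) and which never connects an identity label on a cell with a nonidentity one. Noise is
diagonal: with q = e^(-γ), it multiplies a string by q to the number of noisy qubits on which the
string is not the identity.

Accuracy for gate-based noise: cut the vector off at weight ℓ before every layer of noise. Noise on
idle qubits commutes with the layer, so the read-out noise can be moved backwards past the qubits
that are idle; together with the gate noise it gives noise on all qubits at any chosen time. A
discarded tail therefore shrinks by q^(ℓ+1) before the end (`nrm_circuitVec_gateBased_le`). Each
tail is orthogonal to what is kept, so the d+1 errors add up to √(d+1) q^(ℓ+1) only
(`nrm_circuitVec_sub_truncCircuit_le`).

Accuracy for uniform noise: if q^(d+1) ≤ ε, the identity component alone is good enough, since the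
traceless part shrinks by q at each of the d+1 noise layers. Otherwise d+1 is at most log(1/ε)/γ,
and the Pauli paths of total weight above W are dropped. The vectors are graded by accumulated
weight, and the norms of the grades are summed with weights b^k. Noise acts on such sums as a
convolution with a geometric series, so it costs a factor 1/(1-bq), while the gates cost nothing.
With b = (1+q)/(2q) the tail is at most (2q/(1+q))^W (2/(1-q))^(d+1)
(`nrm_pathSum_sub_circuitVec_le`). The least W that brings this to ε is of order log(1/ε)
log(1/γ)/γ².

Time for uniform noise: the paths are enumerated as lists of strings with amplitudes. A gate turns
an item into sixteen, but only if the item has a nonidentity label there, and that label has just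
been charged to the weight budget. So the potential, the sum of 16^(W - accumulated weight), never
grows (`listPotential_layerStep_le`), and 16^W is of the form (1/ε)^O(log(1/γ)/γ²). For a state
known only through queries, the relevant input strings must be found first. A path of total weight
at most W has a string of weight at most W/(d+1) at some layer, so all such strings, about
n^(W/(d+1)) of them, are followed back to the input from every layer (`exists_mem_traceBack`,
`pathSum_backItems`).

Time for gate-based noise: the vector is stored in an array addressed by the base-4 codes of the
strings and the gates are applied one by one. In the middle of a layer the weight may exceed ℓ, but
not the number of nonidentity cells (`gatesVec_eq_zero`). For one gate it suffices to run over the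
strings that are the identity on its cell and not the identity on at most ℓ-1 others, which are
O(n^(ℓ-1)) many, and to update the sixteen strings over each in place (`run_gateCmd`). This makes
O(n^ℓ) steps for a layer. Queries and outputs run over the strings of weight at most ℓ as one-label
extensions of strings of weight at most ℓ-1, so that the cost of unpacking a string is shared by its
extensions.

The programs find their cutoffs by search, without logarithms, and their correctness is proved with
a small Hoare logic with time bounds (`Run`). -/

theorem sum_pauliMatrix_mul (x y z w : Fin 2) :
    ∑ p, pauliMatrix p x y * pauliMatrix p z w = if y = z ∧ x = w then 2 else 0 := by
  fin_cases x <;> fin_cases y <;> fin_cases z <;> fin_cases w <;>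
    simp [pauliMatrix, Fin.sum_univ_four] <;> norm_num

theorem trace_pauliMatrix_mul (p q : Fin 4) :
    ∑ x, ∑ y, pauliMatrix p x y * pauliMatrix q y x = if p = q then 2 else 0 := by
  fin_cases p <;> fin_cases q <;> simp [pauliMatrix, Fin.sum_univ_two] <;> norm_num

theorem star_pauliMatrix (p : Fin 4) (x y : Fin 2) :
    star (pauliMatrix p x y) = pauliMatrix p y x := by
  fin_cases p <;> fin_cases x <;> fin_cases y <;> simp [pauliMatrix]

theorem pauliMatrix_zero : pauliMatrix 0 = 1 := rfl

theorem pauliOp_isHermitian {n : ℕ} (P : PauliString n) : (pauliOp P).IsHermitian := by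
  ext x y
  simp only [conjTranspose_apply, pauliOp, of_apply]
  rw [star_prod]
  exact Finset.prod_congr rfl fun j _ => star_pauliMatrix _ _ _

theorem trace_pauliOp_mul {n : ℕ} (P Q : PauliString n) :
    (pauliOp P * pauliOp Q).trace = if P = Q then 2 ^ n else 0 := by
  have h : (pauliOp P * pauliOp Q).trace
      = ∑ z : Fin n → Fin 2 × Fin 2, ∏ j, pauliMatrix (P j) (z j).1 (z j).2 *
          pauliMatrix (Q j) (z j).2 (z j).1 := by
    simp only [Matrix.trace, diag_apply, mul_apply, pauliOp, of_apply, ← Finset.prod_mul_distrib]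
    rw [← Fintype.sum_prod_type']
    refine Fintype.sum_equiv (Equiv.arrowProdEquivProdArrow (Fin n) (fun _ => Fin 2) (fun _ => Fin 2)).symm _ _ ?_
    rintro ⟨x, y⟩; rfl
  rw [h, ← Fintype.prod_sum (fun j (c : Fin 2 × Fin 2) => pauliMatrix (P j) c.1 c.2 *
          pauliMatrix (Q j) c.2 c.1)]
  simp only [Fintype.sum_prod_type, trace_pauliMatrix_mul]
  split_ifs with hPQ
  · subst hPQ; simp
  · obtain ⟨j, hj⟩ := Function.ne_iff.1 hPQ
    exact Finset.prod_eq_zero (Finset.mem_univ j) (if_neg hj)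

/-- The completeness relation: the sum of P ⊗ P over all strings is 2^n times the swap. It is the
tensor power of the single-qubit case. -/
theorem sum_pauliOp_mul {n : ℕ} (x y z w : Fin n → Fin 2) :
    ∑ P : PauliString n, pauliOp P x y * pauliOp P z w = if y = z ∧ x = w then 2 ^ n else 0 := by
  simp only [pauliOp, of_apply, ← Finset.prod_mul_distrib]
  rw [← Fintype.prod_sum (fun j (p : Fin 4) => pauliMatrix p (x j) (y j) * pauliMatrix p (z j) (w j))]
  simp only [sum_pauliMatrix_mul]
  split_ifs with h
  · obtain ⟨rfl, rfl⟩ := h; simp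
  · rw [not_and_or] at h
    rcases h with h | h <;> obtain ⟨j, hj⟩ := Function.ne_iff.1 h <;>
    exact Finset.prod_eq_zero (Finset.mem_univ j) (if_neg (by tauto))

/-- Every operator is the sum of its Pauli components. -/
theorem sum_trace_smul_pauliOp {n : ℕ} (A : Op n) :
    ∑ P : PauliString n, ((A * pauliOp P).trace / 2 ^ n) • pauliOp P = A := by
  ext z w
  simp only [Matrix.sum_apply, Matrix.smul_apply, smul_eq_mul, Matrix.trace, diag_apply, mul_apply]
  calc ∑ P : PauliString n, (∑ x, ∑ y, A x y * pauliOp P y x) / 2 ^ n * pauliOp P z w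
      = ∑ P : PauliString n, ∑ x, ∑ y, A x y / 2 ^ n * (pauliOp P y x * pauliOp P z w) := by
        refine Finset.sum_congr rfl fun P _ => ?_
        rw [Finset.sum_div, Finset.sum_mul]
        refine Finset.sum_congr rfl fun x _ => ?_
        rw [Finset.sum_div, Finset.sum_mul]
        exact Finset.sum_congr rfl fun y _ => by ring
    _ = ∑ x, ∑ y, A x y / 2 ^ n * ∑ P : PauliString n, (pauliOp P y x * pauliOp P z w) := by
        rw [Finset.sum_comm]
        refine Finset.sum_congr rfl fun x _ => ?_
        rw [Finset.sum_comm]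
        exact Finset.sum_congr rfl fun y _ => by rw [Finset.mul_sum]
    _ = A z w := by
        simp only [sum_pauliOp_mul]
        rw [Finset.sum_eq_single z, Finset.sum_eq_single w]
        · simp
        · intro y _ hy; rw [if_neg (by tauto)]; simp
        · simp
        · intro x _ hx; exact Finset.sum_eq_zero fun y _ => by rw [if_neg (by tauto)]; simp
        · simp

/-- The operator with given real Pauli coefficients. -/
noncomputable def toOp {n : ℕ} (x : PauliString n → ℝ) : Op n := ∑ P, (x P : ℂ) • pauliOp P

theorem trace_toOp_mul {n : ℕ} (x : PauliString n → ℝ) (Q : PauliString n) :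
    (toOp x * pauliOp Q).trace = x Q * 2 ^ n := by
  simp [toOp, Finset.sum_mul, trace_sum, trace_pauliOp_mul]

theorem pauliCoeff_toOp {n : ℕ} (x : PauliString n → ℝ) : pauliCoeff (toOp x) = x := by
  ext Q
  rw [pauliCoeff, trace_toOp_mul]
  have : ((x Q : ℂ) * 2 ^ n).re = x Q * 2 ^ n := by
    rw [show ((x Q : ℂ) * 2 ^ n) = ((x Q * 2 ^ n : ℝ) : ℂ) by push_cast; rfl]; exact Complex.ofReal_re _
  rw [this]; field_simp

/-- For Hermitian operators the traces against Pauli strings are real, so the real part taken in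
`pauliCoeff` loses nothing. -/
theorem toOp_pauliCoeff {n : ℕ} {A : Op n} (hA : A.IsHermitian) : toOp (pauliCoeff A) = A := by
  rw [toOp]
  conv_rhs => rw [← sum_trace_smul_pauliOp A]
  refine Finset.sum_congr rfl fun P _ => ?_
  congr 1
  have h : star (A * pauliOp P).trace = (A * pauliOp P).trace := by
    rw [← trace_conjTranspose, conjTranspose_mul, hA.eq, (pauliOp_isHermitian P).eq, trace_mul_comm]
  have h2 : (((A * pauliOp P).trace.re : ℝ) : ℂ) = (A * pauliOp P).trace := Complex.conj_eq_iff_re.1 h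
  rw [pauliCoeff]; push_cast; rw [h2]

theorem toOp_add {n : ℕ} (x y : PauliString n → ℝ) : toOp (x + y) = toOp x + toOp y := by
  simp [toOp, add_smul, Finset.sum_add_distrib]

theorem toOp_sub {n : ℕ} (x y : PauliString n → ℝ) : toOp (x - y) = toOp x - toOp y := by
  simp [toOp, sub_smul, Finset.sum_sub_distrib]

theorem toOp_smul {n : ℕ} (a : ℝ) (x : PauliString n → ℝ) : toOp (a • x) = (a : ℂ) • toOp x := by
  rw [toOp, toOp, Finset.smul_sum]
  refine Finset.sum_congr rfl fun P _ => ?_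
  rw [smul_smul, Pi.smul_apply, smul_eq_mul, Complex.ofReal_mul]

theorem toOp_single {n : ℕ} (P : PauliString n) (a : ℝ) :
    toOp (Pi.single P a) = (a : ℂ) • pauliOp P := by
  rw [toOp, Finset.sum_eq_single P]
  · simp
  · intro Q _ hQ; simp [Pi.single_eq_of_ne hQ]
  · simp

theorem toOp_isHermitian {n : ℕ} (x : PauliString n → ℝ) : (toOp x).IsHermitian := by
  unfold Matrix.IsHermitian toOp
  rw [conjTranspose_sum]
  refine Finset.sum_congr rfl fun P _ => ?_
  rw [conjTranspose_smul, (pauliOp_isHermitian P).eq]; simp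

/-- Parseval for the Pauli basis, whose elements are orthogonal with squared 2-norm 2^n. -/
theorem normTwoSq_toOp {n : ℕ} (x : PauliString n → ℝ) :
    normTwoSq (toOp x) = 2 ^ n * ∑ P, x P ^ 2 := by
  have h : ((toOp x)ᴴ * toOp x).trace = ((2 ^ n * ∑ P, x P ^ 2 : ℝ) : ℂ) := by
    rw [(toOp_isHermitian x).eq]
    conv_lhs => enter [1, 2]; rw [toOp]
    rw [Finset.mul_sum, trace_sum]
    push_cast
    rw [Finset.mul_sum]
    refine Finset.sum_congr rfl fun P _ => ?_
    rw [mul_smul_comm, trace_smul, trace_toOp_mul, smul_eq_mul]; ring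
  rw [normTwoSq, h, Complex.ofReal_re]

/-- The vector of coefficients of a list of Pauli terms. -/
noncomputable def listCoeff {n : ℕ} (l : List (PauliString n × ℝ)) (P : PauliString n) : ℝ :=
  (l.map fun t => if t.1 = P then t.2 else 0).sum

theorem toOp_listCoeff {n : ℕ} (l : List (PauliString n × ℝ)) : toOp (listCoeff l) = pauliSum l := by
  induction l with
  | nil => simp [toOp, listCoeff, pauliSum]
  | cons t l ih =>
    have h : listCoeff (t :: l) = Pi.single t.1 t.2 + listCoeff l := by
      ext P
      simp [listCoeff, Pi.single_apply, eq_comm]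
    rw [h, toOp_add, ih, toOp_single]; simp [pauliSum]

/-! ### Norms -/

/-- Cauchy–Schwarz for the 2^n singular values. -/
theorem traceNorm_le {n : ℕ} (A : Op n) : traceNorm A ≤ √(2 ^ n * normTwoSq A) := by
  have hH := isHermitian_conjTranspose_mul_self A
  have hpos : ∀ i, 0 ≤ hH.eigenvalues i := (posSemidef_conjTranspose_mul_self A).eigenvalues_nonneg
  apply Real.le_sqrt_of_sq_le
  have h1 : normTwoSq A = ∑ i, hH.eigenvalues i := by
    rw [normTwoSq, hH.trace_eq_sum_eigenvalues]; simp
  have h2 := sq_sum_le_card_mul_sum_sq (s := Finset.univ) (f := fun i => √(hH.eigenvalues i))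
  simp only [Real.sq_sqrt (hpos _)] at h2
  rw [h1]
  refine h2.trans (le_of_eq ?_)
  simp

/-- The Euclidean norm of a vector of Pauli coefficients. -/
noncomputable def nrm {ι : Type*} [Fintype ι] (x : ι → ℝ) : ℝ := √(∑ i, x i ^ 2)

section nrm
variable {ι : Type*} [Fintype ι]

theorem nrm_eq_norm (x : ι → ℝ) : nrm x = ‖WithLp.toLp 2 x‖ := by
  rw [EuclideanSpace.norm_eq]; simp [nrm]

theorem nrm_nonneg (x : ι → ℝ) : 0 ≤ nrm x := Real.sqrt_nonneg _

theorem nrm_sq (x : ι → ℝ) : nrm x ^ 2 = ∑ i, x i ^ 2 :=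
  Real.sq_sqrt (Finset.sum_nonneg fun _ _ => sq_nonneg _)

theorem nrm_add_le (x y : ι → ℝ) : nrm (x + y) ≤ nrm x + nrm y := by
  simp only [nrm_eq_norm]; exact norm_add_le (WithLp.toLp 2 x) (WithLp.toLp 2 y)

theorem nrm_zero : nrm (0 : ι → ℝ) = 0 := by simp [nrm]

theorem nrm_sum_le {κ : Type*} (s : Finset κ) (f : κ → ι → ℝ) :
    nrm (∑ k ∈ s, f k) ≤ ∑ k ∈ s, nrm (f k) :=
  Finset.le_sum_of_subadditive nrm nrm_zero.le nrm_add_le s f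

theorem nrm_smul (a : ℝ) (x : ι → ℝ) : nrm (a • x) = |a| * nrm x := by
  rw [nrm_eq_norm, nrm_eq_norm, WithLp.toLp_smul, norm_smul, Real.norm_eq_abs]

theorem nrm_mono {x y : ι → ℝ} (h : ∀ i, |x i| ≤ |y i|) : nrm x ≤ nrm y :=
  Real.sqrt_le_sqrt (Finset.sum_le_sum fun i _ => sq_le_sq.2 (h i))

end nrm

/-- Approximating the Pauli coefficients relative to the 2-norm of the input approximates the
output in trace norm. -/
theorem traceNorm_toOp_sub_le {n : ℕ} {ρ : Op n} {c ε : ℝ} (hρ : IsState ρ) (hc : 0 < c)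
    (hS : renyiTwo ρ = n - Real.logb 2 c) (x y : PauliString n → ℝ)
    (h : nrm (x - y) ≤ ε * nrm (pauliCoeff ρ)) : traceNorm (toOp x - toOp y) ≤ ε * √c := by
  have hx : normTwoSq ρ = 2 ^ n * nrm (pauliCoeff ρ) ^ 2 := by
    rw [nrm_sq, ← normTwoSq_toOp, toOp_pauliCoeff hρ.1.isHermitian]
  -- The logarithms below need a positive 2-norm; it holds because the trace of a state is 1.
  have hne : nrm (pauliCoeff ρ) ≠ 0 := by
    intro h0
    have h1 : ∀ P, pauliCoeff ρ P = 0 := by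
      have := nrm_sq (pauliCoeff ρ)
      rw [h0] at this
      intro P
      have h2 := (Finset.sum_eq_zero_iff_of_nonneg (fun P _ => sq_nonneg (pauliCoeff ρ P))).1
        (by rw [← this]; norm_num) P (Finset.mem_univ _)
      exact pow_eq_zero_iff (two_ne_zero) |>.1 h2
    have h2 : ρ = 0 := by
      rw [← toOp_pauliCoeff hρ.1.isHermitian, toOp]
      exact Finset.sum_eq_zero fun P _ => by rw [h1]; simp
    have := hρ.2
    rw [h2] at this; simp at this
  have hpos : 0 < normTwoSq ρ := by rw [hx]; positivity
  -- The only use of the entropy: it makes √c equal to 2^n times the Euclidean norm of the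
  -- coefficients.
  have hc2 : 2 ^ n * normTwoSq ρ = c := by
    have h1 : Real.logb 2 (2 ^ n * normTwoSq ρ) = Real.logb 2 c := by
      rw [Real.logb_mul (by positivity) hpos.ne', Real.logb_pow]
      rw [renyiTwo, one_div, Real.logb_inv] at hS
      rw [Real.logb_self_eq_one (by norm_num)]; linarith
    exact Real.logb_injOn_pos (by norm_num) (Set.mem_Ioi.2 (by positivity)) (Set.mem_Ioi.2 hc) h1
  rw [← toOp_sub]
  refine (traceNorm_le _).trans ?_
  rw [normTwoSq_toOp, ← nrm_sq, ← mul_assoc, Real.sqrt_mul (by positivity) (nrm (x - y) ^ 2),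
    Real.sqrt_sq (nrm_nonneg _)]
  rw [hx, ← mul_assoc] at hc2
  rw [← hc2, Real.sqrt_mul (by positivity) (nrm (pauliCoeff ρ) ^ 2), Real.sqrt_sq (nrm_nonneg _)]
  calc _ ≤ √(2 ^ n * 2 ^ n) * (ε * nrm (pauliCoeff ρ)) := by gcongr
    _ = _ := by ring


/-! ### Products and sums over the cells of an involution -/

section cells
variable {ι R : Type*} [Fintype ι] [LinearOrder ι] [CommSemiring R]

/-- A cell is represented by its smaller qubit and its larger qubit contributes 1. Products over
cells thus keep the index set of the qubits, and no quotient is needed. -/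
theorem prod_cells {p : ι → ι} (hp : ∀ j, p (p j) = j) (g : ι → R) :
    ∏ j, (if p j = j then g j else if j < p j then g j * g (p j) else 1) = ∏ j, g j := by
  have h1 : ∀ j, (if p j = j then g j else if j < p j then g j * g (p j) else 1)
      = (if p j = j then g j else if j < p j then g j else 1) *
        (if j < p j then g (p j) else 1) := by
    intro j
    by_cases h : p j = j
    · simp [h]
    · by_cases h' : j < p j <;> simp [h, h']
  have h2 : ∏ j, (if j < p j then g (p j) else 1) = ∏ j, (if p j < j then g j else 1) := by
    refine Fintype.prod_equiv (Function.Involutive.toPerm p hp) _ _ fun j => ?_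
    change _ = if p (p j) < p j then g (p j) else 1
    rw [hp]
  rw [Finset.prod_congr rfl fun j _ => h1 j, Finset.prod_mul_distrib, h2, ← Finset.prod_mul_distrib]
  refine Finset.prod_congr rfl fun j _ => ?_
  rcases lt_trichotomy j (p j) with h | h | h
  · simp [h, h.ne', h.not_gt]
  · simp [← h]
  · simp [h, h.ne, h.not_gt]

/-- Distributivity over the cells: sums over bit strings of products of local factors become
products of local sums. All tensor-product computations with layers rest on this. -/
theorem sum_prod_cells {κ : Type*} [Fintype κ] [DecidableEq κ] [Inhabited κ] {p : ι → ι}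
    (hp : ∀ j, p (p j) = j) (I : ι → κ → R) (F : ι → κ → κ → R) :
    ∑ x : ι → κ, ∏ j, (if p j = j then I j (x j) else if j < p j then F j (x j) (x (p j)) else 1)
      = ∏ j, (if p j = j then ∑ a, I j a else if j < p j then ∑ a, ∑ b, F j a b else 1) := by
  -- The values on a cell as a pair at its first qubit: diagonal pairs for idle qubits, all pairs
  -- for gates. The second qubit of a gate gets a single dummy pair, so that choices from all `t j`
  -- correspond to functions on the qubits.
  let t : ι → Finset (κ × κ) := fun j =>
    if p j = j then Finset.univ.image fun a => (a, a)
    else if j < p j then Finset.univ else {(default, default)}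
  let f : ι → κ × κ → R := fun j c =>
    if p j = j then I j c.1 else if j < p j then F j c.1 c.2 else 1
  have hR : ∀ j, (if p j = j then ∑ a, I j a else if j < p j then ∑ a, ∑ b, F j a b else 1)
      = ∑ c ∈ t j, f j c := by
    intro j
    simp only [t, f]
    split_ifs with h1 h2
    · rw [Finset.sum_image fun a _ b _ h => (Prod.ext_iff.1 h).1]
    · rw [Fintype.sum_prod_type]
    · simp
  rw [Finset.prod_congr rfl fun j _ => hR j, Finset.prod_univ_sum]
  refine Finset.sum_bij'
    (fun x _ j => if p j = j ∨ j < p j then (x j, x (p j)) else (default, default))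
    (fun c _ j => if p j = j ∨ j < p j then (c j).1 else (c (p j)).2) ?_ ?_ ?_ ?_ ?_
  · intro x _
    rw [Fintype.mem_piFinset]
    intro j
    simp only [t]
    by_cases h1 : p j = j
    · simp [h1]
    · by_cases h2 : j < p j <;> simp [h1, h2]
  · intros; exact Finset.mem_univ _
  · intro x _
    ext j
    rcases lt_trichotomy j (p j) with h | h | h
    · simp [h]
    · simp [← h]
    · simp [h.ne, h.not_gt, hp, h]
  · intro c hc
    rw [Fintype.mem_piFinset] at hc
    funext j
    have hj := hc j
    simp only [t] at hj
    rcases lt_trichotomy j (p j) with h | h | h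
    · simp [h, hp, h.ne, h.not_gt]
    · simp only [← h, if_true, Finset.mem_image, Finset.mem_univ, true_and] at hj
      obtain ⟨a, ha⟩ := hj
      simp [← h, ← ha]
    · simp only [h.ne, h.not_gt, if_false, Finset.mem_singleton] at hj
      simp [h.ne, h.not_gt, hj]
  · intro x _
    refine Finset.prod_congr rfl fun j _ => ?_
    simp only [f]
    by_cases h1 : p j = j
    · simp [h1]
    · by_cases h2 : j < p j <;> simp [h1, h2]

end cells

/-! ### The action of a gate and of a layer on Pauli strings -/

/-- A two-qubit Pauli operator. -/
def pauliTwo (p : Fin 4 × Fin 4) : Matrix (Fin 2 × Fin 2) (Fin 2 × Fin 2) ℂ :=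
  Matrix.of fun x y => pauliMatrix p.1 x.1 y.1 * pauliMatrix p.2 x.2 y.2

/-- The coefficient of the Pauli operator `q` in `G p G†`. -/
noncomputable def gateCoeff (G : Matrix (Fin 2 × Fin 2) (Fin 2 × Fin 2) ℂ)
    (q p : Fin 4 × Fin 4) : ℝ :=
  (G * pauliTwo p * Gᴴ * pauliTwo q).trace.re / 4

theorem pauliTwo_isHermitian (p : Fin 4 × Fin 4) : (pauliTwo p).IsHermitian := by
  ext x y
  simp [pauliTwo, conjTranspose_apply, star_mul', -RCLike.star_def, star_pauliMatrix]

theorem trace_gate_real (G : Matrix (Fin 2 × Fin 2) (Fin 2 × Fin 2) ℂ) (q p : Fin 4 × Fin 4) :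
    (G * pauliTwo p * Gᴴ * pauliTwo q).trace = 4 * (gateCoeff G q p : ℂ) := by
  have h : star (G * pauliTwo p * Gᴴ * pauliTwo q).trace = (G * pauliTwo p * Gᴴ * pauliTwo q).trace := by
    rw [← trace_conjTranspose]
    simp only [conjTranspose_mul, conjTranspose_conjTranspose, (pauliTwo_isHermitian _).eq]
    rw [trace_mul_comm]; simp only [Matrix.mul_assoc]
  have h2 := Complex.conj_eq_iff_re.1 h
  rw [gateCoeff, ← h2]; push_cast; simp; ring

theorem pauliTwo_zero : pauliTwo (0, 0) = 1 := by
  ext x y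
  rw [pauliTwo, of_apply, pauliMatrix_zero, one_apply, one_apply, one_apply]
  by_cases h1 : x.1 = y.1 <;> by_cases h2 : x.2 = y.2 <;> simp [h1, h2, Prod.ext_iff]

theorem trace_pauliTwo (p : Fin 4 × Fin 4) : (pauliTwo p).trace = if p = (0, 0) then 4 else 0 := by
  obtain ⟨p, p'⟩ := p
  fin_cases p <;> fin_cases p' <;>
    simp [Matrix.trace, pauliTwo, pauliMatrix, Fintype.sum_prod_type, Prod.ext_iff]

/-- Conjugation by a unitary fixes the identity (G G† = 1). -/
theorem gateCoeff_zero_right {G : Matrix (Fin 2 × Fin 2) (Fin 2 × Fin 2) ℂ}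
    (hG : G ∈ Matrix.unitaryGroup (Fin 2 × Fin 2) ℂ) (q : Fin 4 × Fin 4) :
    gateCoeff G q (0, 0) = if q = (0, 0) then 1 else 0 := by
  have h : G * Gᴴ = 1 := (mem_unitaryGroup_iff).1 hG
  rw [gateCoeff, pauliTwo_zero, Matrix.mul_one, h,
    Matrix.one_mul, trace_pauliTwo]
  split_ifs <;> simp

/-- Conjugation by a unitary preserves the trace (G† G = 1), so nothing traceless feeds the
identity. -/
theorem gateCoeff_zero_left {G : Matrix (Fin 2 × Fin 2) (Fin 2 × Fin 2) ℂ}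
    (hG : G ∈ Matrix.unitaryGroup (Fin 2 × Fin 2) ℂ) (p : Fin 4 × Fin 4) :
    gateCoeff G (0, 0) p = if p = (0, 0) then 1 else 0 := by
  have h : Gᴴ * G = 1 := (mem_unitaryGroup_iff').1 hG
  rw [gateCoeff, pauliTwo_zero, Matrix.mul_one,
    Matrix.mul_assoc, trace_mul_comm, Matrix.mul_assoc, h, Matrix.mul_one, trace_pauliTwo]
  split_ifs <;> simp

/-- The coefficient of `Q` in `U P U†` for a layer `U`. -/
noncomputable def layerCoeff {n : ℕ} (U : Layer n) (Q P : PauliString n) : ℝ :=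
  ∏ j, if U.partner j = j then (if Q j = P j then 1 else 0)
    else if j < U.partner j then
      gateCoeff (U.gate j) (Q j, Q (U.partner j)) (P j, P (U.partner j))
    else 1

/-- One sum over a product type, in the order that makes `splitFour` and `regroup` turn it into a
sum over functions on the qubits. -/
theorem trace_mul_four {ι : Type*} [Fintype ι] (A B C D : Matrix ι ι ℂ) :
    (A * B * C * D).trace = ∑ z : ι × ι × ι × ι,
      A z.1 z.2.2.2 * B z.2.2.2 z.2.2.1 * C z.2.2.1 z.2.1 * D z.2.1 z.1 := by
  simp only [Matrix.trace, diag_apply, mul_apply, Fintype.sum_prod_type, Finset.sum_mul]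

/-- Regrouping four bits of two qubits. -/
def regroup {α : Type*} : (α × α × α × α) × (α × α × α × α) ≃
    (α × α) × (α × α) × (α × α) × (α × α) where
  toFun c := ((c.1.1, c.2.1), (c.1.2.1, c.2.2.1), (c.1.2.2.1, c.2.2.2.1), (c.1.2.2.2, c.2.2.2.2))
  invFun c := ((c.1.1, c.2.1.1, c.2.2.1.1, c.2.2.2.1), (c.1.2, c.2.1.2, c.2.2.1.2, c.2.2.2.2))
  left_inv _ := rfl
  right_inv _ := rfl

/-- Functions into fourfold products. -/
def splitFour {ι α : Type*} : (ι → α × α × α × α) ≃ (ι → α) × (ι → α) × (ι → α) × (ι → α) where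
  toFun z := (fun i => (z i).1, fun i => (z i).2.1, fun i => (z i).2.2.1, fun i => (z i).2.2.2)
  invFun c i := (c.1 i, c.2.1 i, c.2.2.1 i, c.2.2.2 i)
  left_inv _ := rfl
  right_inv _ := rfl

theorem star_one_apply {ι : Type*} [DecidableEq ι] (i j : ι) :
    star ((1 : Matrix ι ι ℂ) i j) = (1 : Matrix ι ι ℂ) i j := by
  rw [one_apply]; split_ifs <;> simp

theorem one_apply_comm {ι : Type*} [DecidableEq ι] (i j : ι) :
    (1 : Matrix ι ι ℂ) i j = (1 : Matrix ι ι ℂ) j i := by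
  rw [one_apply, one_apply]; simp only [eq_comm]

/-- All four operators are products over the cells, so the trace factorizes into one trace for every
idle qubit and one for every gate. -/
theorem trace_layer {n : ℕ} (U : Layer n) (P Q : PauliString n) :
    (U.op * pauliOp P * U.opᴴ * pauliOp Q).trace = 2 ^ n * (layerCoeff U Q P : ℂ) := by
  have hp := U.involutive
  rw [trace_mul_four, ← Equiv.sum_comp (splitFour (ι := Fin n) (α := Fin 2))]
  have hcell := sum_prod_cells hp
    (fun j (c : Fin 2 × Fin 2 × Fin 2 × Fin 2) => (1 : Matrix (Fin 2) (Fin 2) ℂ) c.1 c.2.2.2 *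
      pauliMatrix (P j) c.2.2.2 c.2.2.1 * (1 : Matrix (Fin 2) (Fin 2) ℂ) c.2.2.1 c.2.1 *
      pauliMatrix (Q j) c.2.1 c.1)
    (fun j c d => U.gate j (regroup (c, d)).1 (regroup (c, d)).2.2.2 *
      pauliTwo (P j, P (U.partner j)) (regroup (c, d)).2.2.2 (regroup (c, d)).2.2.1 *
      (U.gate j)ᴴ (regroup (c, d)).2.2.1 (regroup (c, d)).2.1 *
      pauliTwo (Q j, Q (U.partner j)) (regroup (c, d)).2.1 (regroup (c, d)).1)
  refine (Finset.sum_congr rfl fun z _ => ?_).trans (hcell.trans ?_)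
  · simp only [Layer.op, pauliOp, of_apply, conjTranspose_apply]
    rw [← prod_cells hp (fun j => pauliMatrix (P j) _ _), ← prod_cells hp (fun j => pauliMatrix (Q j) _ _),
      star_prod, ← Finset.prod_mul_distrib, ← Finset.prod_mul_distrib, ← Finset.prod_mul_distrib]
    refine Finset.prod_congr rfl fun j _ => ?_
    split_ifs with h1 h2
    · rw [star_one_apply, one_apply_comm ((splitFour z).2.1 j)]; rfl
    · simp only [splitFour, regroup, Equiv.coe_fn_mk, pauliTwo, of_apply]
    · simp
  -- The dimension is distributed over the cells as well, 2 for an idle qubit and 4 for a gate, so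
  -- that the comparison is cell by cell.
  have h2 : (2 : ℂ) ^ n = ∏ j : Fin n, (if U.partner j = j then 2 else if j < U.partner j then 2 * 2 else 1) := by
    rw [prod_cells hp (fun _ => (2 : ℂ))]; simp
  rw [h2, layerCoeff]
  push_cast
  rw [← Finset.prod_mul_distrib]
  refine Finset.prod_congr rfl fun j _ => ?_
  split_ifs with h3 h4 h5
  · have := trace_mul_four (1 : Matrix (Fin 2) (Fin 2) ℂ) (pauliMatrix (P j)) 1 (pauliMatrix (Q j))
    rw [← this]
    have h6 := trace_pauliMatrix_mul (P j) (Q j)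
    simp only [Matrix.one_mul, Matrix.mul_one, Matrix.trace, diag_apply, mul_apply, h6]
    simp [h4]
  · have := trace_mul_four (1 : Matrix (Fin 2) (Fin 2) ℂ) (pauliMatrix (P j)) 1 (pauliMatrix (Q j))
    rw [← this]
    have h6 := trace_pauliMatrix_mul (P j) (Q j)
    simp only [Matrix.one_mul, Matrix.mul_one, Matrix.trace, diag_apply, mul_apply, h6]
    simp [Ne.symm h4]
  · have := trace_mul_four (U.gate j) (pauliTwo (P j, P (U.partner j))) (U.gate j)ᴴ
      (pauliTwo (Q j, Q (U.partner j)))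
    rw [← Equiv.sum_comp regroup, Fintype.sum_prod_type] at this
    rw [← this, trace_gate_real]; norm_num
  · simp

/-- The linear map on Pauli coefficients given by a layer. -/
noncomputable def layerVec {n : ℕ} (U : Layer n) (x : PauliString n → ℝ) : PauliString n → ℝ :=
  fun Q => ∑ P, layerCoeff U Q P * x P

theorem layer_conj_toOp {n : ℕ} (U : Layer n) (x : PauliString n → ℝ) :
    U.op * toOp x * U.opᴴ = toOp (layerVec U x) := by
  rw [← sum_trace_smul_pauliOp (U.op * toOp x * U.opᴴ)]
  conv_rhs => rw [toOp]
  refine Finset.sum_congr rfl fun Q _ => ?_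
  congr 1
  conv_lhs => rw [toOp]
  rw [Finset.mul_sum, Finset.sum_mul, Finset.sum_mul, trace_sum, Finset.sum_div, layerVec]
  push_cast
  refine Finset.sum_congr rfl fun P _ => ?_
  rw [mul_smul_comm, smul_mul_assoc, smul_mul_assoc, trace_smul, trace_layer, smul_eq_mul]
  field_simp

/-- The matrix product also factorizes over the cells and reduces to unitarity of the single gates.
-/
theorem layer_op_unitary {n : ℕ} (U : Layer n) : U.opᴴ * U.op = 1 := by
  have hp := U.involutive
  ext x y
  rw [mul_apply]
  have hcell := sum_prod_cells hp
    (fun j a => (1 : Matrix (Fin 2) (Fin 2) ℂ) (x j) a * (1 : Matrix (Fin 2) (Fin 2) ℂ) a (y j))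
    (fun j a b => (U.gate j)ᴴ (x j, x (U.partner j)) (a, b) *
        (U.gate j) (a, b) (y j, y (U.partner j)))
  refine (Finset.sum_congr rfl fun z _ => ?_).trans (hcell.trans ?_)
  · simp only [Layer.op, of_apply, conjTranspose_apply]
    rw [star_prod, ← Finset.prod_mul_distrib]
    refine Finset.prod_congr rfl fun j _ => ?_
    split_ifs with h1 h2
    · rw [star_one_apply, one_apply_comm]
    · simp
    · simp
  have h2 : (1 : Op n) x y = ∏ j, (1 : Matrix (Fin 2) (Fin 2) ℂ) (x j) (y j) := by
    by_cases h : x = y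
    · subst h; simp
    · obtain ⟨j, hj⟩ := Function.ne_iff.1 h
      rw [one_apply_ne h]
      exact (Finset.prod_eq_zero (f := fun j => (1 : Matrix (Fin 2) (Fin 2) ℂ) (x j) (y j))
        (Finset.mem_univ j) (Matrix.one_apply_ne hj)).symm
  rw [h2, ← prod_cells hp (fun j => (1 : Matrix (Fin 2) (Fin 2) ℂ) (x j) (y j))]
  refine Finset.prod_congr rfl fun j _ => ?_
  split_ifs with h3 h4
  · rw [← mul_apply, Matrix.mul_one]
  · have h5 : (U.gate j)ᴴ * U.gate j = 1 := (mem_unitaryGroup_iff').1 (U.unitary j h4)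
    have h6 := congrFun (congrFun h5 (x j, x (U.partner j))) (y j, y (U.partner j))
    rw [mul_apply, Fintype.sum_prod_type] at h6
    rw [h6]
    rw [one_apply, one_apply, one_apply]
    by_cases h1 : x j = y j <;> by_cases h2 : x (U.partner j) = y (U.partner j) <;>
      simp [h1, h2, Prod.ext_iff]
  · rfl

/-- Unitary conjugation preserves the 2-norm; Parseval transfers this to coefficients. -/
theorem nrm_layerVec {n : ℕ} (U : Layer n) (x : PauliString n → ℝ) : nrm (layerVec U x) = nrm x := by
  have h : normTwoSq (toOp (layerVec U x)) = normTwoSq (toOp x) := by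
    rw [← layer_conj_toOp, normTwoSq, normTwoSq]
    congr 1
    have h1 : (U.op * toOp x * U.opᴴ)ᴴ * (U.op * toOp x * U.opᴴ)
        = U.op * ((toOp x)ᴴ * (U.opᴴ * U.op) * toOp x * U.opᴴ) := by
      simp only [conjTranspose_mul, conjTranspose_conjTranspose, Matrix.mul_assoc]
    rw [h1, trace_mul_comm, layer_op_unitary, Matrix.mul_one, Matrix.mul_assoc, layer_op_unitary,
      Matrix.mul_one]
  rw [normTwoSq_toOp, normTwoSq_toOp] at h
  rw [nrm, nrm, mul_left_cancel₀ (by positivity) h]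

/-! ### The noise in the Pauli basis -/

/-- The partial trace over a qubit kills X, Y and Z there and is undone by the maximally mixed state
if the label is the identity. -/
theorem mixQubit_pauliOp {n : ℕ} (j : Fin n) (P : PauliString n) :
    mixQubit j (pauliOp P) = if P j = 0 then pauliOp P else 0 := by
  have htr : ∀ p : Fin 4, ∑ b : Fin 2, pauliMatrix p b b = if p = 0 then 2 else 0 := by
    intro p; fin_cases p <;> simp [pauliMatrix]
  ext x y
  simp only [mixQubit, of_apply]
  have h1 : ∀ b, pauliOp P (Function.update x j b) (Function.update y j b)
      = pauliMatrix (P j) b b * ∏ i ∈ Finset.univ.erase j, pauliMatrix (P i) (x i) (y i) := by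
    intro b
    rw [pauliOp, of_apply, ← Finset.mul_prod_erase _ _ (Finset.mem_univ j)]
    simp only [Function.update_self]
    congr 1
    refine Finset.prod_congr rfl fun i hi => ?_
    rw [Function.update_of_ne (Finset.ne_of_mem_erase hi), Function.update_of_ne (Finset.ne_of_mem_erase hi)]
  simp only [h1, ← Finset.sum_mul, htr]
  by_cases hP : P j = 0
  · simp only [hP, if_true, pauliOp, of_apply]
    rw [← Finset.mul_prod_erase Finset.univ _ (Finset.mem_univ j), hP, pauliMatrix_zero, one_apply]
    split_ifs <;> simp
  · simp [hP]

theorem mixQubit_toOp {n : ℕ} (j : Fin n) (x : PauliString n → ℝ) :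
    mixQubit j (toOp x) = toOp fun P => if P j = 0 then x P else 0 := by
  have hlin : mixQubit j (toOp x) = ∑ P, (x P : ℂ) • mixQubit j (pauliOp P) := by
    ext a b
    simp only [mixQubit, toOp, of_apply, Matrix.sum_apply, Matrix.smul_apply, smul_eq_mul]
    split_ifs
    · rw [Finset.sum_comm, Finset.mul_sum]
      refine Finset.sum_congr rfl fun P _ => ?_
      rw [← Finset.mul_sum]; ring
    · simp
  rw [hlin, toOp]
  refine Finset.sum_congr rfl fun P _ => ?_
  rw [mixQubit_pauliOp]
  split_ifs <;> simp

/-- Damping of the Pauli coefficients by depolarizing noise on the qubits that satisfy `p`. -/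
noncomputable def damp {n : ℕ} (q : ℝ) (p : Fin n → Bool) (x : PauliString n → ℝ) :
    PauliString n → ℝ :=
  fun P => q ^ (Finset.univ.filter fun j => p j ∧ P j ≠ 0).card * x P

theorem depolarize_toOp {n : ℕ} (γ : ℝ) (j : Fin n) (x : PauliString n → ℝ) :
    depolarize γ j (toOp x) = toOp fun P => (if P j = 0 then 1 else Real.exp (-γ)) * x P := by
  rw [depolarize, mixQubit_toOp, ← toOp_smul, ← toOp_smul, ← toOp_add]
  congr 1
  ext P
  simp only [Pi.add_apply, Pi.smul_apply, smul_eq_mul]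
  split_ifs <;> ring

/-- Each single-qubit channel is diagonal in the Pauli basis with entries 1 and e^(-γ); the product
over the noisy qubits counts the nonidentity labels. -/
theorem noise_toOp {n : ℕ} (γ : ℝ) (p : Fin n → Bool) (x : PauliString n → ℝ) :
    noise γ p (toOp x) = toOp (damp (Real.exp (-γ)) p x) := by
  have h : ∀ l : List (Fin n), l.foldr (depolarize γ) (toOp x)
      = toOp fun P => (l.map fun j => if P j = 0 then 1 else Real.exp (-γ)).prod * x P := by
    intro l
    induction l with
    | nil => simp
    | cons j l ih =>
      rw [List.foldr_cons, ih, depolarize_toOp]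
      congr 1; ext P; simp [mul_assoc]
  rw [noise, h]
  congr 1
  ext P
  rw [damp]
  congr 1
  rw [← List.prod_toFinset _ ((List.nodup_finRange n).filter _)]
  have : ((List.finRange n).filter p).toFinset = Finset.univ.filter fun j => p j = true := by
    ext j; simp
  rw [this]
  rw [← Finset.filter_filter, ← Finset.prod_const, Finset.prod_filter (fun j => P j ≠ 0)]
  exact Finset.prod_congr rfl fun j _ => by by_cases h : P j = 0 <;> simp [h]

/-- One layer with its noise, on Pauli coefficients. -/
noncomputable def stepVec {n : ℕ} (M : NoiseModel) (q : ℝ) (U : Layer n)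
    (x : PauliString n → ℝ) : PauliString n → ℝ :=
  layerVec U (damp q (M.noisy U) x)

/-- The noisy circuit on Pauli coefficients. -/
noncomputable def circuitVec {n : ℕ} (M : NoiseModel) (q : ℝ) (L : List (Layer n))
    (x : PauliString n → ℝ) : PauliString n → ℝ :=
  damp q (fun _ => true) (L.foldr (stepVec M q) x)

theorem noisyCircuit_toOp {n : ℕ} (M : NoiseModel) (γ : ℝ) (L : List (Layer n))
    (x : PauliString n → ℝ) :
    noisyCircuit M γ L (toOp x) = toOp (circuitVec M (Real.exp (-γ)) L x) := by
  have h : evolve M γ L (toOp x) = toOp (L.foldr (stepVec M (Real.exp (-γ))) x) := by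
    induction L with
    | nil => rfl
    | cons U L ih => rw [evolve, ih, noise_toOp, layer_conj_toOp]; rfl
  rw [noisyCircuit, h, noise_toOp]; rfl


/-! ### Structure of the layer coefficients -/

theorem layerCoeff_idle {n : ℕ} {U : Layer n} {Q P : PauliString n} (h : layerCoeff U Q P ≠ 0)
    {j : Fin n} (hj : U.partner j = j) : Q j = P j := by
  by_contra hne
  exact h (Finset.prod_eq_zero (Finset.mem_univ j) (by rw [if_pos hj, if_neg hne]))

/-- The identity on a gate decouples from all other labels, because conjugation is unital and trace
preserving. Hence Pauli paths branch only at gates that they meet nontrivially. -/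
theorem layerCoeff_gate {n : ℕ} {U : Layer n} {Q P : PauliString n} (h : layerCoeff U Q P ≠ 0)
    {j : Fin n} (hj : j < U.partner j) :
    (Q j = 0 ∧ Q (U.partner j) = 0) ↔ (P j = 0 ∧ P (U.partner j) = 0) := by
  have h1 : gateCoeff (U.gate j) (Q j, Q (U.partner j)) (P j, P (U.partner j)) ≠ 0 := by
    intro h0
    exact h (Finset.prod_eq_zero (Finset.mem_univ j) (by rw [if_neg hj.ne', if_pos hj, h0]))
  constructor
  · rintro ⟨ha, hb⟩
    rw [ha, hb, gateCoeff_zero_left (U.unitary j hj)] at h1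
    simpa using h1
  · rintro ⟨ha, hb⟩
    rw [ha, hb, gateCoeff_zero_right (U.unitary j hj)] at h1
    simpa using h1

theorem layerCoeff_zero_zero {n : ℕ} (U : Layer n) : layerCoeff U 0 0 = 1 := by
  refine Finset.prod_eq_one fun j _ => ?_
  split_ifs with h1 h2 h3
  · rfl
  · exact absurd rfl h2
  · simp [gateCoeff_zero_left (U.unitary j h3)]
  · rfl

theorem layerCoeff_zero_iff {n : ℕ} {U : Layer n} {Q P : PauliString n} (h : layerCoeff U Q P ≠ 0) :
    Q = 0 ↔ P = 0 := by
  have key : ∀ j, (Q j = 0 ∧ Q (U.partner j) = 0) ↔ (P j = 0 ∧ P (U.partner j) = 0) := by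
    intro j
    rcases lt_trichotomy j (U.partner j) with h1 | h1 | h1
    · exact layerCoeff_gate h h1
    · rw [← h1, layerCoeff_idle h h1.symm]
    · have h2 := layerCoeff_gate h (j := U.partner j) (by rw [U.involutive]; exact h1)
      rw [U.involutive] at h2
      rw [and_comm, h2, and_comm]
  constructor
  · rintro rfl; ext1 j; exact ((key j).1 ⟨rfl, rfl⟩).1
  · rintro rfl; ext1 j; exact ((key j).2 ⟨rfl, rfl⟩).1

/-! ### Linearity and contraction -/

theorem layerVec_sub {n : ℕ} (U : Layer n) (x y : PauliString n → ℝ) :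
    layerVec U (x - y) = layerVec U x - layerVec U y := by
  ext Q; simp [layerVec, mul_sub, Finset.sum_sub_distrib]

theorem layerVec_sum {n : ℕ} {κ : Type*} (s : Finset κ) (U : Layer n) (x : κ → PauliString n → ℝ) :
    layerVec U (∑ k ∈ s, x k) = ∑ k ∈ s, layerVec U (x k) := by
  ext Q
  simp only [layerVec, Finset.sum_apply, Finset.mul_sum]
  rw [Finset.sum_comm]

theorem damp_sub {n : ℕ} (q : ℝ) (p : Fin n → Bool) (x y : PauliString n → ℝ) :
    damp q p (x - y) = damp q p x - damp q p y := by
  ext Q; simp [damp, mul_sub]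

theorem circuitVec_sub {n : ℕ} (M : NoiseModel) (q : ℝ) (L : List (Layer n))
    (x y : PauliString n → ℝ) :
    circuitVec M q L (x - y) = circuitVec M q L x - circuitVec M q L y := by
  rw [circuitVec, circuitVec, circuitVec, ← damp_sub]
  congr 1
  induction L with
  | nil => rfl
  | cons U L ih => simp only [List.foldr_cons, ih, stepVec, damp_sub, layerVec_sub]

theorem damp_all {n : ℕ} (q : ℝ) (x : PauliString n → ℝ) (P : PauliString n) :
    damp q (fun _ => true) x P = q ^ weight P * x P := by simp [damp, weight]

theorem nrm_damp_le {n : ℕ} {q : ℝ} (h0 : 0 ≤ q) (h1 : q ≤ 1) (p : Fin n → Bool)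
    (x : PauliString n → ℝ) : nrm (damp q p x) ≤ nrm x := by
  refine nrm_mono fun P => ?_
  rw [damp, abs_mul, abs_of_nonneg (pow_nonneg h0 _)]
  exact mul_le_of_le_one_left (abs_nonneg _) (pow_le_one₀ h0 h1)

/-! ### Gate-based noise: truncation of the weight -/

theorem damp_damp_not {n : ℕ} (q : ℝ) (p : Fin n → Bool) (x : PauliString n → ℝ) :
    damp q p (damp q (fun j => !p j) x) = damp q (fun _ => true) x := by
  ext P
  rw [damp_all, damp, damp, ← mul_assoc, ← pow_add, weight,
    ← Finset.card_filter_add_card_filter_not (s := Finset.univ.filter fun j => P j ≠ 0) (fun j => p j = true),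
    Finset.filter_filter, Finset.filter_filter]
  simp [and_comm]

theorem damp_comm {n : ℕ} (q : ℝ) (p p' : Fin n → Bool) (x : PauliString n → ℝ) :
    damp q p (damp q p' x) = damp q p' (damp q p x) := by
  ext P; simp only [damp]; ring

/-- A layer does not change the labels of idle qubits, so noise on these qubits may act before or
after it. -/
theorem damp_idle_layerVec {n : ℕ} (q : ℝ) (U : Layer n) (x : PauliString n → ℝ) :
    damp q (fun j => !NoiseModel.gateBased.noisy U j) (layerVec U x)
      = layerVec U (damp q (fun j => !NoiseModel.gateBased.noisy U j) x) := by
  ext Q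
  rw [damp, layerVec, layerVec, Finset.mul_sum]
  refine Finset.sum_congr rfl fun P _ => ?_
  by_cases h : layerCoeff U Q P = 0
  · simp [h]
  · rw [damp, ← mul_assoc, ← mul_assoc, mul_comm (q ^ _)]
    have hc : ∀ j, ((!NoiseModel.gateBased.noisy U j) = true ∧ Q j ≠ 0) ↔
        ((!NoiseModel.gateBased.noisy U j) = true ∧ P j ≠ 0) := by
      intro j
      refine and_congr_right fun hj => ?_
      rw [layerCoeff_idle h (by simpa [NoiseModel.noisy] using hj)]
    simp only [hc]

/-- Although gate-based noise spares idle qubits, the whole circuit contracts at least as much as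
one round of noise on all qubits at the input. Noise on all qubits after a layer is weakened to
noise on its idle qubits, moved to the other side of the layer, and completed there by the gate
noise. The induction peels off the layer that is executed first. -/
theorem nrm_circuitVec_gateBased_le {n : ℕ} {q : ℝ} (h0 : 0 ≤ q) (h1 : q ≤ 1) (L : List (Layer n))
    (y : PauliString n → ℝ) :
    nrm (circuitVec .gateBased q L y) ≤ nrm (damp q (fun _ => true) y) := by
  induction L using List.reverseRecOn generalizing y with
  | nil => exact le_rfl
  | append_singleton L U ih =>
    have h2 : circuitVec .gateBased q (L ++ [U]) y = circuitVec .gateBased q L (stepVec .gateBased q U y) := by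
      simp [circuitVec]
    rw [h2]
    refine (ih _).trans ?_
    -- Of the noise after the layer, the part on gate qubits is thrown away and the part on idle
    -- qubits is kept.
    rw [← damp_damp_not q (NoiseModel.gateBased.noisy U)]
    refine (nrm_damp_le h0 h1 _ _).trans (le_of_eq ?_)
    rw [stepVec, damp_idle_layerVec, nrm_layerVec, damp_comm, damp_damp_not]

/-- Truncation to Pauli strings of weight at most `ℓ`. -/
noncomputable def trunc {n : ℕ} (ℓ : ℕ) (x : PauliString n → ℝ) : PauliString n → ℝ :=
  fun P => if weight P ≤ ℓ then x P else 0

/-- The circuit with gate-based noise, truncated to weight `ℓ` before every layer of noise. -/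
noncomputable def truncCircuit {n : ℕ} (q : ℝ) (ℓ : ℕ) (L : List (Layer n))
    (x : PauliString n → ℝ) : PauliString n → ℝ :=
  damp q (fun _ => true) (trunc ℓ (L.foldr (fun U y => stepVec .gateBased q U (trunc ℓ y)) x))

/-- Pythagoras: truncation is an orthogonal projection. -/
theorem nrm_sq_trunc_add {n : ℕ} (ℓ : ℕ) (x : PauliString n → ℝ) :
    nrm (x - trunc ℓ x) ^ 2 + nrm (trunc ℓ x) ^ 2 = nrm x ^ 2 := by
  rw [nrm_sq, nrm_sq, nrm_sq, ← Finset.sum_add_distrib]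
  refine Finset.sum_congr rfl fun P _ => ?_
  by_cases h : weight P ≤ ℓ <;> simp [trunc, h]

/-- Discarded strings have weight at least ℓ + 1; this is the source of the -1 in the exponent of
the running time. -/
theorem nrm_damp_tail_le {n : ℕ} {q : ℝ} (h0 : 0 ≤ q) (h1 : q ≤ 1) (ℓ : ℕ) (x : PauliString n → ℝ) :
    nrm (damp q (fun _ => true) (x - trunc ℓ x)) ≤ q ^ (ℓ + 1) * nrm (x - trunc ℓ x) := by
  rw [← abs_of_nonneg (pow_nonneg h0 (ℓ + 1)), ← nrm_smul]
  refine nrm_mono fun P => ?_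
  rw [damp_all, Pi.smul_apply, smul_eq_mul, abs_mul, abs_mul, abs_of_nonneg (pow_nonneg h0 _),
    abs_of_nonneg (pow_nonneg h0 (ℓ + 1))]
  by_cases h : weight P ≤ ℓ
  · simp [trunc, h]
  · exact mul_le_mul_of_nonneg_right (pow_le_pow_of_le_one h0 h1 (by omega)) (abs_nonneg _)

/-- Cauchy–Schwarz for (1, √m) and (a, b). It is the induction step that lets orthogonal errors
accumulate as a square root of their number. -/
theorem add_sqrt_mul_le {m a b c : ℝ} (hm : 0 ≤ m) (hc : 0 ≤ c) (h : a ^ 2 + b ^ 2 = c ^ 2) :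
    a + √m * b ≤ √(m + 1) * c := by
  have hs := Real.sq_sqrt hm
  have hs1 := Real.sq_sqrt (show (0 : ℝ) ≤ m + 1 by linarith)
  apply le_of_sq_le_sq _ (by positivity)
  have : (√(m + 1) * c) ^ 2 = (m + 1) * (a ^ 2 + b ^ 2) := by rw [mul_pow, hs1, h]
  rw [this]
  nlinarith [sq_nonneg (√m * a - b)]

/-- Each discarded tail is damped by q^(ℓ+1) on its way through the exact circuit. The kept part is
orthogonal to the tail and is left with a smaller norm for later errors, so d + 1 truncations cost
√(d+1) and not d + 1. -/
theorem nrm_circuitVec_sub_truncCircuit_le {n : ℕ} {q : ℝ} (h0 : 0 ≤ q) (h1 : q ≤ 1) (ℓ : ℕ)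
    (L : List (Layer n)) (x : PauliString n → ℝ) :
    nrm (circuitVec .gateBased q L x - truncCircuit q ℓ L x)
      ≤ q ^ (ℓ + 1) * (√((L.length : ℝ) + 1) * nrm x) := by
  have hδ := pow_nonneg h0 (ℓ + 1)
  induction L using List.reverseRecOn generalizing x with
  | nil =>
    have : circuitVec .gateBased q [] x - truncCircuit q ℓ [] x
        = damp q (fun _ => true) (x - trunc ℓ x) := by
      rw [damp_sub]; rfl
    rw [this]
    refine (nrm_damp_tail_le h0 h1 ℓ x).trans ?_
    gcongr
    have h2 := nrm_sq_trunc_add ℓ x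
    have h3 : nrm (x - trunc ℓ x) ≤ nrm x :=
      le_of_sq_le_sq (by nlinarith [sq_nonneg (nrm (trunc ℓ x))]) (nrm_nonneg _)
    simpa using h3
  | append_singleton L U ih =>
    set y := stepVec .gateBased q U (trunc ℓ x) with hy
    have h2 : circuitVec .gateBased q (L ++ [U]) (trunc ℓ x) = circuitVec .gateBased q L y := by
      simp [circuitVec, hy]
    have h3 : truncCircuit q ℓ (L ++ [U]) x = truncCircuit q ℓ L y := by simp [truncCircuit, hy]
    -- The tail runs through the exact circuit, and the kept part meets the induction hypothesis
    -- after one exact step.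
    have h4 : circuitVec .gateBased q (L ++ [U]) x - truncCircuit q ℓ (L ++ [U]) x
        = circuitVec .gateBased q (L ++ [U]) (x - trunc ℓ x)
          + (circuitVec .gateBased q L y - truncCircuit q ℓ L y) := by
      rw [circuitVec_sub, h2, h3]; abel
    have h5 : nrm y ≤ nrm (trunc ℓ x) := by
      rw [hy, stepVec, nrm_layerVec]; exact nrm_damp_le h0 h1 _ _
    have h6 := add_sqrt_mul_le (m := (L.length : ℝ) + 1) (by positivity) (nrm_nonneg x)
      (nrm_sq_trunc_add ℓ x)
    rw [h4]
    calc _ ≤ nrm (circuitVec .gateBased q (L ++ [U]) (x - trunc ℓ x))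
          + nrm (circuitVec .gateBased q L y - truncCircuit q ℓ L y) := nrm_add_le _ _
      _ ≤ q ^ (ℓ + 1) * nrm (x - trunc ℓ x)
          + q ^ (ℓ + 1) * (√((L.length : ℝ) + 1) * nrm (trunc ℓ x)) := by
        refine add_le_add ((nrm_circuitVec_gateBased_le h0 h1 _ _).trans (nrm_damp_tail_le h0 h1 _ _))
          ((ih y).trans ?_)
        gcongr
      _ = q ^ (ℓ + 1) * (nrm (x - trunc ℓ x) + √((L.length : ℝ) + 1) * nrm (trunc ℓ x)) := by ring
      _ ≤ _ := by
        refine mul_le_mul_of_nonneg_left (h6.trans_eq ?_) hδ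
        rw [List.length_append]; simp

/-! ### Uniform noise -/

theorem stepVec_uniform {n : ℕ} (q : ℝ) (U : Layer n) (x : PauliString n → ℝ) :
    stepVec .uniform q U x = layerVec U (damp q (fun _ => true) x) := rfl

theorem layerVec_single_zero {n : ℕ} (U : Layer n) (a : ℝ) :
    layerVec U (Pi.single 0 a) = Pi.single 0 a := by
  ext Q
  rw [layerVec, Finset.sum_eq_single 0]
  · by_cases hQ : Q = 0
    · subst hQ; simp [layerCoeff_zero_zero]
    · have : layerCoeff U Q 0 = 0 := by
        by_contra h; exact hQ ((layerCoeff_zero_iff h).2 rfl)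
      simp [this, Pi.single_eq_of_ne hQ]
  · intro P _ hP; simp [Pi.single_eq_of_ne hP]
  · simp

theorem damp_single_zero {n : ℕ} (q a : ℝ) (p : Fin n → Bool) :
    damp q p (Pi.single (0 : PauliString n) a) = Pi.single 0 a := by
  ext Q
  rw [damp]
  by_cases hQ : Q = 0
  · subst hQ; simp
  · simp [Pi.single_eq_of_ne hQ]

theorem nrm_damp_all_le {n : ℕ} {q : ℝ} (h0 : 0 ≤ q) (h1 : q ≤ 1) {y : PauliString n → ℝ}
    (hy : y 0 = 0) : nrm (damp q (fun _ => true) y) ≤ q * nrm y := by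
  conv_rhs => rw [← abs_of_nonneg h0, ← nrm_smul]
  refine nrm_mono fun P => ?_
  rw [damp_all, Pi.smul_apply, smul_eq_mul, abs_mul, abs_mul, abs_of_nonneg (pow_nonneg h0 _),
    abs_of_nonneg h0]
  by_cases hP : P = 0
  · simp [hP, hy]
  · refine mul_le_mul_of_nonneg_right ?_ (abs_nonneg _)
    obtain ⟨j, hj⟩ := Function.ne_iff.1 hP
    have : 1 ≤ weight P := Finset.card_pos.2 ⟨j, by simpa using hj⟩
    simpa using pow_le_pow_of_le_one h0 h1 this

/-- The traceless part stays traceless, and every nonidentity string has weight at least 1, so each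
of the d + 1 rounds of noise contributes a factor q. -/
theorem nrm_circuitVec_uniform_le {n : ℕ} {q : ℝ} (h0 : 0 ≤ q) (h1 : q ≤ 1) (L : List (Layer n))
    {y : PauliString n → ℝ} (hy : y 0 = 0) :
    nrm (circuitVec .uniform q L y) ≤ q ^ (L.length + 1) * nrm y := by
  have h : (L.foldr (stepVec .uniform q) y) 0 = 0 ∧
      nrm (L.foldr (stepVec .uniform q) y) ≤ q ^ L.length * nrm y := by
    induction L with
    | nil => simp [hy]
    | cons U L ih =>
      rw [List.foldr_cons, stepVec_uniform]
      constructor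
      · rw [layerVec]
        refine Finset.sum_eq_zero fun P _ => ?_
        by_cases hP : P = 0
        · rw [hP, damp_all, ih.1]; simp
        · have : layerCoeff U 0 P = 0 := by
            by_contra h; exact hP ((layerCoeff_zero_iff h).1 rfl)
          simp [this]
      · rw [nrm_layerVec]
        refine (nrm_damp_all_le h0 h1 ih.1).trans ?_
        rw [List.length_cons, pow_succ', mul_assoc]
        exact mul_le_mul_of_nonneg_left ih.2 h0
  refine (nrm_damp_all_le h0 h1 h.1).trans ?_
  rw [pow_succ', mul_assoc]
  exact mul_le_mul_of_nonneg_left h.2 h0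

/-- In a deep circuit with uniform noise only the identity component survives. -/
theorem nrm_single_sub_circuitVec_le {n : ℕ} {q : ℝ} (h0 : 0 ≤ q) (h1 : q ≤ 1) (L : List (Layer n))
    (x : PauliString n → ℝ) :
    nrm (Pi.single 0 (x 0) - circuitVec .uniform q L x) ≤ q ^ (L.length + 1) * nrm x := by
  -- The identity is a fixed point of gates and noise, so by linearity only the traceless part has
  -- to be contracted.
  have h2 : circuitVec .uniform q L (Pi.single 0 (x 0)) = Pi.single 0 (x 0) := by
    rw [circuitVec]
    have : L.foldr (stepVec .uniform q) (Pi.single 0 (x 0)) = Pi.single 0 (x 0) := by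
      induction L with
      | nil => rfl
      | cons U L ih => rw [List.foldr_cons, ih, stepVec_uniform, damp_single_zero, layerVec_single_zero]
    rw [this, damp_single_zero]
  have h3 : Pi.single 0 (x 0) - circuitVec .uniform q L x
      = circuitVec .uniform q L (Pi.single 0 (x 0) - x) := by rw [circuitVec_sub, h2]
  rw [h3]
  refine (nrm_circuitVec_uniform_le h0 h1 L (by simp)).trans ?_
  refine mul_le_mul_of_nonneg_left (nrm_mono fun P => ?_) (pow_nonneg h0 _)
  by_cases hP : P = 0
  · subst hP; simp
  · simp [Pi.single_eq_of_ne hP]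

/-! ### Uniform noise: truncation of the total weight of Pauli paths -/

/-- Noise on vectors that are graded by the total weight of the Pauli paths so far. -/
noncomputable def gradedNoise {n : ℕ} (q : ℝ) (v : ℕ → PauliString n → ℝ) :
    ℕ → PauliString n → ℝ :=
  fun k P => if weight P ≤ k then q ^ weight P * v (k - weight P) P else 0

/-- The contributions of the Pauli paths through the layers `L`, graded by their total weight. -/
noncomputable def gradedEvolve {n : ℕ} (q : ℝ) (x : PauliString n → ℝ) :
    List (Layer n) → ℕ → PauliString n → ℝ
  | [] => fun k => if k = 0 then x else 0
  | U :: L => fun k => layerVec U (gradedNoise q (gradedEvolve q x L) k)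

/-- Summing over all grades forgets the grading. `B` bounds the grades that occur before the noise,
which raises a grade by at most n. -/
theorem sum_gradedNoise {n : ℕ} (q : ℝ) (v : ℕ → PauliString n → ℝ) {N B : ℕ} (hN : B + n < N)
    {y : PauliString n → ℝ} (h : ∀ N, B < N → ∑ k ∈ Finset.range N, v k = y) :
    ∑ k ∈ Finset.range N, gradedNoise q v k = damp q (fun _ => true) y := by
  ext P
  have hw : weight P ≤ n := by
    refine (Finset.card_le_univ _).trans ?_; simp
  rw [damp_all, ← h (N - weight P) (by omega), Finset.sum_apply, Finset.sum_apply, Finset.mul_sum]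
  obtain ⟨m, rfl⟩ : ∃ m, N = weight P + m := ⟨N - weight P, by omega⟩
  rw [Finset.sum_range_add, Finset.sum_eq_zero, zero_add, Nat.add_sub_cancel_left]
  · exact Finset.sum_congr rfl fun k _ => by simp [gradedNoise]
  · intro k hk
    rw [gradedNoise, if_neg (by have := Finset.mem_range.1 hk; omega)]

theorem sum_gradedEvolve {n : ℕ} (q : ℝ) (x : PauliString n → ℝ) (L : List (Layer n)) :
    ∀ N, n * L.length < N →
      ∑ k ∈ Finset.range N, gradedEvolve q x L k = L.foldr (stepVec .uniform q) x := by
  induction L with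
  | nil =>
    intro N hN
    simp only [gradedEvolve]
    rw [Finset.sum_ite_eq' (Finset.range N) 0 (fun _ => x), if_pos (by simpa using hN)]
    rfl
  | cons U L ih =>
    intro N hN
    simp only [gradedEvolve]
    rw [← layerVec_sum, sum_gradedNoise q _ (by rw [List.length_cons, mul_add_one] at hN; exact hN) ih]
    rfl

/-- Sorting the strings by their weight i exhibits noise as a convolution with q^i. -/
theorem nrm_gradedNoise_le {n : ℕ} {q : ℝ} (h0 : 0 ≤ q) (v : ℕ → PauliString n → ℝ) (k : ℕ) :
    nrm (gradedNoise q v k) ≤ ∑ i ∈ Finset.range (k + 1), q ^ i * nrm (v (k - i)) := by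
  have h : gradedNoise q v k = ∑ i ∈ Finset.range (k + 1),
      (fun P => if weight P = i then q ^ i * v (k - i) P else 0) := by
    ext P
    rw [Finset.sum_apply, gradedNoise, Finset.sum_ite_eq]
    simp
  rw [h]
  refine (nrm_sum_le _ _).trans (Finset.sum_le_sum fun i _ => ?_)
  rw [← abs_of_nonneg (pow_nonneg h0 i), ← nrm_smul]
  refine nrm_mono fun P => ?_
  split_ifs
  · simp [abs_mul]
  · rw [abs_zero]; exact abs_nonneg _

/-- In terms of generating functions at b, the convolution is a product with a partial sum of the
geometric series of ratio bq. -/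
theorem sum_nrm_gradedNoise_le {n : ℕ} {q b : ℝ} (h0 : 0 ≤ q) (hb : 0 ≤ b) (hqb : b * q < 1)
    (v : ℕ → PauliString n → ℝ) (N : ℕ) :
    ∑ k ∈ Finset.range N, b ^ k * nrm (gradedNoise q v k)
      ≤ (1 - b * q)⁻¹ * ∑ k ∈ Finset.range N, b ^ k * nrm (v k) := by
  calc _ ≤ ∑ k ∈ Finset.range N, ∑ i ∈ Finset.range (k + 1),
        (b * q) ^ i * (b ^ (k - i) * nrm (v (k - i))) := by
        refine Finset.sum_le_sum fun k _ => ?_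
        refine (mul_le_mul_of_nonneg_left (nrm_gradedNoise_le h0 v k) (pow_nonneg hb _)).trans_eq ?_
        rw [Finset.mul_sum]
        refine Finset.sum_congr rfl fun i hi => ?_
        have : k = i + (k - i) := by have := Finset.mem_range.1 hi; omega
        conv_lhs => rw [this, pow_add]
        rw [Nat.add_sub_cancel_left]; ring
    _ = ∑ i ∈ Finset.range N, ∑ k ∈ Finset.range (N - i), (b * q) ^ i * (b ^ k * nrm (v k)) :=
        Finset.sum_range_diag_flip N fun i k => (b * q) ^ i * (b ^ k * nrm (v k))
    _ ≤ ∑ i ∈ Finset.range N, ∑ k ∈ Finset.range N, (b * q) ^ i * (b ^ k * nrm (v k)) := by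
        refine Finset.sum_le_sum fun i _ => Finset.sum_le_sum_of_subset_of_nonneg
          (Finset.range_mono (Nat.sub_le _ _)) fun k _ _ => ?_
        have := nrm_nonneg (v k); positivity
    _ = (∑ i ∈ Finset.range N, (b * q) ^ i) * ∑ k ∈ Finset.range N, b ^ k * nrm (v k) := by
        rw [Finset.sum_mul_sum]
    _ ≤ _ := by
        refine mul_le_mul_of_nonneg_right ?_
          (Finset.sum_nonneg fun k _ => mul_nonneg (pow_nonneg hb _) (nrm_nonneg _))
        rw [← tsum_geometric_of_lt_one (by positivity) hqb]
        exact (summable_geometric_of_lt_one (by positivity) hqb).sum_le_tsum _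
          fun _ _ => by positivity

/-- Gates act isometrically on every grade separately, so only noise enlarges the generating
function. The bound does not depend on the number of qubits. -/
theorem sum_nrm_gradedEvolve_le {n : ℕ} {q b : ℝ} (h0 : 0 ≤ q) (hb : 0 ≤ b) (hqb : b * q < 1)
    (x : PauliString n → ℝ) (L : List (Layer n)) (N : ℕ) :
    ∑ k ∈ Finset.range N, b ^ k * nrm (gradedEvolve q x L k)
      ≤ (1 - b * q)⁻¹ ^ L.length * nrm x := by
  induction L with
  | nil =>
    simp only [gradedEvolve, List.length_nil, pow_zero, one_mul]
    calc _ = ∑ k ∈ Finset.range N, if k = 0 then nrm x else 0 := by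
          refine Finset.sum_congr rfl fun k _ => ?_
          split_ifs with h
          · simp [h]
          · simp [nrm_zero]
      _ ≤ nrm x := by
          rw [Finset.sum_ite_eq']; split_ifs
          · exact le_rfl
          · exact nrm_nonneg x
  | cons U L ih =>
    simp only [gradedEvolve, nrm_layerVec]
    refine (sum_nrm_gradedNoise_le h0 hb hqb _ N).trans ?_
    rw [List.length_cons, pow_succ', mul_assoc]
    exact mul_le_mul_of_nonneg_left ih (inv_nonneg.2 (by linarith))

/-- The contribution of the Pauli paths of total weight at most `W`. -/
noncomputable def pathSum {n : ℕ} (q : ℝ) (W : ℕ) (L : List (Layer n)) (x : PauliString n → ℝ) :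
    PauliString n → ℝ :=
  ∑ k ∈ Finset.range (W + 1), gradedNoise q (gradedEvolve q x L) k

/-- An exponential Markov inequality: grades above W carry the factor b^k ≥ b^W in the generating
function, which is bounded by one factor for each of the d + 1 rounds of noise. -/
theorem nrm_pathSum_sub_circuitVec_le {n : ℕ} {q : ℝ} (h0 : 0 < q) (h1 : q < 1) (W : ℕ)
    (L : List (Layer n)) (x : PauliString n → ℝ) :
    nrm (pathSum q W L x - circuitVec .uniform q L x)
      ≤ (2 * q / (1 + q)) ^ W * (2 / (1 - q)) ^ (L.length + 1) * nrm x := by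
  -- The choice needs b > 1 for decay in W and bq < 1 for convergence; here bq lies halfway between
  -- q and 1.
  set b : ℝ := (1 + q) / (2 * q) with hb
  have hb1 : 1 ≤ b := by rw [hb, one_le_div (by positivity)]; linarith
  have hbq : b * q = (1 + q) / 2 := by rw [hb]; field_simp
  have hbq1 : b * q < 1 := by rw [hbq]; linarith
  -- Any number beyond W and beyond the largest possible total weight n(d+1).
  set N := n * L.length + n + W + 2 with hN
  have hfull : ∑ k ∈ Finset.range N, gradedNoise q (gradedEvolve q x L) k = circuitVec .uniform q L x :=
    sum_gradedNoise q _ (B := n * L.length) (by omega) (sum_gradedEvolve q x L)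
  rw [← hfull, pathSum, ← Finset.sum_range_add_sum_Ico _ (show W + 1 ≤ N by omega), sub_add_cancel_left]
  have hneg : ∀ y : PauliString n → ℝ, nrm (-y) = nrm y := fun y => by simp [nrm]
  rw [hneg]
  have hbpos : 0 < b := by linarith
  calc _ ≤ ∑ k ∈ Finset.Ico (W + 1) N, nrm (gradedNoise q (gradedEvolve q x L) k) := nrm_sum_le _ _
    _ ≤ ∑ k ∈ Finset.Ico (W + 1) N, b⁻¹ ^ W * (b ^ k * nrm (gradedNoise q (gradedEvolve q x L) k)) := by
        refine Finset.sum_le_sum fun k hk => ?_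
        rw [← mul_assoc]
        refine le_mul_of_one_le_left (nrm_nonneg _) ?_
        rw [inv_pow, inv_mul_eq_div, one_le_div (by positivity)]
        exact pow_le_pow_right₀ hb1 (by have := Finset.mem_Ico.1 hk; omega)
    _ ≤ b⁻¹ ^ W * ∑ k ∈ Finset.range N, b ^ k * nrm (gradedNoise q (gradedEvolve q x L) k) := by
        rw [← Finset.mul_sum]
        refine mul_le_mul_of_nonneg_left (Finset.sum_le_sum_of_subset_of_nonneg ?_ ?_) (by positivity)
        · intro k hk; exact Finset.mem_range.2 (Finset.mem_Ico.1 hk).2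
        · intro k _ _; exact mul_nonneg (by positivity) (nrm_nonneg _)
    _ ≤ b⁻¹ ^ W * ((1 - b * q)⁻¹ * ((1 - b * q)⁻¹ ^ L.length * nrm x)) := by
        refine mul_le_mul_of_nonneg_left ((sum_nrm_gradedNoise_le h0.le hbpos.le hbq1 _ N).trans ?_)
          (by positivity)
        exact mul_le_mul_of_nonneg_left (sum_nrm_gradedEvolve_le h0.le hbpos.le hbq1 x L N)
          (inv_nonneg.2 (by linarith))
    _ = _ := by
        have e1 : b⁻¹ = 2 * q / (1 + q) := by rw [hb, inv_div]
        have e2 : (1 - b * q)⁻¹ = 2 / (1 - q) := by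
          rw [hbq, show 1 - (1 + q) / 2 = (1 - q) / 2 by ring, inv_div]
        rw [e1, e2, pow_succ']; ring


/-! ### Running programs -/

infixr:60 " ;; " => Cmd.seq

/-- The value of a natural-number register. -/
def V (a : ℕ) : NExp := .cell a (.const 0)

/-- The value of a real register. -/
def RV (a : ℕ) : RExp := .cell a (.const 0)

/-- Assign to a natural-number register. -/
def letN (a : ℕ) (e : NExp) : Cmd := .setNat a (.const 0) e

/-- Assign to a real register. -/
def letR (a : ℕ) (e : RExp) : Cmd := .setReal a (.const 0) e

section store
variable {n : ℕ}

/-- A store with one natural number replaced. -/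
def Store.setN (s : Store n) (a i v : ℕ) : Store n := { s with nat := setCell s.nat a i v }

/-- A store with one real number replaced. -/
def Store.setR (s : Store n) (a i : ℕ) (v : ℝ) : Store n := { s with real := setCell s.real a i v }

@[simp] theorem setN_nat (s : Store n) (a i v b k : ℕ) :
    (s.setN a i v).nat b k = if b = a ∧ k = i then v else s.nat b k := rfl

theorem setN_nat_row {s : Store n} {a i v b : ℕ} (h : b ≠ a) : (s.setN a i v).nat b = s.nat b := by
  ext k; simp [h]

@[simp] theorem setN_real (s : Store n) (a i v : ℕ) : (s.setN a i v).real = s.real := rfl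

@[simp] theorem setN_out (s : Store n) (a i v : ℕ) : (s.setN a i v).out = s.out := rfl

@[simp] theorem setR_real (s : Store n) (a i : ℕ) (v : ℝ) (b k : ℕ) :
    (s.setR a i v).real b k = if b = a ∧ k = i then v else s.real b k := rfl

theorem setR_real_row {s : Store n} {a i b : ℕ} {v : ℝ} (h : b ≠ a) :
    (s.setR a i v).real b = s.real b := by
  ext k; simp [h]

@[simp] theorem setR_nat (s : Store n) (a i : ℕ) (v : ℝ) : (s.setR a i v).nat = s.nat := rfl

@[simp] theorem setR_out (s : Store n) (a i : ℕ) (v : ℝ) : (s.setR a i v).out = s.out := rfl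

end store

/-- Programs without loops, queries and outputs. -/
def Cmd.simple : Cmd → Bool
  | skip => true
  | setNat _ _ _ => true
  | setReal _ _ _ => true
  | query _ _ _ => false
  | emit _ _ => false
  | seq c c' => c.simple && c'.simple
  | ite _ c c' => c.simple && c'.simple
  | loop _ _ => false

/-- An upper bound on the running time of simple programs. -/
def Cmd.size : Cmd → ℕ
  | seq c c' => c.size + c'.size
  | ite _ c c' => c.size + c'.size + 1
  | _ => 1

open Classical in
/-- The effect of a simple program. -/
noncomputable def sem {n : ℕ} : Cmd → Store n → Store n
  | .skip, s => s
  | .setNat a i e, s => s.setN a (i.eval s) (e.eval s)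
  | .setReal a i e, s => s.setR a (i.eval s) (e.eval s)
  | .seq c c', s => sem c' (sem c s)
  | .ite b c c', s => if b.holds s then sem c s else sem c' s
  | _, s => s

/-- The smallest number of an array that the program may write. -/
def Cmd.lowW : Cmd → ℕ
  | skip => 1000
  | setNat a _ _ => a
  | setReal a _ _ => a
  | query _ a _ => a
  | emit _ _ => 1000
  | seq c c' => min c.lowW c'.lowW
  | ite _ c c' => min c.lowW c'.lowW
  | loop _ c => c.lowW

/-- The largest number of an array that the program may write. -/
def Cmd.highW : Cmd → ℕ
  | skip => 0
  | setNat a _ _ => a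
  | setReal a _ _ => a
  | query _ a _ => a
  | emit _ _ => 0
  | seq c c' => max c.highW c'.highW
  | ite _ c c' => max c.highW c'.highW
  | loop _ c => c.highW

/-- Programs without outputs. -/
def Cmd.silent : Cmd → Bool
  | emit _ _ => false
  | seq c c' => c.silent && c'.silent
  | ite _ c c' => c.silent && c'.silent
  | loop _ c => c.silent
  | _ => true

/-! ### Memory frames and Hoare rules with time bounds -/

section run
variable {n : ℕ} {orc : PauliString n → ℝ}

/-- The interval from `lowW` to `highW` contains the numbers of all arrays that are written. So for
concrete programs it is decidable which data survive. Temporary data get larger numbers than the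
data they must not disturb. -/
theorem Exec.frame {c : Cmd} {s s' : Store n} {T : ℕ} (h : Exec orc c s s' T) (a : ℕ)
    (ha : a < c.lowW ∨ c.highW < a) : s'.nat a = s.nat a ∧ s'.real a = s.real a := by
  induction h with
  | skip => exact ⟨rfl, rfl⟩
  | setNat s b i e => exact ⟨setN_nat_row (by simp only [Cmd.lowW, Cmd.highW] at ha; omega), rfl⟩
  | setReal s b i e => exact ⟨rfl, setR_real_row (by simp only [Cmd.lowW, Cmd.highW] at ha; omega)⟩
  | query s p b i => exact ⟨rfl, setR_real_row (by simp only [Cmd.lowW, Cmd.highW] at ha; omega)⟩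
  | emit => exact ⟨rfl, rfl⟩
  | seq _ _ ih1 ih2 =>
    simp only [Cmd.lowW, Cmd.highW] at ha
    obtain ⟨h1, h2⟩ := ih1 (by omega)
    obtain ⟨h3, h4⟩ := ih2 (by omega)
    exact ⟨h3.trans h1, h4.trans h2⟩
  | iteTrue _ _ ih => simp only [Cmd.lowW, Cmd.highW] at ha; exact ih (by omega)
  | iteFalse _ _ ih => simp only [Cmd.lowW, Cmd.highW] at ha; exact ih (by omega)
  | loopDone => exact ⟨rfl, rfl⟩
  | loopStep _ _ _ ih1 ih2 =>
    obtain ⟨h1, h2⟩ := ih1 ha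
    obtain ⟨h3, h4⟩ := ih2 ha
    exact ⟨h3.trans h1, h4.trans h2⟩

theorem Exec.silent {c : Cmd} {s s' : Store n} {T : ℕ} (h : Exec orc c s s' T)
    (hc : c.silent = true) : s'.out = s.out := by
  induction h with
  | emit => simp [Cmd.silent] at hc
  | seq _ _ ih1 ih2 =>
    simp only [Cmd.silent, Bool.and_eq_true] at hc
    exact (ih2 hc.2).trans (ih1 hc.1)
  | iteTrue _ _ ih => simp only [Cmd.silent, Bool.and_eq_true] at hc; exact ih hc.1
  | iteFalse _ _ ih => simp only [Cmd.silent, Bool.and_eq_true] at hc; exact ih hc.2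
  | loopStep _ _ _ ih1 ih2 => exact (ih2 hc).trans (ih1 hc)
  | _ => rfl

/-- The program halts within `T` steps in a store that satisfies `post`. -/
def Run (orc : PauliString n → ℝ) (c : Cmd) (s : Store n) (T : ℕ) (post : Store n → Prop) : Prop :=
  ∃ s' t, Exec orc c s s' t ∧ t ≤ T ∧ post s'

theorem Run.mono {c : Cmd} {s : Store n} {T T' : ℕ} {post post' : Store n → Prop}
    (h : Run orc c s T post) (hT : T ≤ T') (hp : ∀ s', post s' → post' s') :
    Run orc c s T' post' := by
  obtain ⟨s', t, h1, h2, h3⟩ := h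
  exact ⟨s', t, h1, h2.trans hT, hp s' h3⟩

theorem Run.seq {c c' : Cmd} {s : Store n} {T T' : ℕ} {mid post : Store n → Prop}
    (h : Run orc c s T mid) (h' : ∀ s', mid s' → Run orc c' s' T' post) :
    Run orc (c ;; c') s (T + T') post := by
  obtain ⟨s1, t1, h1, h2, h3⟩ := h
  obtain ⟨s2, t2, h4, h5, h6⟩ := h' s1 h3
  exact ⟨s2, t1 + t2, .seq h1 h4, by omega, h6⟩

theorem Run.ite {b : Test} {c c' : Cmd} {s : Store n} {T : ℕ} {post : Store n → Prop}
    (h : b.holds s → Run orc c s T post) (h' : ¬ b.holds s → Run orc c' s T post) :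
    Run orc (.ite b c c') s (T + 1) post := by
  by_cases hb : b.holds s
  · obtain ⟨s1, t1, h1, h2, h3⟩ := h hb
    exact ⟨s1, t1 + 1, .iteTrue hb h1, by omega, h3⟩
  · obtain ⟨s1, t1, h1, h2, h3⟩ := h' hb
    exact ⟨s1, t1 + 1, .iteFalse hb h1, by omega, h3⟩

theorem run_simple {c : Cmd} (hc : c.simple = true) (s : Store n) :
    Run orc c s c.size fun s' => s' = sem c s := by
  induction c generalizing s with
  | skip => exact ⟨s, 1, .skip s, le_rfl, rfl⟩
  | setNat a i e => exact ⟨_, 1, .setNat s a i e, le_rfl, rfl⟩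
  | setReal a i e => exact ⟨_, 1, .setReal s a i e, le_rfl, rfl⟩
  | query => simp [Cmd.simple] at hc
  | emit => simp [Cmd.simple] at hc
  | seq c c' ih ih' =>
    simp only [Cmd.simple, Bool.and_eq_true] at hc
    refine (ih hc.1 s).seq fun s1 hs1 => ?_
    subst hs1
    exact ih' hc.2 _
  | ite b c c' ih ih' =>
    simp only [Cmd.simple, Bool.and_eq_true] at hc
    refine (Run.ite (T := c.size + c'.size) (fun hb => (ih hc.1 s).mono (by omega) ?_)
      (fun hb => (ih' hc.2 s).mono (by omega) ?_)).mono le_rfl fun s' hs' => hs'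
    · rintro s' rfl; simp [sem, hb]
    · rintro s' rfl; simp [sem, hb]
  | loop => simp [Cmd.simple] at hc

/-- A simple program followed by another one. -/
theorem Run.simple_seq {c c' : Cmd} (hc : c.simple = true) {s : Store n} {T : ℕ}
    {post : Store n → Prop} (h : Run orc c' (sem c s) T post) :
    Run orc (c ;; c') s (c.size + T) post :=
  (run_simple hc s).seq fun s' hs' => by subst hs'; exact h

/-- The store outside the arrays that the program writes is unchanged. -/
def Frame (c : Cmd) (s s' : Store n) : Prop :=
  (∀ a, a < c.lowW ∨ c.highW < a → s'.nat a = s.nat a ∧ s'.real a = s.real a) ∧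
  (c.silent = true → s'.out = s.out)

theorem Run.frame {c : Cmd} {s : Store n} {T : ℕ} {post : Store n → Prop} (h : Run orc c s T post) :
    Run orc c s T fun s' => post s' ∧ Frame c s s' := by
  obtain ⟨s', t, h1, h2, h3⟩ := h
  exact ⟨s', t, h1, h2, h3, fun a ha => h1.frame a ha, fun hc => h1.silent hc⟩

/-- The arrays with numbers below `b` and the output are unchanged. -/
structure Keep (b : ℕ) (s s' : Store n) : Prop where
  nat : ∀ a < b, s'.nat a = s.nat a
  real : ∀ a < b, s'.real a = s.real a
  out : s'.out = s.out

theorem Keep.refl (b : ℕ) (s : Store n) : Keep b s s := ⟨fun _ _ => rfl, fun _ _ => rfl, rfl⟩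

theorem Keep.trans {b : ℕ} {s s' s'' : Store n} (h : Keep b s s') (h' : Keep b s' s'') :
    Keep b s s'' :=
  ⟨fun a ha => (h'.nat a ha).trans (h.nat a ha), fun a ha => (h'.real a ha).trans (h.real a ha),
    h'.out.trans h.out⟩

theorem Keep.mono {b b' : ℕ} {s s' : Store n} (h : Keep b s s') (hb : b' ≤ b) : Keep b' s s' :=
  ⟨fun a ha => h.nat a (by omega), fun a ha => h.real a (by omega), h.out⟩

theorem Keep.setN {b : ℕ} {s s' : Store n} (h : Keep b s s') {a i v : ℕ} (ha : b ≤ a) :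
    Keep b s (s'.setN a i v) :=
  ⟨fun c hc => (setN_nat_row (by omega)).trans (h.nat c hc), h.real, h.out⟩

theorem Keep.setR {b : ℕ} {s s' : Store n} (h : Keep b s s') {a i : ℕ} {v : ℝ} (ha : b ≤ a) :
    Keep b s (s'.setR a i v) :=
  ⟨h.nat, fun c hc => (setR_real_row (by omega)).trans (h.real c hc), h.out⟩

theorem Frame.keep {c : Cmd} {s s' : Store n} (h : Frame c s s') {b : ℕ} (hb : b ≤ c.lowW)
    (hc : c.silent = true) : Keep b s s' :=
  ⟨fun a ha => (h.1 a (Or.inl (by omega))).1, fun a ha => (h.1 a (Or.inl (by omega))).2, h.2 hc⟩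

theorem Run.keep {c : Cmd} {s : Store n} {T b : ℕ} {post : Store n → Prop} (h : Run orc c s T post)
    (hb : b ≤ c.lowW) (hc : c.silent = true) :
    Run orc c s T fun s' => post s' ∧ Keep b s s' :=
  h.frame.mono le_rfl fun _ hs => ⟨hs.1, hs.2.keep hb hc⟩

/-- The rule for loops with a known number of iterations. -/
theorem Run.loop {b : Test} {c : Cmd} (I : ℕ → Store n → Prop) (t : ℕ → ℕ) (k : ℕ)
    (hstep : ∀ m < k, ∀ s, I m s → b.holds s ∧ Run orc c s (t m) (I (m + 1)))
    (hend : ∀ s, I k s → ¬ b.holds s) {s : Store n} (hs : I 0 s) :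
    Run orc (.loop b c) s ((∑ m ∈ Finset.range k, (t m + 1)) + 1) (I k) := by
  have key : ∀ d m, m + d = k → ∀ s, I m s →
      Run orc (.loop b c) s ((∑ i ∈ Finset.range d, (t (m + i) + 1)) + 1) (I k) := by
    intro d
    induction d with
    | zero =>
      intro m hm s hI
      have : m = k := by omega
      subst this
      exact ⟨s, 1, .loopDone (hend s hI), by simp, hI⟩
    | succ d ih =>
      intro m hm s hI
      obtain ⟨hb, s1, t1, h1, h2, h3⟩ := hstep m (by omega) s hI
      obtain ⟨s2, t2, h4, h5, h6⟩ := ih (m + 1) (by omega) s1 h3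
      refine ⟨s2, t1 + t2 + 1, .loopStep hb h1 h4, ?_, h6⟩
      rw [Finset.sum_range_succ']
      have : ∀ i, t (m + (i + 1)) = t (m + 1 + i) := fun i => by congr 1; omega
      simp only [this, add_zero]
      omega
  simpa using key k 0 (by omega) s hs

/-- A loop in which the register `v` counts up to the value of `e`. -/
def forTo (v : ℕ) (e : NExp) (body : Cmd) : Cmd :=
  .loop (.natLe (.add (V v) (.const 1)) e) (body ;; letN v (.add (V v) (.const 1)))

/-- The invariant is required after the counter has been advanced, hence in `s'.setN v 0 (m + 1)`;
that the counter survives the body comes from the frame. The 2 added in every round pays for the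
test and the increment. -/
theorem run_forTo {v : ℕ} {e : NExp} {body : Cmd} (J : ℕ → Store n → Prop) (t : ℕ → ℕ) {k k0 : ℕ}
    (hk : k0 ≤ k) (hv : v < body.lowW ∨ body.highW < v)
    (he : ∀ m s, J m s → s.nat v 0 = m → e.eval s = k)
    (hstep : ∀ m, k0 ≤ m → m < k → ∀ s, J m s → s.nat v 0 = m →
      Run orc body s (t m) fun s' => J (m + 1) (s'.setN v 0 (m + 1)))
    {s : Store n} (hs : J k0 s) (hsv : s.nat v 0 = k0) :
    Run orc (forTo v e body) s ((∑ m ∈ Finset.Ico k0 k, (t m + 2)) + 1)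
      fun s' => J k s' ∧ s'.nat v 0 = k := by
  have h := Run.loop (orc := orc) (b := .natLe (.add (V v) (.const 1)) e)
    (c := body ;; letN v (.add (V v) (.const 1)))
    (fun m s => J (k0 + m) s ∧ s.nat v 0 = k0 + m) (fun m => t (k0 + m) + 1) (k - k0) ?_ ?_ (s := s)
    ⟨by simpa using hs, by simpa using hsv⟩
  · rw [show k0 + (k - k0) = k by omega] at h
    refine h.mono (le_of_eq ?_) fun _ h => h
    rw [Finset.sum_Ico_eq_sum_range]
  · intro m hm s hI
    refine ⟨?_, ?_⟩
    · simp only [Test.holds, NExp.eval, V, he _ s hI.1 hI.2, hI.2]; omega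
    · refine (hstep (k0 + m) (by omega) (by omega) s hI.1 hI.2).frame.seq fun s1 hs1 => ?_
      refine (run_simple rfl s1).mono le_rfl ?_
      rintro s' rfl
      have h1 : s1.nat v 0 = k0 + m := by rw [(hs1.2.1 v hv).1, hI.2]
      have h2 : sem (letN v (.add (V v) (.const 1))) s1 = s1.setN v 0 (k0 + m + 1) := by
        simp [sem, letN, NExp.eval, V, h1]
      rw [h2]
      exact ⟨hs1.1, by simp; omega⟩
  · intro s hI
    simp only [Test.holds, NExp.eval, V, he _ s hI.1 hI.2, hI.2]; omega

/-- The sequence of the programs in a list. -/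
def seqList (l : List Cmd) : Cmd := l.foldr Cmd.seq .skip

end run


/-! ### Expressions for complex numbers and gate coefficients -/

/-- Complex expressions. -/
abbrev CExp := RExp × RExp

namespace CExp

/-- The value of a complex expression. -/
noncomputable def eval {n : ℕ} (s : Store n) (e : CExp) : ℂ := ⟨e.1.eval s, e.2.eval s⟩

def zero : CExp := (.const 0, .const 0)
def one : CExp := (.const 1, .const 0)
def I : CExp := (.const 0, .const 1)
def neg (e : CExp) : CExp := (.sub (.const 0) e.1, .sub (.const 0) e.2)
def add (e f : CExp) : CExp := (.add e.1 f.1, .add e.2 f.2)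
def conj (e : CExp) : CExp := (e.1, .sub (.const 0) e.2)
def mul (e f : CExp) : CExp :=
  (.sub (.mul e.1 f.1) (.mul e.2 f.2), .add (.mul e.1 f.2) (.mul e.2 f.1))

variable {n : ℕ} (s : Store n)

@[simp] theorem eval_zero : eval s zero = 0 := by
  apply Complex.ext <;> simp [eval, zero, RExp.eval]
@[simp] theorem eval_one : eval s one = 1 := by
  apply Complex.ext <;> simp [eval, one, RExp.eval]
@[simp] theorem eval_I : eval s I = Complex.I := by
  apply Complex.ext <;> simp [eval, I, RExp.eval]
@[simp] theorem eval_neg (e : CExp) : eval s e.neg = -eval s e := by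
  apply Complex.ext <;> simp [eval, neg, RExp.eval]
@[simp] theorem eval_add (e f : CExp) : eval s (e.add f) = eval s e + eval s f := by
  apply Complex.ext <;> simp [eval, add, RExp.eval]
@[simp] theorem eval_conj (e : CExp) : eval s e.conj = star (eval s e) := by
  apply Complex.ext <;> simp [eval, conj, RExp.eval]
@[simp] theorem eval_mul (e f : CExp) : eval s (e.mul f) = eval s e * eval s f := by
  apply Complex.ext <;> simp [eval, mul, RExp.eval]

/-- Sums over the basis of two qubits. -/
def sum (f : Fin 2 × Fin 2 → CExp) : CExp :=
  ((f (0, 0)).add (f (0, 1))).add ((f (1, 0)).add (f (1, 1)))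

@[simp] theorem eval_sum (f : Fin 2 × Fin 2 → CExp) : eval s (sum f) = ∑ x, eval s (f x) := by
  simp [sum, Fintype.sum_prod_type]

/-- The entries of the Pauli matrices. -/
def pauli : Fin 4 → Fin 2 → Fin 2 → CExp :=
  ![![![one, zero], ![zero, one]], ![![zero, one], ![one, zero]], ![![zero, I.neg], ![I, zero]],
    ![![one, zero], ![zero, one.neg]]]

@[simp] theorem eval_pauli (p : Fin 4) (x y : Fin 2) : eval s (pauli p x y) = pauliMatrix p x y := by
  fin_cases p <;> fin_cases x <;> fin_cases y <;> simp [pauli, pauliMatrix]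

/-- The number of the entry in row `x` and column `y` of a gate. -/
def entryNo (x y : Fin 2 × Fin 2) : ℕ := 8 * x.1 + 4 * x.2 + 2 * y.1 + y.2

/-- An entry of the gate whose data are stored at `site`. -/
def gate (site : NExp) (x y : Fin 2 × Fin 2) : CExp :=
  (.cell (2 + entryNo x y) site, .cell (18 + entryNo x y) site)

end CExp

theorem entryNo_lt (x y : Fin 2 × Fin 2) : CExp.entryNo x y < 16 := by
  unfold CExp.entryNo; omega

theorem gateEntry_entryNo (G : Matrix (Fin 2 × Fin 2) (Fin 2 × Fin 2) ℂ) (x y : Fin 2 × Fin 2) :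
    gateEntry G (CExp.entryNo x y) = G x y := by
  have : ∀ x y : Fin 2 × Fin 2, ((Fin.ofNat 2 (CExp.entryNo x y / 8), Fin.ofNat 2 (CExp.entryNo x y / 4)),
    (Fin.ofNat 2 (CExp.entryNo x y / 2), Fin.ofNat 2 (CExp.entryNo x y))) = (x, y) := by decide
  have h := this x y
  exact congrArg₂ G (Prod.ext_iff.1 h).1 (Prod.ext_iff.1 h).2

/-- The data of the gate `G` are stored at `site`. -/
def GateAt {n : ℕ} (s : Store n) (G : Matrix (Fin 2 × Fin 2) (Fin 2 × Fin 2) ℂ) (site : ℕ) : Prop :=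
  ∀ e < 16, s.real (2 + e) site = (gateEntry G e).re ∧ s.real (18 + e) site = (gateEntry G e).im

/-- An expression for `gateCoeff`. -/
def gateExp (site : NExp) (q p : Fin 4 × Fin 4) : RExp :=
  .div (CExp.sum fun x => CExp.sum fun y => CExp.sum fun v => CExp.sum fun u =>
    (((CExp.gate site x u).mul ((CExp.pauli p.1 u.1 v.1).mul (CExp.pauli p.2 u.2 v.2))).mul
      (CExp.gate site y v).conj).mul
      ((CExp.pauli q.1 y.1 x.1).mul (CExp.pauli q.2 y.2 x.2))).1 (.const 4)

/-- For fixed labels the coefficient is a fixed polynomial in the entries of the gate, so it is one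
expression of the program and costs no extra steps. -/
theorem eval_gateExp {n : ℕ} {s : Store n} {G : Matrix (Fin 2 × Fin 2) (Fin 2 × Fin 2) ℂ}
    {site : NExp} (h : GateAt s G (site.eval s)) (q p : Fin 4 × Fin 4) :
    (gateExp site q p).eval s = gateCoeff G q p := by
  have hg : ∀ x y, CExp.eval s (CExp.gate site x y) = G x y := by
    intro x y
    obtain ⟨h1, h2⟩ := h _ (entryNo_lt x y)
    rw [gateEntry_entryNo] at h1 h2
    apply Complex.ext
    · exact h1
    · exact h2
  have hre : ∀ e : CExp, e.1.eval s = (CExp.eval s e).re := fun e => rfl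
  rw [gateExp, RExp.eval, hre, gateCoeff, trace_mul_four]
  simp only [CExp.eval_sum, CExp.eval_mul, CExp.eval_conj, CExp.eval_pauli, hg, RExp.eval]
  simp only [Fintype.sum_prod_type (α₁ := Fin 2 × Fin 2), conjTranspose_apply, pauliTwo, of_apply]
  norm_num

/-! ### Codes of Pauli strings -/

/-- The number with the labels of a Pauli string as its digits in base 4. -/
def code {n : ℕ} (P : PauliString n) : ℕ := ∑ j, (P j : ℕ) * 4 ^ (j : ℕ)

theorem code_eq {n : ℕ} (P : PauliString n) : code P = (finFunctionFinEquiv P : ℕ) :=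
  (finFunctionFinEquiv_apply P).symm

theorem code_lt {n : ℕ} (P : PauliString n) : code P < 4 ^ n := by
  rw [code_eq]; exact Fin.is_lt _

theorem code_injective {n : ℕ} : Function.Injective (code (n := n)) := by
  intro P Q h
  rw [code_eq, code_eq] at h
  exact finFunctionFinEquiv.injective (Fin.ext h)

theorem code_div_mod {n : ℕ} (P : PauliString n) (j : Fin n) : code P / 4 ^ (j : ℕ) % 4 = P j := by
  have h := congrFun (finFunctionFinEquiv.symm_apply_apply P) j
  rw [← Fin.val_inj] at h
  rw [← h, code_eq]
  rfl

theorem code_zero {n : ℕ} : code (0 : PauliString n) = 0 := by simp [code]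

/-- Stated with sums on both sides to avoid truncated subtraction. -/
theorem code_update {n : ℕ} (P : PauliString n) (j : Fin n) (a : Fin 4) :
    code (Function.update P j a) + P j * 4 ^ (j : ℕ) = code P + a * 4 ^ (j : ℕ) := by
  rw [code, code, ← Finset.add_sum_erase _ _ (Finset.mem_univ j),
    ← Finset.add_sum_erase _ (fun i => (P i : ℕ) * 4 ^ (i : ℕ)) (Finset.mem_univ j),
    Function.update_self]
  have : ∑ i ∈ Finset.univ.erase j, ((Function.update P j a i : Fin 4) : ℕ) * 4 ^ (i : ℕ)
      = ∑ i ∈ Finset.univ.erase j, (P i : ℕ) * 4 ^ (i : ℕ) :=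
    Finset.sum_congr rfl fun i hi => by rw [Function.update_of_ne (Finset.ne_of_mem_erase hi)]
  rw [this]; ring

/-! ### The table of powers of four -/

/-- Array 40 holds the powers of four. -/
def Powers {n : ℕ} (s : Store n) : Prop := ∀ j ≤ n, s.nat 40 j = 4 ^ j

/-- The product of an expression with a fixed number. -/
def NExp.times (e : NExp) : ℕ → NExp
  | 0 => .const 0
  | k + 1 => .add (e.times k) e

@[simp] theorem eval_times {n : ℕ} (s : Store n) (e : NExp) (k : ℕ) :
    (e.times k).eval s = k * e.eval s := by
  induction k with
  | zero => simp [NExp.times, NExp.eval]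
  | succ k ih => rw [NExp.times, NExp.eval, ih]; ring

/-- Fill in the table of powers of four. -/
def powersCmd : Cmd :=
  letN 41 (.const 0) ;; .setNat 40 (.const 0) (.const 1) ;;
    forTo 41 (.cell 0 (.const 0))
      (.setNat 40 (.add (V 41) (.const 1)) (NExp.times (.cell 40 (V 41)) 4))

section run
variable {n : ℕ} {orc : PauliString n → ℝ}

/-- Natural numbers can only be added, so a power of four is obtained by adding its predecessor four
times; all later digit arithmetic uses this table. -/
theorem run_powersCmd {s : Store n} (hn : s.nat 0 0 = n) :
    Run orc powersCmd s (3 * n + 3) fun s' => Powers s' ∧ Keep 40 s s' := by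
  refine Run.keep ?_ (by decide) (by decide)
  refine (Run.simple_seq rfl (Run.simple_seq rfl
    ((run_forTo (fun m s' => s'.nat 0 0 = n ∧ ∀ j ≤ m, s'.nat 40 j = 4 ^ j) (fun _ => 1)
      (k := n) (k0 := 0) (Nat.zero_le _) (by decide) ?_ ?_ ?_ ?_).mono le_rfl
      fun s' hs' => hs'.1.2))).mono ?_ fun _ h => h
  · intro m s' hs _; exact hs.1
  · intro m _ _ s' hs' hm
    refine (run_simple rfl s').mono le_rfl ?_
    rintro s1 rfl
    simp only [sem, NExp.eval, V, hm, eval_times]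
    refine ⟨by simpa using hs'.1, fun j hj => ?_⟩
    simp only [setN_nat]
    rcases Nat.lt_or_ge m j with h | h
    · have : j = m + 1 := by omega
      subst this
      simp [hs'.2 m le_rfl, pow_succ']
    · rw [if_neg (by omega), if_neg (by omega), hs'.2 j h]
  · simp [sem, NExp.eval, letN, hn]
  · simp [sem, letN, NExp.eval]
  · simp [Cmd.size, letN]; omega

/-! ### Decoding -/

/-- Step `111` of the decoding of the number in register 101. -/
def decodeStep : Cmd :=
  .ite (.natLe (.cell 40 (V 111)) (V 101))
    (letN 101 (.sub (V 101) (.cell 40 (V 111))) ;;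
     .setNat 100 (V 111) (.add (.cell 100 (V 111)) (.const 1)) ;;
     .setNat 102 (V 111) (.add (.cell 102 (V 111)) (.cell 40 (V 111)))) .skip

/-- Decode the number in register 101: the labels go to array 100, the contributions of the labels
to the number go to array 102, the weight goes to register 103, and the noise factor to the real
register 100. -/
def decode : Cmd :=
  letN 111 (.cell 0 (.const 0)) ;; letN 103 (.const 0) ;; letR 100 (.const 1) ;;
  .loop (.natLe (.const 1) (V 111))
    (letN 111 (.sub (V 111) (.const 1)) ;;
     .setNat 100 (V 111) (.const 0) ;; .setNat 102 (V 111) (.const 0) ;;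
     decodeStep ;; decodeStep ;; decodeStep ;;
     .ite (.natLe (.const 1) (.cell 100 (V 111)))
       (letN 103 (.add (V 103) (.const 1)) ;; letR 100 (.mul (RV 100) (.cell 0 (.const 0)))) .skip)

/-- What decoding `P` leaves behind. -/
structure Decoded (s : Store n) (q : ℝ) (P : PauliString n) : Prop where
  label : ∀ j : Fin n, s.nat 100 j = P j
  part : ∀ j : Fin n, s.nat 102 j = P j * 4 ^ (j : ℕ)
  wt : s.nat 103 0 = weight P
  factor : s.real 100 0 = q ^ weight P

/-- The weight of a Pauli string on the last qubits. -/
def tailWeight {n : ℕ} (P : PauliString n) (m : ℕ) : ℕ :=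
  (Finset.univ.filter fun j : Fin n => m ≤ j ∧ P j ≠ 0).card

theorem tailWeight_step (P : PauliString n) (j : Fin n) :
    tailWeight P j = tailWeight P (j + 1) + if P j = 0 then 0 else 1 := by
  rw [tailWeight, tailWeight]
  split_ifs with h
  · rw [add_zero]; congr 1; ext i
    simp only [Finset.mem_filter, Finset.mem_univ, true_and]
    constructor
    · rintro ⟨h1, h2⟩
      have : i ≠ j := by rintro rfl; exact h2 h
      exact ⟨by have := Fin.val_ne_of_ne this; omega, h2⟩
    · rintro ⟨h1, h2⟩; exact ⟨by omega, h2⟩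
  · rw [← Finset.card_insert_of_notMem (a := j) (by simp)]
    congr 1; ext i
    simp only [Finset.mem_filter, Finset.mem_univ, true_and, Finset.mem_insert]
    constructor
    · rintro ⟨h1, h2⟩
      by_cases hij : i = j
      · exact Or.inl hij
      · exact Or.inr ⟨by have := Fin.val_ne_of_ne hij; omega, h2⟩
    · rintro (rfl | ⟨h1, h2⟩)
      · exact ⟨le_rfl, h⟩
      · exact ⟨by omega, h2⟩

/-- The intermediate states when a digit in base 4 is read off; `a` is left and `b` is done. -/
structure DigitState (s0 s : Store n) (j w r a b : ℕ) : Prop where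
  rest : s.nat 101 0 = r + a * w
  label : s.nat 100 j = b
  part : s.nat 102 j = b * w
  nat : ∀ c, c ≠ 100 ∧ c ≠ 101 ∧ c ≠ 102 → s.nat c = s0.nat c
  real : s.real = s0.real
  idx : ∀ i, i ≠ j → s.nat 100 i = s0.nat 100 i ∧ s.nat 102 i = s0.nat 102 i

/-- One conditional subtraction of w = 4^j moves a unit from the digit `a` that is left to the digit
`b` that has been read; `r` stands for the lower digits. -/
theorem DigitState.step {s0 s : Store n} {j w r a b : ℕ} (h : DigitState s0 s j w r a b)
    (hj : s0.nat 111 0 = j) (hw : s0.nat 40 j = w) (hr : r < w) :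
    DigitState s0 (sem decodeStep s) j w r (a - 1) (if a = 0 then b else b + 1) := by
  have h1 : s.nat 111 0 = j := by rw [h.nat 111 (by decide), hj]
  have h2 : s.nat 40 j = w := by rw [h.nat 40 (by decide), hw]
  rcases a with _ | a
  · have : ¬ w ≤ r := by omega
    have hs : sem decodeStep s = s := by
      simp [sem, decodeStep, Test.holds, NExp.eval, V, h1, h2, h.rest, this]
    rw [hs]; simpa using h
  · have h3 : w ≤ r + (a + 1) * w := by nlinarith
    have h4 : r + (a + 1) * w - w = r + a * w := by rw [add_mul, one_mul]; omega
    have hs : sem decodeStep s = ((s.setN 101 0 (r + a * w)).setN 100 j (b + 1)).setN 102 j (b * w + w) := by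
      simp [sem, decodeStep, Test.holds, NExp.eval, letN, V, h1, h2, h.rest, h3, h4, h.label, h.part]
    rw [hs]
    refine ⟨by simp, by simp, by simp [add_mul], ?_, h.real, ?_⟩
    · intro c hc
      rw [setN_nat_row (by omega), setN_nat_row (by omega), setN_nat_row (by omega), h.nat c hc]
    · intro i hi
      simp [hi, h.idx i hi]

/-- Without division the digits are read from the highest one down by comparison and subtraction;
after m rounds the register holds the code modulo 4^(n-m). -/
theorem run_decode {s : Store n} {P : PauliString n} (hn : s.nat 0 0 = n) (hp : Powers s)
    (hP : s.nat 101 0 = code P) :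
    Run orc decode s (24 * n + 4) fun s' => Decoded s' (s.real 0 0) P := by
  have hloop : ∀ s1 : Store n, s1.nat 111 0 = n → s1.nat 103 0 = 0 → s1.real 100 0 = 1 → Powers s1 →
      s1.nat 101 0 = code P → s1.real 0 0 = s.real 0 0 → Run orc (.loop (.natLe (.const 1) (V 111))
    (letN 111 (.sub (V 111) (.const 1)) ;;
     .setNat 100 (V 111) (.const 0) ;; .setNat 102 (V 111) (.const 0) ;;
     decodeStep ;; decodeStep ;; decodeStep ;;
     .ite (.natLe (.const 1) (.cell 100 (V 111)))
       (letN 103 (.add (V 103) (.const 1)) ;; letR 100 (.mul (RV 100) (.cell 0 (.const 0)))) .skip))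
       s1 (24 * n + 1) fun s' => Decoded s' (s.real 0 0) P := by
    intro s1 h1 h2 h3 h4 h5 h6
    refine (Run.loop (fun m s' => s'.nat 111 0 = n - m ∧ s'.nat 103 0 = tailWeight P (n - m) ∧
      s'.real 100 0 = s.real 0 0 ^ tailWeight P (n - m) ∧ Powers s' ∧
      s'.nat 101 0 = code P % 4 ^ (n - m) ∧ s'.real 0 0 = s.real 0 0 ∧
      ∀ j : Fin n, n - m ≤ j → s'.nat 100 j = P j ∧ s'.nat 102 j = P j * 4 ^ (j : ℕ)) (fun _ => 22) n
      ?_ ?_ ?_).mono ?_ ?_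
    · rintro m hm s' ⟨i1, i2, i3, i4, i5, i6, i7⟩
      refine ⟨?_, ?_⟩
      · simp only [Test.holds, NExp.eval, V, i1]; omega
      · refine (run_simple rfl s').mono (by decide) ?_
        rintro s2 rfl
        obtain ⟨j, hj⟩ : ∃ j : Fin n, (j : ℕ) = n - (m + 1) := ⟨⟨n - (m + 1), by omega⟩, rfl⟩
        have hj1 : n - m = j + 1 := by omega
        rw [hj1] at i1 i2 i3 i5 i7
        rw [← hj]
        have hpow := i4 j (by omega)
        have hdig : code P % 4 ^ ((j : ℕ) + 1) = code P % 4 ^ (j : ℕ) + 4 ^ (j : ℕ) * P j := by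
          rw [pow_succ, Nat.mod_mul, code_div_mod]
        rw [hdig] at i5
        have hlt : code P % 4 ^ (j : ℕ) < 4 ^ (j : ℕ) := Nat.mod_lt _ (by positivity)
        set s1 := ((s'.setN 111 0 j).setN 100 j 0).setN 102 j 0 with hs1
        have hs1' : sem (letN 111 (.sub (V 111) (.const 1)) ;; .setNat 100 (V 111) (.const 0) ;;
            .setNat 102 (V 111) (.const 0)) s' = s1 := by
          simp [sem, letN, NExp.eval, V, i1, hs1]
        have d0 : DigitState s1 s1 j (4 ^ (j : ℕ)) (code P % 4 ^ (j : ℕ)) (P j) 0 :=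
          ⟨by simp [hs1, i5, mul_comm], by simp [hs1], by simp [hs1], fun _ _ => rfl, rfl,
            fun _ _ => ⟨rfl, rfl⟩⟩
        have e1 : s1.nat 111 0 = j := by simp [hs1]
        have e2 : s1.nat 40 j = 4 ^ (j : ℕ) := by simp [hs1, hpow]
        have d3 := ((d0.step e1 e2 hlt).step e1 e2 hlt).step e1 e2 hlt
        -- Labels are at most 3, so three conditional subtractions exhaust a digit.
        have hPj : (P j : ℕ) - 1 - 1 - 1 = 0 := by have := (P j).isLt; omega
        have hPj2 : (if (P j : ℕ) - 1 - 1 = 0 then (if (P j : ℕ) - 1 = 0 then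
            (if (P j : ℕ) = 0 then 0 else 0 + 1) else (if (P j : ℕ) = 0 then 0 else 0 + 1) + 1)
            else (if (P j : ℕ) - 1 = 0 then
            (if (P j : ℕ) = 0 then 0 else 0 + 1) else (if (P j : ℕ) = 0 then 0 else 0 + 1) + 1) + 1)
            = (P j : ℕ) := by have := (P j).isLt; split_ifs <;> omega
        rw [hPj, hPj2] at d3
        generalize hs3 : sem decodeStep (sem decodeStep (sem decodeStep s1)) = s3 at d3
        have hsem : sem (letN 111 (.sub (V 111) (.const 1)) ;;
            .setNat 100 (V 111) (.const 0) ;; .setNat 102 (V 111) (.const 0) ;;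
            decodeStep ;; decodeStep ;; decodeStep ;;
            .ite (.natLe (.const 1) (.cell 100 (V 111)))
             (letN 103 (.add (V 103) (.const 1)) ;; letR 100 (.mul (RV 100) (.cell 0 (.const 0)))) .skip) s'
            = sem (.ite (.natLe (.const 1) (.cell 100 (V 111)))
             (letN 103 (.add (V 103) (.const 1)) ;; letR 100 (.mul (RV 100) (.cell 0 (.const 0)))) .skip) s3 := by
          rw [← hs3, ← hs1']; rfl
        rw [hsem]
        have f111 : s3.nat 111 0 = j := by rw [d3.nat 111 (by decide), e1]
        have f103 : s3.nat 103 0 = tailWeight P (j + 1) := by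
          rw [d3.nat 103 (by decide), hs1]; simpa using i2
        have f100 : s3.real 100 0 = s.real 0 0 ^ tailWeight P (j + 1) := by rw [d3.real, hs1]; simpa using i3
        have f00 : s3.real 0 0 = s.real 0 0 := by rw [d3.real, hs1]; simpa using i6
        have f40 : Powers s3 := by
          intro i hi; rw [d3.nat 40 (by decide), hs1]; simpa using i4 i hi
        have fl : ∀ i : Fin n, (j : ℕ) ≤ i → s3.nat 100 i = P i ∧ s3.nat 102 i = P i * 4 ^ (i : ℕ) := by
          intro i hi
          by_cases hij : i = j
          · subst hij; exact ⟨d3.label, d3.part⟩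
          · have hij' : (i : ℕ) ≠ j := Fin.val_ne_of_ne hij
            rw [(d3.idx i hij').1, (d3.idx i hij').2, hs1]
            have := i7 i (by omega)
            simpa [hij'] using this
        have htw := tailWeight_step P j
        have hrest := d3.rest
        rw [Nat.mul_comm, Nat.mul_zero, Nat.add_zero] at hrest
        by_cases hz : P j = 0
        · have hl : s3.nat 100 j = 0 := by rw [d3.label, hz]; rfl
          rw [if_pos hz, add_zero] at htw
          rw [htw]
          simp only [sem, Test.holds, NExp.eval, V, f111, hl]
          exact ⟨f111, f103, f100, f40, hrest, f00, fl⟩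
        · have hl : 1 ≤ s3.nat 100 j := by
            rw [d3.label]; exact Nat.one_le_iff_ne_zero.2 fun h => hz (Fin.ext h)
          rw [if_neg hz] at htw
          rw [htw]
          simp only [sem, Test.holds, NExp.eval, V, f111, hl, if_true, letN, letR, RExp.eval, RV]
          refine ⟨by simp [f111], by simp [f103], by simp [f100, f00, pow_succ], ?_, by simp [hrest],
            by simp [f00], ?_⟩
          · intro i hi; simpa using f40 i hi
          · intro i hi; simpa using fl i hi
    · rintro s' ⟨i1, -⟩
      simp only [Test.holds, NExp.eval, V, i1]; omega
    · have hw0 : tailWeight P n = 0 := by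
        rw [tailWeight, Finset.card_eq_zero, Finset.filter_eq_empty_iff]
        rintro j - ⟨h, -⟩
        omega
      refine ⟨by simpa using h1, by simp [h2, hw0], by simp [h3, hw0], h4, ?_, h6, fun j hj => by omega⟩
      rw [Nat.sub_zero, Nat.mod_eq_of_lt (code_lt P), h5]
    · simp; omega
    · rintro s' ⟨i1, i2, i3, i4, i5, i6, i7⟩
      have hw : tailWeight P (n - n) = weight P := by simp [tailWeight, weight]
      rw [hw] at i2 i3
      exact ⟨fun j => (i7 j (by omega)).1, fun j => (i7 j (by omega)).2, i2, i3⟩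
  refine (Run.simple_seq rfl (Run.simple_seq rfl (Run.simple_seq rfl (hloop _ ?_ ?_ ?_ ?_ ?_ ?_)))).mono ?_
    fun _ h => h
  all_goals simp [sem, letN, letR, NExp.eval, RExp.eval, hn, hP, Cmd.size]
  · intro j hj; simpa using hp j hj
  · omega

end run

/-! ### Lists of Pauli strings with amplitudes and accumulated weights -/

/-- A Pauli string with an amplitude and the accumulated weight of a Pauli path. -/
structure Item (n : ℕ) where
  P : PauliString n
  amp : ℝ
  cum : ℕ

section items
variable {n : ℕ} {orc : PauliString n → ℝ}

/-- Entry `k` of the item arrays is `e`. -/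
def ItemAt (s : Store n) (k : ℕ) (e : Item n) : Prop :=
  s.nat 200 k = code e.P ∧ s.nat 201 k = e.cum ∧ s.real 200 k = e.amp

/-- The item arrays hold the list `l` from entry `a` on. -/
def ItemsFrom (s : Store n) (a : ℕ) (l : List (Item n)) : Prop :=
  ∀ k (hk : k < l.length), ItemAt s (a + k) l[k]

/-- The current list of items, between the registers 92 and 202. -/
def Items (s : Store n) (l : List (Item n)) : Prop :=
  ItemsFrom s (s.nat 92 0) l ∧ s.nat 202 0 = s.nat 92 0 + l.length

/-- The items `l` have been appended. -/
structure Appends (s s' : Store n) (l : List (Item n)) : Prop where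
  hi : s'.nat 202 0 = s.nat 202 0 + l.length
  new : ItemsFrom s' (s.nat 202 0) l
  old : ∀ k < s.nat 202 0,
    s'.nat 200 k = s.nat 200 k ∧ s'.nat 201 k = s.nat 201 k ∧ s'.real 200 k = s.real 200 k

theorem ItemAt.congr {s s' : Store n} {k : ℕ} {e : Item n} (h : ItemAt s k e)
    (h' : s'.nat 200 k = s.nat 200 k ∧ s'.nat 201 k = s.nat 201 k ∧ s'.real 200 k = s.real 200 k) :
    ItemAt s' k e := by
  unfold ItemAt; rw [h'.1, h'.2.1, h'.2.2]; exact h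

theorem Appends.nil {s s' : Store n} (h : ∀ a, 200 ≤ a → s'.nat a = s.nat a ∧ s'.real a = s.real a) :
    Appends s s' [] :=
  ⟨by rw [(h 202 (by decide)).1]; rfl, fun k hk => absurd hk (by simp),
    fun k _ => by rw [(h 200 (by decide)).1, (h 201 (by decide)).1, (h 200 (by decide)).2]; simp⟩

theorem Appends.trans {s s' s'' : Store n} {l l' : List (Item n)} (h : Appends s s' l)
    (h' : Appends s' s'' l') : Appends s s'' (l ++ l') where
  hi := by rw [h'.hi, h.hi, List.length_append]; ring
  new := by
    intro k hk
    rcases Nat.lt_or_ge k l.length with hkl | hkl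
    · rw [List.getElem_append_left hkl]
      exact (h.new k hkl).congr (h'.old _ (by rw [h.hi]; omega))
    · rw [List.getElem_append_right hkl]
      have := h'.new (k - l.length) (by rw [List.length_append] at hk; omega)
      rw [h.hi] at this
      convert this using 1
      omega
  old := fun k hk => by
    have h1 := h.old k hk
    have h2 := h'.old k (by rw [h.hi]; omega)
    exact ⟨h2.1.trans h1.1, h2.2.1.trans h1.2.1, h2.2.2.trans h1.2.2⟩

/-- `Appends` does not depend on the arrays with small numbers. -/
theorem Appends.congr_left {s₀ s s' : Store n} {l : List (Item n)} (h : Appends s s' l)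
    (h0 : ∀ a, 200 ≤ a → s.nat a = s₀.nat a ∧ s.real a = s₀.real a) : Appends s₀ s' l := by
  simpa using (Appends.nil h0).trans h

/-- Append an item. -/
def push (e₁ : NExp) (e₂ : RExp) (e₃ : NExp) : Cmd :=
  .setNat 200 (V 202) e₁ ;; .setReal 200 (V 202) e₂ ;; .setNat 201 (V 202) e₃ ;;
    letN 202 (.add (V 202) (.const 1))

/-- The three expressions are evaluated between the writes, so their values are demanded in every
store that agrees with `s` on the arrays below 200. -/
theorem run_push {s : Store n} {e₁ : NExp} {e₂ : RExp} {e₃ : NExp} {e : Item n}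
    (h : ∀ s', Keep 200 s s' → e₁.eval s' = code e.P ∧ e₂.eval s' = e.amp ∧ e₃.eval s' = e.cum) :
    Run orc (push e₁ e₂ e₃) s 4 fun s' => Appends s s' [e] ∧ Keep 200 s s' := by
  refine (run_simple rfl s).mono (by simp [push, Cmd.size, letN]) ?_
  rintro s' rfl
  have k0 := Keep.refl 200 s
  have k1 := k0.setN (a := 200) (i := s.nat 202 0) (v := code e.P) le_rfl
  have k2 := k1.setR (a := 200) (i := s.nat 202 0) (v := e.amp) le_rfl
  have k3 := k2.setN (a := 201) (i := s.nat 202 0) (v := e.cum) (by decide)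
  have k4 := k3.setN (a := 202) (i := 0) (v := s.nat 202 0 + 1) (by decide)
  have hs : sem (push e₁ e₂ e₃) s = ((((s.setN 200 (s.nat 202 0) (code e.P)).setR 200 (s.nat 202 0)
      e.amp).setN 201 (s.nat 202 0) e.cum).setN 202 0 (s.nat 202 0 + 1)) := by
    simp [push, sem, V, NExp.eval, letN, (h s k0).1, (h _ k1).2.1, (h _ k2).2.2]
  rw [hs]
  refine ⟨⟨by simp, ?_, ?_⟩, k4⟩
  · intro k hk
    obtain rfl : k = 0 := by simpa using hk
    simp [ItemAt]
  · intro k hk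
    simp [hk.ne]

theorem run_pushes {α : Type*} {s : Store n} (as : List α) (e₁ : α → NExp) (e₂ : α → RExp)
    (e₃ : α → NExp) (e : α → Item n)
    (h : ∀ a ∈ as, ∀ s', Keep 200 s s' →
      (e₁ a).eval s' = code (e a).P ∧ (e₂ a).eval s' = (e a).amp ∧ (e₃ a).eval s' = (e a).cum) :
    Run orc (seqList (as.map fun a => push (e₁ a) (e₂ a) (e₃ a))) s (4 * as.length + 1)
      fun s' => Appends s s' (as.map e) ∧ Keep 200 s s' := by
  induction as generalizing s with
  | nil => exact ⟨s, 1, .skip s, by simp, .nil fun _ _ => ⟨rfl, rfl⟩, .refl _ _⟩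
  | cons a as ih =>
    refine (Run.seq (run_push (h a (by simp))) fun s1 hs1 => (ih fun a' ha' s' hs' =>
      h a' (by simp [ha']) s' (hs1.2.trans hs')).mono le_rfl fun s2 hs2 => ?_).mono ?_ fun _ h => h
    · exact ⟨by simpa using hs1.1.trans hs2.1, hs1.2.trans hs2.2⟩
    · simp; omega

/-! ### Loops over the current list -/

/-- Run `body` with register 90 pointing at every item of the current list; the items that it
appends form the new list. -/
def forItems (body : Cmd) : Cmd :=
  letN 91 (V 202) ;; letN 90 (V 92) ;; forTo 90 (V 91) body ;; letN 92 (V 91)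

/-- The item arrays are used as a queue: the new list grows behind the old one while the old one is
scanned, and register 91 remembers where the old one ends. `J p` may depend on the prefix `p`
already treated, but not on the loop registers 90 to 99 (`hJ`). The body may use that its item
occurs in `l`. -/
theorem run_forItems {body : Cmd} (hlow : 100 ≤ body.lowW) {s₀ : Store n} {l : List (Item n)}
    (hl : Items s₀ l) (f : Item n → List (Item n)) (J : List (Item n) → Store n → Prop) (t : ℕ)
    (hJ0 : J [] s₀)
    (hJ : ∀ p s s', J p s → (∀ a, a < 90 ∨ 100 ≤ a → s'.nat a = s.nat a) → s'.real = s.real →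
      s'.out = s.out → J p s')
    (H : ∀ p e s, p ++ [e] <+: l → J p s → ItemAt s (s.nat 90 0) e →
      Run orc body s t fun s' => Appends s s' (f e) ∧ J (p ++ [e]) s') :
    Run orc (forItems body) s₀ (l.length * (t + 2) + 4) fun s' => Items s' (l.flatMap f) ∧ J l s' := by
  obtain ⟨hl, hhi⟩ := hl
  set lo := s₀.nat 92 0 with hlo
  set hi := s₀.nat 202 0 with hhi'
  have hbound : ∀ (v w x : ℕ) (s : Store n) , ∀ a, a < 90 ∨ 100 ≤ a →
      (((s.setN 91 0 v).setN 90 0 w)).nat a = s.nat a := by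
    intro v w x s a ha
    rw [setN_nat_row (by omega), setN_nat_row (by omega)]
  refine (Run.simple_seq rfl (Run.simple_seq rfl
    ((run_forTo (fun m s => (∃ k ≤ l.length, m = lo + k ∧ J (l.take k) s ∧
        Appends s₀ s ((l.take k).flatMap f)) ∧ s.nat 91 0 = hi) (fun _ => t)
      (k := hi) (k0 := lo) (by omega) (Or.inl (by omega)) ?_ ?_ ?_ ?_).seq fun s' hs' =>
        (run_simple rfl s').mono le_rfl (post' := fun s' => Items s' (l.flatMap f) ∧ J l s') ?_))).mono ?_ fun _ h => h
  · rintro m s ⟨-, h⟩ -; simpa [NExp.eval, V] using h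
  · rintro m hm1 hm2 s ⟨⟨k, hk, rfl, hJs, happ⟩, h91⟩ h90
    have hk : k < l.length := by omega
    have htake : l.take (k + 1) = l.take k ++ [l[k]] := List.take_succ_eq_append_getElem hk
    have hat : ItemAt s (s.nat 90 0) l[k] := by
      rw [h90]; exact (hl k hk).congr (happ.old _ (by omega))
    refine (H _ _ s (by rw [← htake]; exact List.take_prefix _ _) hJs hat).frame.mono le_rfl ?_
    rintro s' ⟨⟨h1, h2⟩, h3⟩
    refine ⟨⟨k + 1, hk, by omega, ?_, ?_⟩, ?_⟩
    · rw [htake]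
      exact hJ _ _ _ h2 (fun a ha => setN_nat_row (by omega)) rfl rfl
    · rw [htake, List.flatMap_append]
      have h4 : Appends s₀ s' ((l.take k).flatMap f ++ f l[k]) := happ.trans h1
      have : [l[k]].flatMap f = f l[k] := by simp
      rw [this]
      refine ⟨?_, ?_, ?_⟩
      · rw [setN_nat_row (by decide)]; exact h4.hi
      · intro i hi
        refine (h4.new i hi).congr ?_
        simp
      · intro i hi
        have := h4.old i hi
        simpa using this
    · rw [setN_nat_row (by decide), (h3.1 91 (Or.inl (by omega))).1, h91]
  · refine ⟨⟨0, Nat.zero_le _, rfl, ?_, ?_⟩, ?_⟩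
    · refine hJ _ _ _ hJ0 (fun a ha => ?_) rfl rfl
      simp only [sem, letN]
      rw [setN_nat_row (by omega), setN_nat_row (by omega)]
    · refine .nil fun a ha => ?_
      simp only [sem, letN]
      rw [setN_nat_row (by omega), setN_nat_row (by omega)]
      exact ⟨rfl, rfl⟩
    · simp [sem, letN, V, NExp.eval, hhi']
  · simp [sem, letN, V, NExp.eval, hlo]
  · obtain ⟨⟨⟨k, hk, hkm, hJs, happ⟩, h91⟩, h90⟩ := hs'
    obtain rfl : k = l.length := by omega
    rw [List.take_length] at hJs happ
    rintro s'' rfl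
    have hsem : sem (letN 92 (V 91)) s' = s'.setN 92 0 hi := by simp [sem, letN, V, NExp.eval, h91]
    rw [hsem]
    refine ⟨⟨?_, ?_⟩, hJ _ _ _ hJs (fun a ha => setN_nat_row (by omega)) rfl rfl⟩
    · intro i hi'
      have := happ.new i hi'
      simp only [setN_nat, and_self, if_true]
      exact this.congr (by simp)
    · simp [happ.hi, hhi']
  · simp [Cmd.size, letN]
    have : hi - lo = l.length := by omega
    rw [this]; omega

/-- Loops over the current list whose bodies only append items. -/
theorem run_forItems_keep {body : Cmd} (hlow : 100 ≤ body.lowW) (hsil : body.silent = true)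
    {s₀ : Store n} {l : List (Item n)}
    (hl : Items s₀ l) (f : Item n → List (Item n)) (t : ℕ)
    (H : ∀ e s, Keep 90 s₀ s → ItemAt s (s.nat 90 0) e →
      Run orc body s t fun s' => Appends s s' (f e)) :
    Run orc (forItems body) s₀ (l.length * (t + 2) + 4)
      fun s' => Items s' (l.flatMap f) ∧ Keep 90 s₀ s' := by
  refine run_forItems hlow hl f (fun _ s => Keep 90 s₀ s) t (.refl _ _) ?_ ?_
  · intro _ s s' h h1 h2 h3
    exact ⟨fun a ha => (h1 a (Or.inl ha)).trans (h.nat a ha), fun a ha => by rw [h2, h.real a ha],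
      h3.trans h.out⟩
  · intro p e s _ hk he
    refine ((H e s hk he).keep hlow hsil).mono le_rfl fun s' hs' =>
      ⟨hs'.1, hk.trans (hs'.2.mono (by omega))⟩

/-! ### Loading an item -/

/-- Copy the data of the current item to registers and decode its Pauli string. -/
def loadItem : Cmd :=
  letN 101 (.cell 200 (V 90)) ;; letN 114 (.cell 200 (V 90)) ;; letN 115 (.cell 201 (V 90)) ;;
    letR 112 (.cell 200 (V 90)) ;; decode

/-- What loading the item `e` leaves behind. -/
structure Loaded (s : Store n) (q : ℝ) (e : Item n) : Prop where
  dec : Decoded s q e.P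
  code : s.nat 114 0 = code e.P
  cum : s.nat 115 0 = e.cum
  amp : s.real 112 0 = e.amp

theorem run_loadItem {s : Store n} {e : Item n} (hn : s.nat 0 0 = n) (hp : Powers s)
    (he : ItemAt s (s.nat 90 0) e) :
    Run orc loadItem s (24 * n + 8) fun s' => Loaded s' (s.real 0 0) e ∧ Keep 100 s s' ∧
      ∀ a, 200 ≤ a → s'.nat a = s.nat a ∧ s'.real a = s.real a := by
  obtain ⟨h1, h2, h3⟩ := he
  have hmain : Run orc loadItem s (24 * n + 8) fun s' => Loaded s' (s.real 0 0) e := by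
    refine (Run.simple_seq rfl (Run.simple_seq rfl (Run.simple_seq rfl (Run.simple_seq rfl
      (Run.mono ((run_decode (orc := orc) (P := e.P) ?_ ?_ ?_).frame) le_rfl
      fun s' hs' => ?_))))).mono ?_ fun _ h => h
    · simpa [sem, letN, letR, NExp.eval, V, RExp.eval] using hn
    · intro j hj; simpa [sem, letN, letR, NExp.eval, V, RExp.eval] using hp j hj
    · simpa [sem, letN, letR, NExp.eval, V, RExp.eval] using h1
    · obtain ⟨hd, hf⟩ := hs'
      refine ⟨?_, ?_, ?_, ?_⟩
      · simpa [sem, letN, letR, NExp.eval, V, RExp.eval] using hd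
      · rw [(hf.1 114 (Or.inr (by decide))).1]; simpa [sem, letN, letR, NExp.eval, V, RExp.eval] using h1
      · rw [(hf.1 115 (Or.inr (by decide))).1]; simpa [sem, letN, letR, NExp.eval, V, RExp.eval] using h2
      · rw [(hf.1 112 (Or.inr (by decide))).2]; simpa [sem, letN, letR, NExp.eval, V, RExp.eval] using h3
    · simp [Cmd.size, letN, letR]; omega
  refine hmain.frame.mono le_rfl fun s' hs' => ⟨hs'.1, hs'.2.keep (by decide) rfl, fun a ha => ?_⟩
  exact hs'.2.1 a (Or.inr (lt_of_lt_of_le (by decide) ha))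

end items

/-! ### One layer with uniform noise on lists of items -/

/-- All pairs of labels. -/
def labelPairs : List (Fin 4 × Fin 4) := List.product (List.finRange 4) (List.finRange 4)

theorem sum_labelPairs {R : Type*} [AddCommMonoid R] (f : Fin 4 × Fin 4 → R) :
    (labelPairs.map f).sum = ∑ p, f p := by
  rw [← List.sum_toFinset f (by decide : labelPairs.Nodup)]
  congr 1

theorem mem_labelPairs (p : Fin 4 × Fin 4) : p ∈ labelPairs := by
  revert p; decide

section lists
variable {n : ℕ}

/-- Noise, and truncation of the accumulated weight. -/
noncomputable def noiseStep (q : ℝ) (W : ℕ) (e : Item n) : List (Item n) :=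
  if e.cum + weight e.P ≤ W then [⟨e.P, e.amp * q ^ weight e.P, e.cum + weight e.P⟩] else []

/-- Replace the labels of the qubits `j` and `k`. -/
def setPair (P : PauliString n) (j k : Fin n) (ab : Fin 4 × Fin 4) : PauliString n :=
  Function.update (Function.update P j ab.1) k ab.2

/-- The gate at qubit `j`. -/
noncomputable def gateStep (U : Layer n) (j : Fin n) (e : Item n) : List (Item n) :=
  if j < U.partner j ∧ ¬(e.P j = 0 ∧ e.P (U.partner j) = 0) then
    labelPairs.map fun ab => ⟨setPair e.P j (U.partner j) ab,
      e.amp * gateCoeff (U.gate j) ab (e.P j, e.P (U.partner j)), e.cum⟩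
  else [e]

/-- The gates at the first qubits. -/
noncomputable def gatesUpTo (U : Layer n) (l : List (Item n)) : ℕ → List (Item n)
  | 0 => l
  | m + 1 => if h : m < n then (gatesUpTo U l m).flatMap (gateStep U ⟨m, h⟩) else gatesUpTo U l m

/-- A layer with its noise. -/
noncomputable def layerStep (q : ℝ) (W : ℕ) (U : Layer n) (l : List (Item n)) : List (Item n) :=
  gatesUpTo U (l.flatMap (noiseStep q W)) n

theorem code_setPair (P : PauliString n) {j k : Fin n} (hjk : j ≠ k) (ab : Fin 4 × Fin 4) :
    code (setPair P j k ab) = code P - P j * 4 ^ (j : ℕ) - P k * 4 ^ (k : ℕ) + ab.1 * 4 ^ (j : ℕ)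
      + ab.2 * 4 ^ (k : ℕ) := by
  have h1 := code_update P j ab.1
  have h2 := code_update (Function.update P j ab.1) k ab.2
  rw [Function.update_of_ne hjk.symm] at h2
  -- Two different digits fit into the code, so the truncated subtractions are exact.
  have h3 : (P j : ℕ) * 4 ^ (j : ℕ) + P k * 4 ^ (k : ℕ) ≤ code P := by
    rw [code, ← Finset.add_sum_erase _ _ (Finset.mem_univ j),
      ← Finset.add_sum_erase (Finset.univ.erase j) _ (Finset.mem_erase.2 ⟨hjk.symm, Finset.mem_univ k⟩)]
    omega
  rw [setPair]
  omega

/-! ### Programs for the steps -/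

/-- The program for `noiseStep`; the bound on the accumulated weight stands in register 42. -/
def noiseBody : Cmd :=
  loadItem ;; .ite (.natLe (.add (V 115) (V 103)) (V 42))
    (push (V 114) (.mul (RV 112) (RV 100)) (.add (V 115) (V 103))) .skip

/-- The indicator of `x = k`. -/
def indicator (x : NExp) (k : ℕ) : RExp :=
  .ofNat (.sub (.const 1) (.add (.sub x (.const k)) (.sub (.const k) x)))

/-- The sum of the expressions in a list. -/
def sumExp (l : List RExp) : RExp := l.foldr .add (.const 0)

/-- With truncated subtraction, (x - k) + (k - x) is the distance of x and k, and 1 minus a positive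
number is 0. -/
theorem eval_indicator (s : Store n) (x : NExp) (k : ℕ) :
    (indicator x k).eval s = if x.eval s = k then 1 else 0 := by
  simp only [indicator, RExp.eval, NExp.eval]
  split_ifs with h
  · simp [h]
  · have : 1 - (x.eval s - k + (k - x.eval s)) = 0 := by omega
    simp [this]

theorem eval_sumExp (s : Store n) (l : List RExp) : (sumExp l).eval s = (l.map (RExp.eval s)).sum := by
  induction l with
  | nil => simp [sumExp, RExp.eval]
  | cons e l ih =>
    rw [sumExp, List.foldr_cons, RExp.eval, List.map_cons, List.sum_cons]
    rw [sumExp] at ih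
    rw [ih]

/-- The coefficient of the gate at `site` from the labels that are the values of `x` and `y`. -/
def gateExpAt (site x y : NExp) (q : Fin 4 × Fin 4) : RExp :=
  sumExp (labelPairs.map fun p =>
    .mul (.mul (indicator x p.1) (indicator y p.2)) (gateExp site q p))

/-- `gateExp` has the labels in its syntax, while the program knows them only at run time. A sum
over all sixteen pairs with indicators selects the right one in a single expression. -/
theorem eval_gateExpAt {s : Store n} {G : Matrix (Fin 2 × Fin 2) (Fin 2 × Fin 2) ℂ}
    {site x y : NExp} (h : GateAt s G (site.eval s)) {p : Fin 4 × Fin 4} (hx : x.eval s = p.1)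
    (hy : y.eval s = p.2) (q : Fin 4 × Fin 4) :
    (gateExpAt site x y q).eval s = gateCoeff G q p := by
  rw [gateExpAt, eval_sumExp, List.map_map, sum_labelPairs, Finset.sum_eq_single p]
  · simp [RExp.eval, eval_indicator, hx, hy, eval_gateExp h]
  · intro p' _ hp'
    simp only [Function.comp, RExp.eval, eval_indicator, hx, hy, Fin.val_inj]
    by_cases h1 : p.1 = p'.1
    · by_cases h2 : p.2 = p'.2
      · exact absurd (Prod.ext h1 h2).symm hp'
      · simp [h2]
    · simp [h1]
  · simp

/-- The site of qubit `j` in the current layer; its offset is in register 44, the qubit in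
register 80. -/
def siteExp : NExp := .add (V 44) (V 80)

/-- The program for `gateStep`. -/
def gateBody : Cmd :=
  loadItem ;; letN 116 (.cell 1 siteExp) ;;
    .ite (.natLe (.add (V 80) (.const 1)) (V 116))
      (.ite (.natLe (.const 1) (.add (.cell 100 (V 80)) (.cell 100 (V 116))))
        (seqList (labelPairs.map fun ab =>
          push (.add (.add (.sub (.sub (V 114) (.cell 102 (V 80))) (.cell 102 (V 116)))
              (NExp.times (.cell 40 (V 80)) ab.1)) (NExp.times (.cell 40 (V 116)) ab.2))
            (.mul (RV 112) (gateExpAt siteExp (.cell 100 (V 80)) (.cell 100 (V 116)) ab))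
            (V 115)))
        (push (V 114) (RV 112) (V 115)))
      (push (V 114) (RV 112) (V 115))

/-- The program for `layerStep`. -/
def layerCmd : Cmd :=
  forItems noiseBody ;; letN 80 (.const 0) ;; forTo 80 (.cell 0 (.const 0)) (forItems gateBody)

/-- The data of the layer `U` are stored from entry `base` on. -/
def LayerAt (s : Store n) (U : Layer n) (base : ℕ) : Prop :=
  ∀ j : Fin n, s.nat 1 (base + j) = U.partner j ∧ GateAt s (U.gate j) (base + j)

variable {orc : PauliString n → ℝ}

theorem LayerAt.keep {s s' : Store n} {U : Layer n} {base b : ℕ} (h : LayerAt s U base)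
    (hk : Keep b s s') (hb : 40 ≤ b) : LayerAt s' U base := fun j => by
  refine ⟨by rw [hk.nat 1 (by omega)]; exact (h j).1, fun e he => ?_⟩
  rw [hk.real _ (by omega), hk.real _ (by omega)]
  exact (h j).2 e he

theorem Powers.keep {s s' : Store n} {b : ℕ} (h : Powers s) (hk : Keep b s s') (hb : 41 ≤ b) :
    Powers s' := fun j hj => by rw [hk.nat 40 (by omega)]; exact h j hj

theorem Items.setN {s : Store n} {l : List (Item n)} (h : Items s l) {a i v : ℕ}
    (ha : a ≠ 92 ∧ a ≠ 200 ∧ a ≠ 201 ∧ a ≠ 202) : Items (s.setN a i v) l := by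
  have e : ∀ b, b ≠ a → (s.setN a i v).nat b = s.nat b := fun b hb => setN_nat_row hb
  refine ⟨?_, by rw [e 202 (by omega), e 92 (by omega)]; exact h.2⟩
  rw [e 92 (by omega)]
  intro k hk
  exact (h.1 k hk).congr (by rw [e 200 (by omega), e 201 (by omega)]; simp)

theorem run_noiseBody {s : Store n} {e : Item n} (hn : s.nat 0 0 = n) (hp : Powers s)
    (he : ItemAt s (s.nat 90 0) e) :
    Run orc noiseBody s (24 * n + 13)
      fun s' => Appends s s' (noiseStep (s.real 0 0) (s.nat 42 0) e) := by
  refine (Run.seq (run_loadItem hn hp he) (T' := 5) ?_).mono (by omega) fun _ h => h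
  rintro s1 ⟨hl, hk, hr⟩
  have h42 : s1.nat 42 0 = s.nat 42 0 := by rw [hk.nat 42 (by decide)]
  refine Run.ite (fun h => ?_) fun h => ?_
  · simp only [Test.holds, NExp.eval, V, hl.cum, hl.dec.wt, h42] at h
    rw [noiseStep, if_pos h]
    refine (run_push fun s' hk' => ⟨?_, ?_, ?_⟩).mono le_rfl fun s' hs' => hs'.1.congr_left hr
    · simp [NExp.eval, V, hk'.nat 114 (by decide), hl.code]
    · simp [RExp.eval, RV, NExp.eval, hk'.real 112 (by decide), hk'.real 100 (by decide), hl.amp, hl.dec.factor]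
    · simp [NExp.eval, V, hk'.nat 115 (by decide), hk'.nat 103 (by decide), hl.cum, hl.dec.wt]
  · simp only [Test.holds, NExp.eval, V, hl.cum, hl.dec.wt, h42] at h
    rw [noiseStep, if_neg h]
    exact ⟨s1, 1, .skip _, by omega, .nil hr⟩

theorem gateBody_lowW : 100 ≤ gateBody.lowW := by decide

theorem gateBody_silent : gateBody.silent = true := by decide

theorem run_gateBody {s : Store n} {e : Item n} (U : Layer n) (j : Fin n) (hn : s.nat 0 0 = n)
    (hp : Powers s) (hU : LayerAt s U (s.nat 44 0)) (hj : s.nat 80 0 = j)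
    (he : ItemAt s (s.nat 90 0) e) :
    Run orc gateBody s (24 * n + 80) fun s' => Appends s s' (gateStep U j e) := by
  refine (Run.seq (run_loadItem hn hp he) (T' := 68) ?_).mono (by omega) fun _ h => h
  rintro s1 ⟨hl, hk, hr⟩
  refine (Run.simple_seq rfl (T := 67) ?_).mono (by simp [letN, Cmd.size]) fun _ h => h
  have hU1 := hU.keep hk (by decide)
  have hs2 : sem (letN 116 (.cell 1 siteExp)) s1 = s1.setN 116 0 (U.partner j) := by
    have := (hU j).1
    simp [sem, letN, NExp.eval, V, siteExp, hk.nat 44 (by decide), hk.nat 80 (by decide), hj,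
      hk.nat 1 (by decide), this]
  rw [hs2]
  set s2 := s1.setN 116 0 (U.partner j) with hs2'
  have hk2 : Keep 100 s s2 := hk.setN (by decide)
  have hr2 : ∀ a, 200 ≤ a → s2.nat a = s.nat a ∧ s2.real a = s.real a := fun a ha =>
    ⟨by rw [hs2', setN_nat_row (by omega), (hr a ha).1], (hr a ha).2⟩
  have h116 : s2.nat 116 0 = U.partner j := by simp [hs2']
  have h80 : s2.nat 80 0 = j := by rw [hk2.nat 80 (by decide), hj]
  have hlab : ∀ i : Fin n, s2.nat 100 i = e.P i := fun i => by simpa [hs2'] using hl.dec.label i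
  have hpart : ∀ i : Fin n, s2.nat 102 i = e.P i * 4 ^ (i : ℕ) := fun i => by
    simpa [hs2'] using hl.dec.part i
  have h114 : s2.nat 114 0 = code e.P := by simpa [hs2'] using hl.code
  have h115 : s2.nat 115 0 = e.cum := by simpa [hs2'] using hl.cum
  have h112 : s2.real 112 0 = e.amp := by simpa [hs2'] using hl.amp
  have hsame : Run orc (push (V 114) (RV 112) (V 115)) s2 65 fun s' => Appends s s' [e] := by
    refine (run_push fun s' hk' => ⟨?_, ?_, ?_⟩).mono (by omega) fun s' hs' => hs'.1.congr_left hr2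
    · simp [NExp.eval, V, hk'.nat 114 (by decide), h114]
    · simp [RExp.eval, RV, NExp.eval, hk'.real 112 (by decide), h112]
    · simp [NExp.eval, V, hk'.nat 115 (by decide), h115]
  refine Run.ite (fun h => ?_) fun h => ?_
  · have hlt : j < U.partner j := by
      simp only [Test.holds, NExp.eval, V, h80, h116] at h
      exact h
    -- The longest branch appends sixteen items at four steps each, and the end of the sequence
    -- takes one more.
    refine (Run.ite (T := 65) (fun h' => ?_) fun h' => ?_)
    · simp only [Test.holds, NExp.eval, V, h80, h116, hlab] at h'
      have hne : ¬(e.P j = 0 ∧ e.P (U.partner j) = 0) := by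
        rintro ⟨h1, h2⟩
        rw [h1, h2] at h'
        simp at h'
      rw [gateStep, if_pos ⟨hlt, hne⟩]
      refine (run_pushes labelPairs _ _ _ _ fun ab _ s' hk' => ⟨?_, ?_, ?_⟩).mono (by decide)
        fun s' hs' => hs'.1.congr_left hr2
      · have hp2 : ∀ i ≤ n, s'.nat 40 i = 4 ^ i := fun i hi => by
          rw [hk'.nat 40 (by decide), hk2.nat 40 (by decide)]; exact hp i hi
        simp only [NExp.eval, V, hk'.nat 114 (by decide), hk'.nat 102 (by decide), hk'.nat 80 (by decide),
          hk'.nat 116 (by decide), h114, h80, h116, hpart, eval_times, hp2 _ j.2.le,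
          hp2 _ (U.partner j).2.le]
        rw [code_setPair _ hlt.ne]
      · have hU' : GateAt s' (U.gate j) (siteExp.eval s') := by
          have h44 : s'.nat 44 0 = s.nat 44 0 := by rw [hk'.nat 44 (by decide), hk2.nat 44 (by decide)]
          simp only [siteExp, NExp.eval, V, h44, hk'.nat 80 (by decide), h80]
          exact (((hU.keep hk2 (by decide)).keep hk' (by decide)) j).2
        simp only [RExp.eval, RV, NExp.eval, hk'.real 112 (by decide), h112]
        rw [eval_gateExpAt hU' (p := (e.P j, e.P (U.partner j)))]
        · simp [NExp.eval, V, hk'.nat 100 (by decide), hk'.nat 80 (by decide), h80, hlab]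
        · simp [NExp.eval, V, hk'.nat 100 (by decide), hk'.nat 116 (by decide), h116, hlab]
      · simp [NExp.eval, V, hk'.nat 115 (by decide), h115]
    · have h3 : ¬ (1 ≤ (e.P j : ℕ) + e.P (U.partner j)) := by
        simpa only [Test.holds, NExp.eval, V, h80, h116, hlab] using h'
      have h1 : e.P j = 0 := Fin.ext (by rw [Fin.val_zero]; omega)
      have h2 : e.P (U.partner j) = 0 := Fin.ext (by rw [Fin.val_zero]; omega)
      rw [gateStep, if_neg (by tauto)]
      exact hsame
  · have hlt : ¬ j < U.partner j := by
      simp only [Test.holds, NExp.eval, V, h80, h116] at h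
      exact h
    rw [gateStep, if_neg (by tauto)]
    exact hsame.mono (by omega) fun _ h => h

/-- Every gate scans the whole current list, so `B` has to bound all intermediate lists within the
layer; the potential provides this. -/
theorem run_layerCmd {s : Store n} {l : List (Item n)} (U : Layer n) {B : ℕ} (hn : s.nat 0 0 = n)
    (hp : Powers s) (hU : LayerAt s U (s.nat 44 0)) (hl : Items s l) (hB : l.length ≤ B)
    (hB' : ∀ m ≤ n, (gatesUpTo U (l.flatMap (noiseStep (s.real 0 0) (s.nat 42 0))) m).length ≤ B) :
    Run orc layerCmd s ((n + 1) * (B * (24 * n + 82) + 8))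
      fun s' => Items s' (layerStep (s.real 0 0) (s.nat 42 0) U l) ∧ Keep 80 s s' := by
  refine (Run.seq (run_forItems_keep (by decide) rfl hl (noiseStep (s.real 0 0) (s.nat 42 0))
    (24 * n + 13) ?_)
    (T' := 1 + (n * (B * (24 * n + 82) + 6) + 1)) ?_).mono ?_ fun _ h => h
  · intro e s' hk he
    have := run_noiseBody (orc := orc) (by rw [hk.nat 0 (by decide), hn]) (hp.keep hk (by decide)) he
    rwa [hk.real 0 (by decide), hk.nat 42 (by decide)] at this
  · rintro s1 ⟨hl1, hk1⟩
    refine Run.simple_seq rfl ?_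
    have hs2 : sem (letN 80 (.const 0)) s1 = s1.setN 80 0 0 := by simp [sem, letN, NExp.eval]
    rw [hs2]
    refine (run_forTo (fun m s' => Items s' (gatesUpTo U (l.flatMap
      (noiseStep (s.real 0 0) (s.nat 42 0))) m) ∧ Keep 80 s s') (fun _ => B * (24 * n + 82) + 4)
      (k := n) (k0 := 0) (Nat.zero_le _) (Or.inl (by decide)) ?_ ?_ ?_ ?_).mono ?_ fun s' hs' => hs'.1
    · intro m s' hs' _
      simp [NExp.eval, hs'.2.nat 0 (by decide), hn]
    · rintro m - hm s' ⟨hi, hk⟩ hj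
      refine (run_forItems_keep gateBody_lowW gateBody_silent hi (gateStep U ⟨m, hm⟩)
        (24 * n + 80) ?_).mono ?_ ?_
      · intro e s'' hk' he
        have hk2 := hk.trans (hk'.mono (by decide))
        refine run_gateBody U ⟨m, hm⟩ (by rw [hk2.nat 0 (by decide), hn]) (hp.keep hk2 (by decide)) ?_ ?_ he
        · rw [hk2.nat 44 (by decide)]; exact hU.keep hk2 (by decide)
        · rw [hk'.nat 80 (by decide), hj]
      · have := hB' m hm.le
        gcongr
      · rintro s'' ⟨hi', hk'⟩
        refine ⟨?_, (hk.trans (hk'.mono (by decide))).setN le_rfl⟩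
        rw [gatesUpTo, dif_pos hm]
        exact hi'.setN (by decide)
    · exact ⟨hl1.setN (by decide), (hk1.mono (by decide)).setN le_rfl⟩
    · simp
    · simp
  · have : l.length * (24 * n + 15) ≤ B * (24 * n + 82) := Nat.mul_le_mul hB (by omega)
    nlinarith

end lists

/-! ### Lists of items as graded vectors -/

section vec
variable {n : ℕ}

/-- The graded vector of a list of items. -/
noncomputable def itemVec (l : List (Item n)) (k : ℕ) (P : PauliString n) : ℝ :=
  (l.map fun e => if e.P = P ∧ e.cum = k then e.amp else 0).sum

theorem itemVec_cons (e : Item n) (l : List (Item n)) (k : ℕ) (P : PauliString n) :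
    itemVec (e :: l) k P = (if e.P = P ∧ e.cum = k then e.amp else 0) + itemVec l k P := by
  simp [itemVec]

theorem itemVec_append (l l' : List (Item n)) (k : ℕ) (P : PauliString n) :
    itemVec (l ++ l') k P = itemVec l k P + itemVec l' k P := by
  simp [itemVec]

theorem itemVec_nil (k : ℕ) (P : PauliString n) : itemVec [] k P = 0 := rfl

/-- Items whose accumulated weight would exceed W are dropped. Grades never decrease, so grades up
to W are unaffected. -/
theorem itemVec_noiseStep (q : ℝ) {W k : ℕ} (hk : k ≤ W) (l : List (Item n)) :
    itemVec (l.flatMap (noiseStep q W)) k = gradedNoise q (itemVec l) k := by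
  ext Q
  induction l with
  | nil => simp [itemVec, gradedNoise]
  | cons e l ih =>
    have hadd : gradedNoise q (itemVec (e :: l)) k Q
        = (if weight Q ≤ k then q ^ weight Q *
            (if e.P = Q ∧ e.cum = k - weight Q then e.amp else 0) else 0)
          + gradedNoise q (itemVec l) k Q := by
      simp only [gradedNoise, itemVec_cons]
      split_ifs <;> ring
    rw [List.flatMap_cons, itemVec_append, ih, hadd]
    congr 1
    by_cases hP : e.P = Q
    · subst hP
      rw [noiseStep]
      by_cases h1 : e.cum + weight e.P ≤ W
      · rw [if_pos h1, itemVec_cons, itemVec_nil]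
        by_cases h2 : e.cum + weight e.P = k
        · have h3 : weight e.P ≤ k := by omega
          have h4 : e.cum = k - weight e.P := by omega
          simp [h2, h3, ← h4]; ring
        · by_cases h3 : weight e.P ≤ k
          · have h4 : ¬ e.cum = k - weight e.P := by omega
            simp [h2, h4]
          · simp [h2, h3]
      · rw [if_neg h1, itemVec_nil]
        by_cases h3 : weight e.P ≤ k
        · have h4 : ¬ e.cum = k - weight e.P := by omega
          simp [h4]
        · simp [h3]
    · rw [noiseStep]
      by_cases h1 : e.cum + weight e.P ≤ W <;> simp [h1, itemVec, hP]

/-- Both sides say that P and Q agree off the pair and that Q has the labels `ab` on it.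
Consequently sums over the labels of a pair have only one term for each given item. -/
theorem setPair_eq_iff {P Q : PauliString n} {j k : Fin n} (hjk : j ≠ k) (ab : Fin 4 × Fin 4) :
    setPair P j k ab = Q ↔ ab = (Q j, Q k) ∧ P = setPair Q j k (P j, P k) := by
  constructor
  · rintro rfl
    refine ⟨by simp [setPair, hjk], ?_⟩
    ext1 i
    by_cases h1 : i = k
    · subst h1; simp [setPair]
    · by_cases h2 : i = j
      · subst h2; simp [setPair, h1]
      · simp [setPair, h1, h2]
  · rintro ⟨rfl, h⟩
    ext1 i
    by_cases h1 : i = k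
    · subst h1; simp [setPair]
    · by_cases h2 : i = j
      · subst h2; simp [setPair, h1]
      · have := congrFun h i
        simpa [setPair, h1, h2] using this

/-- Copying items that are the identity on the gate is exact, because a unitary fixes the identity;
no sixteenfold branching is needed for them. -/
theorem itemVec_gateStep (U : Layer n) {j : Fin n} (hj : j < U.partner j) (l : List (Item n))
    (k : ℕ) (Q : PauliString n) :
    itemVec (l.flatMap (gateStep U j)) k Q = ∑ ab : Fin 4 × Fin 4,
      gateCoeff (U.gate j) (Q j, Q (U.partner j)) ab *
        itemVec l k (setPair Q j (U.partner j) ab) := by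
  induction l with
  | nil => simp [itemVec]
  | cons e l ih =>
    rw [List.flatMap_cons, itemVec_append, ih]
    simp only [itemVec_cons, mul_add, Finset.sum_add_distrib]
    congr 1
    have hR : ∑ ab : Fin 4 × Fin 4, gateCoeff (U.gate j) (Q j, Q (U.partner j)) ab *
        (if e.P = setPair Q j (U.partner j) ab ∧ e.cum = k then e.amp else 0)
        = gateCoeff (U.gate j) (Q j, Q (U.partner j)) (e.P j, e.P (U.partner j)) *
          (if e.P = setPair Q j (U.partner j) (e.P j, e.P (U.partner j)) ∧ e.cum = k then e.amp else 0) := by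
      rw [Finset.sum_eq_single (e.P j, e.P (U.partner j))]
      · intro ab _ hab
        rw [if_neg, mul_zero]
        rintro ⟨h, -⟩
        exact hab ((setPair_eq_iff hj.ne ab).1 h.symm).1
      · simp
    rw [hR, gateStep]
    by_cases hact : e.P j = 0 ∧ e.P (U.partner j) = 0
    · rw [if_neg (by tauto), itemVec_cons, itemVec_nil, hact.1, hact.2,
        gateCoeff_zero_right (U.unitary j hj), add_zero]
      by_cases hQ : (Q j, Q (U.partner j)) = (0, 0)
      · rw [if_pos hQ, one_mul]
        have : e.P = Q ↔ e.P = setPair Q j (U.partner j) (0, 0) := by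
          rw [eq_comm (a := e.P) (b := setPair _ _ _ _), setPair_eq_iff hj.ne, hact.1, hact.2, hQ]
          have h1 : setPair e.P j (U.partner j) (0, 0) = e.P := by
            rw [setPair_eq_iff hj.ne, hact.1, hact.2]
            refine ⟨rfl, ?_⟩
            ext1 i
            by_cases h1 : i = U.partner j
            · subst h1; simp [setPair, hact.2]
            · by_cases h2 : i = j
              · subst h2; simp [setPair, h1, hact.1]
              · simp [setPair, h1, h2]
          rw [h1]; simp [eq_comm]
        simp only [this]
      · have : e.P ≠ Q := by
          rintro rfl; exact hQ (Prod.ext hact.1 hact.2)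
        simp [hQ, this]
    · rw [if_pos ⟨hj, hact⟩, itemVec, List.map_map, sum_labelPairs, Finset.sum_eq_single (Q j, Q (U.partner j))]
      · simp only [Function.comp, setPair_eq_iff hj.ne, true_and]
        split_ifs <;> ring
      · intro ab _ hab
        simp only [Function.comp]
        rw [if_neg]
        rintro ⟨h, -⟩
        exact hab ((setPair_eq_iff hj.ne ab).1 h).1
      · simp

/-- The coefficient of `Q` after the maps `g` on the cells that begin at the first `m` qubits act on
`P`. -/
noncomputable def partialCoeff (U : Layer n) (g : Fin n → Fin 4 × Fin 4 → Fin 4 × Fin 4 → ℝ) (m : ℕ) (Q P : PauliString n) : ℝ :=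
  ∏ j : Fin n, if U.partner j = j then (if Q j = P j then 1 else 0)
    else if j < U.partner j then
      (if (j : ℕ) < m then g j (Q j, Q (U.partner j)) (P j, P (U.partner j))
        else (if Q j = P j then 1 else 0) * (if Q (U.partner j) = P (U.partner j) then 1 else 0))
    else 1

theorem partialCoeff_zero (U : Layer n)
    (g : Fin n → Fin 4 × Fin 4 → Fin 4 × Fin 4 → ℝ) (Q P : PauliString n) :
    partialCoeff U g 0 Q P = if Q = P then 1 else 0 := by
  have h := prod_cells U.involutive (fun j => if Q j = P j then (1 : ℝ) else 0)
  simp only [partialCoeff, Nat.not_lt_zero, if_false]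
  rw [h]
  split_ifs with hQ
  · subst hQ; simp
  · obtain ⟨j, hj⟩ := Function.ne_iff.1 hQ
    exact Finset.prod_eq_zero (Finset.mem_univ j) (if_neg hj)

theorem partialCoeff_last (U : Layer n) (Q P : PauliString n) :
    partialCoeff U (fun j => gateCoeff (U.gate j)) n Q P = layerCoeff U Q P := by
  refine Finset.prod_congr rfl fun j _ => ?_
  simp [j.2]

/-- Cells are disjoint, so acting on the cell of j replaces only the identity factor of this cell.
The maps `g` are arbitrary, since they are taken both as bare gates and as gates with noise. -/
theorem partialCoeff_step (U : Layer n)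
    (g : Fin n → Fin 4 × Fin 4 → Fin 4 × Fin 4 → ℝ) {j : Fin n} (hj : j < U.partner j) (Q P : PauliString n) :
    ∑ ab : Fin 4 × Fin 4, g j (Q j, Q (U.partner j)) ab *
      partialCoeff U g j (setPair Q j (U.partner j) ab) P = partialCoeff U g (j + 1) Q P := by
  have hrest : ∀ ab, partialCoeff U g j (setPair Q j (U.partner j) ab) P
      = (if ab = (P j, P (U.partner j)) then 1 else 0) *
        ∏ i ∈ Finset.univ.erase j, if U.partner i = i then (if Q i = P i then (1 : ℝ) else 0)
          else if i < U.partner i then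
            (if (i : ℕ) < j + 1 then g i (Q i, Q (U.partner i)) (P i, P (U.partner i))
              else (if Q i = P i then 1 else 0) * (if Q (U.partner i) = P (U.partner i) then 1 else 0))
          else 1 := by
    intro ab
    rw [partialCoeff, ← Finset.mul_prod_erase _ _ (Finset.mem_univ j)]
    congr 1
    · simp only [hj.ne', hj, if_true, if_false, lt_irrefl]
      have e1 : setPair Q j (U.partner j) ab j = ab.1 := by simp [setPair, hj.ne]
      have e2 : setPair Q j (U.partner j) ab (U.partner j) = ab.2 := by simp [setPair]
      rw [e1, e2]
      by_cases h1 : ab.1 = P j <;> by_cases h2 : ab.2 = P (U.partner j) <;>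
        simp [h1, h2, Prod.ext_iff]
    · refine Finset.prod_congr rfl fun i hi => ?_
      have hij := Finset.ne_of_mem_erase hi
      have e : ∀ i, i ≠ j → i ≠ U.partner j → setPair Q j (U.partner j) ab i = Q i := by
        intro i h1 h2; simp [setPair, h1, h2]
      by_cases hip : i = U.partner j
      · subst hip
        have h1 : ¬ U.partner (U.partner j) = U.partner j := by rw [U.involutive]; exact hj.ne
        have h2 : ¬ U.partner j < U.partner (U.partner j) := by rw [U.involutive]; exact hj.not_gt
        simp only [h1, h2, if_false]
      · have hpj : U.partner i ≠ j := by
          intro h; apply hip; rw [← h, U.involutive]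
        have hpp : U.partner i ≠ U.partner j := by
          intro h; apply hij; rw [← U.involutive i, h, U.involutive]
        rw [e i hij hip, e _ hpj hpp]
        have : (i : ℕ) < j ↔ (i : ℕ) < j + 1 := by
          have := Fin.val_ne_of_ne hij
          omega
        simp only [this]
  simp only [hrest]
  rw [Finset.sum_eq_single (P j, P (U.partner j))]
  · rw [if_pos rfl, one_mul]
    conv_rhs => rw [partialCoeff, ← Finset.mul_prod_erase _ _ (Finset.mem_univ j)]
    simp [hj.ne', hj]
  · intro ab _ hab; simp [hab]
  · simp

theorem partialCoeff_skip (U : Layer n) (g : Fin n → Fin 4 × Fin 4 → Fin 4 × Fin 4 → ℝ) {j : Fin n}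
    (hj : ¬ j < U.partner j) (Q P : PauliString n) :
    partialCoeff U g (j + 1) Q P = partialCoeff U g j Q P := by
  refine Finset.prod_congr rfl fun i _ => ?_
  by_cases hi : i < U.partner i
  · have : (i : ℕ) ≠ j := Fin.val_ne_of_ne (by rintro rfl; exact hj hi)
    have : (i : ℕ) < j + 1 ↔ (i : ℕ) < j := by omega
    simp only [this]
  · simp [hi]

theorem itemVec_gatesUpTo (U : Layer n) (l : List (Item n)) (k : ℕ) :
    ∀ m ≤ n, ∀ Q, itemVec (gatesUpTo U l m) k Q = ∑ P, partialCoeff U (fun j => gateCoeff (U.gate j)) m Q P * itemVec l k P := by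
  intro m
  induction m with
  | zero => intro _ Q; simp [gatesUpTo, partialCoeff_zero]
  | succ m ih =>
    intro hm Q
    rw [gatesUpTo, dif_pos (by omega)]
    by_cases hj : (⟨m, by omega⟩ : Fin n) < U.partner ⟨m, by omega⟩
    · rw [itemVec_gateStep U hj]
      simp only [ih (by omega), Finset.mul_sum]
      rw [Finset.sum_comm]
      refine Finset.sum_congr rfl fun P _ => ?_
      rw [← partialCoeff_step U _ hj Q P, Finset.sum_mul]
      exact Finset.sum_congr rfl fun ab _ => by ring
    · have h1 : ∀ l : List (Item n), l.flatMap (gateStep U ⟨m, by omega⟩) = l := by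
        intro l
        have : gateStep U ⟨m, by omega⟩ = fun e => [e] := by
          ext1 e; rw [gateStep, if_neg (by tauto)]
        rw [this]; simp
      rw [h1, ih (by omega)]
      exact Finset.sum_congr rfl fun P _ => by rw [← partialCoeff_skip U _ hj]

theorem itemVec_layerStep (q : ℝ) {W k : ℕ} (hk : k ≤ W) (U : Layer n) (l : List (Item n)) :
    itemVec (layerStep q W U l) k = layerVec U (gradedNoise q (itemVec l) k) := by
  ext Q
  rw [layerStep, itemVec_gatesUpTo U _ k n le_rfl, itemVec_noiseStep q hk]
  simp only [partialCoeff_last]; rfl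

theorem gradedNoise_congr (q : ℝ) {v v' : ℕ → PauliString n → ℝ} {W : ℕ}
    (h : ∀ k ≤ W, v k = v' k) {k : ℕ} (hk : k ≤ W) : gradedNoise q v k = gradedNoise q v' k := by
  ext P; simp only [gradedNoise]; rw [h (k - weight P) (by omega)]

theorem itemVec_foldr_layerStep (q : ℝ) {W : ℕ} (x : PauliString n → ℝ) (l : List (Item n))
    (h : ∀ k, itemVec l k = if k = 0 then x else 0) (L : List (Layer n)) :
    ∀ k ≤ W, itemVec (L.foldr (layerStep q W) l) k = gradedEvolve q x L k := by
  induction L with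
  | nil => intro k _; exact h k
  | cons U L ih =>
    intro k hk
    rw [List.foldr_cons, itemVec_layerStep q hk, gradedNoise_congr q ih hk]; rfl

theorem cum_noiseStep_le {q : ℝ} {W : ℕ} {l : List (Item n)} {e : Item n}
    (he : e ∈ l.flatMap (noiseStep q W)) : e.cum ≤ W := by
  obtain ⟨e', -, he'⟩ := List.mem_flatMap.1 he
  rw [noiseStep] at he'
  split_ifs at he' with h
  · rw [List.mem_singleton.1 he']; exact h
  · simp at he'

/-- The items that remain after all layers represent the sum over the Pauli paths of total weight
at most `W`. -/
theorem listCoeff_items (q : ℝ) {W : ℕ} (x : PauliString n → ℝ) (l : List (Item n))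
    (h : ∀ k, itemVec l k = if k = 0 then x else 0) (L : List (Layer n)) :
    listCoeff ((((L.foldr (layerStep q W) l).flatMap (noiseStep q W))).map fun e => (e.P, e.amp))
      = pathSum q W L x := by
  ext Q
  have h1 : ∀ l : List (Item n), (∀ e ∈ l, e.cum ≤ W) → listCoeff (l.map fun e => (e.P, e.amp)) Q
      = ∑ k ∈ Finset.range (W + 1), itemVec l k Q := by
    intro l hl
    induction l with
    | nil => simp [listCoeff, itemVec]
    | cons e l ih =>
      have h2 : e.cum < W + 1 := by have := hl e (by simp); omega
      simp only [itemVec_cons, Finset.sum_add_distrib, ← ih fun e he => hl e (by simp [he])]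
      simp only [listCoeff, List.map_cons, List.sum_cons]
      congr 1
      simp only [ite_and]
      split_ifs with hP
      · rw [Finset.sum_ite_eq, if_pos (Finset.mem_range.2 h2)]
      · simp
  rw [h1 _ fun e he => cum_noiseStep_le he, pathSum, Finset.sum_apply]
  refine Finset.sum_congr rfl fun k hk => ?_
  have hk : k ≤ W := by have := Finset.mem_range.1 hk; omega
  rw [itemVec_noiseStep q hk, gradedNoise_congr q (itemVec_foldr_layerStep q x l h L) hk]

/-! ### The number of items -/

/-- The number of nonidentity labels of `P` in the cells that begin at qubit `m` or later. -/
def activeFrom (U : Layer n) (m : ℕ) (P : PauliString n) : ℕ :=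
  (Finset.univ.filter fun i : Fin n => m ≤ i ∧ m ≤ U.partner i ∧ P i ≠ 0).card

/-- A bound on the number of items to which an item can give rise. -/
def potential (U : Layer n) (W m : ℕ) (e : Item n) : ℕ :=
  16 ^ activeFrom U m e.P * 16 ^ (W - e.cum)

theorem activeFrom_anti (U : Layer n) (m : ℕ) (P : PauliString n) :
    activeFrom U (m + 1) P ≤ activeFrom U m P := by
  refine Finset.card_le_card fun i hi => ?_
  simp only [Finset.mem_filter, Finset.mem_univ, true_and] at hi ⊢
  exact ⟨by omega, by omega, hi.2.2⟩

/-- An item branches into sixteen only if it has a nonidentity label in the cell. Afterwards the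
labels of this cell no longer count in `activeFrom`, and the factor 16 lost there pays for the
branching. -/
theorem sum_potential_gateStep_le (U : Layer n) (W : ℕ) (j : Fin n) (e : Item n) :
    ((gateStep U j e).map (potential U W (j + 1))).sum ≤ potential U W j e := by
  rw [gateStep]
  split_ifs with h
  · have h1 : ∀ ab, activeFrom U (j + 1) (setPair e.P j (U.partner j) ab) = activeFrom U (j + 1) e.P := by
      intro ab
      rw [activeFrom, activeFrom]
      congr 1
      ext i
      simp only [Finset.mem_filter, Finset.mem_univ, true_and]
      refine and_congr_right fun h1 => and_congr_right fun h2 => ?_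
      have h3 : i ≠ j := by rintro rfl; omega
      have h4 : i ≠ U.partner j := by rintro rfl; rw [U.involutive] at h2; omega
      simp [setPair, h3, h4]
    have h2 : activeFrom U (j + 1) e.P + 1 ≤ activeFrom U j e.P := by
      refine Finset.card_lt_card (Finset.ssubset_iff_of_subset ?_ |>.2 ?_)
      · intro i hi
        simp only [Finset.mem_filter, Finset.mem_univ, true_and] at hi ⊢
        exact ⟨by omega, by omega, hi.2.2⟩
      · by_cases h3 : e.P j = 0
        · refine ⟨U.partner j, ?_, ?_⟩
          · simp only [Finset.mem_filter, Finset.mem_univ, true_and, U.involutive]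
            exact ⟨h.1.le, le_rfl, fun h4 => h.2 ⟨h3, h4⟩⟩
          · simp [U.involutive]
        · refine ⟨j, ?_, by simp⟩
          simp only [Finset.mem_filter, Finset.mem_univ, true_and]
          exact ⟨le_rfl, h.1.le, h3⟩
    rw [List.map_map]
    have h3 : (potential U W (j + 1) ∘ fun ab => (⟨setPair e.P j (U.partner j) ab,
        e.amp * gateCoeff (U.gate j) ab (e.P j, e.P (U.partner j)), e.cum⟩ : Item n))
        = fun _ => 16 ^ activeFrom U (j + 1) e.P * 16 ^ (W - e.cum) := by
      ext ab; simp only [Function.comp, potential, h1]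
    rw [h3]
    simp only [List.map_const', List.sum_replicate, smul_eq_mul]
    rw [show labelPairs.length = 16 by rfl, ← mul_assoc, ← pow_succ', potential]
    exact Nat.mul_le_mul_right _ (Nat.pow_le_pow_right (by norm_num) h2)
  · simp only [List.map_cons, List.map_nil, List.sum_cons, List.sum_nil, add_zero]
    exact Nat.mul_le_mul_right _ (Nat.pow_le_pow_right (by norm_num) (activeFrom_anti U j e.P))

theorem sum_map_flatMap_le {α : Type*} (f : α → List α) (g h : α → ℕ)
    (hfg : ∀ a, ((f a).map g).sum ≤ h a) (l : List α) :
    ((l.flatMap f).map g).sum ≤ (l.map h).sum := by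
  induction l with
  | nil => simp
  | cons a l ih =>
    simp only [List.flatMap_cons, List.map_append, List.sum_append, List.map_cons, List.sum_cons]
    exact add_le_add (hfg a) ih

/-- A bound on the number of items to which a list of items can give rise. -/
def listPotential (W : ℕ) (l : List (Item n)) : ℕ := (l.map fun e => 16 ^ (W - e.cum)).sum

/-- Noise moves the weight of a string from the remaining budget to the labels that are about to
meet gates, keeping the exponent; every gate then spends at most that. -/
theorem sum_potential_gatesUpTo_le (U : Layer n) (q : ℝ) (W : ℕ) (l : List (Item n)) :
    ∀ m ≤ n, ((gatesUpTo U (l.flatMap (noiseStep q W)) m).map (potential U W m)).sum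
      ≤ listPotential W l := by
  intro m
  induction m with
  | zero =>
    intro _
    refine sum_map_flatMap_le _ _ _ (fun e => ?_) l
    rw [noiseStep]
    split_ifs with h
    · simp only [List.map_cons, List.map_nil, List.sum_cons, List.sum_nil, add_zero, potential]
      have : activeFrom U 0 e.P = weight e.P := by simp [activeFrom, weight]
      rw [this, ← pow_add]
      exact Nat.pow_le_pow_right (by norm_num) (by omega)
    · simp
  | succ m ih =>
    intro hm
    rw [gatesUpTo, dif_pos (by omega)]
    exact (sum_map_flatMap_le _ _ _ (sum_potential_gateStep_le U W ⟨m, by omega⟩) _).trans (ih (by omega))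

theorem length_le_sum {α : Type*} (l : List α) (g : α → ℕ) (h : ∀ a, 1 ≤ g a) :
    l.length ≤ (l.map g).sum := by
  induction l with
  | nil => simp
  | cons a l ih => have := h a; simp; omega

theorem length_le_listPotential (W : ℕ) (l : List (Item n)) : l.length ≤ listPotential W l :=
  length_le_sum l _ fun _ => Nat.one_le_pow _ _ (by norm_num)

theorem length_gatesUpTo_le (U : Layer n) (q : ℝ) (W : ℕ) (l : List (Item n)) {m : ℕ} (hm : m ≤ n) :
    (gatesUpTo U (l.flatMap (noiseStep q W)) m).length ≤ listPotential W l :=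
  (length_le_sum _ _ fun _ => Nat.mul_pos (by positivity) (by positivity)).trans
    (sum_potential_gatesUpTo_le U q W l m hm)

/-- The potential never grows, so lists that begin with m items of accumulated weight 0 stay below m
· 16^W, whatever the depth. -/
theorem listPotential_layerStep_le (U : Layer n) (q : ℝ) (W : ℕ) (l : List (Item n)) :
    listPotential W (layerStep q W U l) ≤ listPotential W l := by
  refine le_trans (le_of_eq ?_) (sum_potential_gatesUpTo_le U q W l n le_rfl)
  rw [listPotential, layerStep]
  congr 1
  refine List.map_congr_left fun e _ => ?_
  have : activeFrom U n e.P = 0 := by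
    rw [activeFrom, Finset.card_eq_zero, Finset.filter_eq_empty_iff]
    rintro i - ⟨h, -⟩
    omega
  rw [potential, this, pow_zero, one_mul]

theorem listPotential_zero {W : ℕ} {l : List (Item n)} (h : ∀ e ∈ l, e.cum = 0) :
    listPotential W l = l.length * 16 ^ W := by
  rw [listPotential]
  have : l.map (fun e => 16 ^ (W - e.cum)) = l.map fun _ => 16 ^ W :=
    List.map_congr_left fun e he => by rw [h e he, Nat.sub_zero]
  rw [this]; simp

theorem listPotential_foldr_le (q : ℝ) (W : ℕ) (L : List (Layer n)) (l : List (Item n)) :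
    listPotential W (L.foldr (layerStep q W) l) ≤ listPotential W l := by
  induction L with
  | nil => exact le_rfl
  | cons U L ih => exact (listPotential_layerStep_le U q W _).trans ih

theorem length_noise_le (q : ℝ) (W : ℕ) (l : List (Item n)) :
    (l.flatMap (noiseStep q W)).length ≤ l.length := by
  rw [List.length_flatMap]
  refine (List.sum_le_card_nsmul _ 1 ?_).trans (by simp)
  intro x hx
  obtain ⟨e, -, rfl⟩ := List.mem_map.1 hx
  rw [noiseStep]; split_ifs <;> simp

end vec

/-! ### Pauli paths -/

section paths
variable {n : ℕ}

/-- There is a Pauli path of weight `w` from `P` through the layers `L` to `Q`; the weight of `Q`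
does not count. -/
def Path : List (Layer n) → PauliString n → PauliString n → ℕ → Prop
  | [], P, Q, w => P = Q ∧ w = 0
  | U :: L, P, Q, w => ∃ R w', Path L P R w' ∧ layerCoeff U Q R ≠ 0 ∧ w = w' + weight R

theorem gradedEvolve_congr (q : ℝ) {x y : PauliString n → ℝ} (L : List (Layer n)) :
    ∀ {k : ℕ} {Q : PauliString n}, (∀ P, Path L P Q k → x P = y P) →
      gradedEvolve q x L k Q = gradedEvolve q y L k Q := by
  induction L with
  | nil =>
    intro k Q h
    simp only [gradedEvolve]
    split_ifs with hk
    · exact h Q ⟨rfl, hk⟩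
    · rfl
  | cons U L ih =>
    intro k Q h
    simp only [gradedEvolve, layerVec]
    refine Finset.sum_congr rfl fun R _ => ?_
    by_cases hR : layerCoeff U Q R = 0
    · simp [hR]
    · congr 1
      simp only [gradedNoise]
      split_ifs with hw
      · rw [ih fun P hP => h P ⟨R, k - weight R, hP, hR, by omega⟩]
      · rfl

/-- Only input strings at which some path of total weight at most W begins influence the truncated
sum; these are the ones worth querying. -/
theorem pathSum_congr (q : ℝ) {W : ℕ} {x y : PauliString n → ℝ} (L : List (Layer n))
    (h : ∀ P Q w, Path L P Q w → w + weight Q ≤ W → x P = y P) :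
    pathSum q W L x = pathSum q W L y := by
  ext Q
  rw [pathSum, pathSum, Finset.sum_apply, Finset.sum_apply]
  refine Finset.sum_congr rfl fun k hk => ?_
  have hk := Finset.mem_range.1 hk
  simp only [gradedNoise]
  split_ifs with hw
  · rw [gradedEvolve_congr q L fun P hP => h P Q _ hP (by omega)]
  · rfl

/-- The list contains `P` with accumulated weight at most `c`. -/
def Reach (l : List (Item n)) (P : PauliString n) (c : ℕ) : Prop :=
  ∃ e ∈ l, e.P = P ∧ e.cum ≤ c

theorem Reach.append_left {l l' : List (Item n)} {P : PauliString n} {c : ℕ} (h : Reach l P c) :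
    Reach (l ++ l') P c := by
  obtain ⟨e, he, h⟩ := h
  exact ⟨e, List.mem_append_left _ he, h⟩

/-- The labels of `P` on the cells that begin before qubit `m`, and those of `Q` elsewhere. -/
def mix (U : Layer n) (m : ℕ) (P Q : PauliString n) : PauliString n :=
  fun i => if (i : ℕ) < m ∨ (U.partner i : ℕ) < m then P i else Q i

/-- The branching of the forward evolution also serves to go backwards. On a gate where Q is not the
identity all sixteen labels are produced, among them those of P; where Q is the identity, so is P.
Only strings matter here, so the amplitudes need not be those of the inverse gates. -/
theorem reach_gatesUpTo {U : Layer n} {l : List (Item n)} {P Q : PauliString n} {c : ℕ}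
    (hl : Reach l Q c) (hU : layerCoeff U Q P ≠ 0) :
    ∀ m ≤ n, Reach (gatesUpTo U l m) (mix U m P Q) c := by
  have hfac : ∀ j : Fin n, _ ≠ (0 : ℝ) := fun j => Finset.prod_ne_zero_iff.1 hU j (Finset.mem_univ j)
  intro m
  induction m with
  | zero =>
    intro _
    have : mix U 0 P Q = Q := by ext1 i; simp [mix]
    rw [this]; exact hl
  | succ m ih =>
    intro hm
    obtain ⟨e, he, heP, hec⟩ := ih (by omega)
    rw [gatesUpTo, dif_pos (by omega)]
    obtain ⟨j, hj⟩ : ∃ j : Fin n, (j : ℕ) = m := ⟨⟨m, by omega⟩, rfl⟩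
    have hj' : (⟨m, by omega⟩ : Fin n) = j := Fin.ext hj.symm
    rw [hj']
    have hother : ∀ i, i ≠ j → i ≠ U.partner j → mix U (m + 1) P Q i = mix U m P Q i := by
      intro i h1 h2
      have h3 : (i : ℕ) ≠ m := by rw [← hj]; exact Fin.val_ne_of_ne h1
      have h4 : (U.partner i : ℕ) ≠ m := by
        rw [← hj]; refine Fin.val_ne_of_ne fun h => h2 ?_
        rw [← h, U.involutive]
      simp only [mix]
      congr 1
      simp only [eq_iff_iff]; omega
    by_cases hlt : j < U.partner j
    · have hlt' : (j : ℕ) < U.partner j := hlt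
      have hmj : mix U m P Q j = Q j := by
        simp only [mix]; rw [if_neg (by omega)]
      have hmk : mix U m P Q (U.partner j) = Q (U.partner j) := by
        simp only [mix, U.involutive]; rw [if_neg (by omega)]
      have hmj' : mix U (m + 1) P Q j = P j := by
        simp only [mix]; rw [if_pos (by omega)]
      have hmk' : mix U (m + 1) P Q (U.partner j) = P (U.partner j) := by
        simp only [mix, U.involutive]; rw [if_pos (by omega)]
      have hf := hfac j
      rw [if_neg hlt.ne', if_pos hlt] at hf
      by_cases hz : Q j = 0 ∧ Q (U.partner j) = 0
      · refine ⟨e, List.mem_flatMap.2 ⟨e, he, ?_⟩, ?_, hec⟩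
        · rw [gateStep, heP, hmj, hmk, if_neg (by tauto)]; simp
        · have hP0 : (P j, P (U.partner j)) = (0, 0) := by
            by_contra hne
            rw [hz.1, hz.2, gateCoeff_zero_left (U.unitary j hlt)] at hf
            exact hf (if_neg hne)
          rw [heP]
          ext1 i
          by_cases h1 : i = j
          · subst h1; rw [hmj, hmj', hz.1]; exact (congrArg Prod.fst hP0).symm
          · by_cases h2 : i = U.partner j
            · subst h2; rw [hmk, hmk', hz.2]; exact (congrArg Prod.snd hP0).symm
            · rw [hother i h1 h2]
      · refine ⟨⟨setPair e.P j (U.partner j) (P j, P (U.partner j)), e.amp * gateCoeff (U.gate j)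
          (P j, P (U.partner j)) (e.P j, e.P (U.partner j)), e.cum⟩,
          List.mem_flatMap.2 ⟨e, he, ?_⟩, ?_, hec⟩
        · rw [gateStep, heP, hmj, hmk, if_pos ⟨hlt, hz⟩]
          exact List.mem_map.2 ⟨(P j, P (U.partner j)), mem_labelPairs _, rfl⟩
        · show setPair e.P _ _ _ = _
          rw [heP]
          ext1 i
          by_cases h2 : i = U.partner j
          · subst h2; rw [hmk']; simp [setPair]
          · by_cases h1 : i = j
            · subst h1; rw [hmj']; simp [setPair, hlt.ne]
            · rw [hother i h1 h2]; simp [setPair, h1, h2]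
    · refine ⟨e, List.mem_flatMap.2 ⟨e, he, ?_⟩, ?_, hec⟩
      · rw [gateStep, if_neg (by tauto)]; simp
      · rw [heP]
        ext1 i
        -- No gate begins at j: either j is idle, where P and Q agree, or it is the second qubit of
        -- a gate that has been treated already.
        have hle : (U.partner j : ℕ) ≤ j := not_lt.1 hlt
        by_cases heq : U.partner j = j
        · by_cases h1 : i = j
          · subst h1
            have hf := hfac i
            rw [if_pos heq] at hf
            have hQP : Q i = P i := by by_contra h; exact hf (if_neg h)
            simp [mix, hQP]
          · rw [hother i h1 (by rwa [heq])]
        · have hne : (U.partner j : ℕ) ≠ j := Fin.val_ne_of_ne heq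
          simp only [mix]
          by_cases h1 : i = j
          · subst h1; rw [if_pos (by omega), if_pos (by omega)]
          · by_cases h2 : i = U.partner j
            · subst h2; rw [if_pos (by omega), if_pos (by omega)]
            · exact (hother i h1 h2).symm

theorem reach_layerStep {U : Layer n} {q : ℝ} {W : ℕ} {l : List (Item n)} {P Q : PauliString n}
    {c : ℕ} (hl : Reach l Q c) (hU : layerCoeff U Q P ≠ 0) (hW : c + weight Q ≤ W) :
    Reach (layerStep q W U l) P (c + weight Q) := by
  have h1 : Reach (l.flatMap (noiseStep q W)) Q (c + weight Q) := by
    obtain ⟨e, he, rfl, hec⟩ := hl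
    refine ⟨⟨e.P, e.amp * q ^ weight e.P, e.cum + weight e.P⟩, List.mem_flatMap.2 ⟨e, he, ?_⟩, rfl,
      Nat.add_le_add_right hec _⟩
    rw [noiseStep, if_pos (by omega)]
    exact List.mem_singleton.2 rfl
  have h2 := reach_gatesUpTo h1 hU n le_rfl
  have h3 : mix U n P Q = P := by ext1 i; simp [mix]
  rwa [h3] at h2

/-- Follow Pauli paths from their ends to their beginnings, with new ends `S` at every layer. -/
noncomputable def traceBack (q : ℝ) (W : ℕ) (S : List (Item n)) :
    List (Item n) → List (Layer n) → List (Item n) :=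
  List.foldl fun l U => layerStep q W U l ++ S

theorem reach_traceBack {q : ℝ} {W : ℕ} {S : List (Item n)} (L : List (Layer n)) :
    ∀ {l : List (Item n)} {P Q : PauliString n} {w c : ℕ}, Path L P Q w → Reach l Q c →
      c + w + weight Q ≤ W → ∃ e ∈ traceBack q W S l L, e.P = P ∧ e.cum + weight P ≤ W := by
  induction L with
  | nil =>
    rintro l P Q w c ⟨rfl, rfl⟩ ⟨e, he, h1, h2⟩ hW
    exact ⟨e, he, h1, by omega⟩
  | cons U L ih =>
    rintro l P Q w c ⟨R, w', hp, hU, rfl⟩ hl hW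
    exact ih hp (reach_layerStep hl hU (by omega)).append_left (by omega)

/-- Pigeonhole: a path of total weight below (d+1)(K+1) has weight at most K at one of its d + 1
strings. From there it is traced back within the budget W, because new ends are added at every
layer. -/
theorem exists_mem_traceBack {q : ℝ} {W K : ℕ} {S : List (Item n)}
    (hS : ∀ P, weight P ≤ K → Reach S P 0) (L : List (Layer n)) :
    ∀ {l : List (Item n)} {P Q : PauliString n} {w : ℕ}, (∀ P, weight P ≤ K → Reach l P 0) →
      Path L P Q w → w + weight Q ≤ W → w + weight Q < (L.length + 1) * (K + 1) →
      ∃ e ∈ traceBack q W S l L, e.P = P ∧ e.cum + weight P ≤ W := by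
  induction L with
  | nil =>
    intro l P Q w hl hp hW hK
    exact reach_traceBack [] hp (hl Q (by simp at hK; omega)) (by omega)
  | cons U L ih =>
    intro l P Q w hl hp hW hK
    -- If the end of the path is too heavy, it uses up K + 1 of the weight, and the shorter path
    -- still satisfies the pigeonhole bound.
    by_cases hQ : weight Q ≤ K
    · exact reach_traceBack (U :: L) hp (hl Q hQ) (by omega)
    · obtain ⟨R, w', hp, hU, rfl⟩ := hp
      refine ih (l := layerStep q W U l ++ S) (fun P hP => ?_) hp (by omega) ?_
      · obtain ⟨e, he, h⟩ := hS P hP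
        exact ⟨e, List.mem_append_right _ he, h⟩
      · rw [List.length_cons, add_mul (L.length + 1)] at hK
        omega

theorem listPotential_append (W : ℕ) (l l' : List (Item n)) :
    listPotential W (l ++ l') = listPotential W l + listPotential W l' := by
  simp [listPotential]

theorem listPotential_traceBack_le (q : ℝ) (W : ℕ) (S : List (Item n)) (L : List (Layer n)) :
    ∀ l, listPotential W (traceBack q W S l L) ≤ listPotential W l + L.length * listPotential W S := by
  induction L with
  | nil => intro l; simp [traceBack]
  | cons U L ih =>
    intro l
    refine (ih _).trans ?_
    have := listPotential_layerStep_le U q W l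
    rw [listPotential_append, List.length_cons, add_mul]
    omega

/-! ### The ends of Pauli paths -/

/-- Extend the items by a label on qubit `j`, up to weight `K`. -/
noncomputable def seedStep (K : ℕ) (j : Fin n) (e : Item n) : List (Item n) :=
  if e.cum + 1 ≤ K then
    (List.finRange 4).map fun a => ⟨Function.update e.P j a, 1, if a = 0 then e.cum else e.cum + 1⟩
  else [e]

/-- Items for all Pauli strings of weight at most `K` on the first `m` qubits. -/
noncomputable def seedItems (K : ℕ) : ℕ → List (Item n)
  | 0 => [⟨0, 1, 0⟩]
  | m + 1 => if h : m < n then (seedItems K m).flatMap (seedStep K ⟨m, h⟩) else seedItems K m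

/-- A Pauli string on the first `m` qubits. -/
def headPart (P : PauliString n) (m : ℕ) : PauliString n := fun i => if (i : ℕ) < m then P i else 0

/-- Here the accumulated weight counts the nonidentity labels so far. Once it is K, a string of
weight at most K has no further nonidentity labels, so keeping the item unchanged misses nothing. -/
theorem mem_seedItems {K : ℕ} {P : PauliString n} (hP : weight P ≤ K) :
    ∀ m ≤ n, ∃ e ∈ seedItems (n := n) K m, e.P = headPart P m ∧ e.cum = weight (headPart P m) := by
  intro m
  induction m with
  | zero =>
    intro _
    refine ⟨⟨0, 1, 0⟩, by simp [seedItems], ?_, ?_⟩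
    · ext1 i; simp [headPart]
    · simp [headPart, weight]
  | succ m ih =>
    intro hm
    obtain ⟨e, he, h1, h2⟩ := ih (by omega)
    rw [seedItems, dif_pos (by omega)]
    set j : Fin n := ⟨m, by omega⟩ with hj
    have hup : headPart P (m + 1) = Function.update (headPart P m) j (P j) := by
      ext1 i
      by_cases hi : i = j
      · subst hi; simp [headPart, hj]
      · have : (i : ℕ) ≠ m := fun h => hi (Fin.ext h)
        rw [Function.update_of_ne hi]
        simp only [headPart]
        congr 1
        simp only [eq_iff_iff]; omega
    have h0 : headPart P m j = 0 := by simp [headPart, hj]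
    by_cases hz : P j = 0
    · have hsame : headPart P (m + 1) = headPart P m := by rw [hup, hz, ← h0, Function.update_eq_self]
      rw [hsame]
      by_cases hK : e.cum + 1 ≤ K
      · refine ⟨⟨Function.update e.P j 0, 1, e.cum⟩, List.mem_flatMap.2 ⟨e, he, ?_⟩, ?_, h2⟩
        · rw [seedStep, if_pos hK]
          exact List.mem_map.2 ⟨0, List.mem_finRange _, by simp⟩
        · show Function.update e.P j 0 = _
          rw [h1, ← h0, Function.update_eq_self]
      · exact ⟨e, List.mem_flatMap.2 ⟨e, he, by rw [seedStep, if_neg hK]; simp⟩, h1, h2⟩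
    · have hw : weight (headPart P (m + 1)) = weight (headPart P m) + 1 := by
        rw [weight, weight, ← Finset.card_insert_of_notMem (a := j) (by simp [h0])]
        congr 1
        ext i
        simp only [Finset.mem_filter, Finset.mem_univ, true_and, Finset.mem_insert]
        rw [hup]
        by_cases hi : i = j
        · subst hi; simp [hz]
        · simp [hi]
      have hle : weight (headPart P (m + 1)) ≤ weight P := by
        refine Finset.card_le_card fun i hi => ?_
        simp only [Finset.mem_filter, Finset.mem_univ, true_and, headPart] at hi ⊢
        intro h; simp [h] at hi
      refine ⟨⟨Function.update e.P j (P j), 1, e.cum + 1⟩, List.mem_flatMap.2 ⟨e, he, ?_⟩, ?_, ?_⟩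
      · rw [seedStep, if_pos (by omega)]
        exact List.mem_map.2 ⟨P j, List.mem_finRange _, by simp [hz]⟩
      · show Function.update e.P j (P j) = _
        rw [h1, hup]
      · show e.cum + 1 = _
        rw [hw, h2]

/-- Weighting an item by b^(K - cum) makes a qubit cost a factor of at most 1 + 3/b, one for the
identity and 3/b for the other labels. The parameter is used twice: b = n gives O(n^K), and b = n/2
gains a factor 2^(-K). -/
theorem sum_pow_seedItems_le {K : ℕ} {b : ℝ} (hb : 1 ≤ b) : ∀ m ≤ n,
    (((seedItems K m : List (Item n)).map fun e => b ^ (K - e.cum)).sum) ≤ (1 + 3 / b) ^ m * b ^ K := by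
  have key : ∀ (j : Fin n) (l : List (Item n)),
      ((l.flatMap (seedStep K j)).map fun e => b ^ (K - e.cum)).sum
        ≤ (1 + 3 / b) * (l.map fun e => b ^ (K - e.cum)).sum := by
    intro j l
    induction l with
    | nil => simp
    | cons e l ih =>
      rw [List.flatMap_cons, List.map_append, List.sum_append, List.map_cons, List.sum_cons, mul_add]
      refine add_le_add ?_ ih
      rw [seedStep]
      split_ifs with h
      · obtain ⟨r, hr⟩ : ∃ r, K - e.cum = r + 1 := ⟨K - e.cum - 1, by omega⟩
        have hr' : K - (e.cum + 1) = r := by omega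
        have : List.finRange 4 = [0, 1, 2, 3] := by decide
        rw [this]
        simp [hr, hr', pow_succ]
        apply le_of_eq
        field_simp; ring
      · simp only [List.map_cons, List.map_nil, List.sum_cons, List.sum_nil, add_zero]
        refine le_mul_of_one_le_left (by positivity) ?_
        have : (0 : ℝ) ≤ 3 / b := by positivity
        linarith
  intro m
  induction m with
  | zero => intro _; simp [seedItems]
  | succ m ih =>
    intro hm
    rw [seedItems, dif_pos (by omega), pow_succ', mul_assoc]
    exact (key _ _).trans (mul_le_mul_of_nonneg_left (ih (by omega)) (by positivity))

theorem length_seedItems_mono (K m : ℕ) :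
    (seedItems K m : List (Item n)).length ≤ (seedItems K (m + 1) : List (Item n)).length := by
  rw [seedItems]
  split_ifs with h
  · rw [List.length_flatMap]
    refine le_trans (le_of_eq ?_) (List.card_nsmul_le_sum _ 1 ?_)
    · simp
    · intro x hx
      obtain ⟨e, -, rfl⟩ := List.mem_map.1 hx
      rw [seedStep]; split_ifs <;> simp
  · exact le_rfl

theorem length_le_sum_pow {α : Type*} (l : List α) (f : α → ℕ) {b : ℝ} (hb : 1 ≤ b) :
    (l.length : ℝ) ≤ (l.map fun e => b ^ f e).sum := by
  induction l with
  | nil => simp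
  | cons e l ih =>
    have := one_le_pow₀ hb (n := f e)
    simp; linarith

theorem length_seedItems_le {K : ℕ} {b : ℝ} (hb : 1 ≤ b) :
    ((seedItems K n : List (Item n)).length : ℝ) ≤ Real.exp (3 * n / b) * b ^ K := by
  refine (length_le_sum_pow _ (fun e => K - e.cum) hb).trans ((sum_pow_seedItems_le hb n le_rfl).trans ?_)
  refine mul_le_mul_of_nonneg_right ?_ (by positivity)
  calc (1 + 3 / b) ^ n ≤ Real.exp (3 / b) ^ n := by
        refine pow_le_pow_left₀ (by positivity) ?_ n
        have := Real.add_one_le_exp (3 / b); linarith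
    _ = Real.exp (3 * n / b) := by rw [← Real.exp_nat_mul]; congr 1; ring

end paths

/-! ### The parts of the programs for uniform noise -/

/-- The number of qubits, the depth, the damping factor and the tolerance in the input. -/
def nExp : NExp := .cell 0 (.const 0)
def depthExp : NExp := .cell 0 (.const 1)
def dampExp : RExp := .cell 0 (.const 0)
def tolExp : RExp := .cell 0 (.const 1)

section uniform
variable {n : ℕ} {orc : PauliString n → ℝ}

/-- The memory holds the circuit `L`, the damping factor `q` and the tolerance `ε`. -/
structure Input (s : Store n) (L : List (Layer n)) (q ε : ℝ) : Prop where
  size : s.nat 0 0 = n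
  depth : s.nat 0 1 = L.length
  damp : s.real 0 0 = q
  tol : s.real 0 1 = ε
  layer : ∀ t (h : t < L.length), LayerAt s L[t] (t * n)

theorem Input.keep {s s' : Store n} {L : List (Layer n)} {q ε : ℝ} {b : ℕ} (h : Input s L q ε)
    (hk : Keep b s s') (hb : 40 ≤ b) : Input s' L q ε where
  size := by rw [hk.nat 0 (by omega)]; exact h.size
  depth := by rw [hk.nat 0 (by omega)]; exact h.depth
  damp := by rw [hk.real 0 (by omega)]; exact h.damp
  tol := by rw [hk.real 0 (by omega)]; exact h.tol
  layer := fun t ht => (h.layer t ht).keep hk hb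

/-- Multiply 1 by the damping factor, at most once for every layer of noise, until the product is
below the tolerance. -/
def dampCmd : Cmd :=
  letN 50 (.const 0) ;; letR 50 (.const 1) ;;
  .loop (.realLe tolExp (.mul (RV 50) (.ofNat (.sub (.const 1) (.sub (V 50) depthExp)))))
    (letN 50 (.add (V 50) (.const 1)) ;; letR 50 (.mul (RV 50) dampExp))

/-- The factor `1 - (k - d)` in the test is 1 while k ≤ d and 0 for k = d + 1, where the positive
tolerance stops the loop. For deep circuits the loop ends as soon as the product falls below the
tolerance, so its time does not depend on the depth. -/
theorem run_dampCmd {s : Store n} {L : List (Layer n)} {q ε : ℝ} (h : Input s L q ε) (hε : 0 < ε) :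
    ∃ k ≤ L.length + 1, (k = L.length + 1 ∨ q ^ k < ε) ∧ (∀ m < k, ε ≤ q ^ m) ∧
      Run orc dampCmd s (3 * k + 3) fun s' => s'.real 50 0 = q ^ k ∧ Keep 50 s s' := by
  classical
  have hex : ∃ k, k = L.length + 1 ∨ q ^ k < ε := ⟨_, Or.inl rfl⟩
  refine ⟨Nat.find hex, Nat.find_min' hex (Or.inl rfl), Nat.find_spec hex, fun m hm => ?_, ?_⟩
  · have := Nat.find_min hex hm
    push Not at this
    exact this.2
  refine Run.keep ?_ (by decide) (by decide)
  have hlt : ∀ m < Nat.find hex, m ≤ L.length := fun m hm => by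
    have := Nat.find_min' hex (Or.inl rfl); omega
  refine (Run.simple_seq rfl (Run.simple_seq rfl ((Run.loop (fun m s' => s'.nat 50 0 = m ∧
    s'.real 50 0 = q ^ m ∧ s'.nat 0 1 = L.length ∧ s'.real 0 0 = q ∧ s'.real 0 1 = ε)
    (fun _ => 2) (Nat.find hex) ?_ ?_ ?_).mono le_rfl fun s' hs' => hs'.2.1))).mono ?_ fun _ h => h
  · rintro m hm s' ⟨h1, h2, h3, h4, h5⟩
    have hm' := Nat.find_min hex hm
    push Not at hm'
    constructor
    · have : 1 - (m - L.length) = 1 := by have := hlt m hm; omega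
      simp only [Test.holds, tolExp, depthExp, RExp.eval, NExp.eval, V, RV, h1, h2, h3, h5, this]
      simpa using hm'.2
    · refine (run_simple rfl s').mono le_rfl ?_
      rintro s1 rfl
      simp [sem, letN, letR, NExp.eval, RExp.eval, V, RV, dampExp, h1, h2, h3, h4, h5, pow_succ]
  · rintro s' ⟨h1, h2, h3, h4, h5⟩
    simp only [Test.holds, tolExp, depthExp, RExp.eval, NExp.eval, V, RV, h1, h2, h3, h5]
    rcases Nat.find_spec hex with hk | hk
    · have : 1 - (Nat.find hex - L.length) = 0 := by omega
      rw [this]; simpa using hε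
    · push Not
      by_cases hL : Nat.find hex ≤ L.length
      · have : 1 - (Nat.find hex - L.length) = 1 := by omega
        rw [this]; simpa using hk
      · have : 1 - (Nat.find hex - L.length) = 0 := by omega
        rw [this]; simpa using hε
  · simp [sem, letN, letR, NExp.eval, RExp.eval, h.depth, h.damp, h.tol]
  · simp [Cmd.size, letN, letR]; omega

/-- Output only the identity component of the input. -/
def identityCmd : Cmd := .query 3 51 (.const 0) ;; .emit 3 (RV 51)

/-- An array of zeros reads as the identity string, whose query and output cost one step each. -/
theorem run_identityCmd {s : Store n} (h3 : s.nat 3 = 0) :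
    Run orc identityCmd s 2 fun s' => s'.out = s.out ++ [(0, orc 0)] := by
  have hz : readPauli n (s.nat 3) = 0 := by ext j; simp [readPauli, h3]
  have hw : weight (0 : PauliString n) = 0 := by simp [weight]
  refine ⟨_, _, .seq (.query s 3 51 (.const 0)) (.emit _ 3 (RV 51)), ?_, ?_⟩
  · simp [hz, hw]
  · simp [hz, RV, RExp.eval, NExp.eval, setCell]

/-- Choose the bound on the total weight of Pauli paths. -/
def weightCmd : Cmd :=
  letR 51 (.div (.const 2) (.sub (.const 1) dampExp)) ;;
  letR 52 (.div (.mul (.const 2) dampExp) (.add (.const 1) dampExp)) ;;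
  letR 53 (.const 1) ;; letN 51 (.const 0) ;;
  forTo 51 (.add depthExp (.const 1)) (letR 53 (.mul (RV 53) (RV 51))) ;;
  letN 42 (.const 0) ;;
  .loop (.realLe tolExp (RV 53))
    (letR 53 (.mul (RV 53) (RV 52)) ;; letN 42 (.add (V 42) (.const 1)))

/-- The cutoff is found by multiplying up the error bound, without logarithms. It is the least one
that works, and its minimality is what bounds it in the time estimates. -/
theorem run_weightCmd {s : Store n} {L : List (Layer n)} {q ε : ℝ} (h : Input s L q ε) (hε : 0 < ε)
    (h0 : 0 < q) (h1 : q < 1) :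
    ∃ W, (2 * q / (1 + q)) ^ W * (2 / (1 - q)) ^ (L.length + 1) < ε ∧
      (∀ m < W, ε ≤ (2 * q / (1 + q)) ^ m * (2 / (1 - q)) ^ (L.length + 1)) ∧
      Run orc weightCmd s (3 * L.length + 3 * W + 10) fun s' => s'.nat 42 0 = W ∧ Keep 42 s s' := by
  classical
  set κ := 2 / (1 - q) with hκ
  set β := 2 * q / (1 + q) with hβ
  have hκ0 : 0 < κ := div_pos (by norm_num) (by linarith)
  have hβ0 : 0 < β := by positivity
  have hβ1 : β < 1 := by rw [hβ, div_lt_one (by linarith)]; linarith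
  have hex : ∃ W, β ^ W * κ ^ (L.length + 1) < ε := by
    obtain ⟨W, hW⟩ := exists_pow_lt_of_lt_one (div_pos hε (pow_pos hκ0 (L.length + 1))) hβ1
    exact ⟨W, (lt_div_iff₀ (pow_pos hκ0 _)).1 hW⟩
  refine ⟨Nat.find hex, Nat.find_spec hex, fun m hm => not_lt.1 (Nat.find_min hex hm), ?_⟩
  refine Run.keep ?_ (by decide) (by decide)
  refine (Run.simple_seq rfl (Run.simple_seq rfl (Run.simple_seq rfl (Run.simple_seq rfl
    ((run_forTo (fun m s' => s'.real 53 0 = κ ^ m ∧ s'.real 51 0 = κ ∧ s'.real 52 0 = β ∧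
      s'.nat 0 1 = L.length ∧ s'.real 0 1 = ε) (fun _ => 1) (k := L.length + 1) (k0 := 0)
      (Nat.zero_le _) (by decide) ?_ ?_ ?_ ?_).seq fun s1 hs1 => Run.simple_seq rfl
      ((Run.loop (fun m s' => s'.nat 42 0 = m ∧ s'.real 53 0 = β ^ m * κ ^ (L.length + 1) ∧
        s'.real 52 0 = β ∧ s'.real 0 1 = ε) (fun _ => 2) (Nat.find hex) ?_ ?_ ?_).mono le_rfl
        fun s' hs' => hs'.1)))))).mono ?_ fun _ h => h
  · rintro m s' hs' -
    simp [NExp.eval, depthExp, hs'.2.2.2.1]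
  · rintro m - - s' ⟨h1, h2, h3, h4, h5⟩ -
    refine (run_simple rfl s').mono le_rfl ?_
    rintro s1 rfl
    simp [sem, letR, RExp.eval, RV, NExp.eval, h1, h2, h3, h4, h5, pow_succ]
  · simp [sem, letN, letR, NExp.eval, RExp.eval, dampExp, h.depth, h.damp, h.tol, ← hκ, ← hβ]
  · simp [sem, letN, letR, NExp.eval]
  · rintro m hm s' ⟨h1, h2, h3, h4⟩
    constructor
    · simp only [Test.holds, tolExp, RExp.eval, NExp.eval, RV, h2, h4]
      exact not_lt.1 (Nat.find_min hex hm)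
    · refine (run_simple rfl s').mono le_rfl ?_
      rintro s2 rfl
      simp [sem, letN, letR, NExp.eval, RExp.eval, V, RV, h1, h2, h3, h4]
      ring
  · rintro s' ⟨h1, h2, h3, h4⟩
    simp only [Test.holds, tolExp, RExp.eval, NExp.eval, RV, h2, h4, not_le]
    exact Nat.find_spec hex
  · obtain ⟨⟨g1, g2, g3, g4, g5⟩, -⟩ := hs1
    simp [sem, letN, NExp.eval, g1, g3, g5]
  · simp [Cmd.size, letN, letR]; omega

/-- Output the current items. -/
def emitBody : Cmd := loadItem ;; .emit 100 (RV 112)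

theorem weight_le (P : PauliString n) : weight P ≤ n :=
  (Finset.card_le_univ _).trans (by simp)

theorem readPauli_label {s : Store n} {q : ℝ} {P : PauliString n} (h : Decoded s q P) :
    readPauli n (s.nat 100) = P := by
  ext j
  have := (P j).isLt
  simp only [readPauli, h.label, Fin.ofNat]
  omega

theorem run_emitItems {s : Store n} {l : List (Item n)} (hn : s.nat 0 0 = n) (hp : Powers s)
    (hl : Items s l) :
    Run orc (forItems emitBody) s (l.length * (25 * n + 11) + 4)
      fun s' => s'.out = s.out ++ l.map fun e => (e.P, e.amp) := by
  refine (run_forItems (by decide) hl (fun _ => []) (fun p s' => s'.nat 0 0 = n ∧ Powers s' ∧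
    s'.out = s.out ++ p.map fun e => (e.P, e.amp)) (25 * n + 9) ⟨hn, hp, by simp⟩ ?_ ?_).mono
    (by ring_nf; omega) fun s' hs' => hs'.2.2.2
  · rintro p s1 s2 ⟨h1, h2, h3⟩ h4 h5 h6
    refine ⟨by rw [h4 0 (by omega)]; exact h1, fun j hj => ?_, by rw [h6]; exact h3⟩
    rw [h4 40 (by omega)]; exact h2 j hj
  · rintro p e s1 - ⟨h1, h2, h3⟩ he
    refine (Run.seq (run_loadItem h1 h2 he) (T' := n + 1) ?_).mono (by omega) fun _ h => h
    rintro s2 ⟨hd, hk, hr⟩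
    refine ⟨_, _, .emit s2 100 (RV 112), ?_, .nil hr, ?_, fun j hj => ?_, ?_⟩
    · have := weight_le (readPauli n (s2.nat 100)); omega
    · show s2.nat 0 0 = n
      rw [hk.nat 0 (by decide)]; exact h1
    · show s2.nat 40 j = _
      rw [hk.nat 40 (by decide)]; exact h2 j hj
    · simp [readPauli_label hd.dec, RExp.eval, RV, NExp.eval, hd.amp, hk.out, h3]

theorem Items.congr {s s' : Store n} {l : List (Item n)} (h : Items s l)
    (hn : ∀ a, 90 ≤ a → s'.nat a = s.nat a) (hr : s'.real 200 = s.real 200) : Items s' l := by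
  refine ⟨?_, by rw [hn 202 (by decide), hn 92 (by decide)]; exact h.2⟩
  rw [hn 92 (by decide)]
  intro k hk
  exact (h.1 k hk).congr (by rw [hn 200 (by decide), hn 201 (by decide), hr]; simp)

/-- Set register 44 to the first entry after the data of all layers. -/
def baseCmd : Cmd :=
  letN 44 (.const 0) ;; letN 54 (.const 0) ;; forTo 54 depthExp (letN 44 (.add (V 44) nExp))

theorem run_baseCmd {s : Store n} {L : List (Layer n)} {q ε : ℝ} (h : Input s L q ε) :
    Run orc baseCmd s (3 * L.length + 3) fun s' => s'.nat 44 0 = L.length * n ∧ Keep 44 s s' ∧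
      ∀ a, 90 ≤ a → s'.nat a = s.nat a ∧ s'.real a = s.real a := by
  refine Run.mono (post := fun s' => s'.nat 44 0 = L.length * n ∧ Frame baseCmd s s') (Run.frame ?_)
    le_rfl fun s' hs' => ⟨hs'.1, hs'.2.keep (by decide) rfl, fun a ha => hs'.2.1 a (Or.inr
      (lt_of_lt_of_le (by decide) ha))⟩
  refine (Run.simple_seq rfl (Run.simple_seq rfl ((run_forTo (fun m s' => s'.nat 44 0 = m * n ∧
    s'.nat 0 0 = n ∧ s'.nat 0 1 = L.length) (fun _ => 1) (k := L.length) (k0 := 0) (Nat.zero_le _)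
    (by decide) ?_ ?_ ?_ ?_).mono le_rfl fun s' hs' => hs'.1.1))).mono ?_ fun _ h => h
  · rintro m s' hs' -; exact hs'.2.2
  · rintro m - - s' ⟨h1, h2, h3⟩ -
    refine (run_simple rfl s').mono le_rfl ?_
    rintro s1 rfl
    simp [sem, letN, NExp.eval, V, nExp, h1, h2, h3]
    ring
  · simp [sem, letN, NExp.eval, h.size, h.depth]
  · simp [sem, letN, NExp.eval]
  · simp [Cmd.size, letN]; omega

/-- Apply all layers to the current items, from the last one on. -/
def layersCmd : Cmd :=
  letN 43 (.const 0) ;; forTo 43 depthExp (letN 44 (.sub (V 44) nExp) ;; layerCmd)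

theorem run_layersCmd {s : Store n} {L : List (Layer n)} {q ε : ℝ} {l : List (Item n)} {W B : ℕ}
    (h : Input s L q ε) (hp : Powers s) (hW : s.nat 42 0 = W) (h44 : s.nat 44 0 = L.length * n)
    (hl : Items s l) (hB : listPotential W l ≤ B) :
    Run orc layersCmd s (L.length * ((n + 1) * (B * (24 * n + 82) + 8) + 3) + 2) fun s' =>
      Items s' (L.foldr (layerStep q W) l) ∧ Keep 43 s s' := by
  set d := L.length with hd
  refine (Run.simple_seq rfl ((run_forTo (fun m s' => s'.nat 44 0 = (d - m) * n ∧
    Items s' ((L.drop (d - m)).foldr (layerStep q W) l) ∧ Keep 43 s s')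
    (fun _ => (n + 1) * (B * (24 * n + 82) + 8) + 1) (k := d) (k0 := 0) (Nat.zero_le _)
    (Or.inl (by decide)) ?_ ?_ ?_ ?_).mono le_rfl fun s' hs' => ?_)).mono ?_ fun _ h => h
  · rintro m s' ⟨-, -, hk⟩ -
    simp only [depthExp, NExp.eval, hk.nat 0 (by decide)]; exact h.depth
  · rintro m - hm s' ⟨h1, h2, h3⟩ h43
    have hdm : d - m = d - (m + 1) + 1 := by omega
    have hlt : d - (m + 1) < L.length := by omega
    refine (Run.simple_seq rfl (T := (n + 1) * (B * (24 * n + 82) + 8)) ?_).mono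
      (by simp [Cmd.size, letN]; omega) fun _ h => h
    have hs1 : sem (letN 44 (.sub (V 44) nExp)) s' = s'.setN 44 0 ((d - (m + 1)) * n) := by
      have : (d - m) * n - n = (d - (m + 1)) * n := by rw [hdm, add_mul, one_mul]; omega
      simp [sem, letN, NExp.eval, V, nExp, h1, h3.nat 0 (by decide), h.size, this]
    rw [hs1]
    have k1 : Keep 43 s (s'.setN 44 0 ((d - (m + 1)) * n)) := h3.setN (by decide)
    have e42 : (s'.setN 44 0 ((d - (m + 1)) * n)).nat 42 0 = W := by rw [k1.nat 42 (by decide), hW]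
    have e0 : (s'.setN 44 0 ((d - (m + 1)) * n)).real 0 0 = q := by
      rw [k1.real 0 (by decide)]; exact h.damp
    have hpot : listPotential W ((L.drop (d - m)).foldr (layerStep q W) l) ≤ B :=
      (listPotential_foldr_le q W _ l).trans hB
    have hrun := run_layerCmd (orc := orc) (s := s'.setN 44 0 ((d - (m + 1)) * n))
      (l := (L.drop (d - m)).foldr (layerStep q W) l) L[d - (m + 1)] (B := B)
      (by rw [k1.nat 0 (by decide)]; exact h.size) (hp.keep k1 (by decide))
      (by simpa using (h.layer _ hlt).keep k1 (by decide)) (h2.setN (by decide))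
      ((length_le_listPotential W _).trans hpot)
      (fun i hi => by rw [e42, e0]; exact (length_gatesUpTo_le _ q W _ hi).trans hpot)
    rw [e42, e0] at hrun
    refine hrun.mono le_rfl fun s'' hs'' => ⟨?_, ?_, ?_⟩
    · rw [setN_nat_row (by decide), hs''.2.nat 44 (by decide)]; simp
    · rw [List.drop_eq_getElem_cons hlt, List.foldr_cons, ← hdm]
      exact hs''.1.setN (by decide)
    · exact (k1.trans (hs''.2.mono (by decide))).setN (by decide)
  · refine ⟨?_, ?_, (Keep.refl _ _).setN (by decide)⟩
    · simp [sem, letN, h44]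
    · rw [Nat.sub_zero, hd, List.drop_length]
      exact hl.setN (by decide)
  · simp [sem, letN, NExp.eval]
  · refine ⟨?_, hs'.1.2.2⟩
    have := hs'.1.2.1
    rwa [Nat.sub_self, List.drop_zero] at this
  · simp [Cmd.size, letN]; ring_nf; omega

/-- Evolve the current items through the circuit and output them. -/
def evolveCmd : Cmd := baseCmd ;; layersCmd ;; forItems noiseBody ;; forItems emitBody

theorem run_noiseItems {s : Store n} {l : List (Item n)} (hn : s.nat 0 0 = n) (hp : Powers s)
    (hl : Items s l) :
    Run orc (forItems noiseBody) s (l.length * (24 * n + 15) + 4) fun s' =>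
      Items s' (l.flatMap (noiseStep (s.real 0 0) (s.nat 42 0))) ∧ Keep 90 s s' := by
  refine run_forItems_keep (by decide) rfl hl _ (24 * n + 13) fun e s' hk he => ?_
  have := run_noiseBody (orc := orc) (by rw [hk.nat 0 (by decide), hn]) (hp.keep hk (by decide)) he
  rwa [hk.real 0 (by decide), hk.nat 42 (by decide)] at this

theorem run_evolveCmd {s : Store n} {L : List (Layer n)} {q ε : ℝ} {l : List (Item n)} {W B : ℕ}
    (h : Input s L q ε) (hp : Powers s) (hW : s.nat 42 0 = W) (hl : Items s l)
    (hB : listPotential W l ≤ B) :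
    Run orc evolveCmd s (200 * (L.length + 1) * (n + 1) ^ 2 * (B + 1)) fun s' => s'.out = s.out ++
      ((L.foldr (layerStep q W) l).flatMap (noiseStep q W)).map fun e => (e.P, e.amp) := by
  have hpot : (L.foldr (layerStep q W) l).length ≤ B :=
    (length_le_listPotential W _).trans ((listPotential_foldr_le q W _ l).trans hB)
  refine ((run_baseCmd h).seq (T' := (L.length * ((n + 1) * (B * (24 * n + 82) + 8) + 3) + 2) +
    ((B * (24 * n + 15) + 4) + (B * (25 * n + 11) + 4))) fun s1 hs1 => ?_).mono ?_ fun _ h => h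
  · obtain ⟨e44, k1, hr1⟩ := hs1
    refine (run_layersCmd (h.keep k1 (by decide)) (hp.keep k1 (by decide))
      (by rw [k1.nat 42 (by decide), hW]) e44 (hl.congr (fun a ha => (hr1 a ha).1)
      (hr1 200 (by decide)).2) hB).seq fun s2 hs2 => ?_
    obtain ⟨hl2, k2⟩ := hs2
    have k12 := (k1.mono (by decide)).trans k2
    have hin2 := h.keep k12 (by decide)
    have hrun := run_noiseItems (orc := orc) hin2.size (hp.keep k12 (by decide)) hl2
    rw [hin2.damp, k12.nat 42 (by decide), hW] at hrun
    refine Run.seq (hrun.mono (Nat.add_le_add_right (Nat.mul_le_mul_right _ hpot) _) fun _ h => h)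
      fun s3 hs3 => ?_
    have k13 := k12.trans (hs3.2.mono (by decide))
    refine (run_emitItems (h.keep k13 (by decide)).size (hp.keep k13 (by decide)) hs3.1).mono
      (Nat.add_le_add_right (Nat.mul_le_mul_right _ ((length_noise_le q W _).trans hpot)) _)
      fun s4 hs4 => ?_
    rw [hs4, k13.out]
  · have : 200 * (L.length + 1) * (n + 1) ^ 2 * (B + 1) = L.length * ((n + 1) * (B * (24 * n + 82) + 8) + 3)
      + L.length * (B * (200 * (n + 1) ^ 2 - (n + 1) * (24 * n + 82)) + (200 * (n + 1) ^ 2 - ((n + 1) * 8 + 3)))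
      + 200 * (n + 1) ^ 2 * (B + 1) := by
      have h1 : (n + 1) * (24 * n + 82) ≤ 200 * (n + 1) ^ 2 := by nlinarith
      have h2 : (n + 1) * 8 + 3 ≤ 200 * (n + 1) ^ 2 := by nlinarith
      zify [h1, h2]; ring
    rw [this]
    have h3 : L.length * 3 ≤ L.length * (B * (200 * (n + 1) ^ 2 - (n + 1) * (24 * n + 82)) +
        (200 * (n + 1) ^ 2 - ((n + 1) * 8 + 3))) := by
      refine Nat.mul_le_mul_left _ (le_add_left ?_)
      have : (n + 1) * 8 + 3 + 3 ≤ 200 * (n + 1) ^ 2 := by nlinarith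
      omega
    have h4 : B * (24 * n + 15) + B * (25 * n + 11) ≤ 100 * (n + 1) ^ 2 * B := by
      nlinarith [Nat.zero_le (n * B), Nat.zero_le (n ^ 2 * B)]
    have h5 : 200 * (n + 1) ^ 2 * (B + 1) = 100 * (n + 1) ^ 2 * B + 100 * (n + 1) ^ 2 * B + 200 * (n + 1) ^ 2 := by ring
    have h6 : 1 ≤ (n + 1) ^ 2 := Nat.one_le_pow _ _ (by omega)
    omega

end uniform

/-! ### The programs for uniform noise -/

section input
variable {n : ℕ}

theorem atSite_eq {α : Type} [Zero α] (L : List (Layer n)) {t : ℕ} (ht : t < L.length) (j : Fin n)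
    (f : Layer n → Fin n → α) : atSite L (t * n + j) f = f L[t] j := by
  have h1 : (t * n + (j : ℕ)) / n = t := by
    rw [mul_comm, Nat.mul_add_div (by have := j.2; omega), Nat.div_eq_of_lt j.2, add_zero]
  have h2 : (t * n + (j : ℕ)) % n = j := by
    rw [mul_comm, Nat.mul_add_mod, Nat.mod_eq_of_lt j.2]
  have h3 : (t * n + (j : ℕ)) / n < L.length ∧ (t * n + (j : ℕ)) % n < n := by
    rw [h1, h2]; exact ⟨ht, j.2⟩
  rw [atSite, dif_pos h3]
  congr 1
  · simp only [h1]
  · exact Fin.ext h2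

theorem layerAt_inputStore (L : List (Layer n)) (γ ε : ℝ) (terms : List (PauliString n × ℝ)) {t : ℕ}
    (ht : t < L.length) : LayerAt (inputStore L γ ε terms) L[t] (t * n) := by
  intro j
  refine ⟨?_, fun e he => ⟨?_, ?_⟩⟩
  · show atSite L _ (fun U j => (U.partner j : ℕ)) = _
    rw [atSite_eq L ht]
  · have : (inputStore L γ ε terms).real (2 + e) (t * n + j)
        = atSite L (t * n + j) fun U j => (gateEntry (U.gate j) e).re := by
      rw [add_comm]
      simp only [inputStore, inputReal]
      rw [if_pos (by omega)]; simp
    rw [this, atSite_eq L ht]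
  · have : (inputStore L γ ε terms).real (18 + e) (t * n + j)
        = atSite L (t * n + j) fun U j => (gateEntry (U.gate j) e).im := by
      rw [show 18 + e = (e + 16) + 2 by ring]
      simp only [inputStore, inputReal]
      rw [if_neg (by omega), if_pos (by omega)]; simp
    rw [this, atSite_eq L ht]

theorem input_inputStore (L : List (Layer n)) (γ ε : ℝ) (terms : List (PauliString n × ℝ)) :
    Input (inputStore L γ ε terms) L (Real.exp (-γ)) ε :=
  ⟨rfl, rfl, rfl, rfl, fun _ ht => layerAt_inputStore L γ ε terms ht⟩

end input

/-- The program for uniform noise, with the part `start` that makes the list of initial items. -/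
def uniformProg (start : Cmd) : Cmd :=
  dampCmd ;; .ite (.realLe (RV 50) tolExp) identityCmd (powersCmd ;; weightCmd ;; start ;; evolveCmd)

theorem traceNorm_out_sub_le {n : ℕ} {M : NoiseModel} {γ ε c : ℝ} {L : List (Layer n)} {ρ : Op n}
    (hρ : IsState ρ) (hc : 0 < c) (hS : renyiTwo ρ = n - Real.logb 2 c)
    {out : List (PauliString n × ℝ)}
    (h : nrm (listCoeff out - circuitVec M (Real.exp (-γ)) L (pauliCoeff ρ)) ≤ ε * nrm (pauliCoeff ρ)) :
    traceNorm (pauliSum out - noisyCircuit M γ L ρ) ≤ ε * √c := by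
  have h1 := traceNorm_toOp_sub_le hρ hc hS _ _ h
  rwa [toOp_listCoeff, ← noisyCircuit_toOp, toOp_pauliCoeff hρ.1.isHermitian] at h1

/-- Common to both ways of giving the input state. The lists, the vectors and the bounds are indexed
by the cutoff, which is found at run time. The vector `y W` may differ from the true coefficients
wherever no path of total weight at most W begins. -/
theorem computes_uniform {start : Cmd} {n : ℕ} {L : List (Layer n)} {γ ε c : ℝ} {ρ : Op n}
    {terms : List (PauliString n × ℝ)} (hγ : 0 < γ) (hε : 0 < ε) (hc : 0 < c) (hρ : IsState ρ)
    (hS : renyiTwo ρ = n - Real.logb 2 c) (T B : ℕ → ℕ) (l : ℕ → List (Item n))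
    (y : ℕ → PauliString n → ℝ)
    (hy : ∀ W, pathSum (Real.exp (-γ)) W L (y W) = pathSum (Real.exp (-γ)) W L (pauliCoeff ρ))
    (hl : ∀ W k, itemVec (l W) k = if k = 0 then y W else 0)
    (hB : ∀ W, listPotential W (l W) ≤ B W)
    (hstart : ∀ s W, Input s L (Real.exp (-γ)) ε → Powers s → Keep 40 (inputStore L γ ε terms) s →
      s.nat 42 0 = W → Run (pauliCoeff ρ) start s (T W) fun s' => Items s' (l W) ∧ Keep 43 s s')
    {bound : ℝ}
    (hb1 : ∀ k : ℕ, (∀ m < k, ε ≤ Real.exp (-γ) ^ m) → (3 * k + 6 : ℝ) ≤ bound)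
    (hb2 : ∀ W : ℕ, ε < Real.exp (-γ) ^ (L.length + 1) →
      (∀ m < W, ε ≤ (2 * Real.exp (-γ) / (1 + Real.exp (-γ))) ^ m *
        (2 / (1 - Real.exp (-γ))) ^ (L.length + 1)) →
      ((T W + 200 * (L.length + 1) * (n + 1) ^ 2 * (B W + 1) + 6 * L.length + 3 * n + 3 * W + 20 : ℕ) : ℝ)
        ≤ bound) :
    Computes (uniformProg start) .uniform L γ ε ρ terms (ε * √c) bound := by
  set q := Real.exp (-γ) with hq
  have h0 : 0 < q := Real.exp_pos _
  have h1 : q < 1 := by rw [hq, Real.exp_lt_one_iff]; linarith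
  have hin := input_inputStore L γ ε terms
  obtain ⟨k, hk, hk1, hk2, hrun⟩ := run_dampCmd (orc := pauliCoeff ρ) hin hε
  -- In this case k ≤ d + 1 gives q^(d+1) ≤ ε, and the identity component suffices.
  by_cases htriv : q ^ k ≤ ε
  · have hR : Run (pauliCoeff ρ) (uniformProg start) (inputStore L γ ε terms) (3 * k + 6)
        fun s' => s'.out = [(0, pauliCoeff ρ 0)] := by
      refine Run.seq (T' := 3) hrun fun s1 ⟨hr, hk⟩ => Run.ite (fun _ => ?_) fun h => ?_
      · refine (run_identityCmd ?_).mono le_rfl fun s' hs' => ?_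
        · rw [hk.nat 3 (by decide)]; rfl
        · rw [hs', hk.out]; rfl
      · refine absurd ?_ h
        simp only [Test.holds, RV, tolExp, RExp.eval, NExp.eval, hr, hk.real 0 (by decide)]
        exact htriv
    obtain ⟨s', t, h2, h3, h4⟩ := hR
    refine ⟨s', t, h2, ?_, traceNorm_out_sub_le hρ hc hS ?_⟩
    · have := hb1 k hk2
      have h3' : (t : ℝ) ≤ 3 * k + 6 := by exact_mod_cast h3
      linarith
    · have h5 : listCoeff s'.out = Pi.single 0 (pauliCoeff ρ 0) := by
        ext P; simp [h4, listCoeff, Pi.single_apply, eq_comm]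
      rw [h5]
      refine (nrm_single_sub_circuitVec_le h0.le h1.le L _).trans
        (mul_le_mul_of_nonneg_right (le_trans ?_ htriv) (nrm_nonneg _))
      exact pow_le_pow_of_le_one h0.le h1.le hk
  · have hk : k = L.length + 1 := hk1.resolve_right fun h => htriv h.le
    subst hk
    push Not at htriv
    obtain ⟨W, hW1, hW2, -⟩ := run_weightCmd (orc := pauliCoeff ρ) hin hε h0 h1
    have hR : Run (pauliCoeff ρ) (uniformProg start) (inputStore L γ ε terms)
        (T W + 200 * (L.length + 1) * (n + 1) ^ 2 * (B W + 1) + 6 * L.length + 3 * n + 3 * W + 20)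
        fun s' => s'.out = ((L.foldr (layerStep q W) (l W)).flatMap (noiseStep q W)).map
          fun e => (e.P, e.amp) := by
      refine (Run.seq (T' := (3 * n + 3) + ((3 * L.length + 3 * W + 10) + (T W +
        200 * (L.length + 1) * (n + 1) ^ 2 * (B W + 1))) + 1) hrun
        fun s1 ⟨hr, k1⟩ => Run.ite (fun h => ?_) fun _ => ?_).mono (by omega) fun _ h => h
      · simp only [Test.holds, RV, tolExp, RExp.eval, NExp.eval, hr, k1.real 0 (by decide)] at h
        exact absurd h (not_le.2 htriv)
      · have i1 := hin.keep k1 (by decide)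
        refine (run_powersCmd i1.size).seq fun s2 ⟨p2, k2⟩ => ?_
        have k02 := (k1.mono (by decide)).trans k2
        have i2 := hin.keep k02 (by decide)
        obtain ⟨W', hW1', hW2', hrunW⟩ := run_weightCmd (orc := pauliCoeff ρ) i2 hε h0 h1
        -- The cutoff was announced for the initial store and is computed in a later one; both are
        -- the least solution of the same inequality.
        have hWW : W' = W := by
          rcases lt_trichotomy W' W with h | h | h
          · exact absurd hW1' (not_lt.2 (hW2 _ h))
          · exact h
          · exact absurd hW1 (not_lt.2 (hW2' _ h))
        subst hWW
        refine hrunW.seq fun s3 ⟨e3, k3⟩ => ?_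
        have k03 := k02.trans (k3.mono (by decide))
        refine (hstart s3 W' (hin.keep k03 (by decide)) (p2.keep k3 (by decide)) k03 e3).seq
          fun s4 ⟨l4, k4⟩ => ?_
        have k04 := k03.trans (k4.mono (by decide))
        refine (run_evolveCmd (hin.keep k04 (by decide)) ((p2.keep k3 (by decide)).keep k4 (by decide))
          (by rw [k4.nat 42 (by decide), e3]) l4 (hB W')).mono le_rfl fun s5 h5 => ?_
        rw [h5, k04.out]; rfl
    obtain ⟨s', t, h2, h3, h4⟩ := hR
    refine ⟨s', t, h2, le_trans (by exact_mod_cast h3) (hb2 W htriv hW2),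
      traceNorm_out_sub_le hρ hc hS ?_⟩
    rw [h4, listCoeff_items q (y W) (l W) (hl W) L, hy]
    exact (nrm_pathSum_sub_circuitVec_le h0 h1 W L _).trans
      (mul_le_mul_of_nonneg_right hW1.le (nrm_nonneg _))

/-! ### Initial items from given Pauli terms -/

section terms
variable {n : ℕ} {orc : PauliString n → ℝ}

theorem headPart_succ (P : PauliString n) (j : Fin n) :
    headPart P (j + 1) = Function.update (headPart P j) j (P j) := by
  ext1 i
  by_cases hi : i = j
  · subst hi; simp [headPart]
  · have : (i : ℕ) ≠ j := Fin.val_ne_of_ne hi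
    rw [Function.update_of_ne hi]
    simp only [headPart]
    congr 1
    simp only [eq_iff_iff]; omega

theorem code_headPart_succ (P : PauliString n) (j : Fin n) :
    code (headPart P (j + 1)) = code (headPart P j) + P j * 4 ^ (j : ℕ) := by
  have h := code_update (headPart P j) j (P j)
  have h0 : headPart P j j = 0 := by simp [headPart]
  rw [h0] at h
  rw [headPart_succ]
  simpa using h

theorem headPart_last (P : PauliString n) : headPart P n = P := by
  ext1 i; simp [headPart]

/-- Add to register 57 the product of the label that register 55 points at with the power of four
that register 58 points at. -/
def addLabelCmd : Cmd :=
  .ite (.natLe (.const 1) (.cell 2 (V 55))) (letN 57 (.add (V 57) (.cell 40 (V 58)))) .skip ;;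
  .ite (.natLe (.const 2) (.cell 2 (V 55))) (letN 57 (.add (V 57) (.cell 40 (V 58)))) .skip ;;
  .ite (.natLe (.const 3) (.cell 2 (V 55))) (letN 57 (.add (V 57) (.cell 40 (V 58)))) .skip ;;
  letN 55 (.add (V 55) (.const 1))

/-- Compute the code of the Pauli term whose labels begin where register 55 points. -/
def termCodeCmd : Cmd :=
  letN 57 (.const 0) ;; letN 58 (.const 0) ;; forTo 58 nExp addLabelCmd

/-- Make the list of items from the given Pauli terms. -/
def termsCmd : Cmd :=
  letN 92 (.const 0) ;; letN 202 (.const 0) ;; letN 55 (.const 0) ;; letN 54 (.const 0) ;;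
  forTo 54 (.cell 0 (.const 2))
    (termCodeCmd ;; push (V 57) (.cell 1 (V 54)) (.const 0))

/-- The memory holds the Pauli terms. -/
def TermsAt (s : Store n) (terms : List (PauliString n × ℝ)) : Prop :=
  s.nat 0 2 = terms.length ∧ ∀ k (hk : k < terms.length),
    s.real 1 k = terms[k].2 ∧ ∀ j : Fin n, s.nat 2 (k * n + j) = terms[k].1 j

theorem termsAt_inputStore (L : List (Layer n)) (γ ε : ℝ) (terms : List (PauliString n × ℝ)) :
    TermsAt (inputStore L γ ε terms) terms := by
  refine ⟨rfl, fun k hk => ⟨?_, fun j => ?_⟩⟩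
  · simp [inputStore, inputReal, hk]
  · have h1 : (k * n + (j : ℕ)) / n = k := by
      rw [mul_comm, Nat.mul_add_div (by have := j.2; omega), Nat.div_eq_of_lt j.2, add_zero]
    have h2 : (k * n + (j : ℕ)) % n = j := by
      rw [mul_comm, Nat.mul_add_mod, Nat.mod_eq_of_lt j.2]
    simp [inputStore, inputNat, h1, h2, hk]

theorem TermsAt.keep {s s' : Store n} {terms : List (PauliString n × ℝ)} (h : TermsAt s terms)
    {b : ℕ} (hk : Keep b s s') (hb : 3 ≤ b) : TermsAt s' terms := by
  unfold TermsAt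
  rw [hk.nat 0 (by omega), hk.real 1 (by omega), hk.nat 2 (by omega)]
  exact h

/-- Register 55 runs through the labels of all terms in succession, which replaces the product k ·
n. -/
theorem run_termCode {s : Store n} {P : PauliString n} {k : ℕ} (hn : s.nat 0 0 = n) (hp : Powers s)
    (h55 : s.nat 55 0 = k * n) (hP : ∀ j : Fin n, s.nat 2 (k * n + j) = P j) :
    Run orc termCodeCmd s (12 * n + 3)
      fun s' => s'.nat 57 0 = code P ∧ s'.nat 55 0 = (k + 1) * n := by
  refine (Run.simple_seq rfl (Run.simple_seq rfl ((run_forTo (fun m s' => s'.nat 57 0 = code (headPart P m) ∧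
    s'.nat 55 0 = k * n + m ∧ Keep 50 s s') (fun _ => 10) (k := n) (k0 := 0)
    (Nat.zero_le _) (by decide) ?_ ?_ ?_ ?_).mono le_rfl fun s' hs' => ?_))).mono ?_ fun _ h => h
  · rintro m s' hs' -
    simp [nExp, NExp.eval, hs'.2.2.nat 0 (by decide), hn]
  · rintro m - hm s' ⟨h1, h2, h3⟩ h58
    refine (run_simple rfl s').mono (by decide) ?_
    rintro s1 rfl
    obtain ⟨j, hj⟩ : ∃ j : Fin n, (j : ℕ) = m := ⟨⟨m, hm⟩, rfl⟩
    have hlab : s'.nat 2 (k * n + m) = P j := by rw [h3.nat 2 (by decide), ← hj, hP]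
    have hpow : s'.nat 40 m = 4 ^ m := by rw [h3.nat 40 (by decide)]; exact hp m hm.le
    have hcode := code_headPart_succ P j
    rw [hj] at hcode
    rw [hcode]
    have hlt := (P j).isLt
    have hcases : (P j : ℕ) = 0 ∨ (P j : ℕ) = 1 ∨ (P j : ℕ) = 2 ∨ (P j : ℕ) = 3 := by omega
    have hsem : ∃ v, sem addLabelCmd s' = (v.setN 55 0 (k * n + (m + 1))) ∧ Keep 50 s v ∧
        v.nat 57 0 = code (headPart P m) + P j * 4 ^ m := by
      rcases hcases with h | h | h | h
      · refine ⟨s', ?_, h3, by rw [h1, h]; ring⟩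
        simp [addLabelCmd, sem, letN, Test.holds, NExp.eval, V, h2, hlab, h, add_assoc]
      · refine ⟨s'.setN 57 0 (code (headPart P m) + 4 ^ m), ?_, h3.setN (by decide), by simp [h]⟩
        simp [addLabelCmd, sem, letN, Test.holds, NExp.eval, V, h1, h2, h58, hpow, hlab, h, add_assoc]
      · refine ⟨(s'.setN 57 0 (code (headPart P m) + 4 ^ m)).setN 57 0 (code (headPart P m) + 4 ^ m + 4 ^ m),
          ?_, (h3.setN (by decide)).setN (by decide), by simp [h]; ring⟩
        simp [addLabelCmd, sem, letN, Test.holds, NExp.eval, V, h1, h2, h58, hpow, hlab, h, add_assoc]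
      · refine ⟨((s'.setN 57 0 (code (headPart P m) + 4 ^ m)).setN 57 0
          (code (headPart P m) + 4 ^ m + 4 ^ m)).setN 57 0 (code (headPart P m) + 4 ^ m + 4 ^ m + 4 ^ m),
          ?_, ((h3.setN (by decide)).setN (by decide)).setN (by decide), by simp [h]; ring⟩
        simp [addLabelCmd, sem, letN, Test.holds, NExp.eval, V, h1, h2, h58, hpow, hlab, h, add_assoc]
    obtain ⟨v, hv, hv1, hv2⟩ := hsem
    rw [hv]
    exact ⟨by simp [hv2], by simp, (hv1.setN (by decide)).setN (by decide)⟩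
  · refine ⟨?_, ?_, ((Keep.refl _ _).setN (by decide)).setN (by decide)⟩
    · have : headPart P 0 = 0 := by ext1 i; simp [headPart]
      simp [sem, letN, NExp.eval, this, code_zero]
    · simp [sem, letN, NExp.eval, h55]
  · simp [sem, letN, NExp.eval]
  · rw [headPart_last] at hs'
    exact ⟨hs'.1.1, by rw [hs'.1.2.1]; ring⟩
  · simp [Cmd.size, letN]; omega

theorem run_termsCmd {s : Store n} {terms : List (PauliString n × ℝ)} (hn : s.nat 0 0 = n)
    (hp : Powers s) (ht : TermsAt s terms) :
    Run orc termsCmd s (terms.length * (12 * n + 9) + 5) fun s' =>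
      Items s' (terms.map fun t => ⟨t.1, t.2, 0⟩) ∧ Keep 50 s s' := by
  refine Run.keep ?_ (by decide) (by decide)
  refine (Run.simple_seq rfl (Run.simple_seq rfl (Run.simple_seq rfl (Run.simple_seq rfl
    ((run_forTo (fun m s' => s'.nat 55 0 = m * n ∧ s'.nat 92 0 = 0 ∧ s'.nat 202 0 = m ∧ m ≤ terms.length ∧
      ItemsFrom s' 0 ((terms.take m).map fun t => ⟨t.1, t.2, 0⟩) ∧ Keep 50 s s') (fun _ => 12 * n + 7)
      (k := terms.length) (k0 := 0)
    (Nat.zero_le _) (by decide) ?_ ?_ ?_ ?_).mono le_rfl fun s' hs' => ?_))))).mono ?_ fun _ h => h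
  · rintro m s' ⟨-, -, -, -, -, hk⟩ -
    simp only [NExp.eval, hk.nat 0 (by decide)]; exact ht.1
  · rintro m - hm s' ⟨h1, h2, h3, -, h4, h5⟩ h54
    have hn' : s'.nat 0 0 = n := by rw [h5.nat 0 (by decide), hn]
    have htm := (ht.keep h5 (by decide)).2 m hm
    refine (Run.seq (run_termCode (k := m) hn' (hp.keep h5 (by decide)) h1 htm.2).frame (T' := 4)
      ?_).mono (by omega) fun _ h => h
    rintro s1 ⟨⟨g1, g2⟩, g3⟩
    have k1 : Keep 55 s' s1 := g3.keep (by decide) rfl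
    have e54 : s1.nat 54 0 = m := by rw [k1.nat 54 (by decide), h54]
    have hr : ∀ a, 90 ≤ a → s1.nat a = s'.nat a ∧ s1.real a = s'.real a := fun a ha =>
      g3.1 a (Or.inr (lt_of_lt_of_le (by decide) ha))
    refine (run_push (e := ⟨terms[m].1, terms[m].2, 0⟩) fun s2 hs2 => ⟨?_, ?_, ?_⟩).mono le_rfl fun s2 hs2 => ?_
    · simp [NExp.eval, V, hs2.nat 57 (by decide), g1]
    · simp [NExp.eval, RExp.eval, V, hs2.nat 54 (by decide), hs2.real 1 (by decide), e54, k1.real 1 (by decide), htm.1]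
    · rfl
    · obtain ⟨happ, k2⟩ := hs2
      have happ := happ.congr_left (s₀ := s') fun a ha => hr a (by omega)
      refine ⟨?_, ?_, ?_, hm, ?_, ?_⟩
      · simp [k2.nat 55 (by decide), g2]
      · simp [k2.nat 92 (by decide), (hr 92 (by decide)).1, h2]
      · simp [happ.hi, h3]
      · have hI : ItemsFrom s2 0 ((terms.take (m + 1)).map fun t => ⟨t.1, t.2, 0⟩) := by
          rw [List.take_succ_eq_append_getElem hm, List.map_append]
          intro k hk
          rcases Nat.lt_or_ge k m with hkm | hkm
          · rw [List.getElem_append_left (by simpa using ⟨hkm, by omega⟩)]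
            refine (h4 k (by simpa using ⟨hkm, by omega⟩)).congr (happ.old _ ?_)
            omega
          · have hkm : k = m := by simp at hk; omega
            subst hkm
            have := happ.new 0 (by simp)
            rw [h3] at this
            rw [List.getElem_append_right (by simp)]
            simpa [hm.le] using this
        intro k hk
        exact (hI k hk).congr (by simp)
      · exact (h5.trans ((k1.mono (by decide)).trans (k2.mono (by decide)))).setN (by decide)
  · refine ⟨by simp [sem, letN, NExp.eval], by simp [sem, letN, NExp.eval], by simp [sem, letN, NExp.eval],
      Nat.zero_le _, fun k hk => absurd hk (by simp), ?_⟩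
    exact (((Keep.refl _ _ |>.setN (by decide)).setN (by decide)).setN (by decide)).setN (by decide)
  · simp [sem, letN, NExp.eval]
  · obtain ⟨⟨-, h2, h3, -, h4, h5⟩, -⟩ := hs'
    rw [List.take_length] at h4
    refine ⟨by rw [h2]; exact h4, by rw [h2, h3]; simp⟩
  · simp [Cmd.size, letN]; ring_nf; omega

end terms

/-! ### Initial items from queries -/

section collect
variable {n : ℕ}

/-- The Pauli strings that occur in a list of items, without repetitions. -/
def collect (l : List (Item n)) : List (PauliString n) :=
  l.foldl (fun C e => if e.P ∈ C then C else C ++ [e.P]) []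

theorem collect_append (l : List (Item n)) (e : Item n) :
    collect (l ++ [e]) = if e.P ∈ collect l then collect l else collect l ++ [e.P] := by
  rw [collect, List.foldl_append]; rfl

theorem mem_collect (l : List (Item n)) (P : PauliString n) : P ∈ collect l ↔ ∃ e ∈ l, e.P = P := by
  induction l using List.reverseRecOn with
  | nil => simp [collect]
  | append_singleton l e ih =>
    rw [collect_append]
    split_ifs with h
    · rw [ih]
      constructor
      · rintro ⟨e', h1, h2⟩; exact ⟨e', by simp [h1], h2⟩
      · rintro ⟨e', h1, rfl⟩
        rcases List.mem_append.1 h1 with h1 | h1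
        · exact ⟨e', h1, rfl⟩
        · obtain rfl := List.mem_singleton.1 h1
          exact ih.1 h
    · simp only [List.mem_append, ih, List.mem_singleton]
      constructor
      · rintro (⟨e', h1, h2⟩ | rfl)
        · exact ⟨e', Or.inl h1, h2⟩
        · exact ⟨e, Or.inr rfl, rfl⟩
      · rintro ⟨e', h1 | rfl, rfl⟩
        · exact Or.inl ⟨e', h1, rfl⟩
        · exact Or.inr rfl

theorem nodup_collect (l : List (Item n)) : (collect l).Nodup := by
  induction l using List.reverseRecOn with
  | nil => simp [collect]
  | append_singleton l e ih =>
    rw [collect_append]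
    split_ifs with h
    · exact ih
    · exact List.nodup_append.2 ⟨ih, by simp, by rintro a ha b hb rfl; simp at hb; exact h (hb ▸ ha)⟩

theorem length_collect_le (l : List (Item n)) : (collect l).length ≤ l.length := by
  induction l using List.reverseRecOn with
  | nil => simp [collect]
  | append_singleton l e ih =>
    rw [collect_append]
    split_ifs with h
    · simp; omega
    · simpa using ih

/-- Amplitudes of equal strings add up, so every queried string must enter the evolution once only;
this is why repetitions are removed. -/
theorem itemVec_nodup (x : PauliString n → ℝ) {C : List (PauliString n)} (hC : C.Nodup) (k : ℕ) :
    itemVec (C.map fun P => ⟨P, x P, 0⟩) k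
      = if k = 0 then (fun P => if P ∈ C then x P else 0) else 0 := by
  ext Q
  induction C with
  | nil => by_cases hk : k = 0 <;> simp [itemVec, hk]
  | cons P C ih =>
    rw [List.map_cons, itemVec_cons, ih (List.nodup_cons.1 hC).2]
    have hP := (List.nodup_cons.1 hC).1
    by_cases hk : k = 0
    · subst hk
      by_cases hQ : P = Q
      · subst hQ; simp [hP]
      · simp [hQ, Ne.symm hQ]
    · simp [hk, Ne.symm hk]

/-- The initial items: all Pauli strings from which a Pauli path of total weight at most `W` may
begin, with their coefficients. -/
noncomputable def seedList (n K : ℕ) : List (Item n) := (seedItems K n).map fun e => ⟨e.P, 1, 0⟩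

/-- The items that arise from following Pauli paths of total weight at most `W` backwards. -/
noncomputable def backItems (q : ℝ) (W : ℕ) (L : List (Layer n)) : List (Item n) :=
  let S := seedList n (W / (L.length + 1))
  (traceBack q W S S L).flatMap (noiseStep q W)

/-- With K = W / (d+1) one has W < (d+1)(K+1), so the pigeonhole argument covers all paths of total
weight at most W and all their beginnings are collected. -/
theorem pathSum_backItems (q : ℝ) (W : ℕ) (L : List (Layer n)) (x : PauliString n → ℝ) :
    pathSum q W L (fun P => if P ∈ collect (backItems q W L) then x P else 0) = pathSum q W L x := by
  refine pathSum_congr q L fun P Q w hp hW => if_pos ((mem_collect _ _).2 ?_)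
  have hS : ∀ P, weight P ≤ W / (L.length + 1) → Reach (seedList n (W / (L.length + 1))) P 0 := by
    intro P hP
    obtain ⟨e, he, h1, -⟩ := mem_seedItems hP n le_rfl
    exact ⟨⟨e.P, 1, 0⟩, List.mem_map.2 ⟨e, he, rfl⟩, by rw [h1, headPart_last], le_rfl⟩
  obtain ⟨e, he, rfl, h2⟩ := exists_mem_traceBack (q := q) hS L hS hp hW
    (hW.trans_lt (Nat.lt_mul_div_succ W (Nat.succ_pos _)))
  refine ⟨⟨e.P, e.amp * q ^ weight e.P, e.cum + weight e.P⟩, List.mem_flatMap.2 ⟨e, he, ?_⟩, rfl⟩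
  rw [noiseStep, if_pos h2]
  exact List.mem_singleton.2 rfl

theorem listPotential_seedList (n W K : ℕ) :
    listPotential W (seedList n K) = (seedItems K n : List (Item n)).length * 16 ^ W := by
  rw [listPotential_zero]
  · simp [seedList]
  · intro e he
    obtain ⟨e', -, rfl⟩ := List.mem_map.1 he
    rfl

theorem eq_zero_of_mem_seedItems {K : ℕ} : ∀ {m : ℕ}, ∀ {e : Item n}, e ∈ (seedItems K m : List (Item n)) →
    ∀ i : Fin n, m ≤ i → e.P i = 0 := by
  intro m
  induction m with
  | zero => intro e he i _; simp [seedItems] at he; subst he; rfl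
  | succ m ih =>
    intro e he i hi
    rw [seedItems] at he
    split_ifs at he with h
    · obtain ⟨e', he', h2⟩ := List.mem_flatMap.1 he
      rw [seedStep] at h2
      split_ifs at h2
      · obtain ⟨a, -, rfl⟩ := List.mem_map.1 h2
        have : i ≠ ⟨m, h⟩ := by rintro rfl; simp at hi
        show Function.update e'.P _ a i = 0
        rw [Function.update_of_ne this]
        exact ih he' i (by omega)
      · rw [List.mem_singleton.1 h2]; exact ih he' i (by omega)
    · exact ih he i (by omega)

end collect

/-! ### Programs that find and query the relevant input strings -/

section query
variable {n : ℕ} {orc : PauliString n → ℝ}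

/-- Divide the bound on the total weight by the number of layers of noise. -/
def quotientCmd : Cmd :=
  letN 55 (.const 0) ;; letN 56 (.add depthExp (.const 1)) ;;
  .loop (.natLe (V 56) (V 42))
    (letN 55 (.add (V 55) (.const 1)) ;; letN 56 (.add (V 56) (.add depthExp (.const 1))))

/-- Division by repeated addition: register 56 is the next multiple of d + 1. -/
theorem run_quotientCmd {s : Store n} {d W : ℕ} (hd : s.nat 0 1 = d) (hW : s.nat 42 0 = W) :
    Run orc quotientCmd s (3 * W + 3) fun s' => s'.nat 55 0 = W / (d + 1) ∧ Keep 50 s s' := by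
  refine Run.keep ?_ (by decide) (by decide)
  refine (Run.simple_seq rfl (Run.simple_seq rfl ((Run.loop (fun m s' => s'.nat 55 0 = m ∧
    s'.nat 56 0 = (m + 1) * (d + 1) ∧ s'.nat 0 1 = d ∧ s'.nat 42 0 = W) (fun _ => 2) (W / (d + 1))
    ?_ ?_ ?_).mono le_rfl fun s' hs' => hs'.1))).mono ?_ fun _ h => h
  · rintro m hm s' ⟨h1, h2, h3, h4⟩
    constructor
    · simp only [Test.holds, NExp.eval, V, h2, h4]
      exact (Nat.le_div_iff_mul_le (Nat.succ_pos d)).1 hm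
    · refine (run_simple rfl s').mono le_rfl ?_
      rintro s1 rfl
      simp [sem, letN, NExp.eval, V, depthExp, h1, h2, h3, h4]
      ring
  · rintro s' ⟨h1, h2, h3, h4⟩
    simp only [Test.holds, NExp.eval, V, h2, h4, not_le]
    rw [mul_comm]
    exact Nat.lt_mul_div_succ W (Nat.succ_pos d)
  · simp [sem, letN, NExp.eval, depthExp, hd, hW]
  · have := Nat.div_le_self W (d + 1)
    simp [Cmd.size, letN]; omega

/-- The program for `seedStep`. -/
def seedBody : Cmd :=
  letN 114 (.cell 200 (V 90)) ;; letN 115 (.cell 201 (V 90)) ;; letR 112 (.cell 200 (V 90)) ;;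
  .ite (.natLe (.add (V 115) (.const 1)) (V 55))
    (seqList ((List.finRange 4).map fun a : Fin 4 => push (.add (V 114) (NExp.times (.cell 40 (V 80)) (a : ℕ)))
      (.const 1) (.add (V 115) (.const (if a = 0 then 0 else 1)))))
    (push (V 114) (RV 112) (V 115))

theorem run_seedBody {s : Store n} {e : Item n} {K : ℕ} (j : Fin n) (hp : Powers s)
    (hK : s.nat 55 0 = K) (hj : s.nat 80 0 = j) (h0 : e.P j = 0) (he : ItemAt s (s.nat 90 0) e) :
    Run orc seedBody s 21 fun s' => Appends s s' (seedStep K j e) := by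
  obtain ⟨h1, h2, h3⟩ := he
  refine (Run.simple_seq rfl (Run.simple_seq rfl (Run.simple_seq rfl (T := 18) ?_))).mono
    (by simp [Cmd.size, letN, letR]) fun _ h => h
  set s1 := ((s.setN 114 0 (code e.P)).setN 115 0 e.cum).setR 112 0 e.amp with hs1
  have hsem : sem (letR 112 (.cell 200 (V 90))) (sem (letN 115 (.cell 201 (V 90)))
      (sem (letN 114 (.cell 200 (V 90))) s)) = s1 := by
    simp [sem, letN, letR, NExp.eval, RExp.eval, V, hs1, h1, h2, h3]
  rw [hsem]
  have hr : ∀ a, 200 ≤ a → s1.nat a = s.nat a ∧ s1.real a = s.real a := fun a ha =>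
    ⟨by rw [hs1]; simp only [setR_nat]; rw [setN_nat_row (by omega), setN_nat_row (by omega)],
      by rw [hs1, setR_real_row (by omega)]; rfl⟩
  refine Run.ite (fun h => ?_) fun h => ?_
  · have hlt : e.cum + 1 ≤ K := by simpa [Test.holds, NExp.eval, V, hs1, hK] using h
    rw [seedStep, if_pos hlt]
    refine (run_pushes (List.finRange 4) _ _ _ _ fun a _ s' hk' => ⟨?_, ?_, ?_⟩).mono (T := 17) le_rfl
      fun s' hs' => hs'.1.congr_left hr
    · have := code_update e.P j a
      rw [h0] at this
      simp only [NExp.eval, V, eval_times, hk'.nat 114 (by decide), hk'.nat 40 (by decide),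
        hk'.nat 80 (by decide)]
      simp [hs1, hj, hp j j.2.le]
      simpa using this.symm
    · simp [RExp.eval]
    · simp only [NExp.eval, V, hk'.nat 115 (by decide)]
      simp only [hs1]
      split_ifs <;> simp
  · have hlt : ¬ e.cum + 1 ≤ K := by simpa [Test.holds, NExp.eval, V, hs1, hK] using h
    rw [seedStep, if_neg hlt]
    refine (run_push fun s' hk' => ⟨?_, ?_, ?_⟩).mono (by omega) fun s' hs' => hs'.1.congr_left hr
    · simp [NExp.eval, V, hk'.nat 114 (by decide), hs1]
    · simp [RExp.eval, RV, NExp.eval, hk'.real 112 (by decide), hs1]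
    · simp [NExp.eval, V, hk'.nat 115 (by decide), hs1]

/-- Begin a new list of items. -/
def clearCmd : Cmd := letN 92 (.const 0) ;; letN 202 (.const 0)

theorem run_clearCmd (s : Store n) :
    Run orc clearCmd s 2 fun s' => Items s' ([] : List (Item n)) ∧ Keep 90 s s' ∧
      ∀ a, 202 < a → s'.nat a = s.nat a ∧ s'.real a = s.real a := by
  refine (run_simple rfl s).mono (by simp [clearCmd, Cmd.size, letN]) ?_
  rintro s' rfl
  refine ⟨⟨fun k hk => absurd hk (by simp), by simp [sem, clearCmd, letN, NExp.eval]⟩,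
    ((Keep.refl _ _).setN (by decide)).setN (by decide), fun a ha => ?_⟩
  simp only [sem, clearCmd, letN]
  rw [setN_nat_row (by omega), setN_nat_row (by omega)]
  exact ⟨rfl, rfl⟩

theorem Items.appends {s s' : Store n} {l l' : List (Item n)} (h : Items s l) (h' : Appends s s' l')
    (h92 : s'.nat 92 0 = s.nat 92 0) : Items s' (l ++ l') := by
  refine ⟨?_, by rw [h'.hi, h.2, h92, List.length_append]; ring⟩
  rw [h92]
  intro k hk
  rcases Nat.lt_or_ge k l.length with hkl | hkl
  · rw [List.getElem_append_left hkl]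
    exact (h.1 k hkl).congr (h'.old _ (by rw [h.2]; omega))
  · rw [List.getElem_append_right hkl]
    have := h'.new (k - l.length) (by rw [List.length_append] at hk; omega)
    rw [h.2] at this
    convert this using 1
    omega

/-- Begin with the identity, and run `body` on all items for every qubit. -/
def growCmd (body : Cmd) : Cmd :=
  clearCmd ;; push (.const 0) (.const 1) (.const 0) ;; letN 80 (.const 0) ;;
    forTo 80 nExp (forItems body)

/-- Shared by the enumeration by weight and the enumeration by cells. The hypothesis `e ∈ items j`
gives the body access to the fact that the string is still the identity on the qubits to come. -/
theorem run_growCmd {s : Store n} {body : Cmd} (hlow : 100 ≤ body.lowW) (hsil : body.silent = true)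
    {step : Fin n → Item n → List (Item n)} {items : ℕ → List (Item n)} (h0 : items 0 = [⟨0, 1, 0⟩])
    (hitems : ∀ m (h : m < n), items (m + 1) = (items m).flatMap (step ⟨m, h⟩)) {N t : ℕ}
    (hn : s.nat 0 0 = n) (hN : ∀ m ≤ n, (items m).length ≤ N)
    (H : ∀ (j : Fin n) e s', Keep 60 s s' → s'.nat 80 0 = j → e ∈ items j → ItemAt s' (s'.nat 90 0) e →
      Run orc body s' t fun s'' => Appends s' s'' (step j e)) :
    Run orc (growCmd body) s (n * (N * (t + 2) + 6) + 8) fun s' => Items s' (items n) ∧ Keep 60 s s' := by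
  have hlow' : 60 ≤ (growCmd body).lowW := by
    simp only [growCmd, clearCmd, push, forTo, forItems, letN, Cmd.lowW]; omega
  have hsil' : (growCmd body).silent = true := by
    simp [growCmd, clearCmd, push, forTo, forItems, letN, Cmd.silent, hsil]
  refine Run.keep ?_ hlow' hsil'
  refine ((run_clearCmd s).seq (T' := 4 + (1 + (n * (N * (t + 2) + 6) + 1))) fun s1 ⟨l1, k1, _⟩ => Run.seq
    (run_push (e := ⟨0, 1, 0⟩) fun s' _ => ⟨by simp [NExp.eval, code_zero], by simp [RExp.eval], rfl⟩)
    fun s2 ⟨a2, k2⟩ => Run.simple_seq rfl ?_).mono (by omega) fun _ h => h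
  have l2 : Items s2 [⟨0, 1, 0⟩] := l1.appends a2 (by rw [k2.nat 92 (by decide)])
  have k12 := (k1.mono (by decide : 60 ≤ 90)).trans (k2.mono (by decide))
  have hs3 : sem (letN 80 (.const 0)) s2 = s2.setN 80 0 0 := by simp [sem, letN, NExp.eval]
  rw [hs3]
  refine (run_forTo (fun m s' => Items s' (items m) ∧ Keep 60 s s') (fun _ => N * (t + 2) + 4)
    (k := n) (k0 := 0) (Nat.zero_le _) (Or.inl ?_) ?_ ?_ ?_ ?_).mono ?_ fun s' hs' => hs'.1.1
  · simp only [forTo, forItems, letN, Cmd.lowW]; omega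
  · rintro m s' ⟨-, hk⟩ -
    simp [nExp, NExp.eval, hk.nat 0 (by decide), hn]
  · rintro m - hm s' ⟨hi, hk⟩ hj
    refine (run_forItems hlow hi (step ⟨m, hm⟩) (fun _ s'' => Keep 90 s' s'') t
      (.refl _ _) ?_ ?_).mono ?_ ?_
    · intro _ s1 s2 h h1 h2 h3
      exact ⟨fun a ha => (h1 a (Or.inl ha)).trans (h.nat a ha), fun a ha => by rw [h2, h.real a ha],
        h3.trans h.out⟩
    · intro p e s1 hpre hk' he
      refine ((H ⟨m, hm⟩ e s1 (hk.trans (hk'.mono (by decide))) (by rw [hk'.nat 80 (by decide), hj])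
        (hpre.subset (by simp)) he).keep hlow hsil).mono le_rfl
        fun s2 hs2 => ⟨hs2.1, hk'.trans (hs2.2.mono (by decide))⟩
    · have := Nat.mul_le_mul_right (t + 2) (hN m hm.le)
      omega
    · rintro s'' ⟨hi', hk'⟩
      refine ⟨?_, (hk.trans (hk'.mono (by decide))).setN (by decide)⟩
      rw [hitems m hm]
      exact hi'.setN (by decide)
  · exact ⟨by rw [h0]; exact l2.setN (by decide), k12.setN (by decide)⟩
  · simp
  · simp

/-- Make the items `seedItems`. -/
def seedsCmd : Cmd := growCmd seedBody

theorem run_seedsCmd {s : Store n} {K N : ℕ} (hn : s.nat 0 0 = n) (hp : Powers s)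
    (hK : s.nat 55 0 = K) (hN : ∀ m ≤ n, (seedItems K m : List (Item n)).length ≤ N) :
    Run orc seedsCmd s (n * (N * 23 + 6) + 8) fun s' => Items s' (seedItems K n) ∧ Keep 60 s s' := by
  refine run_growCmd (step := seedStep K) (by decide) (by decide) rfl
    (fun m h => by rw [seedItems, dif_pos h]) hn hN fun j e s' hk hj he hat => ?_
  exact run_seedBody j (hp.keep hk (by decide)) (by rw [hk.nat 55 (by decide), hK]) hj
    (eq_zero_of_mem_seedItems he j le_rfl) hat

/-- The arrays 211 and register 212 hold a list of items with accumulated weight 0. -/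
def Stored (s : Store n) (l : List (Item n)) : Prop :=
  s.nat 212 0 = l.length ∧ ∀ k (hk : k < l.length),
    s.nat 211 k = code l[k].P ∧ s.real 211 k = l[k].amp ∧ l[k].cum = 0

theorem Stored.congr {s s' : Store n} {l : List (Item n)} (h : Stored s l)
    (h' : ∀ a, 202 < a → s'.nat a = s.nat a ∧ s'.real a = s.real a) : Stored s' l := by
  unfold Stored
  rw [(h' 211 (by decide)).1, (h' 211 (by decide)).2, (h' 212 (by decide)).1]
  exact h

/-- Store the items of the current list, with amplitude 1. -/
def storeCmd : Cmd :=
  letN 212 (.sub (V 202) (V 92)) ;; letN 56 (.const 0) ;;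
  forTo 56 (V 212) (.setNat 211 (V 56) (.cell 200 (.add (V 92) (V 56))) ;;
    .setReal 211 (V 56) (.const 1))

theorem run_storeCmd {s : Store n} {l : List (Item n)} (hl : Items s l) :
    Run orc storeCmd s (4 * l.length + 3) fun s' => Stored s' (l.map fun e => ⟨e.P, 1, 0⟩) ∧
      Keep 56 s s' := by
  refine Run.keep ?_ (by decide) (by decide)
  refine (Run.simple_seq rfl (Run.simple_seq rfl ((run_forTo (fun m s' => s'.nat 212 0 = l.length ∧
    s'.nat 92 0 = s.nat 92 0 ∧ (∀ k, s'.nat 200 k = s.nat 200 k) ∧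
    ∀ k (hk : k < l.length), k < m → s'.nat 211 k = code l[k].P ∧ s'.real 211 k = 1) (fun _ => 2)
    (k := l.length) (k0 := 0) (Nat.zero_le _) (by decide) ?_ ?_ ?_ ?_).mono le_rfl
    fun s' hs' => ?_))).mono ?_ fun _ h => h
  · rintro m s' ⟨h, -⟩ -
    simpa [V, NExp.eval] using h
  · rintro m - hm s' ⟨h1, h2, h3, h4⟩ h56
    refine (run_simple rfl s').mono le_rfl ?_
    rintro s1 rfl
    have hc := (hl.1 m hm).1
    have hs1 : sem (.setNat 211 (V 56) (.cell 200 (.add (V 92) (V 56))) ;;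
        .setReal 211 (V 56) (.const 1)) s' = (s'.setN 211 m (code l[m].P)).setR 211 m 1 := by
      simp [sem, V, NExp.eval, RExp.eval, h2, h3, h56, hc]
    rw [hs1]
    refine ⟨by simp [h1], by simp [h2], by simp [h3], fun k hk hkm => ?_⟩
    by_cases hkm' : k = m
    · subst hkm'; simp
    · simpa [hkm'] using h4 k hk (by omega)
  · refine ⟨?_, ?_, ?_, fun k _ hk => absurd hk (by omega)⟩
    · simp [sem, letN, V, NExp.eval, hl.2]
    · simp [sem, letN]
    · simp [sem, letN]
  · simp [sem, letN, NExp.eval]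
  · obtain ⟨⟨h1, -, -, h4⟩, -⟩ := hs'
    refine ⟨by simpa using h1, fun k hk => ?_⟩
    have hk' : k < l.length := by simpa using hk
    simpa using h4 k hk' hk'
  · simp [Cmd.size, letN]; omega

/-- Append the stored items to the current list. -/
def appendCmd : Cmd :=
  letN 56 (.const 0) ;; forTo 56 (V 212) (letN 57 (.cell 211 (V 56)) ;; letR 57 (.cell 211 (V 56)) ;;
    push (V 57) (RV 57) (.const 0))

theorem run_appendCmd {s : Store n} {l as : List (Item n)} (hs : Stored s as) (hl : Items s l) :
    Run orc appendCmd s (8 * as.length + 2) fun s' => Items s' (l ++ as) ∧ Keep 56 s s' ∧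
      ∀ a, 202 < a → s'.nat a = s.nat a ∧ s'.real a = s.real a := by
  refine Run.mono (post := fun s' => Items s' (l ++ as) ∧ Frame appendCmd s s') (Run.frame ?_)
    le_rfl fun s' hs' => ⟨hs'.1, hs'.2.keep (by decide) rfl, fun a ha => hs'.2.1 a (Or.inr
      (lt_of_le_of_lt (by decide) ha))⟩
  refine (Run.simple_seq rfl ((run_forTo (fun m s' => m ≤ as.length ∧ Items s' (l ++ as.take m) ∧
    ∀ a, 202 < a → s'.nat a = s.nat a ∧ s'.real a = s.real a) (fun _ => 6) (k := as.length) (k0 := 0)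
    (Nat.zero_le _) (by decide) ?_ ?_ ?_ ?_).mono le_rfl fun s' hs' => ?_)).mono ?_ fun _ h => h
  · rintro m s' ⟨-, -, h⟩ -
    simp [V, NExp.eval, (h 212 (by decide)).1, hs.1]
  · rintro m - hm s' ⟨-, h1, h2⟩ h56
    obtain ⟨g1, g2, g3⟩ := (hs.congr h2).2 m hm
    refine (Run.simple_seq rfl (Run.simple_seq rfl (T := 4) ?_)).mono (by simp [Cmd.size, letN, letR])
      fun _ h => h
    have hs1 : sem (letR 57 (.cell 211 (V 56))) (sem (letN 57 (.cell 211 (V 56))) s')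
        = (s'.setN 57 0 (code as[m].P)).setR 57 0 as[m].amp := by
      simp [sem, letN, letR, NExp.eval, RExp.eval, V, h56, g1, g2]
    rw [hs1]
    set s1 := (s'.setN 57 0 (code as[m].P)).setR 57 0 as[m].amp with hs1'
    have hr : ∀ a, 90 ≤ a → s1.nat a = s'.nat a ∧ s1.real a = s'.real a := fun a ha =>
      ⟨by rw [hs1']; exact setN_nat_row (by omega), by rw [hs1', setR_real_row (by omega)]; rfl⟩
    refine (run_push (e := as[m]) fun s2 k2 => ⟨?_, ?_, ?_⟩).frame.mono le_rfl fun s2 hs2 => ?_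
    · simp [NExp.eval, V, k2.nat 57 (by decide), hs1']
    · simp [NExp.eval, RExp.eval, RV, k2.real 57 (by decide), hs1']
    · simp [NExp.eval, g3]
    · obtain ⟨⟨happ, k2⟩, hf⟩ := hs2
      have l1 : Items s1 (l ++ as.take m) := h1.congr (fun a ha => (hr a ha).1) (hr 200 (by decide)).2
      refine ⟨hm, ?_, fun a ha => ?_⟩
      · rw [List.take_succ_eq_append_getElem hm, ← List.append_assoc]
        exact (l1.appends happ (by rw [k2.nat 92 (by decide)])).setN (by decide)
      · have hlast := hf.1 a (Or.inr (lt_of_le_of_lt (by decide) ha))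
        rw [setN_nat_row (by omega), hlast.1, (hr a (by omega)).1, (h2 a ha).1, setN_real, hlast.2,
          (hr a (by omega)).2, (h2 a ha).2]
        exact ⟨rfl, rfl⟩
  · refine ⟨Nat.zero_le _, ?_, fun a ha => ?_⟩
    · rw [List.take_zero, List.append_nil]; exact hl.setN (by decide)
    · simp only [sem, letN]
      rw [setN_nat_row (by omega)]
      exact ⟨rfl, rfl⟩
  · simp [sem, letN, NExp.eval]
  · have := hs'.1.2.1
    rwa [List.take_length] at this
  · simp [Cmd.size, letN]; omega

/-- Follow Pauli paths backwards from the stored items. -/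
def traceCmd : Cmd :=
  letN 44 (.const 0) ;; letN 43 (.const 0) ;;
    forTo 43 depthExp (layerCmd ;; appendCmd ;; letN 44 (.add (V 44) nExp))

/-- The seeds join the list at the start and once per layer, hence the factor d + 1 in the bound on
the potential. -/
theorem run_traceCmd {s : Store n} {L : List (Layer n)} {q ε : ℝ} {S : List (Item n)} {W B : ℕ}
    (h : Input s L q ε) (hp : Powers s) (hW : s.nat 42 0 = W) (hS : Stored s S) (hl : Items s S)
    (hB : (L.length + 1) * listPotential W S ≤ B) :
    Run orc traceCmd s (L.length * ((n + 1) * (B * (24 * n + 82) + 8) + 8 * B + 5) + 3) fun s' =>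
      Items s' (traceBack q W S S L) ∧ Keep 43 s s' := by
  have hSB : S.length ≤ B := (length_le_listPotential W S).trans
    (le_trans (Nat.le_mul_of_pos_left _ (Nat.succ_pos _)) hB)
  refine (Run.simple_seq rfl (Run.simple_seq rfl ((run_forTo (fun m s' => s'.nat 44 0 = m * n ∧
    Items s' (traceBack q W S S (L.take m)) ∧ Keep 43 s s' ∧ Stored s' S)
    (fun _ => (n + 1) * (B * (24 * n + 82) + 8) + 8 * B + 3) (k := L.length) (k0 := 0) (Nat.zero_le _)
    (Or.inl (by decide)) ?_ ?_ ?_ ?_).mono le_rfl fun s' hs' => ?_))).mono ?_ fun _ h => h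
  · rintro m s' ⟨-, -, hk, -⟩ -
    simp only [depthExp, NExp.eval, hk.nat 0 (by decide)]; exact h.depth
  · rintro m - hm s' ⟨h1, h2, k1, h3⟩ h43
    have hin := h.keep k1 (by decide)
    have e42 : s'.nat 42 0 = W := by rw [k1.nat 42 (by decide), hW]
    have hpot : listPotential W (traceBack q W S S (L.take m)) ≤ B := by
      refine (listPotential_traceBack_le q W S _ S).trans (le_trans ?_ hB)
      rw [List.length_take, min_eq_left hm.le, add_mul, one_mul, add_comm]
      exact Nat.add_le_add_right (Nat.mul_le_mul_right _ hm.le) _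
    have hrun := run_layerCmd (orc := orc) (s := s') (l := traceBack q W S S (L.take m)) L[m] (B := B)
      hin.size (hp.keep k1 (by decide)) (by rw [h1]; exact hin.layer m hm) h2
      ((length_le_listPotential W _).trans hpot)
      (fun i hi => by rw [e42]; exact (length_gatesUpTo_le _ _ W _ hi).trans hpot)
    rw [e42, hin.damp] at hrun
    refine (Run.seq hrun.frame (T' := 8 * B + 3) fun s2 ⟨⟨l2, k2⟩, f2⟩ => ?_).mono (by omega) fun _ h => h
    have hS2 : Stored s2 S := h3.congr fun a ha => f2.1 a (Or.inr (lt_of_le_of_lt (by decide) ha))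
    refine (Run.seq (run_appendCmd hS2 l2) (T' := 1) fun s3 ⟨l3, k3, f3⟩ => ?_).mono (by omega)
      fun _ h => h
    have k03 : Keep 43 s s3 := (k1.trans (k2.mono (by decide))).trans (k3.mono (by decide))
    refine (run_simple rfl s3).mono le_rfl ?_
    rintro s4 rfl
    have hs4 : sem (letN 44 (.add (V 44) nExp)) s3 = s3.setN 44 0 ((m + 1) * n) := by
      simp [sem, letN, NExp.eval, V, nExp, k3.nat 44 (by decide), k2.nat 44 (by decide), h1,
        k03.nat 0 (by decide), h.size]
      ring_nf
    rw [hs4]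
    refine ⟨by simp, ?_, (k03.setN (by decide)).setN le_rfl, ?_⟩
    · rw [List.take_succ_eq_append_getElem hm, traceBack, List.foldl_append]
      exact (l3.setN (by decide)).setN (by decide)
    · refine (hS2.congr f3).congr fun a ha => ?_
      rw [setN_nat_row (by omega), setN_nat_row (by omega)]
      exact ⟨rfl, rfl⟩
  · refine ⟨by simp [sem, letN, NExp.eval], ?_, ((Keep.refl _ _).setN (by decide)).setN le_rfl, ?_⟩
    · exact (hl.setN (by decide)).setN (by decide)
    · refine hS.congr fun a ha => ?_
      simp only [sem, letN]
      rw [setN_nat_row (by omega), setN_nat_row (by omega)]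
      exact ⟨rfl, rfl⟩
  · simp [sem, letN, NExp.eval]
  · obtain ⟨⟨-, h2, h3, -⟩, -⟩ := hs'
    rw [List.take_length] at h2
    exact ⟨h2, h3⟩
  · simp [Cmd.size, letN]; ring_nf; omega

/-- Query the Pauli string of the current item, unless it has been stored before. -/
def collectBody : Cmd :=
  loadItem ;;
  .ite (.natLe (.add (.sub (.add (.cell 210 (V 114)) (.const 1)) (V 212))
      (.add (.sub (.cell 211 (.cell 210 (V 114))) (V 114))
        (.sub (V 114) (.cell 211 (.cell 210 (V 114)))))) (.const 0)) .skip
    (.query 100 211 (V 212) ;; .setNat 210 (V 114) (V 212) ;; .setNat 211 (V 212) (V 114) ;;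
      letN 212 (.add (V 212) (.const 1)))

/-- The Pauli strings `C` and their coefficients have been stored. -/
structure Collected (orc : PauliString n → ℝ) (s : Store n) (C : List (PauliString n)) : Prop where
  length : s.nat 212 0 = C.length
  at' : ∀ k (hk : k < C.length), s.nat 211 k = code C[k] ∧ s.real 211 k = orc C[k] ∧
    s.nat 210 (code C[k]) = k

theorem Collected.congr {s s' : Store n} {C : List (PauliString n)} (h : Collected orc s C)
    (h' : ∀ a, 202 < a → s'.nat a = s.nat a ∧ s'.real a = s.real a) : Collected orc s' C := by
  constructor
  · rw [(h' 212 (by decide)).1]; exact h.length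
  · rw [(h' 211 (by decide)).1, (h' 211 (by decide)).2, (h' 210 (by decide)).1]
    exact h.at'

/-- A sparse set: array 210 sends a code to a position and array 211 sends positions back to codes.
A string is present iff its position is below the current length and points back to its code. This
is correct for any initial contents of array 210, so the table never has to be cleared. -/
theorem run_collectBody {s : Store n} {e : Item n} {C : List (PauliString n)} (hn : s.nat 0 0 = n)
    (hp : Powers s) (hC : Collected orc s C) (he : ItemAt s (s.nat 90 0) e) :
    Run orc collectBody s (25 * n + 13) fun s' =>
      Collected orc s' (if e.P ∈ C then C else C ++ [e.P]) ∧ Appends s s' [] := by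
  refine (Run.seq (run_loadItem hn hp he) (T' := n + 5) ?_).mono (by omega) fun _ h => h
  rintro s1 ⟨hd, hk, hr⟩
  have hC1 := hC.congr (s' := s1) fun a ha => hr a (by omega)
  have h114 := hd.code
  by_cases hmem : e.P ∈ C
  · rw [if_pos hmem]
    obtain ⟨k, hk, hkC⟩ := List.getElem_of_mem hmem
    obtain ⟨g1, -, g3⟩ := hC1.at' k hk
    rw [hkC] at g1 g3
    refine (Run.ite (T := n + 4) (fun _ => ⟨s1, 1, .skip _, by omega, hC1, .nil hr⟩) fun h => absurd ?_ h)
    simp only [Test.holds, NExp.eval, V, h114, g3, g1, hC1.length]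
    omega
  · rw [if_neg hmem]
    refine Run.ite (T := n + 4) (fun h => absurd ?_ hmem) fun _ => ?_
    · simp only [Test.holds, NExp.eval, V, h114, hC1.length] at h
      have hlt : s1.nat 210 (code e.P) < C.length := by omega
      have heq : s1.nat 211 (s1.nat 210 (code e.P)) = code e.P := by omega
      rw [(hC1.at' _ hlt).1] at heq
      rw [← code_injective heq]
      exact List.getElem_mem _
    · have hP : readPauli n (s1.nat 100) = e.P := readPauli_label hd.dec
      refine ⟨_, _, .seq (.query s1 100 211 (V 212)) (.seq (.setNat _ _ _ _) (.seq (.setNat _ _ _ _)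
        (.setNat _ _ _ _))), ?_, ?_⟩
      · have := weight_le (readPauli n (s1.nat 100)); omega
      · have hlen := hC1.length
        have hs' : ∀ s' : Store n, s' = ((((s1.setR 211 C.length (orc e.P)).setN 210 (code e.P) C.length).setN
            211 C.length (code e.P)).setN 212 0 (C.length + 1)) →
            Collected orc s' (C ++ [e.P]) ∧ Appends s s' [] := by
          rintro s' rfl
          refine ⟨⟨by simp, fun k hk => ?_⟩, ?_⟩
          · rcases Nat.lt_or_ge k C.length with hkl | hkl
            · rw [List.getElem_append_left hkl]
              obtain ⟨g1, g2, g3⟩ := hC1.at' k hkl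
              have hne : code C[k] ≠ code e.P := fun h => hmem (code_injective h ▸ List.getElem_mem _)
              simp [g1, g2, g3, hne, hkl.ne]
            · have : k = C.length := by simp at hk; omega
              subst this
              simp
          · have h0 : Appends s s1 [] := .nil hr
            refine ⟨?_, fun k hk => absurd hk (by simp), fun k hk => ?_⟩
            · simpa using h0.hi
            · simpa using h0.old k hk
        refine hs' _ ?_
        simp only [V, NExp.eval, hP]
        simp [Store.setR, Store.setN, setCell, hlen, h114]

/-- Query the Pauli strings of the current items. -/
def collectCmd : Cmd := letN 212 (.const 0) ;; forItems collectBody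

theorem run_collectCmd {s : Store n} {l : List (Item n)} (hn : s.nat 0 0 = n) (hp : Powers s)
    (hl : Items s l) :
    Run orc collectCmd s (l.length * (25 * n + 15) + 5) fun s' =>
      Stored s' ((collect l).map fun P => ⟨P, orc P, 0⟩) ∧ Keep 90 s s' := by
  refine Run.mono (post := fun s' => Collected orc s' (collect l) ∧ Keep 90 s s') (Run.keep ?_ (by decide)
    (by decide)) le_rfl fun s' hs' => ⟨⟨by simpa using hs'.1.length, fun k hk => ?_⟩, hs'.2⟩
  rotate_left
  · have hk' : k < (collect l).length := by simpa using hk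
    have := hs'.1.at' k hk'
    simpa using ⟨this.1, this.2.1⟩
  refine (Run.simple_seq rfl ((run_forItems (by decide) (l := l) ?_ (fun _ => []) (fun p s' =>
    s'.nat 0 0 = n ∧ Powers s' ∧ Collected orc s' (collect p)) (25 * n + 13) ?_ ?_ ?_).mono le_rfl
    fun s' hs' => hs'.2.2.2)).mono ?_ fun _ h => h
  · refine ⟨?_, ?_⟩
    · intro k hk
      have := hl.1 k hk
      simpa [sem, letN, ItemAt] using this
    · simpa [sem, letN] using hl.2
  · refine ⟨by simpa [sem, letN] using hn, fun j hj => by simpa [sem, letN] using hp j hj,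
      ⟨by simp [sem, letN, NExp.eval, collect], fun k hk => absurd hk (by simp [collect])⟩⟩
  · rintro p s1 s2 ⟨h1, h2, h3⟩ h4 h5 h6
    refine ⟨by rw [h4 0 (by omega)]; exact h1, fun j hj => ?_, h3.congr fun a ha => ⟨h4 a (by omega), by rw [h5]⟩⟩
    rw [h4 40 (by omega)]; exact h2 j hj
  · rintro p e s1 - ⟨h1, h2, h3⟩ he
    refine ((run_collectBody h1 h2 h3 he).keep (b := 90) (by decide) (by decide)).mono le_rfl
      fun s2 ⟨⟨g1, g2⟩, g3⟩ => ⟨g2, ?_, fun j hj => ?_, ?_⟩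
    · rw [g3.nat 0 (by decide), h1]
    · rw [g3.nat 40 (by decide)]; exact h2 j hj
    · rw [collect_append]; exact g1
  · have : 25 * n + 13 + 2 = 25 * n + 15 := rfl
    rw [this]
    simp [Cmd.size, letN]; omega

/-- Make the list of items for an input state that is accessible through queries. -/
def queryCmd : Cmd :=
  quotientCmd ;; seedsCmd ;; storeCmd ;; clearCmd ;; appendCmd ;; traceCmd ;; forItems noiseBody ;;
    collectCmd ;; clearCmd ;; appendCmd

theorem run_queryCmd {s : Store n} {L : List (Layer n)} {q ε : ℝ} {W N : ℕ} (h : Input s L q ε)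
    (hp : Powers s) (hW : s.nat 42 0 = W)
    (hN : ∀ m ≤ n, (seedItems (W / (L.length + 1)) m : List (Item n)).length ≤ N) :
    (backItems q W L).length ≤ (L.length + 1) * (N * 16 ^ W) ∧
    Run orc queryCmd s (3 * W + 500 * (L.length + 1) * (n + 1) ^ 2 * ((L.length + 1) * (N * 16 ^ W) + 1))
      fun s' => Items s' ((collect (backItems q W L)).map fun P => ⟨P, orc P, 0⟩) ∧ Keep 43 s s' := by
  set K := W / (L.length + 1) with hK
  set B := (L.length + 1) * (N * 16 ^ W) with hBdef
  have hpotS : (L.length + 1) * listPotential W (seedList n K) ≤ B := by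
    rw [listPotential_seedList]
    exact Nat.mul_le_mul_left _ (Nat.mul_le_mul_right _ (hN n le_rfl))
  have hNB : N ≤ B := by
    have h1 : 1 ≤ 16 ^ W := Nat.one_le_pow _ _ (by norm_num)
    calc N ≤ N * 16 ^ W := Nat.le_mul_of_pos_right _ h1
      _ ≤ B := Nat.le_mul_of_pos_left _ (Nat.succ_pos _)
  have htr : (traceBack q W (seedList n K) (seedList n K) L).length ≤ B := by
    refine (length_le_listPotential W _).trans ((listPotential_traceBack_le q W _ _ _).trans
      (le_trans (le_of_eq ?_) hpotS))
    ring
  have hback : (backItems q W L).length ≤ B := (length_noise_le q W _).trans htr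
  refine ⟨hback, ?_⟩
  refine (Run.seq (T' := (n * (N * 23 + 6) + 8) + ((4 * N + 3) + (2 + ((8 * N + 2) + ((L.length * ((n + 1) *
    (B * (24 * n + 82) + 8) + 8 * B + 5) + 3) + ((B * (24 * n + 15) + 4) + ((B * (25 * n + 15) + 5) +
    (2 + (8 * B + 2))))))))) (run_quotientCmd h.depth hW) fun s1 ⟨e1, k1⟩ => ?_).mono ?_ fun _ h => h
  · have e1 : s1.nat 55 0 = K := e1
    have i1 := h.keep k1 (by decide)
    have hlen := hN n le_rfl
    refine (run_seedsCmd i1.size (hp.keep k1 (by decide)) e1 hN).seq fun s2 ⟨l2, k2⟩ => ?_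
    refine Run.seq ((run_storeCmd l2).mono (by omega) fun _ h => h) fun s3 ⟨l3, k3⟩ => ?_
    have l3 : Stored s3 (seedList n K) := l3
    have k03 : Keep 43 s s3 := ((k1.mono (by decide)).trans (k2.mono (by decide))).trans (k3.mono (by decide))
    refine (run_clearCmd s3).seq fun s4 ⟨l4, k4, f4⟩ => ?_
    have hlen' : (seedList n K).length ≤ N := by simpa [seedList] using hlen
    refine Run.seq ((run_appendCmd (l3.congr f4) l4).mono (by omega) fun _ h => h) fun s5 ⟨l5, k5, f5⟩ => ?_
    have k05 : Keep 43 s s5 := (k03.trans (k4.mono (by decide))).trans (k5.mono (by decide))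
    refine (run_traceCmd (h.keep k05 (by decide)) (hp.keep k05 (by decide))
      (by rw [k05.nat 42 (by decide), hW]) ((l3.congr f4).congr f5) l5 hpotS).seq fun s6 ⟨l6, k6⟩ => ?_
    have k06 := k05.trans k6
    have i6 := h.keep k06 (by decide)
    have hnoise := run_noiseItems (orc := orc) i6.size (hp.keep k06 (by decide)) l6
    rw [i6.damp, k06.nat 42 (by decide), hW] at hnoise
    refine Run.seq (hnoise.mono (Nat.add_le_add_right (Nat.mul_le_mul_right _ htr) _) fun _ h => h)
      fun s7 ⟨l7, k7⟩ => ?_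
    have l7 : Items s7 (backItems q W L) := l7
    have k07 := k06.trans (k7.mono (by decide))
    refine Run.seq ((run_collectCmd (h.keep k07 (by decide)).size (hp.keep k07 (by decide)) l7).mono
      (Nat.add_le_add_right (Nat.mul_le_mul_right _ hback) _) fun _ h => h) fun s8 ⟨l8, k8⟩ => ?_
    refine (run_clearCmd s8).seq fun s9 ⟨l9, k9, f9⟩ => ?_
    have hcol : ((collect (backItems q W L)).map fun P => (⟨P, orc P, 0⟩ : Item n)).length ≤ B := by
      rw [List.length_map]; exact (length_collect_le _).trans hback
    refine (run_appendCmd (l8.congr f9) l9).mono (by omega) fun s10 ⟨l10, k10, _⟩ => ⟨l10, ?_⟩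
    exact ((k07.trans (k8.mono (by decide))).trans (k9.mono (by decide))).trans (k10.mono (by decide))
  · have h1 : n * (N * 23 + 6) ≤ n * (23 * B + 6) := Nat.mul_le_mul_left _ (by omega)
    have h2 : (n + 1) * (B * (24 * n + 82) + 8) + 8 * B + 5 ≤ 100 * ((n + 1) ^ 2 * (B + 1)) := by
      nlinarith [Nat.zero_le (n * B), Nat.zero_le (n ^ 2 * B), Nat.zero_le n, Nat.zero_le B]
    have h3 := Nat.mul_le_mul_left L.length h2
    have h4 : n * (23 * B + 6) + B * (24 * n + 15) + B * (25 * n + 15) + 20 * B + 40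
        ≤ 200 * ((n + 1) ^ 2 * (B + 1)) := by
      nlinarith [Nat.zero_le (n * B), Nat.zero_le (n ^ 2 * B), Nat.zero_le n, Nat.zero_le B]
    have h5 : 500 * (L.length + 1) * (n + 1) ^ 2 * (B + 1) = L.length * (100 * ((n + 1) ^ 2 * (B + 1)))
      + L.length * (400 * ((n + 1) ^ 2 * (B + 1))) + 500 * ((n + 1) ^ 2 * (B + 1)) := by ring
    rw [h5]
    omega

end query

/-! ### Running times for uniform noise -/

/-- Put M = log(1/ε) and Λ = log(1/γ). In the shallow case d + 1 ≤ M/γ, and minimality of the cutoff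
gives W ≤ 1 + (2/γ)(M + (d+1)(2 + Λ)). This is O(1 + MΛ/γ²); after division by d + 1 it is O(Λ/γ +
M/(γd)). Terms without Λ are absorbed because Λ ≥ log(1/γ₀) > 0, and this is why the constant
depends on γ₀. -/
theorem uniform_estimates {γ₀ : ℝ} (h₀ : γ₀ < 1) : ∃ C : ℝ, 1 ≤ C ∧ ∀ (γ ε : ℝ) (d : ℕ), 0 < γ → γ ≤ γ₀ →
    0 < ε → ε ≤ 1 →
    0 ≤ Real.log (1 / γ) / γ ^ 2 ∧ 1 ≤ C * (Real.log (1 / γ) / γ) ∧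
    (∀ k : ℕ, (∀ m < k, ε ≤ Real.exp (-γ) ^ m) →
      (k : ℝ) ≤ C * (1 / ε) ^ (C * (Real.log (1 / γ) / γ ^ 2))) ∧
    (ε < Real.exp (-γ) ^ (d + 1) → (d + 1 : ℝ) ≤ C * (1 / ε) ^ (C * (Real.log (1 / γ) / γ ^ 2)) ∧
      ∀ W : ℕ, (∀ m < W, ε ≤ (2 * Real.exp (-γ) / (1 + Real.exp (-γ))) ^ m *
        (2 / (1 - Real.exp (-γ))) ^ (d + 1)) →
        (16 : ℝ) ^ W ≤ C * (1 / ε) ^ (C * (Real.log (1 / γ) / γ ^ 2)) ∧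
        (1 ≤ d → ((W / (d + 1) : ℕ) : ℝ) ≤ C * (Real.log (1 / γ) / γ) +
          C * (Real.log (1 / ε) / (γ * d)))) := by
  -- For γ₀ ≤ 0 no γ is admissible.
  rcases le_or_gt γ₀ 0 with hneg | hpos
  · exact ⟨1, le_rfl, fun γ ε d h1 h2 => by linarith⟩
  set lam := Real.log (1 / γ₀) with hlam
  have hlam0 : 0 < lam := Real.log_pos (by rw [one_lt_div hpos]; exact h₀)
  set c := 1 / lam with hc
  have hc0 : 0 < c := by positivity
  have he3 : 1 ≤ Real.exp 3 := Real.one_le_exp (by norm_num)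
  -- The exponent 18c + 6 is 3 times 6c + 2, the coefficient in the bound for W, as 16 is replaced
  -- by e³; the summand e³ takes care of the 1 in that bound.
  set C := Real.exp 3 + 18 * c + 6 with hC
  have hC1 : 1 ≤ C := by linarith
  refine ⟨C, hC1, fun γ ε d hγ hγ0 hε hε1 => ?_⟩
  have hγ1 : γ < 1 := by linarith
  set q := Real.exp (-γ) with hq
  have hq0 : 0 < q := Real.exp_pos _
  have hq1 : q < 1 := by rw [hq, Real.exp_lt_one_iff]; linarith
  set M := Real.log (1 / ε) with hM
  have hM0 : 0 ≤ M := Real.log_nonneg (by rw [le_div_iff₀ hε]; linarith)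
  have hlogε : Real.log ε = -M := by rw [hM, one_div, Real.log_inv, neg_neg]
  set Λ := Real.log (1 / γ) with hΛ
  have hΛlam : lam ≤ Λ := Real.log_le_log (by positivity) (one_div_le_one_div_of_le hγ hγ0)
  have hΛ0 : 0 < Λ := hlam0.trans_le hΛlam
  have hcΛ : 1 ≤ c * Λ := by rw [hc, one_div, inv_mul_eq_div, one_le_div hlam0]; exact hΛlam
  have hγinv : 1 ≤ 1 / γ := by rw [le_div_iff₀ hγ]; linarith
  set X := Λ / γ ^ 2 * M with hX
  have hX0 : 0 ≤ X := by positivity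
  have hpow : ∀ a : ℝ, (1 / ε) ^ (a * (Λ / γ ^ 2)) = Real.exp (a * X) := by
    intro a
    rw [Real.rpow_def_of_pos (by positivity), ← hM, hX]
    congr 1; ring
  have hM2 : M / γ ^ 2 ≤ c * X := by
    have : c * X = (c * Λ) * (M / γ ^ 2) := by rw [hX]; ring
    rw [this]
    exact le_mul_of_one_le_left (by positivity) hcΛ
  have hM1 : M / γ ≤ c * X := by
    refine le_trans ?_ hM2
    have : M / γ ^ 2 = 1 / γ * (M / γ) := by field_simp
    rw [this]
    exact le_mul_of_one_le_left (by positivity) hγinv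
  have hinv : 1 / γ ≤ c * (Λ / γ) := by
    have : c * (Λ / γ) = (c * Λ) * (1 / γ) := by ring
    rw [this]
    exact le_mul_of_one_le_left (by positivity) hcΛ
  have hmono : ∀ a : ℝ, a ≤ C → Real.exp (a * X) ≤ C * Real.exp (C * X) := fun a ha =>
    (Real.exp_le_exp.2 (mul_le_mul_of_nonneg_right ha hX0)).trans
      (le_mul_of_one_le_left (Real.exp_pos _).le hC1)
  have hcC : c ≤ C := by linarith
  have hlogpow : ∀ m : ℕ, ε ≤ q ^ m → (m : ℝ) * γ ≤ M := by
    intro m hm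
    have := Real.log_le_log hε hm
    rw [Real.log_pow, hq, Real.log_exp, hlogε] at this
    linarith
  refine ⟨by positivity, ?_, ?_, ?_⟩
  · refine (hγinv.trans hinv).trans (mul_le_mul_of_nonneg_right hcC (by positivity))
  · intro k hk
    rw [hpow]
    refine le_trans ?_ (hmono c hcC)
    rcases k with _ | k
    · simpa using (Real.exp_pos _).le
    · have h1 := hlogpow k (hk k (Nat.lt_succ_self k))
      have h2 : (k : ℝ) ≤ M / γ := by rwa [le_div_iff₀ hγ]
      have := Real.add_one_le_exp (c * X)
      push_cast; linarith
  · intro hd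
    have hdM : ((d : ℝ) + 1) * γ ≤ M := by
      have := hlogpow (d + 1) hd.le
      push_cast at this; exact this
    have hdM' : (d : ℝ) + 1 ≤ M / γ := by rwa [le_div_iff₀ hγ]
    refine ⟨?_, ?_⟩
    · rw [hpow]
      refine le_trans ?_ (hmono c hcC)
      have := Real.add_one_le_exp (c * X)
      linarith
    · intro W hW
      -- With s = e^(-γ/2) this is 2s² ≤ s(1 + s²), that is (s - 1)² ≥ 0.
      have hβ : Real.log (2 * q / (1 + q)) ≤ -(γ / 2) := by
        rw [Real.log_le_iff_le_exp (by positivity), div_le_iff₀ (by positivity)]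
        set s := Real.exp (-(γ / 2)) with hs
        have hqs : q = s * s := by rw [hq, hs, ← Real.exp_add]; congr 1; ring
        have hs0 : 0 < s := Real.exp_pos _
        rw [hqs]
        nlinarith [mul_nonneg hs0.le (sq_nonneg (s - 1))]
      -- From 1 - e^(-γ) ≥ γ/2 for γ ≤ 1 one gets 2/(1-q) ≤ 4/γ, and log 4 ≤ 2.
      have hκ : Real.log (2 / (1 - q)) ≤ 2 + Λ := by
        have h1 : γ / 2 ≤ 1 - q := by
          have h2 := Real.add_one_le_exp γ
          have h3 : q ≤ 1 / (1 + γ) := by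
            rw [hq, Real.exp_neg, one_div]
            exact inv_anti₀ (by linarith) (by linarith)
          have h4 : 1 / (1 + γ) ≤ 1 - γ / 2 := by
            rw [div_le_iff₀ (by linarith)]; nlinarith
          linarith
        have h2 : 2 / (1 - q) ≤ 4 * (1 / γ) := by
          rw [div_le_iff₀ (by linarith)]
          have h3 := mul_le_mul_of_nonneg_left h1 (by positivity : 0 ≤ 4 * (1 / γ))
          have h4 : 4 * (1 / γ) * (γ / 2) = 2 := by field_simp; norm_num
          linarith
        refine (Real.log_le_log (div_pos (by norm_num) (by linarith)) h2).trans ?_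
        rw [Real.log_mul (by norm_num) (by positivity)]
        have h3 : Real.log 4 ≤ 2 := by
          rw [show (4 : ℝ) = 2 ^ 2 by norm_num, Real.log_pow]
          have := Real.log_two_lt_d9
          push_cast; linarith
        linarith
      have hWle : (W : ℝ) ≤ 1 + 2 / γ * (M + (d + 1) * (2 + Λ)) := by
        rcases W with _ | W
        · push_cast; positivity
        · have h1 := Real.log_le_log hε (hW W (Nat.lt_succ_self W))
          rw [Real.log_mul (by positivity) (pow_pos (div_pos (by norm_num) (by linarith)) _).ne',
            Real.log_pow, Real.log_pow, hlogε] at h1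
          have h2 := mul_le_mul_of_nonneg_left hβ (Nat.cast_nonneg (α := ℝ) W)
          have h3 := mul_le_mul_of_nonneg_left hκ (Nat.cast_nonneg (α := ℝ) (d + 1))
          push_cast at h1 h3 ⊢
          have h4 : (W : ℝ) * (γ / 2) ≤ M + (d + 1) * (2 + Λ) := by linarith
          have h5 : (W : ℝ) ≤ (M + (d + 1) * (2 + Λ)) / (γ / 2) := by rwa [le_div_iff₀ (by positivity)]
          have h6 : (M + (d + 1) * (2 + Λ)) / (γ / 2) = 2 / γ * (M + (d + 1) * (2 + Λ)) := by field_simp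
          linarith
      refine ⟨?_, fun hd1 => ?_⟩
      · rw [hpow]
        have h1 : (W : ℝ) ≤ 1 + (6 * c + 2) * X := by
          have h2 : 2 / γ * ((d + 1) * (2 + Λ)) ≤ 2 / γ * (M / γ * (2 + Λ)) := by gcongr
          have h3 : 2 / γ * (M / γ * (2 + Λ)) = 4 * (M / γ ^ 2) + 2 * X := by
            rw [hX]; field_simp; ring
          have h4 : 2 / γ * M = 2 * (M / γ) := by ring
          have h5 : 2 / γ * (M + (d + 1) * (2 + Λ)) = 2 / γ * M + 2 / γ * ((d + 1) * (2 + Λ)) := by ring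
          linarith
        calc (16 : ℝ) ^ W ≤ Real.exp 3 ^ W := by
              refine pow_le_pow_left₀ (by norm_num) ?_ W
              have h2 := Real.exp_one_gt_d9
              have h3 : Real.exp 3 = Real.exp 1 ^ 3 := by rw [← Real.exp_nat_mul]; norm_num
              rw [h3]
              nlinarith [pow_le_pow_left₀ (by norm_num) h2.le 3]
          _ = Real.exp (3 * W) := by rw [← Real.exp_nat_mul]; ring_nf
          _ ≤ Real.exp (3 + (18 * c + 6) * X) := by
              apply Real.exp_le_exp.2; linarith
          _ = Real.exp 3 * Real.exp ((18 * c + 6) * X) := Real.exp_add _ _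
          _ ≤ C * Real.exp (C * X) := by
              refine mul_le_mul (by linarith) (Real.exp_le_exp.2 ?_) (Real.exp_pos _).le (by linarith)
              exact mul_le_mul_of_nonneg_right (by linarith) hX0
      · have hd1' : (1 : ℝ) ≤ d := by exact_mod_cast hd1
        have h1 : ((W / (d + 1) : ℕ) : ℝ) ≤ W / (d + 1) := by
          have := Nat.cast_div_le (α := ℝ) (m := W) (n := d + 1)
          push_cast at this; exact this
        have h2 : (W : ℝ) / (d + 1) ≤ (1 + 2 / γ * (M + (d + 1) * (2 + Λ))) / (d + 1) := by gcongr
        have h3 : (1 + 2 / γ * (M + (d + 1) * (2 + Λ))) / (d + 1)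
            = 1 / (d + 1) + 2 * (M / (γ * (d + 1))) + 4 * (1 / γ) + 2 * (Λ / γ) := by field_simp; ring
        have h4 : 1 / ((d : ℝ) + 1) ≤ 1 / γ := by
          refine one_div_le_one_div_of_le hγ (by linarith)
        have h5 : M / (γ * (d + 1)) ≤ M / (γ * d) := by
          refine div_le_div_of_nonneg_left hM0 (by positivity) ?_
          exact mul_le_mul_of_nonneg_left (by linarith) hγ.le
        have h6 : 0 ≤ M / (γ * d) := by positivity
        have h7 : 0 ≤ Λ / γ := by positivity
        have h8 : (5 * c + 2) * (Λ / γ) ≤ C * (Λ / γ) := mul_le_mul_of_nonneg_right (by linarith) h7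
        have h9 : 2 * (M / (γ * d)) ≤ C * (M / (γ * d)) := mul_le_mul_of_nonneg_right (by linarith) h6
        rw [h3] at h2
        linarith

theorem terms_time_le {n m E Z W d : ℝ} (hn : 1 ≤ n) (hm : 1 ≤ m) (hE1 : 1 ≤ E) (hZ0 : 0 ≤ Z)
    (hd1 : d + 1 ≤ E) (hZ : Z ≤ E) (hWZ : W ≤ Z) :
    m * (12 * n + 9) + 5 + 200 * (d + 1) * (n + 1) ^ 2 * (m * Z + 1) + 6 * d + 3 * n + 3 * W + 20
      ≤ 2000 * (n * m) ^ 2 * E ^ 2 := by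
  have hnm : n ≤ n * m := le_mul_of_one_le_right (by linarith) hm
  have hmu : m ≤ n * m := le_mul_of_one_le_left (by linarith) hn
  have hnm1 : 1 ≤ n * m := hn.trans hnm
  have hE2 : E ≤ E ^ 2 := le_self_pow₀ hE1 (by norm_num)
  have hu2 : n * m ≤ (n * m) ^ 2 := le_self_pow₀ hnm1 (by norm_num)
  have hE21 : 1 ≤ E ^ 2 := one_le_pow₀ hE1
  have hu21 : 1 ≤ (n * m) ^ 2 := one_le_pow₀ hnm1
  have t1 : m * (12 * n + 9) + 5 ≤ 26 * (n * m) := by linarith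
  have t2 : 200 * (d + 1) * (n + 1) ^ 2 * (m * Z + 1) ≤ 200 * E * (4 * n ^ 2) * (2 * (m * E)) := by
    have e1 : (n + 1) ^ 2 ≤ 4 * n ^ 2 := by nlinarith
    have e2 : m * Z + 1 ≤ 2 * (m * E) := by
      have := mul_le_mul_of_nonneg_left hZ (by linarith : 0 ≤ m)
      have := one_le_mul_of_one_le_of_one_le hm hE1
      linarith
    gcongr
  have t3 : 200 * E * (4 * n ^ 2) * (2 * (m * E)) ≤ 1600 * ((n * m) ^ 2 * E ^ 2) := by
    have e1 : (n * m) ^ 2 * E ^ 2 = (n ^ 2 * m * E ^ 2) * m := by ring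
    have e2 : 200 * E * (4 * n ^ 2) * (2 * (m * E)) = 1600 * (n ^ 2 * m * E ^ 2) := by ring
    rw [e1, e2]
    have := le_mul_of_one_le_right (by positivity : 0 ≤ n ^ 2 * m * E ^ 2) hm
    linarith
  have t4 : n * m ≤ (n * m) ^ 2 * E ^ 2 := hu2.trans (le_mul_of_one_le_right (by positivity) hE21)
  have t5 : E ≤ (n * m) ^ 2 * E ^ 2 := hE2.trans (le_mul_of_one_le_left (by positivity) hu21)
  have t6 : 1 ≤ (n * m) ^ 2 * E ^ 2 := hE1.trans t5
  linarith

theorem uniform_terms : ∃ prog : Cmd, ∀ γ₀ : ℝ, γ₀ < 1 → ∃ A : ℝ, ∀ (n : ℕ) (L : List (Layer n)) (γ ε c : ℝ)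
    (ρ : Op n) (terms : List (PauliString n × ℝ)),
    1 ≤ n → 1 ≤ L.length → 0 < γ → γ ≤ γ₀ → 0 < ε → ε ≤ 1 → 0 < c →
    IsState ρ → renyiTwo ρ = n - Real.logb 2 c → ρ = pauliSum terms →
    Computes prog NoiseModel.uniform L γ ε ρ terms (ε * √c)
      (A * ((n : ℝ) * terms.length) ^ A * (1 / ε) ^ (A * (Real.log (1 / γ) / γ ^ 2))) := by
  refine ⟨uniformProg termsCmd, fun γ₀ h₀ => ?_⟩
  obtain ⟨C, hC1, hC⟩ := uniform_estimates h₀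
  -- One constant in three places: 2000 C² for the prefactor, 2C for the exponent of 1/ε (two
  -- factors `E`), 2 for the degree in nm.
  refine ⟨2000 * C ^ 2 + 2 * C + 2, ?_⟩
  intro n L γ ε c ρ terms hn hL hγ hγ0 hε hε1 hc hρ hS hterms
  set A := 2000 * C ^ 2 + 2 * C + 2 with hA
  set m := terms.length with hm
  -- An empty sum is 0, which has trace 0 and is not a state; so powers of nm are at least 1.
  have hm1 : 1 ≤ m := by
    rcases Nat.eq_zero_or_pos m with h | h
    · exfalso
      have h1 : terms = [] := List.length_eq_zero_iff.1 (hm ▸ h)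
      have := hρ.2
      rw [hterms, h1] at this
      simp [pauliSum] at this
    · exact h
  have hn' : (1 : ℝ) ≤ n := by exact_mod_cast hn
  have hm' : (1 : ℝ) ≤ m := by exact_mod_cast hm1
  obtain ⟨hr0, -, hk, hW⟩ := hC γ ε L.length hγ hγ0 hε hε1
  set r := Real.log (1 / γ) / γ ^ 2 with hr
  have hεinv : 1 ≤ 1 / ε := by rw [le_div_iff₀ hε]; linarith
  set E := C * (1 / ε) ^ (C * r) with hE
  have hE1 : 1 ≤ E := by
    have := Real.one_le_rpow hεinv (mul_nonneg (by linarith) hr0 : 0 ≤ C * r)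
    rw [hE]; nlinarith
  have hAbound : 2000 * (n * m : ℝ) ^ 2 * E ^ 2 ≤ A * ((n : ℝ) * m) ^ A * (1 / ε) ^ (A * r) := by
    have hnm : 1 ≤ (n : ℝ) * m := by nlinarith
    have h1 : (n * m : ℝ) ^ 2 ≤ ((n : ℝ) * m) ^ A := by
      rw [← Real.rpow_natCast]
      refine Real.rpow_le_rpow_of_exponent_le hnm ?_
      push_cast; nlinarith
    have h2 : E ^ 2 = C ^ 2 * (1 / ε) ^ (2 * C * r) := by
      rw [hE, mul_pow, ← Real.rpow_natCast (_ ^ (C * r)), ← Real.rpow_mul (by positivity)]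
      congr 2; push_cast; ring
    have h3 : (1 / ε) ^ (2 * C * r) ≤ (1 / ε) ^ (A * r) := by
      refine Real.rpow_le_rpow_of_exponent_le hεinv (mul_le_mul_of_nonneg_right ?_ hr0)
      nlinarith
    calc _ = (2000 * C ^ 2) * (n * m : ℝ) ^ 2 * (1 / ε) ^ (2 * C * r) := by rw [h2]; ring
      _ ≤ A * ((n : ℝ) * m) ^ A * (1 / ε) ^ (A * r) := by
        gcongr
        linarith
  refine computes_uniform hγ hε hc hρ hS (fun _ => m * (12 * n + 9) + 5) (fun W => m * 16 ^ W)
    (fun _ => terms.map fun t => ⟨t.1, t.2, 0⟩) (fun _ => pauliCoeff ρ) (fun _ => rfl) ?_ ?_ ?_ ?_ ?_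
  · intro _ k
    have hx : pauliCoeff ρ = listCoeff terms := by
      rw [hterms, ← toOp_listCoeff]
      exact pauliCoeff_toOp _
    rw [hx]
    have : ∀ l : List (PauliString n × ℝ), itemVec (l.map fun t => ⟨t.1, t.2, 0⟩) k
        = if k = 0 then listCoeff l else 0 := by
      intro l
      ext Q
      induction l with
      | nil => by_cases hk : k = 0 <;> simp [itemVec, hk, listCoeff]
      | cons t l ih =>
        rw [List.map_cons, itemVec_cons, ih]
        by_cases hk : k = 0
        · subst hk; simp [listCoeff]
        · simp [hk, Ne.symm hk]
    exact this terms
  · intro W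
    rw [listPotential_zero]
    · simp [hm]
    · intro e he
      obtain ⟨t, -, rfl⟩ := List.mem_map.1 he
      rfl
  · intro s W hin hp hkeep _
    exact (run_termsCmd hin.size hp ((termsAt_inputStore L γ ε terms).keep hkeep (by decide))).mono le_rfl
      fun s' hs' => ⟨hs'.1, hs'.2.mono (by decide)⟩
  · intro k hk'
    have h1 := hk k hk'
    refine le_trans ?_ hAbound
    have h2 : 1 ≤ (n * m : ℝ) ^ 2 := one_le_pow₀ (by nlinarith)
    have h3 : E ≤ E ^ 2 := by nlinarith
    have h4 : E ^ 2 ≤ (n * m : ℝ) ^ 2 * E ^ 2 := le_mul_of_one_le_left (by positivity) h2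
    linarith
  · intro W hd hW'
    obtain ⟨hd1, hW2⟩ := hW hd
    obtain ⟨hZ, -⟩ := hW2 W hW'
    refine le_trans ?_ hAbound
    have hWZ : (W : ℝ) ≤ 16 ^ W := by exact_mod_cast (Nat.lt_pow_self (by norm_num : 1 < 16)).le
    push_cast
    set Z : ℝ := 16 ^ W with hZdef
    set d : ℝ := (L.length : ℝ) with hd'
    have hZ0 : 0 ≤ Z := by positivity
    exact terms_time_le hn' hm' hE1 hZ0 hd1 hZ hWZ

/-- Four factors `E` enter the time: 16^W for tracing back, 16^W for evolving what was found, and d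
+ 1 twice, for the number of layers to be processed and for the seeds added at each layer. The
number of seeds is the factor `G` up to e³. -/
theorem uniform_query : ∃ prog : Cmd, ∀ γ₀ : ℝ, γ₀ < 1 → ∃ A : ℝ, ∀ (n : ℕ) (L : List (Layer n))
    (γ ε c : ℝ) (ρ : Op n),
    1 ≤ n → 1 ≤ L.length → 0 < γ → γ ≤ γ₀ → 0 < ε → ε ≤ 1 → 0 < c →
    IsState ρ → renyiTwo ρ = n - Real.logb 2 c →
    Computes prog NoiseModel.uniform L γ ε ρ [] (ε * √c)
      (A * (n : ℝ) ^ (A * (Real.log (1 / γ) / γ) + A * (Real.log (1 / ε) / (γ * L.length))) *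
        (1 / ε) ^ (A * (Real.log (1 / γ) / γ ^ 2))) := by
  refine ⟨uniformProg queryCmd, fun γ₀ h₀ => ?_⟩
  obtain ⟨C, hC1, hC⟩ := uniform_estimates h₀
  have he3 : 1 ≤ Real.exp 3 := Real.one_le_exp (by norm_num)
  refine ⟨10000 * Real.exp 3 * C ^ 4 + 4 * C, ?_⟩
  intro n L γ ε c ρ hn hL hγ hγ0 hε hε1 hc hρ hS
  set A := 10000 * Real.exp 3 * C ^ 4 + 4 * C with hA
  have hn' : (1 : ℝ) ≤ n := by exact_mod_cast hn
  obtain ⟨hr0, hCΛ, hk, hW⟩ := hC γ ε L.length hγ hγ0 hε hε1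
  set r := Real.log (1 / γ) / γ ^ 2 with hr
  set Λ := Real.log (1 / γ) / γ with hΛ
  set μ := Real.log (1 / ε) / (γ * L.length) with hμ
  have hεinv : 1 ≤ 1 / ε := by rw [le_div_iff₀ hε]; linarith
  have hμ0 : 0 ≤ μ := div_nonneg (Real.log_nonneg hεinv) (by positivity)
  have hC4 : 1 ≤ C ^ 4 := one_le_pow₀ hC1
  have hΛ0 : 0 ≤ Λ := by
    by_contra h
    push Not at h
    nlinarith
  set E := C * (1 / ε) ^ (C * r) with hE
  have hE1 : 1 ≤ E := by
    have := Real.one_le_rpow hεinv (mul_nonneg (by linarith) hr0 : 0 ≤ C * r)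
    rw [hE]; nlinarith
  set G := (n : ℝ) ^ (C * Λ + C * μ) with hG
  have hG1 : 1 ≤ G := Real.one_le_rpow hn' (by positivity)
  have hAbound : 10000 * Real.exp 3 * (n : ℝ) ^ 2 * G * E ^ 4 ≤ A * (n : ℝ) ^ (A * Λ + A * μ) *
      (1 / ε) ^ (A * r) := by
    have hAC : 4 * C ≤ A := by
      have : 0 ≤ 10000 * Real.exp 3 * C ^ 4 := by positivity
      linarith
    have h1 : (n : ℝ) ^ 2 * G ≤ (n : ℝ) ^ (A * Λ + A * μ) := by
      rw [← Real.rpow_natCast, hG, ← Real.rpow_add (by linarith)]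
      refine Real.rpow_le_rpow_of_exponent_le hn' ?_
      have h2 : 4 * C * Λ ≤ A * Λ := mul_le_mul_of_nonneg_right hAC hΛ0
      have h3 : C * μ ≤ A * μ := mul_le_mul_of_nonneg_right (by linarith) hμ0
      push_cast; linarith
    have h2 : E ^ 4 = C ^ 4 * (1 / ε) ^ (4 * C * r) := by
      rw [hE, mul_pow, ← Real.rpow_natCast (_ ^ (C * r)), ← Real.rpow_mul (by positivity)]
      congr 2; push_cast; ring
    have h3 : (1 / ε) ^ (4 * C * r) ≤ (1 / ε) ^ (A * r) :=
      Real.rpow_le_rpow_of_exponent_le hεinv (mul_le_mul_of_nonneg_right hAC hr0)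
    calc _ = (10000 * Real.exp 3 * C ^ 4) * ((n : ℝ) ^ 2 * G) * (1 / ε) ^ (4 * C * r) := by rw [h2]; ring
      _ ≤ A * (n : ℝ) ^ (A * Λ + A * μ) * (1 / ε) ^ (A * r) := by
        gcongr
        linarith
  set q := Real.exp (-γ) with hq
  set d := L.length with hd
  set N : ℕ → ℕ := fun W => (seedItems (W / (d + 1)) n : List (Item n)).length with hN
  have hNm : ∀ W, ∀ m ≤ n, (seedItems (W / (d + 1)) m : List (Item n)).length ≤ N W := fun W m hm =>
    monotone_nat_of_le_succ (length_seedItems_mono (n := n) (W / (d + 1))) hm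
  set B' : ℕ → ℕ := fun W => (d + 1) * (N W * 16 ^ W) with hB'
  have hback : ∀ W, (backItems q W L).length ≤ B' W := fun W => by
    refine (length_noise_le q W _).trans ((length_le_listPotential W _).trans
      ((listPotential_traceBack_le q W _ _ _).trans (le_of_eq ?_)))
    rw [listPotential_seedList]
    simp only [hB', hN]
    ring
  have hn1 := one_le_pow₀ hn' (n := 2)
  have hGE : 1 ≤ G * E ^ 4 := one_le_mul_of_one_le_of_one_le hG1 (one_le_pow₀ hE1)
  set F := Real.exp 3 * (n : ℝ) ^ 2 * G * E ^ 4 with hF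
  have hFE : E ≤ F := by
    have h1 : 1 ≤ Real.exp 3 * (n : ℝ) ^ 2 * G :=
      one_le_mul_of_one_le_of_one_le (one_le_mul_of_one_le_of_one_le he3 hn1) hG1
    have h2 : E ≤ E ^ 4 := le_self_pow₀ hE1 (by norm_num)
    exact h2.trans (le_mul_of_one_le_left (by positivity) h1)
  have hFn : (n : ℝ) ≤ F := by
    have h2 : (n : ℝ) ≤ n ^ 2 := le_self_pow₀ hn' (by norm_num)
    calc (n : ℝ) ≤ 1 * n ^ 2 * (G * E ^ 4) := by
          rw [one_mul]; exact h2.trans (le_mul_of_one_le_right (by positivity) hGE)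
      _ ≤ Real.exp 3 * n ^ 2 * (G * E ^ 4) := by gcongr
      _ = F := by rw [hF]; ring
  have hAF : 10000 * F ≤ A * (n : ℝ) ^ (A * Λ + A * μ) * (1 / ε) ^ (A * r) :=
    le_trans (le_of_eq (by rw [hF]; ring)) hAbound
  refine computes_uniform hγ hε hc hρ hS
    (fun W => 3 * W + 500 * (d + 1) * (n + 1) ^ 2 * (B' W + 1)) (fun W => B' W * 16 ^ W)
    (fun W => (collect (backItems q W L)).map fun P => ⟨P, pauliCoeff ρ P, 0⟩)
    (fun W P => if P ∈ collect (backItems q W L) then pauliCoeff ρ P else 0)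
    (fun W => pathSum_backItems q W L _) (fun W k => itemVec_nodup _ (nodup_collect _) k) ?_ ?_ ?_ ?_
  · intro W
    rw [listPotential_zero]
    · rw [List.length_map]
      exact Nat.mul_le_mul_right _ ((length_collect_le _).trans (hback W))
    · intro e he
      obtain ⟨t, -, rfl⟩ := List.mem_map.1 he
      rfl
  · intro s W hin hp hkeep hW42
    exact (run_queryCmd hin hp hW42 (hNm W)).2
  · intro k hk'
    have h1 := hk k hk'
    linarith
  · intro W hdε hW'
    obtain ⟨hd1, hW2⟩ := hW hdε
    obtain ⟨hZ, hKb⟩ := hW2 W hW'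
    have hKb := hKb hL
    refine le_trans ?_ hAF
    have hWZ : (W : ℝ) ≤ 16 ^ W := by exact_mod_cast (Nat.lt_pow_self (by norm_num : 1 < 16)).le
    -- The count of strings of weight at most K with b = n gives e³ n^K. The exponent K = W / (d+1)
    -- was estimated for d ≥ 1.
    have hNG : (N W : ℝ) ≤ Real.exp 3 * G := by
      refine (length_seedItems_le hn').trans ?_
      rw [mul_div_assoc, div_self (by positivity), mul_one]
      refine mul_le_mul_of_nonneg_left ?_ (by positivity)
      rw [← Real.rpow_natCast]
      exact Real.rpow_le_rpow_of_exponent_le hn' hKb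
    have hB'r : (B' W : ℝ) = (d + 1) * (N W * 16 ^ W) := by simp only [hB']; push_cast; ring
    push_cast
    rw [hB'r]
    set Z : ℝ := 16 ^ W with hZdef
    have hZ0 : 0 ≤ Z := by positivity
    set D : ℝ := (d : ℝ) with hD
    have hd0 : 0 ≤ D := Nat.cast_nonneg _
    have hb : (D + 1) * (N W * Z) ≤ Real.exp 3 * G * E ^ 2 := by
      calc (D + 1) * (N W * Z) ≤ E * ((Real.exp 3 * G) * E) := by gcongr
        _ = _ := by ring
    have hge1 : 1 ≤ Real.exp 3 * G := one_le_mul_of_one_le_of_one_le he3 hG1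
    have e1 : ((n : ℝ) + 1) ^ 2 ≤ 4 * n ^ 2 := by nlinarith
    have t1 : 500 * (D + 1) * ((n : ℝ) + 1) ^ 2 * ((D + 1) * (N W * Z) + 1) ≤ 4000 * F := by
      have e2 : (D + 1) * (N W * Z) + 1 ≤ 2 * (Real.exp 3 * G * E ^ 3) := by
        have h2 : E ^ 2 ≤ E ^ 3 := pow_le_pow_right₀ hE1 (by norm_num)
        have h3 : Real.exp 3 * G * E ^ 2 ≤ Real.exp 3 * G * E ^ 3 := by gcongr
        have h4 : 1 ≤ Real.exp 3 * G * E ^ 3 := one_le_mul_of_one_le_of_one_le hge1 (one_le_pow₀ hE1)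
        linarith
      calc _ ≤ 500 * E * (4 * (n : ℝ) ^ 2) * (2 * (Real.exp 3 * G * E ^ 3)) := by gcongr
        _ = 4000 * F := by rw [hF]; ring
    have t2 : 200 * (D + 1) * ((n : ℝ) + 1) ^ 2 * ((D + 1) * (N W * Z) * Z + 1) ≤ 1600 * F := by
      have e2 : (D + 1) * (N W * Z) * Z + 1 ≤ 2 * (Real.exp 3 * G * E ^ 3) := by
        have h3 : (D + 1) * (N W * Z) * Z ≤ Real.exp 3 * G * E ^ 2 * E := by gcongr
        have h4 : 1 ≤ Real.exp 3 * G * E ^ 3 := one_le_mul_of_one_le_of_one_le hge1 (one_le_pow₀ hE1)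
        have h5 : Real.exp 3 * G * E ^ 2 * E = Real.exp 3 * G * E ^ 3 := by ring
        linarith
      calc _ ≤ 200 * E * (4 * (n : ℝ) ^ 2) * (2 * (Real.exp 3 * G * E ^ 3)) := by gcongr
        _ = 1600 * F := by rw [hF]; ring
    linarith


/-! ### Gate-based noise: truncated vectors -/

section truncated
variable {n : ℕ}

theorem weight_eq_zero {P : PauliString n} : weight P = 0 ↔ P = 0 := by
  rw [weight, Finset.card_eq_zero, Finset.filter_eq_empty_iff]
  simp only [Finset.mem_univ, true_implies, not_not]
  exact funext_iff.symm

theorem truncCircuit_of_le (q : ℝ) {ℓ : ℕ} (h : n ≤ ℓ) (L : List (Layer n)) (x : PauliString n → ℝ) :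
    truncCircuit q ℓ L x = circuitVec .gateBased q L x := by
  have : ∀ y : PauliString n → ℝ, trunc ℓ y = y := fun y => by
    ext P; exact if_pos ((weight_le P).trans h)
  simp only [truncCircuit, this]; rfl

theorem trunc_zero (x : PauliString n → ℝ) : trunc 0 x = Pi.single 0 (x 0) := by
  ext P
  by_cases hP : P = 0
  · subst hP; simp [trunc, weight_eq_zero]
  · simp [trunc, weight_eq_zero, hP]

theorem truncCircuit_zero (q : ℝ) (L : List (Layer n)) (x : PauliString n → ℝ) :
    truncCircuit q 0 L x = Pi.single 0 (x 0) := by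
  have : (L.foldr (fun U y => stepVec .gateBased q U (trunc 0 y)) x) 0 = x 0 := by
    induction L with
    | nil => rfl
    | cons U L ih =>
      rw [List.foldr_cons, trunc_zero, stepVec, damp_single_zero, layerVec_single_zero, ih]; simp
  rw [truncCircuit, trunc_zero, damp_single_zero, this]

theorem weight_update {P : PauliString n} {j : Fin n} (h : P j = 0) (a : Fin 4) :
    weight (Function.update P j a) = weight P + if a = 0 then 0 else 1 := by
  split_ifs with ha
  · rw [ha, ← h, Function.update_eq_self, add_zero]
  · rw [weight, weight, ← Finset.card_insert_of_notMem (a := j) (by simp [h])]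
    congr 1
    ext i
    by_cases hi : i = j
    · subst hi; simp [ha]
    · simp [hi]

theorem weight_le_of_mem_seedItems {K : ℕ} : ∀ {m : ℕ} {e : Item n}, e ∈ (seedItems K m : List (Item n)) →
    weight e.P ≤ K := by
  suffices ∀ {m : ℕ} {e : Item n}, e ∈ (seedItems K m : List (Item n)) → weight e.P ≤ e.cum ∧ e.cum ≤ K by
    intro m e h
    exact (this h).1.trans (this h).2
  intro m
  induction m with
  | zero => intro e he; simp [seedItems] at he; subst he; simp [weight]
  | succ m ih =>
    intro e he
    rw [seedItems] at he
    split_ifs at he with h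
    · obtain ⟨e', he', h2⟩ := List.mem_flatMap.1 he
      have h0 := eq_zero_of_mem_seedItems he' ⟨m, h⟩ le_rfl
      have := ih he'
      rw [seedStep] at h2
      split_ifs at h2
      · obtain ⟨a, -, rfl⟩ := List.mem_map.1 h2
        simp only [weight_update h0]
        split_ifs <;> omega
      · rw [List.mem_singleton.1 h2]; exact this
    · exact ih he

/-! ### One layer as a sequence of gates -/

/-- The number of nonidentity labels of a pair. -/
def pairWeight (p : Fin 4 × Fin 4) : ℕ := (if p.1 = 0 then 0 else 1) + if p.2 = 0 then 0 else 1

/-- The coefficient of a gate with its noise. -/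
noncomputable def noisyGate (q : ℝ) (U : Layer n) (j : Fin n) (a b : Fin 4 × Fin 4) : ℝ :=
  gateCoeff (U.gate j) a b * q ^ pairWeight b

/-- The action of a gate with its noise. -/
noncomputable def gateMap (q : ℝ) (U : Layer n) (j : Fin n) (z : PauliString n → ℝ) (Q : PauliString n) :
    ℝ :=
  ∑ ab, noisyGate q U j (Q j, Q (U.partner j)) ab * z (setPair Q j (U.partner j) ab)

/-- The action of the gates at the first qubits. -/
noncomputable def gatesVec (q : ℝ) (U : Layer n) (z : PauliString n → ℝ) : ℕ → PauliString n → ℝ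
  | 0 => z
  | m + 1 => if h : m < n then
      if ⟨m, h⟩ < U.partner ⟨m, h⟩ then gateMap q U ⟨m, h⟩ (gatesVec q U z m) else gatesVec q U z m
    else gatesVec q U z m

theorem gatesVec_eq (q : ℝ) (U : Layer n) (z : PauliString n → ℝ) : ∀ m ≤ n, ∀ Q,
    gatesVec q U z m Q = ∑ P, partialCoeff U (noisyGate q U) m Q P * z P := by
  intro m
  induction m with
  | zero => intro _ Q; simp [gatesVec, partialCoeff_zero]
  | succ m ih =>
    intro hm Q
    rw [gatesVec, dif_pos (by omega)]
    split_ifs with hj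
    · rw [gateMap]
      simp only [ih (by omega), Finset.mul_sum]
      rw [Finset.sum_comm]
      refine Finset.sum_congr rfl fun P _ => ?_
      rw [← partialCoeff_step U _ hj Q P, Finset.sum_mul]
      exact Finset.sum_congr rfl fun ab _ => by ring
    · rw [ih (by omega)]
      exact Finset.sum_congr rfl fun P _ => by rw [← partialCoeff_skip U _ hj]

/-- Gate-based noise hits exactly the qubits of the gates, so it can be merged with them cell by
cell, and a noisy layer is a succession of maps on two qubits. -/
theorem gatesVec_last (q : ℝ) (U : Layer n) (z : PauliString n → ℝ) :
    gatesVec q U z n = stepVec .gateBased q U z := by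
  ext Q
  rw [gatesVec_eq q U z n le_rfl, stepVec, layerVec]
  refine Finset.sum_congr rfl fun P _ => ?_
  have h1 : q ^ (Finset.univ.filter fun j => NoiseModel.noisy .gateBased U j ∧ P j ≠ 0).card
      = ∏ j, if U.partner j ≠ j ∧ P j ≠ 0 then q else 1 := by
    rw [Finset.prod_ite, Finset.prod_const, Finset.prod_const_one, mul_one]
    congr 2; ext j; simp [NoiseModel.noisy]
  rw [damp, h1, ← prod_cells U.involutive, ← mul_assoc, layerCoeff, partialCoeff,
    ← Finset.prod_mul_distrib]
  congr 1
  refine Finset.prod_congr rfl fun j _ => ?_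
  by_cases h2 : U.partner j = j
  · simp [h2]
  · by_cases h3 : j < U.partner j
    · simp only [h2, h3, if_false, if_true, j.2, noisyGate, U.involutive, pairWeight, pow_add]
      have h4 : ¬ j = U.partner j := fun h => h2 h.symm
      congr 1
      by_cases h5 : P j = 0 <;> by_cases h6 : P (U.partner j) = 0 <;> simp [h5, h6, h4, h2]
    · simp [h2, h3]

/-! ### Nonidentity cells -/

/-- The number of cells among those that begin at the first `m` qubits on which `R` is not the
identity. -/
def cellCount (U : Layer n) (m : ℕ) (R : PauliString n) : ℕ :=
  (Finset.univ.filter fun j : Fin n =>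
    (j : ℕ) < m ∧ j ≤ U.partner j ∧ ¬(R j = 0 ∧ R (U.partner j) = 0)).card

theorem cellCount_succ (U : Layer n) (j : Fin n) (R : PauliString n) :
    cellCount U (j + 1) R
      = cellCount U j R + if j ≤ U.partner j ∧ ¬(R j = 0 ∧ R (U.partner j) = 0) then 1 else 0 := by
  rw [cellCount, cellCount]
  split_ifs with h
  · rw [← Finset.card_insert_of_notMem (a := j) (by simp)]
    congr 1; ext i
    simp only [Finset.mem_filter, Finset.mem_univ, true_and, Finset.mem_insert]
    constructor
    · rintro ⟨h1, h2⟩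
      by_cases hij : i = j
      · exact Or.inl hij
      · exact Or.inr ⟨by have := Fin.val_ne_of_ne hij; omega, h2⟩
    · rintro (rfl | ⟨h1, h2⟩)
      · exact ⟨by omega, h⟩
      · exact ⟨by omega, h2⟩
  · rw [add_zero]; congr 1; ext i
    simp only [Finset.mem_filter, Finset.mem_univ, true_and]
    constructor
    · rintro ⟨h1, h2⟩
      have : i ≠ j := by rintro rfl; exact h h2
      exact ⟨by have := Fin.val_ne_of_ne this; omega, h2⟩
    · rintro ⟨h1, h2⟩; exact ⟨by omega, h2⟩

theorem cellCount_mono (U : Layer n) (R : PauliString n) {m m' : ℕ} (h : m ≤ m') :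
    cellCount U m R ≤ cellCount U m' R := by
  refine Finset.card_le_card fun i hi => ?_
  simp only [Finset.mem_filter, Finset.mem_univ, true_and] at hi ⊢
  exact ⟨by omega, hi.2⟩

/-- Every nonidentity cell contains a qubit with a nonidentity label, and different cells give
different qubits. -/
theorem cellCount_le_weight (U : Layer n) (m : ℕ) (R : PauliString n) : cellCount U m R ≤ weight R := by
  refine Finset.card_le_card_of_injOn (fun j => if R j = 0 then U.partner j else j) ?_ ?_
  · intro j hj
    simp only [Finset.coe_filter, Finset.mem_univ, true_and, Set.mem_ofPred_eq] at hj ⊢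
    split_ifs with h
    · exact fun h' => hj.2.2 ⟨h, h'⟩
    · exact h
  · intro i hi j hj hij
    simp only [Finset.coe_filter, Finset.mem_univ, true_and, Set.mem_ofPred_eq] at hi hj hij
    have key : ∀ i j : Fin n, i ≤ U.partner i → j ≤ U.partner j → U.partner i = j → i = j := by
      rintro i j h1 h2 rfl
      rw [U.involutive] at h2
      exact le_antisymm h1 h2
    split_ifs at hij
    · rw [← U.involutive i, hij, U.involutive]
    · exact key i j hi.2.1 hj.2.1 hij
    · exact (key j i hj.2.1 hi.2.1 hij.symm).symm
    · exact hij

theorem cellCount_setPair (U : Layer n) {j : Fin n} (hj : j < U.partner j) (R : PauliString n)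
    (ab : Fin 4 × Fin 4) :
    cellCount U n (setPair R j (U.partner j) ab) + (if R j = 0 ∧ R (U.partner j) = 0 then 0 else 1)
      = cellCount U n R + if ab = (0, 0) then 0 else 1 := by
  simp only [cellCount, Finset.card_filter, ← Finset.add_sum_erase _ _ (Finset.mem_univ j)]
  have h1 : setPair R j (U.partner j) ab j = ab.1 := by simp [setPair, hj.ne]
  have h2 : setPair R j (U.partner j) ab (U.partner j) = ab.2 := by simp [setPair]
  have h3 : ∀ i ∈ Finset.univ.erase j, (if (i : ℕ) < n ∧ i ≤ U.partner i ∧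
      ¬(setPair R j (U.partner j) ab i = 0 ∧ setPair R j (U.partner j) ab (U.partner i) = 0) then 1 else 0)
      = if (i : ℕ) < n ∧ i ≤ U.partner i ∧ ¬(R i = 0 ∧ R (U.partner i) = 0) then 1 else 0 := by
    intro i hi
    have hij := Finset.ne_of_mem_erase hi
    by_cases hip : i = U.partner j
    · subst hip
      rw [U.involutive, if_neg (fun h => absurd h.2.1 hj.not_ge), if_neg (fun h => absurd h.2.1 hj.not_ge)]
    · have hpj : U.partner i ≠ j := by rintro rfl; exact hip (U.involutive i).symm
      have hpp : U.partner i ≠ U.partner j := fun h => hij (by rw [← U.involutive i, h, U.involutive])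
      simp only [setPair, Function.update_of_ne hip, Function.update_of_ne hij, Function.update_of_ne hpj,
        Function.update_of_ne hpp]
  rw [Finset.sum_congr rfl h3, h1, h2]
  simp only [j.2, hj.le, true_and, Prod.ext_iff]
  split_ifs <;> simp_all <;> omega

theorem setPair_zero_self {R : PauliString n} {j k : Fin n} (h : R j = 0 ∧ R k = 0) :
    setPair R j k (0, 0) = R := by
  rw [setPair, ← h.1, Function.update_eq_self, h.1, ← h.2, Function.update_eq_self]

/-- No other label of the cell contributes to the identity, and the noise does not damp it. -/
theorem gateMap_of_zero (q : ℝ) {U : Layer n} {j : Fin n} (hj : j < U.partner j)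
    (z : PauliString n → ℝ) {R : PauliString n} (h : R j = 0 ∧ R (U.partner j) = 0) :
    gateMap q U j z R = z R := by
  rw [gateMap, Finset.sum_eq_single (0, 0)]
  · rw [setPair_zero_self h, noisyGate, h.1, h.2, gateCoeff_zero_right (U.unitary j hj)]
    simp [pairWeight]
  · intro ab _ hab
    rw [noisyGate, h.1, h.2, gateCoeff_zero_left (U.unitary j hj), if_neg hab]; simp
  · simp

/-- A gate does not enlarge the number of nonidentity cells. -/
theorem gateMap_eq_zero (q : ℝ) {U : Layer n} {j : Fin n} (hj : j < U.partner j)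
    {z : PauliString n → ℝ} {ℓ : ℕ} (hz : ∀ R, ℓ < cellCount U n R → z R = 0) {R : PauliString n}
    (hR : ℓ < cellCount U n R) : gateMap q U j z R = 0 := by
  by_cases h : R j = 0 ∧ R (U.partner j) = 0
  · rw [gateMap_of_zero q hj z h, hz R hR]
  · refine Finset.sum_eq_zero fun ab _ => ?_
    have h1 := cellCount_setPair U hj R ab
    rw [if_neg h] at h1
    by_cases hab : ab = (0, 0)
    · rw [hab, noisyGate, gateCoeff_zero_right (U.unitary j hj), if_neg]
      · simp
      · intro h2; exact h (by simpa [Prod.ext_iff] using h2)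
    · rw [if_neg hab] at h1
      rw [hz _ (by omega), mul_zero]

/-- Inside a layer a gate may turn one nonidentity label into two, so the weight can exceed ℓ. The
number of nonidentity cells is conserved by every gate and is the quantity that controls the
support. -/
theorem gatesVec_eq_zero (q : ℝ) {U : Layer n} {z : PauliString n → ℝ} {ℓ : ℕ}
    (hz : ∀ R, ℓ < weight R → z R = 0) : ∀ m R, ℓ < cellCount U n R → gatesVec q U z m R = 0 := by
  intro m
  induction m with
  | zero => intro R hR; exact hz R (hR.trans_le (cellCount_le_weight U n R))
  | succ m ih =>
    intro R hR
    rw [gatesVec]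
    split_ifs with h1 h2
    · exact gateMap_eq_zero q h2 ih hR
    · exact ih R hR
    · exact ih R hR

/-! ### The strings with few nonidentity cells -/

/-- The labels for the cell that begins at qubit `j`. -/
def cellPairs (U : Layer n) (j : Fin n) : List (Fin 4 × Fin 4) :=
  if U.partner j = j then (List.finRange 4).map fun a => (0, a) else labelPairs

/-- Extend the items by labels on the cell that begins at qubit `j`, up to `K` nonidentity cells. -/
noncomputable def cellStep (U : Layer n) (K : ℕ) (j : Fin n) (e : Item n) : List (Item n) :=
  if e.cum + 1 ≤ K ∧ j ≤ U.partner j then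
    (cellPairs U j).map fun ab =>
      ⟨setPair e.P j (U.partner j) ab, 1, if ab = (0, 0) then e.cum else e.cum + 1⟩
  else [e]

/-- Items for all Pauli strings with at most `K` nonidentity cells, all of which begin at the first
`m` qubits. -/
noncomputable def cellItems (U : Layer n) (K : ℕ) : ℕ → List (Item n)
  | 0 => [⟨0, 1, 0⟩]
  | m + 1 => if h : m < n then (cellItems U K m).flatMap (cellStep U K ⟨m, h⟩) else cellItems U K m

theorem eq_zero_of_mem_cellItems {U : Layer n} {K : ℕ} : ∀ {m : ℕ} {e : Item n}, e ∈ cellItems U K m →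
    ∀ i : Fin n, m ≤ i → m ≤ U.partner i → e.P i = 0 := by
  intro m
  induction m with
  | zero => intro e he i _ _; simp [cellItems] at he; subst he; rfl
  | succ m ih =>
    intro e he i hi hpi
    rw [cellItems] at he
    split_ifs at he with h
    · obtain ⟨e', he', h2⟩ := List.mem_flatMap.1 he
      have h0 := ih he' i (by omega) (by omega)
      rw [cellStep] at h2
      split_ifs at h2
      · obtain ⟨ab, -, rfl⟩ := List.mem_map.1 h2
        have h3 : i ≠ ⟨m, h⟩ := by rintro rfl; simp at hi
        have h4 : i ≠ U.partner ⟨m, h⟩ := by rintro rfl; rw [U.involutive] at hpi; simp at hpi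
        simpa [setPair, h3, h4] using h0
      · rw [List.mem_singleton.1 h2]; exact h0
    · exact ih he i (by omega) (by omega)

theorem mix_succ (U : Layer n) {j : Fin n} (hj : j ≤ U.partner j) (R : PauliString n) :
    mix U (j + 1) R 0 = setPair (mix U j R 0) j (U.partner j) (R j, R (U.partner j)) := by
  ext1 i
  by_cases h1 : i = U.partner j
  · subst h1; simp [mix, setPair, U.involutive]
  · by_cases h2 : i = j
    · subst h2; simp [mix, setPair, h1]
    · have h3 : (i : ℕ) ≠ j := Fin.val_ne_of_ne h2
      have h4 : (U.partner i : ℕ) ≠ j := Fin.val_ne_of_ne fun h => h1 (by rw [← h, U.involutive])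
      simp only [setPair, Function.update_of_ne h1, Function.update_of_ne h2, mix]
      congr 1
      simp only [eq_iff_iff]; omega

theorem mix_succ_of_lt (U : Layer n) {j : Fin n} (hj : U.partner j < j) (R : PauliString n) :
    mix U (j + 1) R 0 = mix U j R 0 := by
  have hj' : (U.partner j : ℕ) < j := hj
  ext1 i
  simp only [mix]
  congr 1
  by_cases h1 : i = U.partner j
  · subst h1; simp only [U.involutive, eq_iff_iff]; omega
  · by_cases h2 : i = j
    · subst h2; simp only [eq_iff_iff]; omega
    · have h3 : (i : ℕ) ≠ j := Fin.val_ne_of_ne h2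
      have h4 : (U.partner i : ℕ) ≠ j := Fin.val_ne_of_ne fun h => h1 (by rw [← h, U.involutive])
      simp only [eq_iff_iff]; omega

theorem mem_cellItems {U : Layer n} {K : ℕ} {R : PauliString n} (hR : cellCount U n R ≤ K) :
    ∀ m ≤ n, ∃ e ∈ cellItems U K m, e.P = mix U m R 0 ∧ e.cum = cellCount U m R := by
  intro m
  induction m with
  | zero =>
    intro _
    refine ⟨⟨0, 1, 0⟩, by simp [cellItems], ?_, by simp [cellCount]⟩
    ext1 i; simp [mix]
  | succ m ih =>
    intro hm
    obtain ⟨e, he, h1, h2⟩ := ih (by omega)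
    rw [cellItems, dif_pos (by omega)]
    obtain ⟨j, rfl⟩ : ∃ j : Fin n, (j : ℕ) = m := ⟨⟨m, by omega⟩, rfl⟩
    have hcc := cellCount_succ U j R
    have hle := (cellCount_mono U R hm).trans hR
    by_cases hj : j ≤ U.partner j
    · rw [mix_succ U hj]
      by_cases hK : e.cum + 1 ≤ K
      · have hab : ∃ ab ∈ cellPairs U j, setPair e.P j (U.partner j) ab
            = setPair e.P j (U.partner j) (R j, R (U.partner j)) ∧
            (ab = (0, 0) ↔ R j = 0 ∧ R (U.partner j) = 0) := by
          rw [cellPairs]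
          split_ifs with h
          · exact ⟨(0, R j), by simp, by simp [setPair, h], by simp [h]⟩
          · exact ⟨_, mem_labelPairs _, rfl, by simp [Prod.ext_iff]⟩
        obtain ⟨ab, hab1, hab2, hab3⟩ := hab
        refine ⟨⟨setPair e.P j (U.partner j) ab, 1, if ab = (0, 0) then e.cum else e.cum + 1⟩,
          List.mem_flatMap.2 ⟨e, he, ?_⟩, ?_, ?_⟩
        · rw [cellStep, if_pos ⟨hK, hj⟩]
          exact List.mem_map.2 ⟨ab, hab1, rfl⟩
        · rw [← h1]; exact hab2
        · simp only [hab3, hcc, h2, hj, true_and]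
          split_ifs <;> omega
      · have h0 : R j = 0 ∧ R (U.partner j) = 0 := by
          by_contra h
          rw [if_pos ⟨hj, h⟩] at hcc
          omega
        refine ⟨e, List.mem_flatMap.2 ⟨e, he, by rw [cellStep, if_neg (by tauto)]; simp⟩, ?_, ?_⟩
        · have h3 : mix U j R 0 j = 0 ∧ mix U j R 0 (U.partner j) = 0 := by simp [mix, h0]
          rw [h1, h0.1, h0.2, setPair_zero_self h3]
        · rw [hcc, if_neg (by tauto), h2]; rfl
    · rw [mix_succ_of_lt U (not_le.1 hj)]
      refine ⟨e, List.mem_flatMap.2 ⟨e, he, by rw [cellStep, if_neg (by tauto)]; simp⟩, h1, ?_⟩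
      rw [hcc, if_neg (by tauto), h2]; rfl

/-- Gates act in place on the stored vector, so a string listed twice would have its gate applied
twice. -/
theorem nodup_cellItems (U : Layer n) (K : ℕ) : ∀ m ≤ n, ((cellItems U K m).map Item.P).Nodup := by
  intro m
  induction m with
  | zero => intro _; simp [cellItems]
  | succ m ih =>
    intro hm
    have ih := ih (by omega)
    rw [cellItems, dif_pos (by omega), List.map_flatMap, List.nodup_flatMap]
    obtain ⟨j, rfl⟩ : ∃ j : Fin n, (j : ℕ) = m := ⟨⟨m, by omega⟩, rfl⟩
    -- The parent is recovered by erasing the labels on the current cell, so different parents have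
    -- different children.
    have hparent : ∀ e ∈ cellItems U K j, ∀ R ∈ (cellStep U K j e).map Item.P,
        e.P = if j ≤ U.partner j then setPair R j (U.partner j) (0, 0) else R := by
      intro e he R hR
      obtain ⟨e', he', rfl⟩ := List.mem_map.1 hR
      have h0 : j ≤ U.partner j → e.P j = 0 ∧ e.P (U.partner j) = 0 := fun h =>
        ⟨eq_zero_of_mem_cellItems he _ le_rfl h,
          eq_zero_of_mem_cellItems he _ h (by rw [U.involutive])⟩
      rw [cellStep] at he'
      split_ifs at he' with h1
      · obtain ⟨ab, -, rfl⟩ := List.mem_map.1 he'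
        rw [if_pos h1.2]
        have h2 := h0 h1.2
        ext1 i
        by_cases h3 : i = U.partner j
        · subst h3; simp [setPair, h2.2]
        · by_cases h4 : i = j
          · subst h4; simp [setPair, h2.1, h3]
          · simp [setPair, h3, h4]
      · rw [List.mem_singleton.1 he']
        split_ifs with h2
        · rw [setPair_zero_self (h0 h2)]
        · rfl
    constructor
    · intro e he
      rw [cellStep]
      split_ifs with h1
      · rw [List.map_map]
        rw [cellPairs]
        split_ifs with h2
        · rw [List.map_map]
          refine (List.nodup_finRange 4).map fun a b hab => ?_
          have := congrFun hab j
          simpa [setPair, h2] using this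
        · refine (by decide : labelPairs.Nodup).map fun a b hab => ?_
          have h3 := congrFun hab j
          have h4 := congrFun hab (U.partner j)
          have h5 : j ≠ U.partner j := fun h => h2 h.symm
          simp only [Function.comp, setPair, Function.update_self, Function.update_of_ne h5] at h3 h4
          exact Prod.ext h3 h4
      · simp
    · rw [List.Nodup, List.pairwise_map] at ih
      refine ih.imp_of_mem fun {e e'} he he' hne => ?_
      rw [Function.onFun, List.disjoint_left]
      intro R hR hR'
      exact hne ((hparent e he R hR).trans (hparent e' he' R hR').symm)

theorem length_cellItems_mono (U : Layer n) (K m : ℕ) :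
    (cellItems U K m).length ≤ (cellItems U K (m + 1)).length := by
  rw [cellItems]
  split_ifs with h
  · rw [List.length_flatMap]
    refine le_trans (le_of_eq ?_) (List.card_nsmul_le_sum _ 1 ?_)
    · simp
    · intro x hx
      obtain ⟨e, -, rfl⟩ := List.mem_map.1 hx
      rw [cellStep, cellPairs]; split_ifs <;> simp [show labelPairs.length = 16 by rfl]
  · exact le_rfl

/-- The same weighted count as for the seeds, now with at most 15 nonidentity pairs on a cell. With
b = n there are at most e^15 n^K strings. -/
theorem sum_pow_cellItems_le (U : Layer n) {K : ℕ} {b : ℝ} (hb : 1 ≤ b) : ∀ m ≤ n,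
    ((cellItems U K m).map fun e => b ^ (K - e.cum)).sum ≤ (1 + 15 / b) ^ m * b ^ K := by
  have key : ∀ (j : Fin n) (l : List (Item n)),
      ((l.flatMap (cellStep U K j)).map fun e => b ^ (K - e.cum)).sum
        ≤ (1 + 15 / b) * (l.map fun e => b ^ (K - e.cum)).sum := by
    intro j l
    induction l with
    | nil => simp
    | cons e l ih =>
      rw [List.flatMap_cons, List.map_append, List.sum_append, List.map_cons, List.sum_cons, mul_add]
      refine add_le_add ?_ ih
      rw [cellStep]
      split_ifs with h
      · obtain ⟨r, hr⟩ : ∃ r, K - e.cum = r + 1 := ⟨K - e.cum - 1, by omega⟩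
        have hr' : K - (e.cum + 1) = r := by omega
        rw [List.map_map]
        have hf : ((fun e : Item n => b ^ (K - e.cum)) ∘ fun ab : Fin 4 × Fin 4 =>
            (⟨setPair e.P j (U.partner j) ab, 1, if ab = (0, 0) then e.cum else e.cum + 1⟩ : Item n))
            = fun ab => if ab = (0, 0) then b ^ r * b else b ^ r := by
          ext ab
          simp only [Function.comp]
          split_ifs <;> simp [hr, hr', pow_succ]
        rw [hf, hr, pow_succ]
        have hbr : 0 ≤ b ^ r := by positivity
        have hsum : ((cellPairs U j).map fun ab : Fin 4 × Fin 4 => if ab = (0, 0) then b ^ r * b else b ^ r).sum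
            ≤ b ^ r * b + 15 * b ^ r := by
          rw [cellPairs]
          split_ifs
          · have : List.finRange 4 = [0, 1, 2, 3] := by decide
            rw [this]; simp; linarith
          · have : List.finRange 4 = [0, 1, 2, 3] := by decide
            simp [labelPairs, this, List.product]; linarith
        refine hsum.trans (le_of_eq ?_)
        field_simp
      · simp only [List.map_cons, List.map_nil, List.sum_cons, List.sum_nil, add_zero]
        refine le_mul_of_one_le_left (by positivity) ?_
        have : (0 : ℝ) ≤ 15 / b := by positivity
        linarith
  intro m
  induction m with
  | zero => intro _; simp [cellItems]
  | succ m ih =>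
    intro hm
    rw [cellItems, dif_pos (by omega), pow_succ', mul_assoc]
    exact (key _ _).trans (mul_le_mul_of_nonneg_left (ih (by omega)) (by positivity))

theorem length_cellItems_le (U : Layer n) {K : ℕ} {b : ℝ} (hb : 1 ≤ b) :
    ((cellItems U K n).length : ℝ) ≤ Real.exp (15 * n / b) * b ^ K := by
  refine (length_le_sum_pow _ (fun e => K - e.cum) hb).trans
    ((sum_pow_cellItems_le U hb n le_rfl).trans ?_)
  refine mul_le_mul_of_nonneg_right ?_ (by positivity)
  calc (1 + 15 / b) ^ n ≤ Real.exp (15 / b) ^ n := by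
        refine pow_le_pow_left₀ (by positivity) ?_ n
        have := Real.add_one_le_exp (15 / b); linarith
    _ = Real.exp (15 * n / b) := by rw [← Real.exp_nat_mul]; congr 1; ring

end truncated

/-! ### Programs for the strings with few nonidentity cells -/

section cells
variable {n : ℕ} {orc : PauliString n → ℝ}

theorem code_setPair_of_zero {U : Layer n} {j : Fin n} {P : PauliString n}
    (h : P j = 0 ∧ P (U.partner j) = 0) {ab : Fin 4 × Fin 4} (hab : ab ∈ cellPairs U j) :
    code (setPair P j (U.partner j) ab)
      = code P + ab.1 * 4 ^ (j : ℕ) + ab.2 * 4 ^ (U.partner j : ℕ) := by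
  by_cases hj : U.partner j = j
  · rw [cellPairs, if_pos hj] at hab
    obtain ⟨b, -, rfl⟩ := List.mem_map.1 hab
    have := code_update P j b
    rw [h.1] at this
    simpa [setPair, hj] using this
  · rw [code_setPair P (Ne.symm hj), h.1, h.2]; simp

/-- Append an item with new labels on the current cell. -/
def pushPair (ab : Fin 4 × Fin 4) : Cmd :=
  push (.add (.add (V 114) (NExp.times (.cell 40 (V 80)) ab.1)) (NExp.times (.cell 40 (V 116)) ab.2))
    (.const 1) (.add (V 115) (.const (if ab = (0, 0) then 0 else 1)))

/-- The program for `cellStep`. -/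
def cellBody : Cmd :=
  letN 114 (.cell 200 (V 90)) ;; letN 115 (.cell 201 (V 90)) ;; letR 112 (.cell 200 (V 90)) ;;
  letN 116 (.cell 1 siteExp) ;;
  .ite (.natLe (.add (V 115) (.const 1)) (V 55))
    (.ite (.natLe (V 80) (V 116))
      (.ite (.natLe (V 116) (V 80))
        (seqList (((List.finRange 4).map fun a => ((0 : Fin 4), a)).map pushPair))
        (seqList (labelPairs.map pushPair)))
      (push (V 114) (RV 112) (V 115)))
    (push (V 114) (RV 112) (V 115))

theorem run_cellBody {s : Store n} {e : Item n} (U : Layer n) {K : ℕ} (j : Fin n) (hp : Powers s)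
    (hU : LayerAt s U (s.nat 44 0)) (hK : s.nat 55 0 = K) (hj : s.nat 80 0 = j)
    (h0 : j ≤ U.partner j → e.P j = 0 ∧ e.P (U.partner j) = 0) (he : ItemAt s (s.nat 90 0) e) :
    Run orc cellBody s 72 fun s' => Appends s s' (cellStep U K j e) := by
  obtain ⟨h1, h2, h3⟩ := he
  refine (Run.simple_seq rfl (Run.simple_seq rfl (Run.simple_seq rfl (Run.simple_seq rfl (T := 68) ?_)))).mono
    (by simp [Cmd.size, letN, letR]) fun _ h => h
  set s1 := (((s.setN 114 0 (code e.P)).setN 115 0 e.cum).setR 112 0 e.amp).setN 116 0 (U.partner j)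
    with hs1
  have hsem : sem (letN 116 (.cell 1 siteExp)) (sem (letR 112 (.cell 200 (V 90)))
      (sem (letN 115 (.cell 201 (V 90))) (sem (letN 114 (.cell 200 (V 90))) s))) = s1 := by
    have := (hU j).1
    simp [sem, letN, letR, NExp.eval, RExp.eval, V, siteExp, hs1, h1, h2, h3, hj, this]
  rw [hsem]
  have hr : ∀ a, 200 ≤ a → s1.nat a = s.nat a ∧ s1.real a = s.real a := fun a ha =>
    ⟨by rw [hs1, setN_nat_row (by omega)]; simp only [setR_nat];
        rw [setN_nat_row (by omega), setN_nat_row (by omega)],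
      by rw [hs1, setN_real, setR_real_row (by omega)]; rfl⟩
  have hkeep : ∀ T, 4 ≤ T → Run orc (push (V 114) (RV 112) (V 115)) s1 T fun s' => Appends s s' [e] := by
    intro T hT
    refine (run_push fun s' hk' => ⟨?_, ?_, ?_⟩).mono hT fun s' hs' => hs'.1.congr_left hr
    · simp [NExp.eval, V, hk'.nat 114 (by decide), hs1]
    · simp [RExp.eval, RV, NExp.eval, hk'.real 112 (by decide), hs1]
    · simp [NExp.eval, V, hk'.nat 115 (by decide), hs1]
  refine Run.ite (T := 67) (fun hcum => ?_) fun hcum => ?_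
  swap
  · have hlt : ¬ e.cum + 1 ≤ K := by simpa [Test.holds, NExp.eval, V, hs1, hK] using hcum
    rw [cellStep, if_neg (by tauto)]
    exact hkeep _ (by omega)
  have hlt : e.cum + 1 ≤ K := by simpa [Test.holds, NExp.eval, V, hs1, hK] using hcum
  refine Run.ite (T := 66) (fun hle => ?_) fun hle => ?_
  swap
  · have hle' : ¬ j ≤ U.partner j := by simpa [Test.holds, NExp.eval, V, hs1, hj] using hle
    rw [cellStep, if_neg (by tauto)]
    exact hkeep _ (by omega)
  have hle' : j ≤ U.partner j := by simpa [Test.holds, NExp.eval, V, hs1, hj] using hle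
  rw [cellStep, if_pos ⟨hlt, hle'⟩]
  have hmain : ∀ l : List (Fin 4 × Fin 4), (∀ ab ∈ l, ab ∈ cellPairs U j) → l.length ≤ 16 →
      Run orc (seqList (l.map pushPair)) s1 65 fun s' => Appends s s' (l.map fun ab =>
        ⟨setPair e.P j (U.partner j) ab, 1, if ab = (0, 0) then e.cum else e.cum + 1⟩) := by
    intro l hl hlen
    refine (run_pushes l _ _ _ _ fun ab hab s' hk' => ⟨?_, ?_, ?_⟩).mono (by omega)
      fun s' hs' => hs'.1.congr_left hr
    · have e3 := hp j j.2.le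
      have e4 := hp (U.partner j) (U.partner j).2.le
      rw [code_setPair_of_zero (h0 hle') (hl _ hab)]
      simp only [NExp.eval, V, eval_times, hk'.nat 114 (by decide), hk'.nat 40 (by decide),
        hk'.nat 80 (by decide), hk'.nat 116 (by decide)]
      simp [hs1, hj, e3, e4]
    · simp [RExp.eval]
    · simp only [NExp.eval, V, hk'.nat 115 (by decide)]
      simp only [hs1]
      split_ifs <;> simp
  refine Run.ite (T := 65) (fun hid => ?_) fun hid => ?_
  · have hid' : U.partner j ≤ j := by simpa [Test.holds, NExp.eval, V, hs1, hj] using hid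
    have hc : cellPairs U j = (List.finRange 4).map fun a => (0, a) := if_pos (le_antisymm hid' hle')
    rw [hc]
    exact hmain _ (fun ab h => hc ▸ h) (by simp)
  · have hid' : ¬ U.partner j ≤ j := by simpa [Test.holds, NExp.eval, V, hs1, hj] using hid
    have hc : cellPairs U j = labelPairs := if_neg fun h => hid' h.le
    rw [hc]
    exact hmain _ (fun ab h => hc ▸ h) (by decide)

/-- Make the items `cellItems`. -/
def cellsCmd : Cmd := growCmd cellBody

theorem run_cellsCmd {s : Store n} (U : Layer n) {K N : ℕ} (hn : s.nat 0 0 = n) (hp : Powers s)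
    (hU : LayerAt s U (s.nat 44 0)) (hK : s.nat 55 0 = K)
    (hN : ∀ m ≤ n, (cellItems U K m).length ≤ N) :
    Run orc cellsCmd s (n * (N * 74 + 6) + 8) fun s' => Items s' (cellItems U K n) ∧ Keep 60 s s' := by
  refine run_growCmd (step := cellStep U K) (by decide) (by decide) rfl
    (fun m h => by rw [cellItems, dif_pos h]) hn hN fun j e s' hk hj he hat => ?_
  refine run_cellBody U j (hp.keep hk (by decide)) ?_ (by rw [hk.nat 55 (by decide), hK]) hj
    (fun h => ⟨eq_zero_of_mem_cellItems he j le_rfl h,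
      eq_zero_of_mem_cellItems he _ h (by rw [U.involutive])⟩) hat
  rw [hk.nat 44 (by decide)]
  exact hU.keep hk (by decide)

/-! ### Tables of Pauli strings -/

theorem Appends.nil_of_eq {s s' : Store n} (h : ∀ a, 200 ≤ a → a < 203 → s'.nat a = s.nat a ∧
    s'.real a = s.real a) : Appends s s' [] :=
  ⟨by rw [(h 202 (by decide) (by decide)).1]; rfl, fun k hk => absurd hk (by simp),
    fun k _ => by rw [(h 200 (by decide) (by decide)).1, (h 201 (by decide) (by decide)).1,
      (h 200 (by decide) (by decide)).2]; simp⟩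

/-- Array 215, array 216 and register 217 hold the codes, the labels and the number of the Pauli
strings in a list. -/
def Table (s : Store n) (C : List (PauliString n)) : Prop :=
  s.nat 217 0 = C.length ∧ ∀ k (hk : k < C.length),
    s.nat 215 k = code C[k] ∧ ∀ j : Fin n, s.nat 216 (k * n + j) = C[k] j

/-- Append the Pauli string that has been loaded to the table. -/
def tableStep : Cmd :=
  .setNat 215 (V 217) (V 114) ;; letN 219 (.const 0) ;;
  forTo 219 nExp (.setNat 216 (V 218) (.cell 100 (V 219)) ;; letN 218 (.add (V 218) (.const 1))) ;;
  letN 217 (.add (V 217) (.const 1))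

theorem run_tableStep {s : Store n} {q : ℝ} {e : Item n} {C : List (PauliString n)} (hn : s.nat 0 0 = n)
    (he : Loaded s q e) (hC : Table s C) (h218 : s.nat 218 0 = C.length * n) :
    Run orc tableStep s (4 * n + 4) fun s' => Table s' (C ++ [e.P]) ∧
      s'.nat 218 0 = (C ++ [e.P]).length * n := by
  refine (Run.simple_seq rfl (Run.simple_seq rfl ((run_forTo (fun m s' => s'.nat 0 0 = n ∧
    s'.nat 218 0 = C.length * n + m ∧ s'.nat 217 0 = C.length ∧ s'.nat 100 = s.nat 100 ∧
    s'.nat 215 C.length = code e.P ∧ (∀ k < C.length, s'.nat 215 k = s.nat 215 k) ∧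
    (∀ i < C.length * n, s'.nat 216 i = s.nat 216 i) ∧
    ∀ j : Fin n, (j : ℕ) < m → s'.nat 216 (C.length * n + j) = e.P j) (fun _ => 2) (k := n) (k0 := 0)
    (Nat.zero_le _) (by decide) ?_ ?_ ?_ ?_).seq fun s' hs' => (run_simple rfl s').mono le_rfl ?_))).mono
    ?_ fun _ h => h
  · rintro m s' hs' -
    simpa [nExp, NExp.eval] using hs'.1
  · rintro m - hm s' ⟨g1, g2, g3, g4, g5, g6, g7, g8⟩ h219
    refine (run_simple rfl s').mono le_rfl ?_
    rintro s1 rfl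
    have hs1 : sem (.setNat 216 (V 218) (.cell 100 (V 219)) ;; letN 218 (.add (V 218) (.const 1))) s'
        = (s'.setN 216 (C.length * n + m) (e.P ⟨m, hm⟩)).setN 218 0 (C.length * n + m + 1) := by
      have := he.dec.label ⟨m, hm⟩
      simp at this
      simp [sem, letN, V, NExp.eval, g2, g4, h219, this]
    rw [hs1]
    refine ⟨by simpa using g1, by simp; ring, by simpa using g3, ?_, by simpa using g5, ?_, ?_, ?_⟩
    · rw [setN_nat_row (by decide), setN_nat_row (by decide), setN_nat_row (by decide), g4]
    · intro k hk; simpa using g6 k hk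
    · intro i hi
      have : i ≠ C.length * n + m := by omega
      simpa [this] using g7 i hi
    · intro j hj
      by_cases hjm : (j : ℕ) = m
      · subst hjm; simp
      · simpa [hjm] using g8 j (by omega)
  · simp only [sem, letN, NExp.eval, V, hC.1, he.code]
    refine ⟨by simpa using hn, by simp [h218], by simp [hC.1], ?_, by simp, ?_, by simp, fun j hj => by omega⟩
    · rw [setN_nat_row (by decide), setN_nat_row (by decide)]
    · intro k hk; simp [hk.ne]
  · simp [sem, letN, NExp.eval]
  · obtain ⟨⟨-, g2, g3, -, g5, g6, g7, g8⟩, -⟩ := hs'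
    rintro s'' rfl
    have hs1 : sem (letN 217 (.add (V 217) (.const 1))) s' = s'.setN 217 0 (C.length + 1) := by
      simp [sem, letN, V, NExp.eval, g3]
    rw [hs1]
    refine ⟨⟨by simp, fun k hk => ?_⟩, by simp [g2]; ring⟩
    rcases Nat.lt_or_ge k C.length with hkC | hkC
    · rw [List.getElem_append_left hkC]
      have h := hC.2 k hkC
      refine ⟨by simpa [g6 k hkC] using h.1, fun j => ?_⟩
      have : k * n + (j : ℕ) < C.length * n := by
        calc k * n + (j : ℕ) < k * n + n := by omega
          _ = (k + 1) * n := by ring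
          _ ≤ C.length * n := Nat.mul_le_mul_right _ hkC
      simpa [g7 _ this] using h.2 j
    · have : k = C.length := by simp at hk; omega
      subst this
      rw [List.getElem_concat_length rfl]
      exact ⟨by simpa using g5, fun j => by simpa using g8 j j.2⟩
  · simp [Cmd.size, letN]; omega

/-- Make the table of the Pauli strings of the current items. -/
def tableCmd : Cmd := letN 217 (.const 0) ;; letN 218 (.const 0) ;; forItems (loadItem ;; tableStep)

theorem run_tableCmd {s : Store n} {l : List (Item n)} (hn : s.nat 0 0 = n) (hp : Powers s)
    (hl : Items s l) :
    Run orc tableCmd s (l.length * (28 * n + 14) + 6) fun s' => Table s' (l.map Item.P) ∧ Keep 90 s s' := by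
  refine Run.keep ?_ (by decide) (by decide)
  refine (Run.simple_seq rfl (Run.simple_seq rfl ((run_forItems (by decide) (l := l)
    ((hl.setN (a := 217) (i := 0) (v := 0) (by decide)).setN (a := 218) (i := 0) (v := 0) (by decide))
    (fun _ => []) (fun p s' => s'.nat 0 0 = n ∧ Powers s' ∧ Table s' (p.map Item.P) ∧
    s'.nat 218 0 = (p.map Item.P).length * n) (28 * n + 12) ?_ ?_ ?_).mono le_rfl
    fun s' hs' => hs'.2.2.2.1))).mono ?_ fun _ h => h
  · refine ⟨by simpa using hn, fun j hj => by simpa using hp j hj, ⟨by simp, fun k hk => absurd hk (by simp)⟩,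
      by simp⟩
  · rintro p s1 s2 ⟨h1, h2, h3, h4⟩ h5 h6 h7
    refine ⟨by rw [h5 0 (by omega)]; exact h1, fun j hj => ?_, ?_, by rw [h5 218 (by omega)]; exact h4⟩
    · rw [h5 40 (by omega)]; exact h2 j hj
    · unfold Table; rw [h5 217 (by omega), h5 215 (by omega), h5 216 (by omega)]; exact h3
  · rintro p e s1 - ⟨h1, h2, h3, h4⟩ he
    refine (Run.seq (run_loadItem h1 h2 he) (T' := 4 * n + 4) fun s2 ⟨g1, g2, g3⟩ => ?_).mono
      (by omega) fun _ h => h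
    have h3' : Table s2 (p.map Item.P) := by
      unfold Table; rw [(g3 217 (by omega)).1, (g3 215 (by omega)).1, (g3 216 (by omega)).1]; exact h3
    refine (run_tableStep (by rw [g2.nat 0 (by decide), h1]) g1 h3'
      (by rw [(g3 218 (by omega)).1, h4])).frame.mono le_rfl fun s3 ⟨⟨f1, f2⟩, f3⟩ => ?_
    have hsame : ∀ a < 203, s3.nat a = s2.nat a ∧ s3.real a = s2.real a := fun a ha =>
      f3.1 a (Or.inl (lt_of_lt_of_le ha (by decide)))
    refine ⟨.nil_of_eq fun a ha ha' => ?_, ?_, ?_, ?_⟩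
    · exact ⟨(hsame a ha').1.trans (g3 a ha).1, (hsame a ha').2.trans (g3 a ha).2⟩
    · rw [(hsame 0 (by decide)).1, g2.nat 0 (by decide), h1]
    · intro j hj; rw [(hsame 40 (by decide)).1, g2.nat 40 (by decide)]; exact h2 j hj
    · rw [List.map_append]; exact ⟨f1, f2⟩
  · simp only [Cmd.size, letN, Nat.add_assoc, Nat.reduceAdd]; omega

end cells

/-! ### Gates on a vector in memory -/

section gates
variable {n : ℕ} {orc : PauliString n → ℝ}

/-- The values are demanded in all stores that differ from `s` in the real array `A` only, since
earlier assignments have changed it; so they must not depend on what is being written. -/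
theorem run_setReals {α : Type*} {s : Store n} (A : ℕ) (as : List α) (i : α → NExp) (e : α → RExp)
    (idx : α → ℕ) (v : α → ℝ) (hv : ∀ a ∈ as, ∀ b ∈ as, idx a = idx b → v a = v b)
    (h : ∀ a ∈ as, ∀ s' : Store n, s'.nat = s.nat → (∀ b, b ≠ A → s'.real b = s.real b) →
      (i a).eval s' = idx a ∧ (e a).eval s' = v a) :
    Run orc (seqList (as.map fun a => .setReal A (i a) (e a))) s (as.length + 1) fun s' =>
      s'.nat = s.nat ∧ (∀ b, b ≠ A → s'.real b = s.real b) ∧ s'.out = s.out ∧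
      (∀ a ∈ as, s'.real A (idx a) = v a) ∧
      ∀ k, (∀ a ∈ as, k ≠ idx a) → s'.real A k = s.real A k := by
  induction as generalizing s with
  | nil => exact ⟨s, 1, .skip s, by simp, rfl, fun _ _ => rfl, rfl, by simp, fun _ _ => rfl⟩
  | cons a as ih =>
    have ha := h a (by simp) s rfl fun _ _ => rfl
    have hs1 : sem (.setReal A (i a) (e a)) s = s.setR A (idx a) (v a) := by
      simp [sem, ha.1, ha.2]
    refine (Run.simple_seq rfl ?_).mono (T := 1 + (as.length + 1)) (by simp; omega) fun _ h => h
    rw [hs1]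
    refine (ih (s := s.setR A (idx a) (v a)) (fun b hb c hc => hv b (by simp [hb]) c (by simp [hc]))
      fun b hb s' h1 h2 => h b (by simp [hb]) s' h1 fun c hc => by
        rw [h2 c hc, setR_real_row hc]).mono le_rfl ?_
    rintro s' ⟨g1, g2, g3, g4, g5⟩
    refine ⟨g1, fun b hb => by rw [g2 b hb, setR_real_row hb], g3, fun b hb => ?_, fun k hk => ?_⟩
    · by_cases hb' : ∃ c ∈ as, idx b = idx c
      · obtain ⟨c, hc, hbc⟩ := hb'
        rw [hbc, g4 c hc]
        exact hv c (by simp [hc]) b hb hbc.symm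
      · push Not at hb'
        have hba : b = a := by
          rcases List.mem_cons.1 hb with h | h
          · exact h
          · exact absurd rfl (hb' b h)
        subst hba
        rw [g5 _ hb']; simp
    · rw [g5 k fun b hb => hk b (by simp [hb])]
      have := hk a (by simp)
      simp [this]

/-- The vector `z` is stored in array 230 from the entry that register 56 points at, with zeros
after it. -/
def VecAt (s : Store n) (z : PauliString n → ℝ) : Prop :=
  (∀ P, s.real 230 (s.nat 56 0 + code P) = z P) ∧ ∀ i, s.nat 56 0 + 4 ^ n ≤ i → s.real 230 i = 0

/-- A power of the damping factor. -/
def dampPow : ℕ → RExp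
  | 0 => .const 1
  | k + 1 => .mul (dampPow k) dampExp

theorem eval_dampPow (s : Store n) (k : ℕ) : (dampPow k).eval s = s.real 0 0 ^ k := by
  induction k with
  | zero => simp [dampPow, RExp.eval]
  | succ k ih => rw [dampPow, RExp.eval, ih, pow_succ]; rfl

/-- The entry of the Pauli string with the labels `ab` on the current cell. -/
def pairAddr (ab : Fin 4 × Fin 4) : NExp :=
  .add (.add (V 120) (NExp.times (.cell 40 (V 80)) ab.1)) (NExp.times (.cell 40 (V 116)) ab.2)

/-- The number of a pair of labels. -/
def pairNo (ab : Fin 4 × Fin 4) : ℕ := 4 * ab.1 + ab.2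

theorem pairNo_injective : Function.Injective pairNo := by
  intro a b h
  simp only [pairNo] at h
  exact Prod.ext (Fin.ext (by omega)) (Fin.ext (by omega))

/-- Apply a gate to the Pauli strings that agree with the one in register 120 outside of the cell. -/
def fiberCmd : Cmd :=
  letN 120 (.add (V 56) (.cell 215 (V 82))) ;;
  seqList (labelPairs.map fun ab => .setReal 104 (.const (pairNo ab)) (.cell 230 (pairAddr ab))) ;;
  seqList (labelPairs.map fun ab => .setReal 230 (pairAddr ab) (sumExp (labelPairs.map fun p =>
    .mul (.mul (gateExp siteExp ab p) (dampPow (pairWeight p))) (.cell 104 (.const (pairNo p))))))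

theorem run_fiberCmd {s : Store n} {U : Layer n} {j : Fin n} {q : ℝ} {R : PauliString n} (hp : Powers s)
    (hU : LayerAt s U (s.nat 44 0)) (hq : s.real 0 0 = q) (hj : j < U.partner j) (h80 : s.nat 80 0 = j)
    (h116 : s.nat 116 0 = U.partner j) (hR : s.nat 215 (s.nat 82 0) = code R)
    (h0 : R j = 0 ∧ R (U.partner j) = 0) :
    Run orc fiberCmd s 35 fun s' => (∀ a, a ≠ 120 → s'.nat a = s.nat a) ∧
      (∀ ab, s'.real 230 (s.nat 56 0 + code (setPair R j (U.partner j) ab)) = ∑ p, noisyGate q U j ab p *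
        s.real 230 (s.nat 56 0 + code (setPair R j (U.partner j) p))) ∧
      ∀ i, (∀ ab, i ≠ s.nat 56 0 + code (setPair R j (U.partner j) ab)) →
        s'.real 230 i = s.real 230 i := by
  set adr : Fin 4 × Fin 4 → ℕ := fun ab => s.nat 56 0 + code (setPair R j (U.partner j) ab) with hadr
  set s1 := s.setN 120 0 (s.nat 56 0 + code R) with hs1
  have hsem : sem (letN 120 (.add (V 56) (.cell 215 (V 82)))) s = s1 := by
    simp [sem, letN, V, NExp.eval, hR, hs1]
  have hrow : ∀ a, a ≠ 120 → s1.nat a = s.nat a := fun a ha => setN_nat_row ha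
  have hpair : ∀ ab, (s' : Store n) → s'.nat = s1.nat → (pairAddr ab).eval s' = adr ab := by
    intro ab s' h
    have hc : cellPairs U j = labelPairs := if_neg hj.ne'
    simp only [pairAddr, NExp.eval, eval_times, V, h, hrow 40 (by decide), hrow 80 (by decide),
      hrow 116 (by decide), h80, h116, hp _ j.2.le, hp _ (U.partner j).2.le, hadr]
    rw [code_setPair_of_zero h0 (hc ▸ mem_labelPairs ab)]
    simp [hs1]; ring
  have hinj : ∀ a b, adr a = adr b → a = b := by
    intro a b h
    have h1 := code_injective (Nat.add_left_cancel h)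
    have h2 := ((setPair_eq_iff hj.ne a).1 h1).1
    rw [h2]; simp [setPair, hj.ne]
  refine (Run.simple_seq rfl (T := 34) ?_).mono (by simp [Cmd.size, letN]) fun _ h => h
  rw [hsem]
  -- The sixteen old values are saved first, so that the update in place uses none of the new ones.
  refine (run_setReals 104 labelPairs _ _ pairNo (fun ab => s.real 230 (adr ab))
    (fun a _ b _ h => by rw [pairNo_injective h]) fun ab _ s' h1 h2 => ⟨rfl, ?_⟩).seq (T' := 17)
    fun s2 ⟨g1, g2, _, g4, _⟩ => ?_
  · rw [RExp.eval, hpair ab s' h1, h2 230 (by decide)]; rfl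
  · refine (run_setReals 230 labelPairs _ _ adr (fun ab => ∑ p, noisyGate q U j ab p * s.real 230 (adr p))
      (fun a _ b _ h => by rw [hinj a b h]) fun ab _ s' h1 h2 => ⟨hpair ab s' (h1.trans g1), ?_⟩).mono le_rfl
      fun s3 ⟨f1, f2, _, f4, f5⟩ => ⟨fun a ha => ?_, fun ab => f4 ab (mem_labelPairs ab), fun i hi => ?_⟩
    · rw [eval_sumExp, List.map_map, sum_labelPairs]
      refine Finset.sum_congr rfl fun p _ => ?_
      have hr : ∀ b, b < 100 → s'.real b = s.real b := fun b hb => by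
        rw [h2 b (by omega), g2 b (by omega)]; rfl
      have hn' : ∀ a, a ≠ 120 → s'.nat a = s.nat a := fun a ha => by rw [h1, g1, hrow a ha]
      have hg : GateAt s' (U.gate j) (siteExp.eval s') := by
        simp only [siteExp, NExp.eval, V, hn' 44 (by decide), hn' 80 (by decide), h80]
        intro e he
        rw [hr _ (by omega), hr _ (by omega)]
        exact (hU j).2 e he
      simp only [Function.comp, RExp.eval, NExp.eval, eval_gateExp hg, eval_dampPow, hr 0 (by decide), hq,
        h2 104 (by decide), g4 p (mem_labelPairs p), noisyGate]
    · rw [f1, g1, hrow a ha]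
    · rw [f5 i fun ab _ => hi ab, g2 230 (by decide)]; rfl

theorem setPair_setPair (R : PauliString n) (j k : Fin n) (a b : Fin 4 × Fin 4) :
    setPair (setPair R j k a) j k b = setPair R j k b := by
  ext1 i
  by_cases h1 : i = k
  · subst h1; simp [setPair]
  · by_cases h2 : i = j
    · subst h2; simp [setPair, h1]
    · simp [setPair, h1, h2]

theorem setPair_self (R : PauliString n) (j k : Fin n) : setPair R j k (R j, R k) = R := by
  simp [setPair]

/-- Apply the gate at the qubit in register 80, if there is one, to the stored vector. -/
def gateCmd : Cmd :=
  letN 116 (.cell 1 siteExp) ;;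
  .ite (.natLe (.add (V 80) (.const 1)) (V 116))
    (letN 117 (V 80) ;; letN 118 (V 116) ;; letN 82 (.const 0) ;;
      forTo 82 (V 217)
        (.ite (.natLe (.add (.cell 216 (V 117)) (.cell 216 (V 118))) (.const 0)) fiberCmd .skip ;;
          letN 117 (.add (V 117) nExp) ;; letN 118 (.add (V 118) nExp)))
    .skip

/-- A gate mixes only the sixteen strings that agree off its cell. Such a fibre is represented by
its string that is the identity on the cell. If the fibre meets the support in a nonidentity label,
the representative has at most K nonidentity cells and is in the table. The pointers 117 and 118
advance by n with every row, so a row costs a bounded number of steps. -/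
theorem run_gateCmd {s : Store n} {U : Layer n} {j : Fin n} {q : ℝ} {C : List (PauliString n)} {K : ℕ}
    {z : PauliString n → ℝ} (hn : s.nat 0 0 = n) (hp : Powers s) (hU : LayerAt s U (s.nat 44 0))
    (hq : s.real 0 0 = q) (h80 : s.nat 80 0 = j) (hC : Table s C) (hnd : C.Nodup)
    (hmem : ∀ R, cellCount U n R ≤ K → R ∈ C) (hz : ∀ R, K + 1 < cellCount U n R → z R = 0)
    (hv : VecAt s z) :
    Run orc gateCmd s (40 * C.length + 6) fun s' =>
      VecAt s' (if j < U.partner j then gateMap q U j z else z) ∧ Keep 82 s s' ∧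
      ∀ a, 203 ≤ a → s'.nat a = s.nat a := by
  suffices Run orc gateCmd s (40 * C.length + 6) fun s' =>
      (Keep 82 s s' → VecAt s' (if j < U.partner j then gateMap q U j z else z)) ∧
      ∀ a, 203 ≤ a → s'.nat a = s.nat a from
    (this.keep (b := 82) (by decide) (by decide)).mono le_rfl fun s' h => ⟨h.1.1 h.2, h.2, h.1.2⟩
  have hs1 : sem (letN 116 (.cell 1 siteExp)) s = s.setN 116 0 (U.partner j) := by
    have := (hU j).1
    simp [sem, letN, NExp.eval, V, siteExp, h80, this]
  refine (Run.simple_seq rfl (T := 40 * C.length + 5) ?_).mono (by simp [Cmd.size, letN]; omega) fun _ h => h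
  rw [hs1]
  refine Run.ite (T := 40 * C.length + 4) (fun h => ?_) fun h => ?_
  swap
  · have hj : ¬ j < U.partner j := by simpa [Test.holds, NExp.eval, V, h80, Nat.succ_le_iff] using h
    refine ⟨_, 1, .skip _, by omega, fun _ => ?_, fun a ha => setN_nat_row (by omega)⟩
    rw [if_neg hj]
    simpa [VecAt] using hv
  have hj : j < U.partner j := by simpa [Test.holds, NExp.eval, V, h80, Nat.succ_le_iff] using h
  rw [if_pos hj]
  set xo := s.nat 56 0 with hxo
  refine (Run.simple_seq rfl (Run.simple_seq rfl (Run.simple_seq rfl (((run_forTo (fun m s' =>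
    Keep 82 s s' ∧ (∀ a, 203 ≤ a → s'.nat a = s.nat a) ∧ s'.nat 116 0 = U.partner j ∧
    s'.nat 117 0 = m * n + j ∧ s'.nat 118 0 = m * n + U.partner j ∧
    (∀ R, s'.real 230 (xo + code R) = if setPair R j (U.partner j) (0, 0) ∈ C.take m then gateMap q U j z R
      else z R) ∧ ∀ i, xo + 4 ^ n ≤ i → s'.real 230 i = 0) (fun _ => 38) (k := C.length) (k0 := 0)
    (Nat.zero_le _) (Or.inl (by decide)) ?_ ?_ ?_ ?_).mono le_rfl fun s' hs' => ?_))))).mono ?_ fun _ h => h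
  · rintro m s' ⟨-, h2, -⟩ -
    simp [V, NExp.eval, h2 217 (by decide), hC.1]
  · rintro m - hm s' ⟨g1, g2, g3, g4, g5, g6, g7⟩ h82
    have e80 : s'.nat 80 0 = j := by rw [g1.nat 80 (by decide), h80]
    have e47 : s'.nat 56 0 = xo := by rw [g1.nat 56 (by decide)]
    have hCm := hC.2 m hm
    have hf1 : s'.nat 216 (m * n + j) = C[m] j := by rw [g2 216 (by decide)]; exact hCm.2 j
    have hf2 : s'.nat 216 (m * n + U.partner j) = C[m] (U.partner j) := by
      rw [g2 216 (by decide)]; exact hCm.2 _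
    have htake : C.take (m + 1) = C.take m ++ [C[m]] := List.take_succ_eq_append_getElem hm
    have hin : ∀ R, R ∈ C.take (m + 1) ↔ R ∈ C.take m ∨ R = C[m] := fun R => by
      rw [htake, List.mem_append, List.mem_singleton]
    have hnot : C[m] ∉ C.take m := by
      have h1 : (C.take (m + 1)).Nodup := hnd.sublist (List.take_sublist _ _)
      rw [htake] at h1
      intro h2
      exact (List.nodup_append.1 h1).2.2 _ h2 _ (by simp) rfl
    refine Run.seq (T := 36) (T' := 2) (mid := fun s'' => (∀ a, a ≠ 120 → s''.nat a = s'.nat a) ∧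
      Keep 82 s' s'' ∧ (∀ R, s''.real 230 (xo + code R) =
        if setPair R j (U.partner j) (0, 0) ∈ C.take (m + 1) then gateMap q U j z R else z R) ∧
      ∀ i, xo + 4 ^ n ≤ i → s''.real 230 i = 0) ?_ ?_
    · refine (Run.ite (T := 35) (fun h0 => ?_) fun h0 => ?_)
      · have h0 : C[m] j = 0 ∧ C[m] (U.partner j) = 0 := by
          simp only [Test.holds, NExp.eval, V, g4, g5, hf1, hf2] at h0
          exact ⟨Fin.ext (by simp; omega), Fin.ext (by simp; omega)⟩
        have hfib := run_fiberCmd (orc := orc) (s := s') (q := q) (R := C[m]) (hp.keep g1 (by decide))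
          (by rw [g1.nat 44 (by decide)]; exact hU.keep g1 (by decide))
          (by rw [g1.real 0 (by decide), hq]) hj e80 g3 (by rw [h82, g2 215 (by decide)]; exact hCm.1) h0
        rw [e47] at hfib
        refine (hfib.keep (b := 82) (by decide) (by decide)).mono le_rfl ?_
        rintro s'' ⟨⟨f1, f2, f3⟩, f4⟩
        refine ⟨f1, f4, fun R => ?_, fun i hi => ?_⟩
        · by_cases hR : setPair R j (U.partner j) (0, 0) = C[m]
          · rw [if_pos ((hin _).2 (Or.inr hR))]
            have h1 : ∀ p, setPair C[m] j (U.partner j) p = setPair R j (U.partner j) p := fun p => by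
              rw [← hR, setPair_setPair]
            have h2 : R = setPair C[m] j (U.partner j) (R j, R (U.partner j)) := by
              rw [h1, setPair_self]
            conv_lhs => rw [h2]
            rw [f2, gateMap]
            refine Finset.sum_congr rfl fun p _ => ?_
            rw [g6, setPair_setPair, h1 (0, 0), hR, if_neg hnot, h1]
          · rw [f3, g6]
            · simp only [hin, hR, or_false]
            · intro ab h1
              have h2 := code_injective (Nat.add_left_cancel h1)
              rw [h2, setPair_setPair, setPair_zero_self h0] at hR
              exact hR rfl
        · rw [f3, g7 i hi]
          intro ab h1
          have := code_lt (setPair C[m] j (U.partner j) ab)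
          omega
      · refine ⟨s', 1, .skip _, by omega, fun _ _ => rfl, .refl _ _, fun R => ?_, g7⟩
        have hR : setPair R j (U.partner j) (0, 0) ≠ C[m] := by
          intro h1
          apply h0
          simp only [Test.holds, NExp.eval, V, g4, g5, hf1, hf2, ← h1]
          simp [setPair, hj.ne]
        rw [g6]
        simp only [hin, hR, or_false]
    · rintro s2 ⟨f1, f2, f3, f4⟩
      have k2 := g1.trans f2
      refine (run_simple rfl s2).mono le_rfl ?_
      rintro s3 rfl
      have hs3 : sem (letN 117 (.add (V 117) nExp) ;; letN 118 (.add (V 118) nExp)) s2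
          = (s2.setN 117 0 (m * n + j + n)).setN 118 0 (m * n + U.partner j + n) := by
        simp [sem, letN, V, NExp.eval, nExp, f1 117 (by decide), f1 118 (by decide), g4, g5,
          k2.nat 0 (by decide), hn]
      rw [hs3]
      refine ⟨((k2.setN (by decide)).setN (by decide)).setN le_rfl, fun a ha => ?_, ?_, by simp; ring,
        by simp; ring, by simpa using f3, by simpa using f4⟩
      · rw [setN_nat_row (by omega), setN_nat_row (by omega), setN_nat_row (by omega), f1 a (by omega), g2 a ha]
      · simp [f1 116 (by decide), g3]
  · have hs2 : sem (letN 82 (.const 0)) (sem (letN 118 (V 116)) (sem (letN 117 (V 80))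
        (s.setN 116 0 (U.partner j)))) = (((s.setN 116 0 (U.partner j)).setN 117 0 j).setN 118 0
        (U.partner j)).setN 82 0 0 := by
      simp [sem, letN, V, NExp.eval, h80]
    rw [hs2]
    refine ⟨((((Keep.refl _ _).setN (by decide)).setN (by decide)).setN (by decide)).setN le_rfl,
      fun a ha => ?_, by simp, by simp, by simp, by simpa using hv.1, by simpa using hv.2⟩
    rw [setN_nat_row (by omega), setN_nat_row (by omega), setN_nat_row (by omega), setN_nat_row (by omega)]
  · simp [sem, letN, NExp.eval]
  · obtain ⟨⟨g1, g2, -, -, -, g6, g7⟩, -⟩ := hs'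
    refine ⟨fun _ => ?_, g2⟩
    rw [VecAt, g1.nat 56 (by decide)]
    refine ⟨fun R => ?_, g7⟩
    -- A string over no table entry is either the identity on the cell, which the gate leaves alone,
    -- or has more than K + 1 nonidentity cells, where both vectors vanish.
    rw [g6, List.take_length]
    split_ifs with hR
    · rfl
    · by_cases h0 : R j = 0 ∧ R (U.partner j) = 0
      · rw [gateMap_of_zero q hj z h0]
      · have h1 := cellCount_setPair U hj R (0, 0)
        rw [if_neg h0, if_pos rfl] at h1
        have h2 : ¬ cellCount U n (setPair R j (U.partner j) (0, 0)) ≤ K := fun h => hR (hmem _ h)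
        rw [gateMap_eq_zero q hj hz (by omega), hz R (by omega)]
  · simp [Cmd.size, letN]; omega

/-- Apply all gates of a layer to the stored vector. -/
def gatesCmd : Cmd := letN 80 (.const 0) ;; forTo 80 nExp gateCmd

theorem run_gatesCmd {s : Store n} {U : Layer n} {q : ℝ} {C : List (PauliString n)} {K : ℕ}
    {z : PauliString n → ℝ} (hn : s.nat 0 0 = n) (hp : Powers s) (hU : LayerAt s U (s.nat 44 0))
    (hq : s.real 0 0 = q) (hC : Table s C) (hnd : C.Nodup)
    (hmem : ∀ R, cellCount U n R ≤ K → R ∈ C) (hz : ∀ R, K + 1 < weight R → z R = 0) (hv : VecAt s z) :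
    Run orc gatesCmd s (n * (40 * C.length + 8) + 2) fun s' =>
      VecAt s' (stepVec .gateBased q U z) ∧ Keep 80 s s' ∧ ∀ a, 203 ≤ a → s'.nat a = s.nat a := by
  have hs1 : sem (letN 80 (.const 0)) s = s.setN 80 0 0 := by simp [sem, letN, NExp.eval]
  refine (Run.simple_seq rfl ?_).mono (T := 1 + (n * (40 * C.length + 8) + 1)) (by omega) fun _ h => h
  rw [hs1, ← gatesVec_last]
  refine (run_forTo (fun m s' => VecAt s' (gatesVec q U z m) ∧ Keep 80 s s' ∧
    ∀ a, 203 ≤ a → s'.nat a = s.nat a) (fun _ => 40 * C.length + 6) (k := n) (k0 := 0) (Nat.zero_le _)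
    (Or.inl (by decide)) ?_ ?_ ?_ ?_).mono (by simp) fun s' hs' => hs'.1
  · rintro m s' ⟨-, hk, -⟩ -
    simp [nExp, NExp.eval, hk.nat 0 (by decide), hn]
  · rintro m - hm s' ⟨g1, g2, g3⟩ h80
    refine (run_gateCmd (U := U) (j := ⟨m, hm⟩) (q := q) (C := C) (K := K)
      (by rw [g2.nat 0 (by decide), hn]) (hp.keep g2 (by decide))
      (by rw [g2.nat 44 (by decide)]; exact hU.keep g2 (by decide)) (by rw [g2.real 0 (by decide), hq]) h80
      (by unfold Table; rw [g3 217 (by decide), g3 215 (by decide), g3 216 (by decide)]; exact hC)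
      hnd hmem (gatesVec_eq_zero q hz m) g1).mono le_rfl ?_
    rintro s2 ⟨f1, f2, f3⟩
    refine ⟨?_, (g2.trans (f2.mono (by decide))).setN le_rfl, fun a ha => ?_⟩
    · rw [gatesVec, dif_pos hm]
      have : (s2.setN 80 0 (m + 1)).nat 56 0 = s2.nat 56 0 := by simp
      rw [VecAt, this]
      split_ifs at f1 ⊢ <;> exact f1
    · rw [setN_nat_row (by omega), f3 a ha, g3 a ha]
  · refine ⟨?_, (Keep.refl _ _).setN le_rfl, fun a ha => setN_nat_row (by omega)⟩
    simpa [VecAt, gatesVec] using hv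
  · simp

end gates

/-! ### Visiting all Pauli strings of small weight -/

section visits
variable {n : ℕ} {orc : PauliString n → ℝ}

/-- The Pauli strings that differ from `P` at most by a label at one of the first `m` qubits on which
`P` is the identity. -/
def children (P : PauliString n) : ℕ → List (PauliString n)
  | 0 => []
  | m + 1 => children P m ++ if h : m < n then
      if P ⟨m, h⟩ = 0 then (List.finRange 4).map (Function.update P ⟨m, h⟩) else [] else []

theorem mem_children {P R : PauliString n} : ∀ {m : ℕ}, R ∈ children P m ↔
    ∃ j : Fin n, (j : ℕ) < m ∧ P j = 0 ∧ ∃ a, R = Function.update P j a := by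
  intro m
  induction m with
  | zero => simp [children]
  | succ m ih =>
    rw [children, List.mem_append, ih]
    constructor
    · rintro (⟨j, hj, h⟩ | h)
      · exact ⟨j, by omega, h⟩
      · split_ifs at h with h1 h2
        · obtain ⟨a, -, rfl⟩ := List.mem_map.1 h
          exact ⟨⟨m, h1⟩, Nat.lt_succ_self m, h2, a, rfl⟩
        · simp at h
        · simp at h
    · rintro ⟨j, hj, h0, a, rfl⟩
      rcases Nat.lt_succ_iff_lt_or_eq.1 hj with hj | rfl
      · exact Or.inl ⟨j, hj, h0, a, rfl⟩
      · right
        rw [dif_pos j.2, if_pos h0]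
        exact List.mem_map.2 ⟨a, List.mem_finRange a, rfl⟩

/-- All Pauli strings that the items lead to. -/
def visits (l : List (Item n)) : List (PauliString n) := l.flatMap fun e => children e.P n

/-- Erasing one nonidentity label produces a seed; the identity is a child of itself, which needs a
qubit. A string may be visited several times, so the actions have to tolerate repetitions. -/
theorem mem_visits_seedItems (hn : 1 ≤ n) {K : ℕ} {R : PauliString n} :
    R ∈ visits (seedItems K n) ↔ weight R ≤ K + 1 := by
  rw [visits, List.mem_flatMap]
  constructor
  · rintro ⟨e, he, hR⟩
    obtain ⟨j, -, h0, a, rfl⟩ := mem_children.1 hR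
    have := weight_le_of_mem_seedItems he
    rw [weight_update h0]
    split_ifs <;> omega
  · intro hR
    obtain ⟨j, hj⟩ : ∃ j : Fin n, R = 0 ∨ R j ≠ 0 := by
      by_cases h : R = 0
      · exact ⟨⟨0, hn⟩, Or.inl h⟩
      · obtain ⟨j, hj⟩ := Function.ne_iff.1 h
        exact ⟨j, Or.inr hj⟩
    set P := Function.update R j 0 with hP
    have h0 : P j = 0 := by simp [hP]
    have hRP : R = Function.update P j (R j) := by simp [hP]
    have hw : weight P ≤ K := by
      rcases hj with rfl | hj
      · have : P = 0 := by simp [hP]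
        rw [this, weight_eq_zero.2 rfl]; exact Nat.zero_le _
      · have := weight_update h0 (R j)
        rw [← hRP, if_neg hj] at this
        omega
    obtain ⟨e, he, h1, -⟩ := mem_seedItems hw n le_rfl
    rw [headPart_last] at h1
    exact ⟨e, he, mem_children.2 ⟨j, j.2, by rw [h1, h0], R j, by rw [h1]; exact hRP⟩⟩

/-- Put the label `a` on the qubit in register 300 and run `action`. -/
def visitOne (action : Cmd) (a : Fin 4) : Cmd :=
  .setNat 100 (V 300) (.const a) ;; letN 118 (.add (V 114) (NExp.times (.cell 40 (V 300)) a)) ;;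
  letR 118 (.mul (RV 100) (if a = 0 then .const 1 else dampExp)) ;; action

/-- Run `action` on all children of the Pauli string that has been loaded. -/
def visitBody (action : Cmd) : Cmd :=
  letN 300 (.const 0) ;; forTo 300 nExp
    (.ite (.natLe (.cell 100 (V 300)) (.const 0))
      (seqList ((List.finRange 4).map (visitOne action)) ;; .setNat 100 (V 300) (.const 0)) .skip)

/-- Run `action` on all Pauli strings that the current items lead to. -/
def visitCmd (action : Cmd) : Cmd := forItems (loadItem ;; visitBody action)

/-- The state while the children of `P` are visited, with respect to an earlier state. -/
structure Visiting (s₀ s : Store n) (q : ℝ) (P : PauliString n) : Prop where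
  base : ∀ a, a < 90 ∨ 200 ≤ a ∧ a < 203 → s.nat a = s₀.nat a ∧ s.real a = s₀.real a
  code : s.nat 114 0 = code P
  factor : s.real 100 0 = q ^ weight P

theorem Visiting.congr {s₀ s s' : Store n} {q : ℝ} {P : PauliString n} (h : Visiting s₀ s q P)
    (h' : ∀ a, a < 90 ∨ a = 100 ∨ a = 114 ∨ 200 ≤ a ∧ a < 203 →
      (a ≠ 100 → s'.nat a = s.nat a) ∧ s'.real a = s.real a) : Visiting s₀ s' q P where
  base a ha := by
    have h1 := h' a (by omega)
    have h2 := h.base a ha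
    exact ⟨(h1.1 (by omega)).trans h2.1, h1.2.trans h2.2⟩
  code := by rw [(h' 114 (by omega)).1 (by decide), h.code]
  factor := by rw [(h' 100 (by omega)).2, h.factor]

/-- What is needed of an action that is run on every visited Pauli string, with an invariant `J`. -/
structure IsAction (orc : PauliString n → ℝ) (action : Cmd) (q : ℝ) (ℓ t : ℕ)
    (J : List (PauliString n) → Store n → Prop) : Prop where
  low : 203 ≤ action.lowW
  high : action.highW < 300
  congr : ∀ vis s s', J vis s → (∀ a, a < 90 ∨ 203 ≤ a ∧ a < 300 → s'.nat a = s.nat a ∧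
    s'.real a = s.real a) → s'.out = s.out → J vis s'
  run : ∀ vis R s, J vis s → weight R ≤ ℓ → readPauli n (s.nat 100) = R → s.nat 118 0 = NoisyCircuit.code R →
    s.real 118 0 = q ^ weight R → Run orc action s t (J (vis ++ [R]))

/-- Code, damping factor and label array of a child come from those of its parent in three steps,
without decoding the child. -/
theorem run_visitOnes {action : Cmd} {q : ℝ} {ℓ t : ℕ} {J : List (PauliString n) → Store n → Prop}
    (hA : IsAction orc action q ℓ t J) {s₀ : Store n} (hp : Powers s₀) (hq : s₀.real 0 0 = q)
    {P : PauliString n} {j : Fin n} (h0 : P j = 0) (hw : weight P + 1 ≤ ℓ) (as : List (Fin 4)) :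
    ∀ (s : Store n) vis, Visiting s₀ s q P → (∀ i : Fin n, i ≠ j → s.nat 100 i = P i) → s.nat 300 0 = j →
      J vis s → Run orc (seqList (as.map (visitOne action))) s (as.length * (t + 3) + 1) fun s' =>
        J (vis ++ as.map (Function.update P j)) s' ∧ Visiting s₀ s' q P ∧
        (∀ i : Fin n, i ≠ j → s'.nat 100 i = P i) ∧ s'.nat 300 0 = j := by
  induction as with
  | nil => exact fun s vis h1 h2 h3 h4 => ⟨s, 1, .skip s, by simp, by simpa using h4, h1, h2, h3⟩
  | cons a as ih =>
    intro s vis h1 h2 h3 h4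
    have e40 : s.nat 40 j = 4 ^ (j : ℕ) := by rw [(h1.base 40 (by omega)).1]; exact hp j j.2.le
    have e0 : s.real 0 0 = q := by rw [(h1.base 0 (by omega)).2, hq]
    have hcode : code (Function.update P j a) = code P + a * 4 ^ (j : ℕ) := by
      have := code_update P j a
      rw [h0] at this
      simpa using this
    set R := Function.update P j a with hR
    set s1 := ((s.setN 100 j a).setN 118 0 (code R)).setR 118 0 (q ^ weight R) with hs1
    have hsem : sem (letR 118 (.mul (RV 100) (if a = 0 then .const 1 else dampExp)))
        (sem (letN 118 (.add (V 114) (NExp.times (.cell 40 (V 300)) a)))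
          (sem (.setNat 100 (V 300) (.const a)) s)) = s1 := by
      have hwt : (if a = 0 then RExp.const 1 else dampExp).eval
          ((s.setN 100 j a).setN 118 0 (code R)) = q ^ (if a = 0 then 0 else 1) := by
        split_ifs <;> simp [RExp.eval, dampExp, NExp.eval, e0]
      simp only [sem, letN, letR, NExp.eval, V, h3, RExp.eval, RV, eval_times]
      have e1 : (s.setN 100 j a).nat 114 0 = code P := by simp [h1.code]
      have e2 : (s.setN 100 j a).nat 300 0 = j := by simp [h3]
      have e3 : (s.setN 100 j a).nat 40 j = 4 ^ (j : ℕ) := by simp [e40]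
      rw [e1, e2, e3, ← hcode, hwt]
      simp only [setN_real, h1.factor, hs1, hR, weight_update h0, pow_add]
    have hsame : ∀ b, b ≠ 100 → b ≠ 118 → s1.nat b = s.nat b := fun b hb hb' => by
      rw [hs1]; simp only [setR_nat]; rw [setN_nat_row (by omega), setN_nat_row (by omega)]
    have hsame' : ∀ b, b ≠ 118 → s1.real b = s.real b := fun b hb => by
      rw [hs1, setR_real_row hb]; rfl
    have v1 : Visiting s₀ s1 q P := h1.congr fun b hb =>
      ⟨fun hb' => hsame b hb' (by omega), hsame' b (by omega)⟩
    have l1 : ∀ i : Fin n, i ≠ j → s1.nat 100 i = P i := fun i hi => by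
      have : (i : ℕ) ≠ j := Fin.val_ne_of_ne hi
      simp [hs1, this, h2 i hi]
    have hread : readPauli n (s1.nat 100) = R := by
      ext i
      have hlt := (R i).isLt
      have : s1.nat 100 i = R i := by
        by_cases hi : i = j
        · subst hi; simp [hs1, hR]
        · rw [l1 i hi, hR, Function.update_of_ne hi]
      simp only [readPauli, this, Fin.ofNat]
      omega
    have hJ1 : J vis s1 := hA.congr vis s s1 h4
      (fun b hb => ⟨hsame b (by omega) (by omega), hsame' b (by omega)⟩) rfl
    have hwR : weight R ≤ ℓ := by rw [hR, weight_update h0]; split_ifs <;> omega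
    have hrun := (hA.run vis R s1 hJ1 hwR hread (by simp [hs1]) (by simp [hs1])).frame
    have hone : Run orc (visitOne action a) s (3 + t) fun s' => J (vis ++ [R]) s' ∧ Frame action s1 s' := by
      refine (Run.simple_seq rfl (Run.simple_seq rfl (Run.simple_seq rfl ?_))).mono
        (T := 1 + (1 + (1 + t))) (by omega) fun _ h => h
      rw [hsem]
      exact hrun
    refine (Run.seq hone (T' := as.length * (t + 3) + 1) fun s2 ⟨g1, g2⟩ => ?_).mono
      (by simp only [List.length_cons]; ring_nf; omega) fun _ h => h
    have hlow := hA.low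
    have hhigh := hA.high
    have v2 : Visiting s₀ s2 q P := v1.congr fun b hb => by
      have := g2.1 b (Or.inl (by omega))
      exact ⟨fun _ => this.1, this.2⟩
    refine (ih s2 (vis ++ [R]) v2 (fun i hi => ?_) ?_ g1).mono le_rfl fun s3 h => ?_
    · rw [(g2.1 100 (Or.inl (by omega))).1]; exact l1 i hi
    · rw [(g2.1 300 (Or.inr (by omega))).1, hsame 300 (by decide) (by decide), h3]
    · simpa using h

theorem run_visitBody {action : Cmd} {q : ℝ} {ℓ t : ℕ} {J : List (PauliString n) → Store n → Prop}
    (hA : IsAction orc action q ℓ t J) {s₀ : Store n} (hn : s₀.nat 0 0 = n) (hp : Powers s₀)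
    (hq : s₀.real 0 0 = q) {P : PauliString n} (hw : weight P + 1 ≤ ℓ) {s : Store n}
    {vis : List (PauliString n)} (hs : Visiting s₀ s q P) (hl : ∀ i : Fin n, s.nat 100 i = P i)
    (hJ : J vis s) :
    Run orc (visitBody action) s (n * (4 * t + 17) + 2) fun s' =>
      J (vis ++ children P n) s' ∧ Visiting s₀ s' q P := by
  have hlow := hA.low
  have hhigh := hA.high
  refine (Run.simple_seq rfl ((run_forTo (fun m s' => J (vis ++ children P m) s' ∧ Visiting s₀ s' q P ∧
    ∀ i : Fin n, s'.nat 100 i = P i) (fun _ => 4 * t + 15) (k := n) (k0 := 0) (Nat.zero_le _)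
    (Or.inr ?_) ?_ ?_ ?_ ?_).mono le_rfl fun s' hs' => ⟨hs'.1.1, hs'.1.2.1⟩)).mono ?_ fun _ h => h
  · have : List.finRange 4 = [0, 1, 2, 3] := by decide
    simp only [this, seqList, visitOne, List.map_cons, List.map_nil, List.foldr_cons, List.foldr_nil,
      Cmd.highW, letN, letR]
    omega
  · rintro m s' ⟨-, h, -⟩ -
    simp [nExp, NExp.eval, (h.base 0 (by omega)).1, hn]
  · rintro m - hm s' ⟨g1, g2, g3⟩ h300
    have hstep : ∀ s'' : Store n, J (vis ++ children P (m + 1)) s'' → Visiting s₀ s'' q P →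
        (∀ i : Fin n, s''.nat 100 i = P i) → J (vis ++ children P (m + 1)) (s''.setN 300 0 (m + 1)) ∧
        Visiting s₀ (s''.setN 300 0 (m + 1)) q P ∧ ∀ i : Fin n, (s''.setN 300 0 (m + 1)).nat 100 i = P i :=
      fun s'' f1 f2 f3 => ⟨hA.congr _ _ _ f1 (fun a ha => ⟨setN_nat_row (by omega), rfl⟩) rfl,
        f2.congr fun a ha => ⟨fun _ => setN_nat_row (by omega), rfl⟩, by simpa using f3⟩
    have hlab := g3 ⟨m, hm⟩
    refine (Run.ite (T := 4 * t + 14) (fun h => ?_) fun h => ?_)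
    · have h0 : P ⟨m, hm⟩ = 0 := by
        simp only [Test.holds, NExp.eval, V, h300] at h
        exact Fin.ext (by simp at hlab ⊢; omega)
      refine ((run_visitOnes hA hp hq h0 hw (List.finRange 4) s' _ g2 (fun i _ => g3 i) h300 g1).seq
        (T' := 1) fun s2 ⟨f1, f2, f3, f4⟩ => (run_simple rfl s2).mono le_rfl ?_).mono ?_ fun _ h => h
      · rintro s3 rfl
        have hs3 : sem (.setNat 100 (V 300) (.const 0)) s2 = s2.setN 100 m 0 := by
          simp [sem, NExp.eval, V, f4]
        rw [hs3]
        refine hstep _ ?_ ?_ ?_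
        · rw [children, dif_pos hm, if_pos h0, ← List.append_assoc]
          exact hA.congr _ _ _ f1 (fun a ha => ⟨setN_nat_row (by omega), rfl⟩) rfl
        · exact f2.congr fun a ha => ⟨fun ha' => setN_nat_row ha', rfl⟩
        · intro i
          by_cases hi : i = ⟨m, hm⟩
          · subst hi; simp [h0]
          · have : (i : ℕ) ≠ m := fun h => hi (Fin.ext h)
            simp [this, f3 i hi]
      · rw [List.length_finRange]; omega
    · have h0 : P ⟨m, hm⟩ ≠ 0 := by
        intro h0
        apply h
        simp only [Test.holds, NExp.eval, V, h300]
        rw [h0] at hlab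
        simp at hlab; omega
      refine ⟨s', 1, .skip _, by omega, hstep _ ?_ g2 g3⟩
      rw [children, dif_pos hm, if_neg h0, List.append_nil]
      exact g1
  · refine ⟨?_, ?_, ?_⟩
    · simp only [children, List.append_nil]
      exact hA.congr _ _ _ hJ (fun a ha => ⟨setN_nat_row (by omega), rfl⟩) rfl
    · exact hs.congr fun a ha => ⟨fun _ => setN_nat_row (by omega), rfl⟩
    · simpa [sem, letN] using hl
  · simp [sem, letN, NExp.eval]
  · simp only [Cmd.size, letN, Nat.Ico_zero_eq_range, Finset.sum_const, Finset.card_range, smul_eq_mul,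
      Nat.add_assoc, Nat.reduceAdd]
    omega

/-- Decoding takes time O(n) per seed, the same order as running through its O(n) children; decoding
every string of weight K + 1 would cost one more factor n. -/
theorem run_visitCmd {action : Cmd} {q : ℝ} {ℓ t : ℕ} {J : List (PauliString n) → Store n → Prop}
    (hA : IsAction orc action q ℓ t J) {s : Store n} (hn : s.nat 0 0 = n) (hp : Powers s)
    (hq : s.real 0 0 = q) {l : List (Item n)} (hl : Items s l) (hw : ∀ e ∈ l, weight e.P + 1 ≤ ℓ)
    (hJ : J [] s) :
    Run orc (visitCmd action) s (l.length * (n * (4 * t + 41) + 12) + 4) fun s' =>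
      J (visits l) s' ∧ ∀ a, a < 90 → s'.nat a = s.nat a ∧ s'.real a = s.real a := by
  have hlow := hA.low
  have hlow' : 100 ≤ (loadItem ;; visitBody action).lowW := by
    have : List.finRange 4 = [0, 1, 2, 3] := by decide
    have h1 : 100 ≤ loadItem.lowW := by decide
    simp only [Cmd.lowW, visitBody, forTo, this, seqList, visitOne, List.map_cons, List.map_nil,
      List.foldr_cons, List.foldr_nil, letN, letR]
    omega
  refine (run_forItems hlow' hl (fun _ => []) (fun p s' => J (visits p) s' ∧
    ∀ a, a < 90 → s'.nat a = s.nat a ∧ s'.real a = s.real a) (n * (4 * t + 41) + 10) ⟨hJ, fun _ _ => ⟨rfl, rfl⟩⟩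
    ?_ ?_).mono le_rfl fun s' hs' => hs'.2
  · rintro p s1 s2 ⟨h1, h2⟩ h3 h4 h5
    exact ⟨hA.congr _ _ _ h1 (fun a ha => ⟨h3 a (by omega), by rw [h4]⟩) h5,
      fun a ha => ⟨(h3 a (Or.inl ha)).trans (h2 a ha).1, by rw [h4]; exact (h2 a ha).2⟩⟩
  · rintro p e s1 hpre ⟨h1, h2⟩ he
    have hn1 : s1.nat 0 0 = n := by rw [(h2 0 (by decide)).1, hn]
    have hp1 : Powers s1 := fun j hj => by rw [(h2 40 (by decide)).1]; exact hp j hj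
    have hq1 : s1.real 0 0 = q := by rw [(h2 0 (by decide)).2, hq]
    refine (Run.seq (run_loadItem hn1 hp1 he) (T' := n * (4 * t + 17) + 2) fun s2 ⟨g1, g2, g3⟩ => ?_).mono
      (by ring_nf; omega) fun _ h => h
    have hv : Visiting s1 s2 q e.P := by
      refine ⟨fun a ha => ?_, g1.code, by rw [← hq1]; exact g1.dec.factor⟩
      by_cases h : a < 90
      · exact ⟨g2.nat a (by omega), g2.real a (by omega)⟩
      · exact g3 a (by omega)
    have hJ2 : J (visits p) s2 := hA.congr _ _ _ h1 (fun a ha => by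
      by_cases h : a < 90
      · exact ⟨g2.nat a (by omega), g2.real a (by omega)⟩
      · exact g3 a (by omega)) g2.out
    refine (run_visitBody hA hn1 hp1 hq1 (hw e (hpre.subset (by simp))) hv g1.dec.label hJ2).mono le_rfl
      fun s3 ⟨f1, f2⟩ => ⟨.nil_of_eq fun a ha ha' => f2.base a (Or.inr ⟨ha, ha'⟩), ?_, fun a ha => ?_⟩
    · simpa [visits] using f1
    · have h3 := f2.base a (Or.inl ha)
      exact ⟨h3.1.trans (h2 a ha).1, h3.2.trans (h2 a ha).2⟩

end visits

/-! ### The program for gate-based noise -/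

section gateBased
variable {n : ℕ} {orc : PauliString n → ℝ}

/-- Array 221 and register 222 hold the codes of a list of Pauli strings. -/
def Listed (s : Store n) (vis : List (PauliString n)) : Prop :=
  s.nat 222 0 = vis.length ∧ ∀ k (hk : k < vis.length), s.nat 221 k = code vis[k]

/-- Query the coefficient of the visited Pauli string and list its code. -/
def queryAction : Cmd :=
  .query 100 230 (V 118) ;; .setNat 221 (V 222) (V 118) ;; letN 222 (.add (V 222) (.const 1))

/-- Repeated queries overwrite a coefficient with itself; only the list of codes gets repetitions.
-/
theorem isAction_query (q : ℝ) (ℓ : ℕ) : IsAction orc queryAction q ℓ (ℓ + 3) fun vis s =>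
    Listed s vis ∧ (∀ P, s.real 230 (code P) = if P ∈ vis then orc P else 0) ∧
    ∀ i, 4 ^ n ≤ i → s.real 230 i = 0 where
  low := by decide
  high := by decide
  congr vis s s' h h' _ := by
    rw [Listed, (h' 222 (by omega)).1, (h' 221 (by omega)).1, (h' 230 (by omega)).2]
    exact h
  run := by
    rintro vis R s ⟨⟨h1, h2⟩, h3, h4⟩ hw hR h118 -
    refine Run.mono (T := (ℓ + 1) + 2) (Run.seq (mid := fun s' => s' = s.setR 230 (code R) (orc R))
      ⟨_, _, .query s 100 230 (V 118), ?_, ?_⟩ ?_) (by omega) fun _ h => h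
    · rw [hR]; omega
    · simp [Store.setR, V, NExp.eval, h118, hR]
    · rintro s' rfl
      refine (run_simple rfl _).mono le_rfl ?_
      rintro s'' rfl
      have hs : sem (.setNat 221 (V 222) (V 118) ;; letN 222 (.add (V 222) (.const 1)))
          (s.setR 230 (code R) (orc R)) = ((s.setR 230 (code R) (orc R)).setN 221 vis.length
            (code R)).setN 222 0 (vis.length + 1) := by
        simp [sem, letN, V, NExp.eval, h1, h118]
      rw [hs]
      refine ⟨⟨by simp, fun k hk => ?_⟩, fun P => ?_, fun i hi => ?_⟩
      · rw [List.length_append, List.length_singleton] at hk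
        by_cases hk' : k < vis.length
        · rw [List.getElem_append_left hk']
          simpa [hk'.ne] using h2 k hk'
        · have : k = vis.length := by omega
          subst this
          simp
      · simp only [setN_real, setR_real, true_and, List.mem_append, List.mem_singleton, h3]
        by_cases hP : P = R
        · simp [hP]
        · have : code P ≠ code R := fun h => hP (code_injective h)
          simp [this, hP]
      · have := code_lt R
        have : i ≠ code R := by omega
        simpa [this] using h4 i hi

/-- Output the visited Pauli string with its damped coefficient, unless this has been done. -/
def emitAction : Cmd :=
  .emit 100 (.mul (RV 118) (.cell 230 (.add (V 56) (V 118)))) ;;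
  .setReal 230 (.add (V 56) (V 118)) (.const 0)

theorem listCoeff_append (l : List (PauliString n × ℝ)) (R P : PauliString n) (v : ℝ) :
    listCoeff (l ++ [(R, v)]) P = listCoeff l P + if P = R then v else 0 := by
  simp [listCoeff, eq_comm]

/-- The stored coefficient is erased after its output, so a repeated visit outputs 0 and the sum of
the output stays correct. -/
theorem isAction_emit (q : ℝ) (ℓ xo : ℕ) (z : PauliString n → ℝ) :
    IsAction orc emitAction q ℓ (ℓ + 2) fun vis s => s.nat 56 0 = xo ∧
      (∀ P, s.real 230 (xo + code P) = if P ∈ vis then 0 else z P) ∧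
      ∀ P, listCoeff s.out P = if P ∈ vis then q ^ weight P * z P else 0 where
  low := by decide
  high := by decide
  congr vis s s' h h' ho := by
    rw [(h' 56 (by omega)).1, (h' 230 (by omega)).2, ho]
    exact h
  run := by
    rintro vis R s ⟨h1, h2, h3⟩ hw hR h118 hr
    refine Run.mono (T := (ℓ + 1) + 1) (Run.seq (mid := fun s' => s' =
      { s with out := s.out ++ [(R, q ^ weight R * if R ∈ vis then 0 else z R)] })
      ⟨_, _, .emit s 100 _, ?_, ?_⟩ ?_) (by omega) fun _ h => h
    · rw [hR]; omega
    · simp [RExp.eval, RV, V, NExp.eval, h118, hr, h1, hR, h2]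
    · rintro s' rfl
      refine (run_simple rfl _).mono le_rfl ?_
      rintro s'' rfl
      refine ⟨by simpa [sem] using h1, fun P => ?_, fun P => ?_⟩
      · simp only [sem, setR_real, NExp.eval, V, h1, h118, RExp.eval, true_and, List.mem_append,
          List.mem_singleton, h2, Nat.add_left_cancel_iff, code_injective.eq_iff]
        by_cases hP : P = R <;> simp [hP]
      · simp only [sem, setR_out, listCoeff_append, h3, List.mem_append, List.mem_singleton]
        by_cases hP : P = R
        · subst hP
          by_cases hv : P ∈ vis <;> simp [hv]
        · simp [hP]

/-- Copy the coefficients of the listed Pauli strings to fresh memory. -/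
def truncCmd : Cmd :=
  letN 57 (.add (V 56) (.cell 40 nExp)) ;; letN 58 (.const 0) ;;
  forTo 58 (V 222) (.setReal 230 (.add (V 57) (.cell 221 (V 58)))
    (.cell 230 (.add (V 56) (.cell 221 (V 58))))) ;;
  letN 56 (V 57)

/-- Truncation copies what is kept to the next 4^n cells, which are still zero. Erasing in place
would require a list of the heavy strings. Repetitions in the list do no harm. -/
theorem run_truncCmd {s : Store n} {vis : List (PauliString n)} {z : PauliString n → ℝ}
    (hn : s.nat 0 0 = n) (hp : Powers s) (hl : Listed s vis) (hv : VecAt s z) :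
    Run orc truncCmd s (vis.length * 3 + 4) fun s' =>
      VecAt s' (fun P => if P ∈ vis then z P else 0) ∧ Listed s' vis ∧ Keep 56 s s' := by
  set xo := s.nat 56 0 with hxo
  suffices Run orc truncCmd s (vis.length * 3 + 4) fun s' =>
      VecAt s' (fun P => if P ∈ vis then z P else 0) ∧ Listed s' vis from
    (this.keep (b := 56) (by decide) rfl).mono le_rfl fun s' h => ⟨h.1.1, h.1.2, h.2⟩
  refine (Run.simple_seq rfl (Run.simple_seq rfl (Run.seq (run_forTo (fun m s' => Listed s' vis ∧
    s'.nat 56 0 = xo ∧ s'.nat 57 0 = xo + 4 ^ n ∧ (∀ P, s'.real 230 (xo + code P) = z P) ∧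
    (∀ P, s'.real 230 (xo + 4 ^ n + code P) = if P ∈ vis.take m then z P else 0) ∧
    ∀ i, xo + 4 ^ n + 4 ^ n ≤ i → s'.real 230 i = 0) (fun _ => 1) (k := vis.length) (k0 := 0)
    (Nat.zero_le _) (Or.inl (by decide)) ?_ ?_ ?_ ?_) fun s' hs' =>
    (run_simple rfl s').mono le_rfl ?_))).mono ?_ fun _ h => h
  · rintro m s' ⟨h, -⟩ -
    exact h.1
  · rintro m - hm s' ⟨h1, h2, h3, h4, h5, h6⟩ h58
    refine (run_simple rfl s').mono le_rfl ?_
    rintro s2 rfl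
    have hs : sem (.setReal 230 (.add (V 57) (.cell 221 (V 58)))
        (.cell 230 (.add (V 56) (.cell 221 (V 58))))) s'
        = s'.setR 230 (xo + 4 ^ n + code vis[m]) (z vis[m]) := by
      simp [sem, V, NExp.eval, RExp.eval, h2, h3, h58, h1.2 m hm, h4]
    rw [hs]
    refine ⟨⟨h1.1, h1.2⟩, h2, h3, fun P => ?_, fun P => ?_, fun i hi => ?_⟩
    · have := code_lt P
      have h7 : xo + code P ≠ xo + 4 ^ n + code vis[m] := by omega
      simpa [h7] using h4 P
    · have htake : P ∈ vis.take (m + 1) ↔ P ∈ vis.take m ∨ P = vis[m] := by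
        rw [List.take_succ_eq_append_getElem hm, List.mem_append, List.mem_singleton]
      simp only [setN_real, setR_real, htake, true_and, Nat.add_left_cancel_iff, code_injective.eq_iff, h5]
      by_cases hP : P = vis[m]
      · simp [← hP]
      · simp [hP]
    · have := code_lt vis[m]
      have h7 : i ≠ xo + 4 ^ n + code vis[m] := by omega
      simpa [h7] using h6 i hi
  · have hs : sem (letN 58 (.const 0)) (sem (letN 57 (.add (V 56) (.cell 40 nExp))) s)
        = (s.setN 57 0 (xo + 4 ^ n)).setN 58 0 0 := by
      simp [sem, letN, V, NExp.eval, nExp, hn, hp n le_rfl, ← hxo]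
    rw [hs]
    refine ⟨hl, rfl, rfl, hv.1, fun P => ?_, fun i hi => ?_⟩
    · simpa using hv.2 (xo + 4 ^ n + code P) (by omega)
    · simpa using hv.2 i ((Nat.le_add_right _ _).trans hi)
  · simp [sem, letN, NExp.eval]
  · rintro s2 rfl
    obtain ⟨⟨h1, h2, h3, h4, h5, h6⟩, -⟩ := hs'
    have hs : sem (letN 56 (V 57)) s' = s'.setN 56 0 (xo + 4 ^ n) := by
      simp [sem, letN, V, NExp.eval, h3]
    rw [hs]
    refine ⟨?_, h1⟩
    simp only [VecAt]
    simpa using And.intro h5 h6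
  · simp [Cmd.size, letN]; omega

/-- Apply the layer whose data start at the entry in register 44 and truncate. -/
def gateLayerCmd : Cmd := cellsCmd ;; tableCmd ;; gatesCmd ;; truncCmd

/-- The cells depend on the layer, so the table is made anew each time; this takes O(nM) steps, as
do the gates. -/
theorem run_gateLayerCmd {s : Store n} (U : Layer n) {q : ℝ} {K M : ℕ} {vis : List (PauliString n)}
    {z : PauliString n → ℝ} (hn : s.nat 0 0 = n) (hp : Powers s) (hU : LayerAt s U (s.nat 44 0))
    (hq : s.real 0 0 = q) (hK : s.nat 55 0 = K) (hM : ∀ m ≤ n, (cellItems U K m).length ≤ M)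
    (hvis : ∀ P, P ∈ vis ↔ weight P ≤ K + 1) (hl : Listed s vis) (hv : VecAt s (trunc (K + 1) z)) :
    Run orc gateLayerCmd s (M * (142 * n + 14) + n * 14 + vis.length * 3 + 20) fun s' =>
      VecAt s' (trunc (K + 1) (stepVec .gateBased q U (trunc (K + 1) z))) ∧ Listed s' vis ∧ Keep 56 s s' := by
  have hlen := hM n le_rfl
  refine (((run_cellsCmd U hn hp hU hK hM).frame.seq (T' := (M * (28 * n + 14) + 6) +
    ((n * (40 * M + 8) + 2) + (vis.length * 3 + 4))) fun s1 ⟨⟨l1, k1⟩, f1⟩ => ?_)).mono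
    (le_of_eq (by ring)) fun _ h => h
  have hn1 : s1.nat 0 0 = n := by rw [k1.nat 0 (by decide), hn]
  refine Run.seq (((run_tableCmd hn1 (hp.keep k1 (by decide)) l1).mono
    (Nat.add_le_add_right (Nat.mul_le_mul_right _ hlen) _) fun _ h => h).frame) fun s2 ⟨⟨t2, k2⟩, f2⟩ => ?_
  have k02 : Keep 60 s s2 := k1.trans (k2.mono (by decide))
  have e2 : ∀ a, 220 ≤ a → s2.nat a = s.nat a ∧ s2.real a = s.real a := fun a ha =>
    ⟨(f2.1 a (Or.inr (lt_of_lt_of_le (by decide) ha))).1.trans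
      (f1.1 a (Or.inr (lt_of_lt_of_le (by decide) ha))).1,
     (f2.1 a (Or.inr (lt_of_lt_of_le (by decide) ha))).2.trans
      (f1.1 a (Or.inr (lt_of_lt_of_le (by decide) ha))).2⟩
  have hn2 : s2.nat 0 0 = n := by rw [k02.nat 0 (by decide), hn]
  have hv2 : VecAt s2 (trunc (K + 1) z) := by
    unfold VecAt
    rw [k02.nat 56 (by decide), (e2 230 (by decide)).2]
    exact hv
  have hmem : ∀ R, cellCount U n R ≤ K → R ∈ (cellItems U K n).map Item.P := fun R hR => by
    obtain ⟨e, he, h1, -⟩ := mem_cellItems hR n le_rfl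
    have h2 : mix U n R 0 = R := by ext1 i; simp [mix]
    exact List.mem_map.2 ⟨e, he, h1.trans h2⟩
  refine Run.seq ((run_gatesCmd (q := q) (K := K) (z := trunc (K + 1) z) hn2 (hp.keep k02 (by decide))
    (by rw [k02.nat 44 (by decide)]; exact hU.keep k02 (by decide))
    (by rw [k02.real 0 (by decide), hq]) t2 (nodup_cellItems U K n le_rfl) hmem
    (fun R hR => if_neg (by omega)) hv2).mono ?_ fun _ h => h) fun s3 ⟨v3, k3, e3⟩ => ?_
  · rw [List.length_map]
    gcongr
  · have k03 : Keep 60 s s3 := k02.trans (k3.mono (by decide))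
    have hl3 : Listed s3 vis := by
      unfold Listed
      rw [e3 221 (by decide), e3 222 (by decide), (e2 221 (by decide)).1, (e2 222 (by decide)).1]
      exact hl
    refine (run_truncCmd (by rw [k03.nat 0 (by decide), hn]) (hp.keep k03 (by decide)) hl3 v3).mono le_rfl
      fun s4 ⟨v4, l4, k4⟩ => ⟨?_, l4, (k03.mono (by decide)).trans k4⟩
    have : (fun P => if P ∈ vis then stepVec .gateBased q U (trunc (K + 1) z) P else 0)
        = trunc (K + 1) (stepVec .gateBased q U (trunc (K + 1) z)) := by
      funext P; simp only [hvis, trunc]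
    rwa [this] at v4

/-- Apply all layers to the stored vector, from the last one on. -/
def gateLayersCmd : Cmd :=
  letN 43 (.const 0) ;; forTo 43 depthExp (letN 44 (.sub (V 44) nExp) ;; gateLayerCmd)

theorem run_gateLayersCmd {s : Store n} {L : List (Layer n)} {q ε : ℝ} {K M : ℕ}
    {vis : List (PauliString n)} {x : PauliString n → ℝ} (h : Input s L q ε) (hp : Powers s)
    (hK : s.nat 55 0 = K) (h44 : s.nat 44 0 = L.length * n)
    (hM : ∀ U : Layer n, ∀ m ≤ n, (cellItems U K m).length ≤ M)
    (hvis : ∀ P, P ∈ vis ↔ weight P ≤ K + 1) (hl : Listed s vis) (hv : VecAt s (trunc (K + 1) x)) :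
    Run orc gateLayersCmd s (L.length * (M * (142 * n + 14) + n * 14 + vis.length * 3 + 23) + 2) fun s' =>
      VecAt s' (trunc (K + 1) (L.foldr (fun U y => stepVec .gateBased q U (trunc (K + 1) y)) x)) ∧
      s'.nat 55 0 = K ∧ Keep 43 s s' := by
  set f : Layer n → (PauliString n → ℝ) → PauliString n → ℝ :=
    fun U y => stepVec .gateBased q U (trunc (K + 1) y) with hf
  set d := L.length with hd
  refine (Run.simple_seq rfl ((run_forTo (fun m s' => s'.nat 44 0 = (d - m) * n ∧ s'.nat 55 0 = K ∧
    VecAt s' (trunc (K + 1) ((L.drop (d - m)).foldr f x)) ∧ Listed s' vis ∧ Keep 43 s s')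
    (fun _ => M * (142 * n + 14) + n * 14 + vis.length * 3 + 21) (k := d) (k0 := 0) (Nat.zero_le _)
    (Or.inl (by decide)) ?_ ?_ ?_ ?_).mono le_rfl fun s' hs' => ?_)).mono ?_ fun _ h => h
  · rintro m s' ⟨-, -, -, -, hk⟩ -
    simp only [depthExp, NExp.eval, hk.nat 0 (by decide)]; exact h.depth
  · rintro m - hm s' ⟨h1, h55, h2, hl', h3⟩ h43
    have hdm : d - m = d - (m + 1) + 1 := by omega
    have hlt : d - (m + 1) < L.length := by omega
    refine (Run.simple_seq rfl (T := M * (142 * n + 14) + n * 14 + vis.length * 3 + 20) ?_).mono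
      (by simp [Cmd.size, letN]; omega) fun _ h => h
    have hs1 : sem (letN 44 (.sub (V 44) nExp)) s' = s'.setN 44 0 ((d - (m + 1)) * n) := by
      have : (d - m) * n - n = (d - (m + 1)) * n := by rw [hdm, add_mul, one_mul]; omega
      simp [sem, letN, NExp.eval, V, nExp, h1, h3.nat 0 (by decide), h.size, this]
    rw [hs1]
    have k1 : Keep 43 s (s'.setN 44 0 ((d - (m + 1)) * n)) := h3.setN (by decide)
    refine (run_gateLayerCmd L[d - (m + 1)] (q := q) (K := K) (z := (L.drop (d - m)).foldr f x)
      (by rw [k1.nat 0 (by decide)]; exact h.size)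
      (hp.keep k1 (by decide)) (by simpa using (h.layer _ hlt).keep k1 (by decide))
      (by rw [k1.real 0 (by decide)]; exact h.damp) (by simpa using h55) (hM _) hvis (vis := vis) ?_ ?_).mono le_rfl
      fun s'' ⟨v2, l2, k2⟩ => ⟨?_, ?_, ?_, ?_, ?_⟩
    · exact hl'
    · simpa [VecAt] using h2
    · rw [setN_nat_row (by decide), k2.nat 44 (by decide)]; simp
    · rw [setN_nat_row (by decide), k2.nat 55 (by decide)]; simpa using h55
    · rw [List.drop_eq_getElem_cons hlt, List.foldr_cons, ← hdm]
      simpa [VecAt] using v2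
    · exact l2
    · exact (k1.trans (k2.mono (by decide))).setN (by decide)
  · have hs1 : sem (letN 43 (.const 0)) s = s.setN 43 0 0 := by simp [sem, letN, NExp.eval]
    rw [hs1]
    refine ⟨by simp [h44], by simp [hK], ?_, hl, (Keep.refl _ _).setN (by decide)⟩
    rw [Nat.sub_zero, hd, List.drop_length]
    simpa [VecAt] using hv
  · simp [sem, letN, NExp.eval]
  · obtain ⟨⟨-, h55, h2, -, h3⟩, -⟩ := hs'
    refine ⟨?_, h55, h3⟩
    rwa [Nat.sub_self, List.drop_zero] at h2
  · simp [Cmd.size, letN]; ring_nf; omega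

end gateBased

/-! ### The cutoff and the truncated evolution for gate-based noise -/

section gateProg
variable {n : ℕ} {orc : PauliString n → ℝ}

/-- Choose the weight at which the vectors are truncated. -/
def cutoffCmd : Cmd :=
  letN 45 (.const 0) ;; letN 46 (.const 1) ;; letR 45 dampExp ;;
  .loop (.natLe (.const 1) (V 46))
    (.ite (.realLe (.mul (.mul (.add (.ofNat depthExp) (.const 1)) (RV 45)) (RV 45)) (.mul tolExp tolExp))
      (letN 46 (.const 0))
      (.ite (.natLe nExp (V 45)) (letN 46 (.const 0))
        (letN 45 (.add (V 45) (.const 1)) ;; letR 45 (.mul (RV 45) dampExp))))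

/-- Comparing squares avoids roots and logarithms. Stopping at n ensures termination within n rounds
and is harmless, since no string is heavier. Minimality puts the cutoff below the exponent that is
claimed. -/
theorem run_cutoffCmd {s : Store n} {L : List (Layer n)} {q ε : ℝ} (h : Input s L q ε) :
    ∃ k, (((L.length : ℝ) + 1) * (q ^ (k + 1)) ^ 2 ≤ ε ^ 2 ∨ n ≤ k) ∧
      (∀ m, ((L.length : ℝ) + 1) * (q ^ (m + 1)) ^ 2 ≤ ε ^ 2 ∨ n ≤ m → k ≤ m) ∧
      Run orc cutoffCmd s (7 * k + 11) fun s' => s'.nat 45 0 = k ∧ Frame cutoffCmd s s' := by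
  classical
  have hex : ∃ k, ((L.length : ℝ) + 1) * (q ^ (k + 1)) ^ 2 ≤ ε ^ 2 ∨ n ≤ k := ⟨n, Or.inr le_rfl⟩
  refine ⟨Nat.find hex, Nat.find_spec hex, fun m hm => Nat.find_min' hex hm, Run.frame ?_⟩
  set k := Nat.find hex with hk
  refine (Run.simple_seq rfl (Run.simple_seq rfl (Run.simple_seq rfl ((Run.loop (fun m s' =>
    s'.nat 45 0 = min m k ∧ s'.nat 46 0 = (if m ≤ k then 1 else 0) ∧ (m ≤ k → s'.real 45 0 = q ^ (m + 1)) ∧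
    s'.nat 0 = s.nat 0 ∧ s'.real 0 = s.real 0) (fun _ => 6) (k + 1) ?_ ?_ ?_).mono le_rfl
    fun s' hs' => ?_)))).mono ?_ fun _ h => h
  · rintro m hm s' ⟨h1, h2, h3, h4, h5⟩
    have hmk : m ≤ k := by omega
    rw [if_pos hmk] at h2
    have h3 := h3 hmk
    rw [min_eq_left hmk] at h1
    refine ⟨by simp [Test.holds, NExp.eval, V, h2], (run_simple rfl s').mono (by decide) ?_⟩
    rintro s2 rfl
    have e1 : (Test.realLe (.mul (.mul (.add (.ofNat depthExp) (.const 1)) (RV 45)) (RV 45))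
        (.mul tolExp tolExp)).holds s' ↔ ((L.length : ℝ) + 1) * (q ^ (m + 1)) ^ 2 ≤ ε ^ 2 := by
      simp only [Test.holds, RExp.eval, NExp.eval, depthExp, tolExp, RV, h3, h4, h5, h.depth, h.tol,
        Nat.cast_one]
      rw [pow_two, pow_two, mul_assoc]
    have e2 : (Test.natLe nExp (V 45)).holds s' ↔ n ≤ m := by
      simp only [Test.holds, NExp.eval, nExp, V, h1, h4, h.size]
    have key : (((L.length : ℝ) + 1) * (q ^ (m + 1)) ^ 2 ≤ ε ^ 2 ∨ n ≤ m) ↔ m = k :=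
      ⟨fun h => le_antisymm hmk (Nat.find_min' hex h), fun h => h ▸ Nat.find_spec hex⟩
    rw [sem, sem, e1, e2]
    by_cases hc : m = k
    · have : ∀ s3, s3 = s'.setN 46 0 0 → s3.nat 45 0 = min (m + 1) k ∧
          s3.nat 46 0 = (if m + 1 ≤ k then 1 else 0) ∧ (m + 1 ≤ k → s3.real 45 0 = q ^ (m + 1 + 1)) ∧
          s3.nat 0 = s.nat 0 ∧ s3.real 0 = s.real 0 := by
        rintro s3 rfl
        have h6 : ¬ m + 1 ≤ k := by omega
        exact ⟨by simp [h1]; omega, by simp [h6], fun h => absurd h h6, by rw [setN_nat_row (by decide), h4], h5⟩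
      have hs : sem (letN 46 (.const 0)) s' = s'.setN 46 0 0 := by simp [sem, letN, NExp.eval]
      rcases key.2 hc with h6 | h6
      · rw [if_pos h6]; exact this _ hs
      · rw [if_pos h6, ite_self]; exact this _ hs
    · have h6 := not_or.1 fun h => hc (key.1 h)
      rw [if_neg h6.1, if_neg h6.2]
      have h7 : m + 1 ≤ k := by omega
      have hs : sem (letN 45 (.add (V 45) (.const 1)) ;; letR 45 (.mul (RV 45) dampExp)) s'
          = (s'.setN 45 0 (m + 1)).setR 45 0 (q ^ (m + 1 + 1)) := by
        simp [sem, letN, letR, NExp.eval, RExp.eval, V, RV, dampExp, h1, h3, h5, h.damp, ← pow_succ]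
      rw [hs]
      refine ⟨by simp [h7], by simp [h2, h7], fun _ => by simp, ?_, ?_⟩
      · rw [setR_nat, setN_nat_row (by decide), h4]
      · rw [setR_real_row (by decide)]; exact h5
  · rintro s' ⟨-, h2, -⟩
    simp [Test.holds, NExp.eval, V, h2]
  · have hs : sem (letR 45 dampExp) (sem (letN 46 (.const 1)) (sem (letN 45 (.const 0)) s))
        = ((s.setN 45 0 0).setN 46 0 1).setR 45 0 q := by
      simp [sem, letN, letR, NExp.eval, RExp.eval, dampExp, h.damp]
    rw [hs]
    refine ⟨by simp, by simp, by simp, ?_, ?_⟩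
    · rw [setR_nat, setN_nat_row (by decide), setN_nat_row (by decide)]
    · rw [setR_real_row (by decide)]; rfl
  · rw [hs'.1]; simp
  · simp [Cmd.size, letN, letR]; omega

/-- Run the circuit truncated at the weight in register 45, which is not zero. -/
def truncatedCmd : Cmd :=
  letN 55 (.sub (V 45) (.const 1)) ;; letN 56 (.const 0) ;; powersCmd ;; baseCmd ;;
  seedsCmd ;; visitCmd queryAction ;; gateLayersCmd ;; seedsCmd ;; visitCmd emitAction

theorem length_visits_le (l : List (Item n)) : (visits l).length ≤ l.length * (4 * n) := by
  have key : ∀ (P : PauliString n) m, (children P m).length ≤ 4 * m := by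
    intro P m
    induction m with
    | zero => simp [children]
    | succ m ih =>
      rw [children, List.length_append]
      split_ifs
      · rw [List.length_map, List.length_finRange]; omega
      · simp only [List.length_nil]; omega
      · simp only [List.length_nil]; omega
  rw [visits, List.length_flatMap]
  refine (List.sum_le_card_nsmul _ (4 * n) ?_).trans (by simp)
  intro x hx
  obtain ⟨e, -, rfl⟩ := List.mem_map.1 hx
  exact key _ _

/-- The seeds are generated twice, for the queries and for the output, because the enumeration of
cells reuses the item arrays in between. -/
theorem run_truncatedCmd {s : Store n} {L : List (Layer n)} {q ε : ℝ} {K N M : ℕ} (h : Input s L q ε)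
    (hn : 1 ≤ n) (h45 : s.nat 45 0 = K + 1) (h222 : s.nat 222 0 = 0) (h230 : s.real 230 = 0)
    (hout : s.out = []) (hN : ∀ m ≤ n, (seedItems K m : List (Item n)).length ≤ N)
    (hM : ∀ U : Layer n, ∀ m ≤ n, (cellItems U K m).length ≤ M) :
    Run orc truncatedCmd s (L.length * (M * (142 * n + 14) + n * 14 + N * (12 * n) + 26) +
      N * (n * (8 * K + 156) + 24) + 15 * n + 50) fun s' =>
        listCoeff s'.out = truncCircuit q (K + 1) L orc := by
  set s1 := (s.setN 55 0 K).setN 56 0 0 with hs1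
  have hsem : sem (letN 56 (.const 0)) (sem (letN 55 (.sub (V 45) (.const 1))) s) = s1 := by
    simp [sem, letN, NExp.eval, V, h45, hs1]
  have hvis : ∀ P, P ∈ visits (seedItems K n) ↔ weight P ≤ K + 1 := fun P => mem_visits_seedItems hn
  have hlen := hN n le_rfl
  have hvlen : (visits (seedItems K n : List (Item n))).length ≤ N * (4 * n) :=
    (length_visits_le _).trans (Nat.mul_le_mul_right _ hlen)
  have hw : ∀ e ∈ (seedItems K n : List (Item n)), weight e.P + 1 ≤ K + 1 := fun e he =>
    Nat.succ_le_succ (weight_le_of_mem_seedItems he)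
  refine (Run.simple_seq rfl (Run.simple_seq rfl (T := (3 * n + 3) + ((3 * L.length + 3) +
    ((n * (N * 23 + 6) + 8) + ((N * (n * (4 * (K + 1 + 3) + 41) + 12) + 4) +
    ((L.length * (M * (142 * n + 14) + n * 14 + N * (4 * n) * 3 + 23) + 2) +
    ((n * (N * 23 + 6) + 8) + (N * (n * (4 * (K + 1 + 2) + 41) + 12) + 4))))))) ?_)).mono
    (by simp [Cmd.size, letN]; ring_nf; omega) fun _ h => h
  rw [hsem]
  have k1 : Keep 55 s s1 := ((Keep.refl _ _).setN (by decide)).setN (by decide)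
  have i1 := h.keep k1 (by decide)
  refine Run.seq (run_powersCmd i1.size).frame fun s2 ⟨⟨p2, k2⟩, f2⟩ => ?_
  have i2 := i1.keep k2 (by decide)
  refine Run.seq (run_baseCmd i2).frame fun s3 ⟨⟨h44, k3, _⟩, f3⟩ => ?_
  have e3 : ∀ a, 55 ≤ a → s3.nat a = s1.nat a ∧ s3.real a = s1.real a := fun a ha =>
    ⟨(f3.1 a (Or.inr (lt_of_lt_of_le (by decide) ha))).1.trans
      (f2.1 a (Or.inr (lt_of_lt_of_le (by decide) ha))).1,
     (f3.1 a (Or.inr (lt_of_lt_of_le (by decide) ha))).2.trans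
      (f2.1 a (Or.inr (lt_of_lt_of_le (by decide) ha))).2⟩
  have p3 := p2.keep k3 (by decide)
  have i3 := i2.keep k3 (by decide)
  have h55 : s3.nat 55 0 = K := by rw [(e3 55 (by decide)).1]; simp [hs1]
  have h56 : s3.nat 56 0 = 0 := by rw [(e3 56 (by decide)).1]; simp [hs1]
  refine Run.seq (run_seedsCmd i3.size p3 h55 hN).frame fun s4 ⟨⟨l4, k4⟩, f4⟩ => ?_
  have e4 : ∀ a, 220 ≤ a → s4.nat a = s3.nat a ∧ s4.real a = s3.real a := fun a ha =>
    f4.1 a (Or.inr (lt_of_lt_of_le (by decide) ha))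
  have i4 := i3.keep k4 (by decide)
  have p4 := p3.keep k4 (by decide)
  have r4 : s4.real 230 = 0 := by
    rw [(e4 230 (by decide)).2, (e3 230 (by decide)).2]; exact h230
  refine Run.seq (((run_visitCmd (isAction_query q (K + 1)) i4.size p4 i4.damp l4 hw ?_).mono
    (Nat.add_le_add_right (Nat.mul_le_mul_right _ hlen) _) fun _ h => h).keep (b := 90) (by decide) rfl)
    fun s5 ⟨⟨⟨l5, v5, z5⟩, _⟩, k5⟩ => ?_
  · refine ⟨⟨?_, by simp⟩, by simp [r4], by simp [r4]⟩
    rw [(e4 222 (by decide)).1, (e3 222 (by decide)).1]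
    simpa [hs1] using h222
  have k35 : Keep 60 s3 s5 := k4.trans (k5.mono (by decide))
  have i5 := i3.keep k35 (by decide)
  have p5 := p3.keep k35 (by decide)
  have hv5 : VecAt s5 (trunc (K + 1) orc) := by
    unfold VecAt
    rw [k35.nat 56 (by decide), h56]
    simp only [Nat.zero_add]
    refine ⟨fun P => ?_, z5⟩
    simp only [v5, hvis, trunc]
  refine Run.seq ((run_gateLayersCmd i5 p5 (by rw [k35.nat 55 (by decide), h55])
    (by rw [k35.nat 44 (by decide), h44]) hM hvis l5 hv5).mono (by gcongr) fun _ h => h)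
    fun s6 ⟨v6, h55, k6⟩ => ?_
  have i6 := i5.keep k6 (by decide)
  have p6 := p5.keep k6 (by decide)
  refine Run.seq (run_seedsCmd i6.size p6 h55 hN).frame fun s7 ⟨⟨l7, k7⟩, f7⟩ => ?_
  have r7 : s7.real 230 = s6.real 230 := (f7.1 230 (Or.inr (by decide))).2
  have i7 := i6.keep k7 (by decide)
  have hout7 : s7.out = [] := by
    rw [k7.out, k6.out, k35.out, k3.out, k2.out, k1.out, hout]
  refine ((run_visitCmd (isAction_emit q (K + 1) (s6.nat 56 0) (trunc (K + 1) (L.foldr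
    (fun U y => stepVec .gateBased q U (trunc (K + 1) y)) orc))) i7.size (p6.keep k7 (by decide)) i7.damp
    l7 hw ?_).mono (Nat.add_le_add_right (Nat.mul_le_mul_right _ hlen) _) fun s8 h8 => ?_)
  · refine ⟨by rw [k7.nat 56 (by decide)], fun P => ?_, fun P => ?_⟩
    · rw [r7]; simpa using v6.1 P
    · simp [hout7, listCoeff]
  · funext P
    rw [h8.1.2.2 P, truncCircuit, damp_all]
    simp only [hvis]
    split_ifs with hP
    · rfl
    · simp [trunc, hP]

end gateProg

/-! ### Correctness and running time for gate-based noise -/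

section gateProg
variable {n : ℕ}

/-- The program for gate-based noise. -/
def gateProg : Cmd := cutoffCmd ;; .ite (.natLe (.const 1) (V 45)) truncatedCmd identityCmd

theorem nrm_truncCircuit_sub_circuitVec_le {q ε : ℝ} (h0 : 0 ≤ q) (h1 : q ≤ 1) (hε : 0 < ε)
    (L : List (Layer n)) {k : ℕ} (hk : ((L.length : ℝ) + 1) * (q ^ (k + 1)) ^ 2 ≤ ε ^ 2 ∨ n ≤ k)
    (x : PauliString n → ℝ) :
    nrm (truncCircuit q k L x - circuitVec .gateBased q L x) ≤ ε * nrm x := by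
  rcases hk with hk | hk
  · refine (nrm_mono (y := circuitVec .gateBased q L x - truncCircuit q k L x)
      fun P => (abs_sub_comm _ _).le).trans ?_
    refine (nrm_circuitVec_sub_truncCircuit_le h0 h1 k L x).trans ?_
    rw [← mul_assoc]
    refine mul_le_mul_of_nonneg_right ?_ (nrm_nonneg _)
    refine le_of_sq_le_sq ?_ hε.le
    rw [mul_pow, Real.sq_sqrt (by positivity)]
    linarith
  · rw [truncCircuit_of_le q hk, sub_self, nrm_zero]
    exact mul_nonneg hε.le (nrm_nonneg _)

/-- The exponent is chosen so that γ(ℓ+1) ≥ log(√D/ε), that is q^(ℓ+1) ≤ ε/√D. The natural-number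
ceiling supplies the maximum with 0. -/
theorem sq_pow_ceil_le {γ ε D : ℝ} (hγ : 0 < γ) (hε : 0 < ε) (hD : 0 < D) :
    D * (Real.exp (-γ) ^ (⌈1 / γ * Real.log (√D / ε) - 1⌉₊ + 1)) ^ 2 ≤ ε ^ 2 := by
  have hs : 0 < √D := Real.sqrt_pos.2 hD
  set m := ⌈1 / γ * Real.log (√D / ε) - 1⌉₊ with hm
  have h1 : 1 / γ * Real.log (√D / ε) - 1 ≤ m := Nat.le_ceil _
  have h2 : Real.log (√D / ε) ≤ γ * (m + 1) := by
    have h3 : γ * (1 / γ * Real.log (√D / ε)) = Real.log (√D / ε) := by field_simp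
    nlinarith
  have h3 : Real.exp (-γ) ^ (m + 1) ≤ ε / √D := by
    rw [← Real.exp_nat_mul, show ε / √D = Real.exp (-Real.log (√D / ε)) by
      rw [Real.exp_neg, Real.exp_log (by positivity), inv_div]]
    apply Real.exp_le_exp.2
    push_cast
    linarith
  calc D * (Real.exp (-γ) ^ (m + 1)) ^ 2 ≤ D * (ε / √D) ^ 2 := by gcongr
    _ = ε ^ 2 := by rw [div_pow, Real.sq_sqrt hD.le]; field_simp

/-- The number of small seeds, with a factor for the time spent on each of them. -/
theorem seeds_count_le {K : ℕ} (hK : K + 1 ≤ n) :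
    (n : ℝ) * (seedItems K n : List (Item n)).length * (K + 3) ≤ 3 * Real.exp 6 * (n : ℝ) ^ (K + 1) := by
  -- The count below uses b = n/2, which must be at least 1.
  by_cases hn : n = 1
  · subst hn
    have hK0 : K = 0 := by omega
    subst hK0
    have h1 := length_seedItems_le (n := 1) (K := 0) (b := 1) le_rfl
    have h2 : Real.exp 3 ≤ Real.exp 6 := Real.exp_le_exp.2 (by norm_num)
    norm_num at h1 ⊢
    linarith
  · have hn2 : (2 : ℝ) ≤ n := by exact_mod_cast (by omega : 2 ≤ n)
    have h1 := length_seedItems_le (n := n) (K := K) (b := (n : ℝ) / 2) (by linarith)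
    have h2 : 3 * (n : ℝ) / (n / 2) = 6 := by field_simp; norm_num
    rw [h2] at h1
    have h3 : (K : ℝ) + 3 ≤ 3 * 2 ^ K := by
      have : K + 1 ≤ 2 ^ K := Nat.lt_two_pow_self
      have : ((K : ℝ) + 1) ≤ 2 ^ K := by exact_mod_cast this
      linarith [Nat.cast_nonneg (α := ℝ) K]
    -- The cost of a query or output grows with K; the factor 2^(-K) in the count of seeds absorbs
    -- it, so the constant does not depend on the cutoff.
    calc (n : ℝ) * (seedItems K n : List (Item n)).length * (K + 3)
        ≤ n * (Real.exp 6 * (n / 2) ^ K) * (3 * 2 ^ K) := by gcongr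
      _ = 3 * Real.exp 6 * (n : ℝ) ^ (K + 1) := by
        rw [div_pow, pow_succ]; field_simp

theorem gate_time_le {K d N M : ℕ} (hK : K + 1 ≤ n) (hd : 1 ≤ d)
    (hN : (n : ℝ) * N * (K + 3) ≤ 3 * Real.exp 6 * (n : ℝ) ^ (K + 1))
    (hM : (M : ℝ) ≤ Real.exp 15 * (n : ℝ) ^ K) :
    ((7 * (K + 1) + 11 + (d * (M * (142 * n + 14) + n * 14 + N * (12 * n) + 26) +
      N * (n * (8 * K + 156) + 24) + 15 * n + 50 + 1) : ℕ) : ℝ)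
      ≤ 1000 * Real.exp 15 * (d * (n : ℝ) ^ (K + 1)) := by
  have hn : (1 : ℝ) ≤ n := by exact_mod_cast (by omega : 1 ≤ n)
  have hd' : (1 : ℝ) ≤ d := by exact_mod_cast hd
  have hKn : (K : ℝ) + 1 ≤ n := by exact_mod_cast hK
  have hK0 : (0 : ℝ) ≤ K := Nat.cast_nonneg _
  have hN0 : (0 : ℝ) ≤ N := Nat.cast_nonneg _
  have hM0 : (0 : ℝ) ≤ M := Nat.cast_nonneg _
  set A : ℝ := (n : ℝ) ^ (K + 1) with hA
  set E := Real.exp 15 with hE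
  have hE1 : 1 ≤ E := Real.one_le_exp (by norm_num)
  -- The seeds are few compared with the cell strings, as e^9 exceeds 1000; so a single constant
  -- e^15 serves for both.
  have hEE : Real.exp 6 ≤ E / 1000 := by
    have h1 : Real.exp 15 = Real.exp 6 * Real.exp 1 ^ 9 := by
      rw [← Real.exp_nat_mul, ← Real.exp_add]; norm_num
    have h2 : (2.7 : ℝ) ≤ Real.exp 1 := by linarith [Real.exp_one_gt_d9]
    have h3 : (1000 : ℝ) ≤ Real.exp 1 ^ 9 := le_trans (by norm_num) (pow_le_pow_left₀ (by norm_num) h2 9)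
    rw [hE, h1]
    nlinarith [Real.exp_pos 6]
  have hA1 : 1 ≤ A := one_le_pow₀ hn
  have hnA : (n : ℝ) ≤ A := le_self_pow₀ hn (by omega)
  have hnM : (n : ℝ) * M ≤ E * A := by
    calc (n : ℝ) * M ≤ n * (E * (n : ℝ) ^ K) := by gcongr
      _ = E * A := by rw [hA, pow_succ]; ring
  have hMn : (M : ℝ) ≤ n * M := le_mul_of_one_le_left hM0 hn
  have hNn : (N : ℝ) ≤ n * N := le_mul_of_one_le_left hN0 hn
  have hNA : (n : ℝ) * N * (K + 3) ≤ E * A / 300 := by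
    refine hN.trans ?_
    nlinarith
  have hNK : (n : ℝ) * N ≤ E * A / 900 := by nlinarith [mul_nonneg (mul_nonneg (by linarith : (0 : ℝ) ≤ n) hN0) hK0]
  have hEA : A ≤ E * A := le_mul_of_one_le_left (by linarith) hE1
  have h1 : (M : ℝ) * (142 * n + 14) + n * 14 + N * (12 * n) + 26 ≤ 200 * (E * A) := by nlinarith
  have h2 : (N : ℝ) * (n * (8 * K + 156) + 24) + 15 * n + 50 + 1 + (7 * (K + 1) + 11) ≤ 200 * (E * A) := by
    nlinarith
  have h3 : 0 ≤ E * A := by positivity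
  push_cast
  calc _ = (d : ℝ) * ((M : ℝ) * (142 * n + 14) + n * 14 + N * (12 * n) + 26) +
        ((N : ℝ) * (n * (8 * K + 156) + 24) + 15 * n + 50 + 1 + (7 * (K + 1) + 11)) := by ring
    _ ≤ d * (200 * (E * A)) + d * (200 * (E * A)) := by
      gcongr
      exact h2.trans (le_mul_of_one_le_left (by positivity) hd')
    _ ≤ 1000 * E * (d * A) := by nlinarith

theorem gateBased_query : ∃ prog : Cmd, ∃ A : ℝ, ∀ (n : ℕ) (L : List (Layer n)) (γ ε c : ℝ) (ρ : Op n),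
    1 ≤ n → 1 ≤ L.length → 0 < γ → 0 < ε → 0 < c →
    IsState ρ → renyiTwo ρ = n - Real.logb 2 c →
    Computes prog NoiseModel.gateBased L γ ε ρ [] (ε * √c)
      (A * (L.length * (n : ℝ) ^ ⌈1 / γ * Real.log (√((L.length : ℝ) + 1) / ε) - 1⌉₊)) := by
  refine ⟨gateProg, 1000 * Real.exp 15, ?_⟩
  intro n L γ ε c ρ hn hL hγ hε hc hρ hS
  set q := Real.exp (-γ) with hq
  have hq0 : 0 ≤ q := (Real.exp_pos _).le
  have hq1 : q ≤ 1 := Real.exp_le_one_iff.2 (by linarith)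
  set x := pauliCoeff ρ with hx
  set s := inputStore L γ ε ([] : List (PauliString n × ℝ)) with hs
  have hin : Input s L q ε := input_inputStore L γ ε []
  set ℓ := ⌈1 / γ * Real.log (√((L.length : ℝ) + 1) / ε) - 1⌉₊ with hℓ
  have hn' : (1 : ℝ) ≤ n := by exact_mod_cast hn
  have hL' : (1 : ℝ) ≤ L.length := by exact_mod_cast hL
  obtain ⟨k, hk1, hk2, hrun⟩ := run_cutoffCmd (orc := x) hin
  have hkℓ : k ≤ ℓ := hk2 _ (Or.inl (sq_pow_ceil_le hγ hε (by positivity)))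
  have hkn : k ≤ n := hk2 _ (Or.inr le_rfl)
  suffices ∃ T : ℕ, (T : ℝ) ≤ 1000 * Real.exp 15 * (L.length * (n : ℝ) ^ k) ∧
      Run x gateProg s T fun s' => listCoeff s'.out = truncCircuit q k L x by
    obtain ⟨T, hT, s', t, h1, h2, h3⟩ := this
    refine ⟨s', t, h1, ?_, traceNorm_out_sub_le hρ hc hS ?_⟩
    · refine (Nat.cast_le.2 h2).trans (hT.trans ?_)
      gcongr
    · rw [h3]
      exact nrm_truncCircuit_sub_circuitVec_le hq0 hq1 hε L hk1 x
  have h0 : ∀ s' : Store n, Frame cutoffCmd s s' → ∀ a, a < 45 ∨ 46 < a →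
      s'.nat a = s.nat a ∧ s'.real a = s.real a := fun s' hf a ha =>
    hf.1 a (ha.imp (fun h => lt_of_lt_of_le h (by decide)) fun h => lt_of_le_of_lt (by decide) h)
  -- For cutoff 0 only the identity component remains, which is output directly in constant time; a
  -- positive cutoff is written as K + 1.
  rcases Nat.eq_zero_or_pos k with hk0 | hk0
  · subst hk0
    refine ⟨7 * 0 + 11 + (2 + 1), ?_, hrun.seq fun s1 ⟨h45, f1⟩ => Run.ite (fun h => ?_) fun _ => ?_⟩
    · have : 1 ≤ Real.exp 15 := Real.one_le_exp (by norm_num)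
      push_cast
      nlinarith
    · simp [Test.holds, NExp.eval, V, h45] at h
    · refine (run_identityCmd ((h0 s1 f1 3 (by decide)).1.trans ?_)).mono le_rfl fun s2 h2 => ?_
      · funext i; cases i <;> rfl
      · rw [h2, f1.2 rfl, truncCircuit_zero]
        funext P
        simp [listCoeff, hs, inputStore, Pi.single_apply, eq_comm]
  · obtain ⟨K, rfl⟩ : ∃ K, k = K + 1 := ⟨k - 1, by omega⟩
    set N := (seedItems K n : List (Item n)).length with hN
    -- One bound for the tables of all layers, whose cells differ.
    set M := ⌊Real.exp 15 * (n : ℝ) ^ K⌋₊ with hM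
    refine ⟨_, gate_time_le hkn hL (seeds_count_le hkn) (Nat.floor_le (by positivity)),
      hrun.seq fun s1 ⟨h45, f1⟩ => Run.ite (fun _ => ?_) fun h => ?_⟩
    · have k1 : Keep 45 s s1 := f1.keep (by decide) rfl
      refine run_truncatedCmd (hin.keep k1 (by decide)) hn h45 ?_ ?_ ?_ (fun m hm =>
        monotone_nat_of_le_succ (length_seedItems_mono (n := n) K) hm) fun U m hm => ?_
      · rw [(h0 s1 f1 222 (by decide)).1]; rfl
      · rw [(h0 s1 f1 230 (by decide)).2]
        funext i; simp [hs, inputStore, inputReal]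
      · rw [k1.out]; rfl
      · refine (monotone_nat_of_le_succ (length_cellItems_mono U K) hm).trans (Nat.le_floor ?_)
        refine (length_cellItems_le U hn').trans (le_of_eq ?_)
        congr 2
        field_simp
    · simp [Test.holds, NExp.eval, V, h45] at h

end gateProg
end NoisyCircuit

theorem mainTheorem10 :
    -- uniform noise, states given as a sum of Pauli terms: time
    -- `poly(n) * (1/ε) ^ O(log(1/γ) / γ²)` when the number of terms is `poly(n)`
    (∃ prog : Cmd, ∀ γ₀ : ℝ, γ₀ < 1 → ∃ A : ℝ, ∀ (n : ℕ) (L : List (Layer n)) (γ ε c : ℝ)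
      (ρ : Op n) (terms : List (PauliString n × ℝ)),
      1 ≤ n → 1 ≤ L.length → 0 < γ → γ ≤ γ₀ → 0 < ε → ε ≤ 1 → 0 < c →
      IsState ρ → renyiTwo ρ = n - Real.logb 2 c → ρ = pauliSum terms →
      Computes prog NoiseModel.uniform L γ ε ρ terms (ε * √c)
        (A * ((n : ℝ) * terms.length) ^ A *
          (1 / ε) ^ (A * (Real.log (1 / γ) / γ ^ 2)))) ∧
    -- uniform noise, any state: time
    -- `n ^ (O(log(1/γ) / γ) + O(log(1/ε) / (γ d))) * (1/ε) ^ O(log(1/γ) / γ²)`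
    (∃ prog : Cmd, ∀ γ₀ : ℝ, γ₀ < 1 → ∃ A : ℝ, ∀ (n : ℕ) (L : List (Layer n)) (γ ε c : ℝ)
      (ρ : Op n),
      1 ≤ n → 1 ≤ L.length → 0 < γ → γ ≤ γ₀ → 0 < ε → ε ≤ 1 → 0 < c →
      IsState ρ → renyiTwo ρ = n - Real.logb 2 c →
      Computes prog NoiseModel.uniform L γ ε ρ [] (ε * √c)
        (A * (n : ℝ) ^ (A * (Real.log (1 / γ) / γ) + A * (Real.log (1 / ε) / (γ * L.length))) *
          (1 / ε) ^ (A * (Real.log (1 / γ) / γ ^ 2)))) ∧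
    -- gate-based noise, any state: time `O(d * n ^ ℓ)` with
    -- `ℓ = ⌈γ⁻¹ log(√(d+1) / ε) - 1⌉`, and a constant that depends on nothing
    (∃ prog : Cmd, ∃ A : ℝ, ∀ (n : ℕ) (L : List (Layer n)) (γ ε c : ℝ) (ρ : Op n),
      1 ≤ n → 1 ≤ L.length → 0 < γ → 0 < ε → 0 < c →
      IsState ρ → renyiTwo ρ = n - Real.logb 2 c →
      Computes prog NoiseModel.gateBased L γ ε ρ [] (ε * √c)
        (A * (L.length * (n : ℝ) ^
          ⌈1 / γ * Real.log (√((L.length : ℝ) + 1) / ε) - 1⌉₊))) :=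
  ⟨uniform_terms, uniform_query, gateBased_query⟩
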